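/- Circuits are finite lists of NOT, CNOT and Toffoli gates on distinct qubits. Let $\varphi=\frac{1+\sqrt5}{2}$ and $c=1/\log_2\varphi$. **Theorem.** There is an absolute constant $C$ such that for every $n$ and every $n$-bit prime $p$ (that is, $2^{n-1}\le p<2^n$) there is a circuit on exactly $$3n+4\lfloor\log_2 n\rfloor+20$$ qubits that maps $|x\rangle|0^n\rangle|0\cdots0\rangle$ exactly to $|x\rangle|x^{-1}\bmod p\rangle|0\cdots0\rangle$ for all $x\in\{1,\dots,p-1\}$, and whose number of Toffoli gates equals $2(80c-13)\,n^2\log_2 n$ up to an error of absolute value at most $Cn^2$. Here $|2(80c-13)-204|<\tfrac12$. The circuit can be taken of the following form, which realizes the four-phase extended Euclidean algorithm with register sharing. *Algorithm.* The variables are non-negative integers $t,q,r,t',r'$, lengths $\ell_t,\ell_q,\ell_{r'}$, a shift counter $\ell_s$, and bits $\mathrm{Phase1},\mathrm{Phase2},\mathrm{Iter},\mathrm{Sign}$. Initially $t=1$, $q=t'=0$, $r=p$; $r'=x$ and $\mathrm{Iter}=0$ if $2x\le p$, while $r'=p-x$ and $\mathrm{Iter}=1$ if $2x>p$; $\ell_t=1$,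 $\ell_{r'}$ is the bit length of $r'$, and $\ell_q=\ell_s=0$, $\mathrm{Phase1}=\mathrm{Phase2}=\mathrm{Sign}=0$. One step does the following, in this order. 1. According to $(\mathrm{Phase1},\mathrm{Phase2})$: * $(0,0)$: $\ell_s\leftarrow\ell_s+1$, then $\mathrm{Sign}\leftarrow\mathrm{Sign}\oplus[r<2^{\ell_s}r']$; * $(0,1)$: $\ell_s\leftarrow\ell_s-1$, $\ell_q\leftarrow\ell_q+1$, then, if $2^{\ell_s}r'\le r$, $r\leftarrow r-2^{\ell_s}r'$ and $q\leftarrow q+2^{\ell_s}$; * $(1,0)$: if the binary digit of $q$ at place $\ell_s$ is $1$, $t'\leftarrow t'+2^{\ell_s}t$ and $q\leftarrow q-2^{\ell_s}$; then $\ell_s\leftarrow\ell_s+1$, $\ell_q\leftarrow\ell_q-1$; * $(1,1)$: $\mathrm{Sign}\leftarrow\mathrm{Sign}\oplus[t'\ge2^{\ell_s}t]$, then $\ell_s\leftarrow\ell_s-1$. 2. If $\ell_q=0$ and $\ell_{r'}>0$: $\mathrm{Phase2}\leftarrow\mathrm{Phase2}\oplus\mathrm{Sign}\oplus\mathrm{Phase1}$,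 then $\mathrm{Sign}\leftarrow\mathrm{Sign}\oplus\mathrm{Phase2}$. 3. If $\ell_s=0$: flip $\mathrm{Phase1}$ and $\mathrm{Phase2}$. 4. If $\ell_q=\ell_s=0$: exchange $(t,r)$ with $(t',r')$, set $\ell_t$ and $\ell_{r'}$ to the bit lengths of the new $t$ and $r'$, and flip $\mathrm{Iter}$. *Registers.* The qubits are divided into two work registers of $n+3$ qubits; an output register of $n$ qubits; length registers of $\lfloor\log_2n\rfloor+2$ qubits for each of $\ell_t,\ell_q,\ell_{r'}$ and of $\lfloor\log_2n\rfloor+3$ qubits for $\ell_s$; and one qubit for each of $\mathrm{Phase1},\mathrm{Phase2},\mathrm{Iter},\mathrm{Sign}$ and an auxiliary $\mathrm{Ctrl}$. A state of the algorithm is represented as follows. From left to right, the first work register holds $t$ in $\ell_t+1$ cells (least significant bit first), then $\lfloor q/2^{\ell_s}\rfloor$ in $\ell_q$ cells (most significant bit first), then $r$ in the remaining cells (most significant bit first). The second holds $t'$ in $n+3-\ell_{r'}$ cells (least significant bit first), then $r'$ in $\ell_{r'}$ cells (most significant bit first), all cyclically shifted to the left by $\ell_s$ places. The length registers hold the binary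 expansions of the lengths and of $\ell_s$, the control qubits hold their bits, and $\mathrm{Ctrl}$ is $0$. So the cells on which the arithmetic has to act are determined by the contents of the length registers (location-controlled arithmetic). The input $x$ is given in the right-most $n$ qubits of the second work register (most significant bit first), all other qubits being $0$. *Form of the circuit.* There are a number $N$ and circuits $\mathrm{Load}$, $S_0,\dots,S_{N-1}$, $\mathrm{Copy}$ such that the whole circuit is $A=(\mathrm{Load},S_0,\dots,S_{N-1})$, followed by $\mathrm{Copy}$, followed by $A^{-1}$ (the gates of $A$ in reverse order). For every $x\in\{1,\dots,p-1\}$ and every $T\le N$, the circuit $\mathrm{Load},S_0,\dots,S_{T-1}$ maps the input to the representation of the state of the algorithm after $T$ steps, with output register $0$. After $N$ steps the algorithm has terminated ($r'=0$), and on this state $\mathrm{Copy}$ writes $x^{-1}\bmod p$ into the output register and leaves everything else unchanged. -/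

import Mathlib

/-! ### Reversible circuits over NOT, CNOT and Toffoli gates -/

/-- A NOT, CNOT or Toffoli gate on wires labelled by `W`.  The wires of one gate are distinct. -/
inductive Gate (W : Type) where
  | not (target : W) : Gate W
  | cnot (control target : W) (h : control ≠ target) : Gate W
  | toffoli (control₁ control₂ target : W) (h₁₂ : control₁ ≠ control₂)
      (h₁ : control₁ ≠ target) (h₂ : control₂ ≠ target) : Gate W

/-- The action of a gate on a computational basis state, given by the bit on every wire. -/
def Gate.apply {W : Type} [DecidableEq W] : Gate W → (W → Bool) → (W → Bool)
  | .not a, s => Function.update s a (!(s a))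
  | .cnot c a _, s => Function.update s a (xor (s a) (s c))
  | .toffoli c d a _ _ _, s => Function.update s a (xor (s a) (s c && s d))

def Gate.isToffoli {W : Type} : Gate W → Bool
  | .toffoli _ _ _ _ _ _ => true
  | _ => false

/-- A circuit is the list of its gates, in the order in which they are applied. -/
abbrev Circuit (W : Type) : Type := List (Gate W)

/-- The action of a circuit on a computational basis state. -/
def Circuit.run {W : Type} [DecidableEq W] (C : Circuit W) (s : W → Bool) : W → Bool :=
  C.foldl (fun s g => g.apply s) s

def Circuit.toffoliCount {W : Type} (C : Circuit W) : ℕ := C.countP Gate.isToffoli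

/-- Every gate is its own inverse, so the inverse circuit applies the gates in reverse order. -/
def Circuit.inverse {W : Type} (C : Circuit W) : Circuit W := C.reverse

theorem Gate.apply_apply {W : Type} [DecidableEq W] (g : Gate W) (s : W → Bool) :
    g.apply (g.apply s) = s := by
  funext w
  cases g with
  | not a => by_cases hw : w = a <;> simp [Gate.apply, Function.update, hw]
  | cnot c a h => by_cases hw : w = a <;> simp [Gate.apply, Function.update, hw, h]
  | toffoli c d a h h₁ h₂ =>
    by_cases hw : w = a <;> simp [Gate.apply, Function.update, hw, h₁, h₂]

theorem Circuit.run_inverse_run {W : Type} [DecidableEq W] (C : Circuit W) (s : W → Bool) :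
    C.inverse.run (C.run s) = s := by
  induction C generalizing s with
  | nil => rfl
  | cons g C ih =>
    have h := ih (g.apply s)
    simp only [Circuit.inverse, Circuit.run] at h ⊢
    simp [List.reverse_cons, List.foldl_append, h, Gate.apply_apply]

/-! ### The four-phase extended Euclidean algorithm -/

/-- The variables of the four-phase extended Euclidean algorithm.  `lt`, `lq`, `lr` are the numbers
of binary digits currently kept of `t`, `q`, `r'`, and `ls` is the shift counter. -/
structure EEAState where
  t : ℕ
  q : ℕ
  r : ℕ
  t' : ℕ
  r' : ℕ
  lt : ℕ
  lq : ℕ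
  lr : ℕ
  ls : ℕ
  phase1 : Bool
  phase2 : Bool
  iter : Bool
  sign : Bool

/-- The initial state on input `x`; an input `x > p / 2` is replaced by `p - x`, and this is
recorded in `iter`. -/
def EEAState.start (p x : ℕ) : EEAState where
  t := 1
  q := 0
  r := p
  t' := 0
  r' := if p < 2 * x then p - x else x
  lt := 1
  lq := 0
  lr := Nat.size (if p < 2 * x then p - x else x)
  ls := 0
  phase1 := false
  phase2 := false
  iter := decide (p < 2 * x)
  sign := false

/-- The arithmetic of one step.  Phase 1, coded `(0, 0)`, looks for the least `ls` with
`r < 2 ^ ls * r'`; phase 2, coded `(0, 1)`, computes one digit of the quotient `q` by long division;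
phase 3, coded `(1, 0)`, consumes one digit of `q` and accumulates `t' + q * t`; phase 4, coded
`(1, 1)`, undoes the shift. -/
def EEAState.arith (s : EEAState) : EEAState :=
  match s.phase1, s.phase2 with
  | false, false =>
    { s with
      ls := s.ls + 1
      sign := xor s.sign (decide (s.r < 2 ^ (s.ls + 1) * s.r')) }
  | false, true =>
    if 2 ^ (s.ls - 1) * s.r' ≤ s.r then
      { s with
        ls := s.ls - 1
        lq := s.lq + 1
        r := s.r - 2 ^ (s.ls - 1) * s.r'
        q := s.q + 2 ^ (s.ls - 1) }
    else
      { s with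
        ls := s.ls - 1
        lq := s.lq + 1 }
  | true, false =>
    if s.q.testBit s.ls then
      { s with
        ls := s.ls + 1
        lq := s.lq - 1
        t' := s.t' + 2 ^ s.ls * s.t
        q := s.q - 2 ^ s.ls }
    else
      { s with
        ls := s.ls + 1
        lq := s.lq - 1 }
  | true, true =>
    { s with
      ls := s.ls - 1
      sign := xor s.sign (decide (2 ^ s.ls * s.t ≤ s.t')) }

/-- First phase update: if `lq = 0` and `lr > 0`, then `phase2 ← phase2 ⊕ sign ⊕ phase1` and after
that `sign ← sign ⊕ phase2`. -/
def EEAState.updatePhase (s : EEAState) : EEAState :=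
  if s.lq = 0 ∧ 0 < s.lr then
    { s with
      phase2 := xor (xor s.phase2 s.sign) s.phase1
      sign := xor s.sign (xor (xor s.phase2 s.sign) s.phase1) }
  else s

/-- Second phase update: if `ls = 0`, then both phase bits are flipped. -/
def EEAState.flipPhases (s : EEAState) : EEAState :=
  if s.ls = 0 then { s with phase1 := !s.phase1, phase2 := !s.phase2 } else s

/-- The end of one iteration of the Euclidean algorithm: if `lq = ls = 0`, then `(t, r)` and
`(t', r')` are exchanged and the lengths of the new `t` and `r'` are recorded. -/
def EEAState.endIteration (s : EEAState) : EEAState :=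
  if s.lq = 0 ∧ s.ls = 0 then
    { s with
      t := s.t'
      t' := s.t
      r := s.r'
      r' := s.r
      lt := Nat.size s.t'
      lr := Nat.size s.r
      iter := !s.iter }
  else s

/-- One step of the four-phase algorithm.  Once `r' = 0` a step only increases `ls`. -/
def EEAState.step (s : EEAState) : EEAState :=
  s.arith.updatePhase.flipPhases.endIteration

/-- The state of the algorithm on input `x` after `T` steps. -/
def EEAState.after (p x T : ℕ) : EEAState := EEAState.step^[T] (EEAState.start p x)

/-! ### Registers and register sharing -/

/-- The registers of the inversion circuit. -/
inductive Reg where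
  | work1 | work2 | output | lenT | lenQ | lenR | lenS | phase1 | phase2 | iter | sign | ctrl
deriving DecidableEq

instance : Fintype Reg where
  elems := {.work1, .work2, .output, .lenT, .lenQ, .lenR, .lenS, .phase1, .phase2, .iter, .sign,
    .ctrl}
  complete := by intro R; cases R <;> decide

/-- The number of qubits of each register for an `n`-bit modulus. -/
def Reg.width (n : ℕ) : Reg → ℕ
  | .work1 => n + 3
  | .work2 => n + 3
  | .output => n
  | .lenT => Nat.log 2 n + 2
  | .lenQ => Nat.log 2 n + 2
  | .lenR => Nat.log 2 n + 2
  | .lenS => Nat.log 2 n + 3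
  | .phase1 => 1
  | .phase2 => 1
  | .iter => 1
  | .sign => 1
  | .ctrl => 1

/-- The qubits of the inversion circuit. -/
abbrev Qubit (n : ℕ) : Type := Σ R : Reg, Fin (R.width n)

/-- The basis state `|x⟩|y⟩|0⟩`: the right-most `n` qubits of `work2` hold `x` (most significant bit
first), `output` holds `y` (least significant bit first), and all other qubits are `0`. -/
def ioBasis (n x y : ℕ) : Qubit n → Bool
  | ⟨.work2, i⟩ => x.testBit (n + 2 - i)
  | ⟨.output, i⟩ => y.testBit i
  | _ => false

/-- Cell `i` of `work1`, counted from the left: `lt + 1` cells with `t` (least significant bit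
first), then `lq` cells with the digits of `q` in the places `≥ ls` (most significant bit first),
then `r` (most significant bit first, right-aligned). -/
def EEAState.work1Cell (n : ℕ) (s : EEAState) (i : ℕ) : Bool :=
  if i ≤ s.lt then s.t.testBit i
  else if i ≤ s.lt + s.lq then (s.q / 2 ^ s.ls).testBit (s.lt + s.lq - i)
  else s.r.testBit (n + 2 - i)

/-- Cell `i` of the content of `work2` before shifting: `t'` (least significant bit first), then
`lr` cells with `r'` (most significant bit first). -/
def EEAState.work2Cell (n : ℕ) (s : EEAState) (i : ℕ) : Bool :=
  if i < n + 3 - s.lr then s.t'.testBit i else s.r'.testBit (n + 2 - i)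

/-- The basis state that represents the state `s` of the algorithm with `y` in the output register.
The content of `work2` is cyclically shifted to the left by `ls` positions. -/
def EEAState.basis (n : ℕ) (s : EEAState) (y : ℕ) : Qubit n → Bool
  | ⟨.work1, i⟩ => s.work1Cell n i
  | ⟨.work2, i⟩ => s.work2Cell n ((i + s.ls) % (n + 3))
  | ⟨.output, i⟩ => y.testBit i
  | ⟨.lenT, i⟩ => s.lt.testBit i
  | ⟨.lenQ, i⟩ => s.lq.testBit i
  | ⟨.lenR, i⟩ => s.lr.testBit i
  | ⟨.lenS, i⟩ => s.ls.testBit i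
  | ⟨.phase1, _⟩ => s.phase1
  | ⟨.phase2, _⟩ => s.phase2
  | ⟨.iter, _⟩ => s.iter
  | ⟨.sign, _⟩ => s.sign
  | ⟨.ctrl, _⟩ => false

/-! ### The inversion circuit -/

/-- The constant `c = 1 / log₂ φ`, where `φ` is the golden ratio. -/
noncomputable def stepConst : ℝ := 1 / Real.logb 2 Real.goldenRatio

/-- The building blocks of an inversion circuit: `load` prepares the initial state of the
algorithm, `step T` carries out the step that follows the first `T` steps, for `T < numSteps`, and
`copy` writes the result into the output register. -/
structure InversionBlocks (n : ℕ) where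
  numSteps : ℕ
  load : Circuit (Qubit n)
  step : ℕ → Circuit (Qubit n)
  copy : Circuit (Qubit n)

/-- Preparation, followed by the first `T` steps. -/
def InversionBlocks.compute {n : ℕ} (B : InversionBlocks n) (T : ℕ) : Circuit (Qubit n) :=
  B.load ++ ((List.range T).map B.step).flatten

/-- The full circuit: compute, copy the result, uncompute. -/
def InversionBlocks.circuit {n : ℕ} (B : InversionBlocks n) : Circuit (Qubit n) :=
  B.compute B.numSteps ++ B.copy ++ Circuit.inverse (B.compute B.numSteps)

/-- The blocks realize the four-phase algorithm with register sharing for the modulus `p`: for every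
`x` in `{1, …, p - 1}`, after each step the registers hold exactly the shared representation of the
state of the algorithm, all remaining qubits being `0`; after the last step the algorithm has
terminated; and the copy block writes `x⁻¹ mod p` into the output register. -/
def InversionBlocks.RealizesEEA {n : ℕ} (B : InversionBlocks n) (p : ℕ) : Prop :=
  ∀ x : ℕ, 0 < x → x < p →
    (∀ T ≤ B.numSteps,
      (B.compute T).run (ioBasis n x 0) = (EEAState.after p x T).basis n 0) ∧
    (EEAState.after p x B.numSteps).r' = 0 ∧
    B.copy.run ((EEAState.after p x B.numSteps).basis n 0) =
      (EEAState.after p x B.numSteps).basis n ((x : ZMod p)⁻¹).val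

/-!
The circuit runs the four-phase algorithm step by step.  The length registers and the phase bits say
what each cell holds, so every step uses the same circuit `stepCircuit`, in which the cells to be
acted on are selected by the contents of the length registers.

**Acting at a variable place.**  There are no clean qubits for a unary copy of a length.  Instead,
the output register and the bit `iter` are borrowed as an array of `n + 1` position bits with
unknown contents.  A circuit `B` that XORs linear functions of the position bits onto other wires
(with ripple carries, prefix masks or single cells as coefficients) is run twice, the position `v`
given by a length register being toggled after each run (`marked`).  The unknown contents contribute
to both runs and cancel, and what remains is the effect of `B` for the array with a single bit at
`v` (`run_marked`).  Addition, comparison, reading and writing of a cell, and the computation of a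
bit length (a scan for the leading digit) are obtained in this way with `O(n)` Toffoli gates.  The
toggling itself conjugates the toggling of position `0` by a linear map that depends on the bits of
the length register, again with `O(n)` Toffoli gates (`mark`).  For the arithmetic with quotient and
remainder, `r / 2 ^ ls` has to lie against `r'`; the circuit `aligned` achieves this by rotating
both work registers by `ls` places and back, with `⌊log n⌋ + 3` layers of controlled swaps.  These
two rotations are the only part of a step that costs more than `O(n)` Toffoli gates.

**The algorithm.**  An iteration with quotient `quot` of `len` binary digits takes `len` steps in
each of the four phases (`Occurs`).  Let `K` be the total number of digits of the quotients so far.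
The invariants `IterData.Valid` contain `t * r + t' * r' = p`, the congruences for `t * x` and
`t' * x`, and two estimates.  The first, `2 ^ K * r * (r + r') < 2 ^ (2 * n + 1)`, gives
`K ≤ 2 * n`, so that `8 * n` steps suffice.  The second, `t + t' ≤ 2 ^ K`, gives `n ≤ K` at
termination, so that the shift counter, which runs idle from then on, stays at most `4 * n` and fits
into its register.  The sizes of `t`, of the digits of `q` and of `r`, and those of `t'` and `r'`,
together never exceed the length of a work register, because `t * r` and `t' * r'` are at most `p`.
Hence each step circuit realizes a step of the algorithm (`run_stepCircuit_occurs`), for any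
contents of the output register.

**The result.**  At termination `t = p`, `r = 1`, `r' = 0`, and `t' * x` is `1` or `-1` modulo `p`
according to `iter` (`inverse_eq`).  The copy block moves the first work register to `0`, undoes the
rotation of the second one, takes the difference to `p` if needed and copies.

**Counting.**  Computation and uncomputation together need at most `64 * n ^ 2 * log n + O(n ^ 2)`
Toffoli gates (`exists_toffoliCount_blocks`), less than the count in the claim, whose leading
coefficient is close to `204`.  Pairs of equal Toffoli gates in the copy block make up the
difference (`exists_count_near`). -/

set_option linter.unusedSectionVars false

namespace Circuit

variable {W : Type} [DecidableEq W]

/-! ### Elementary circuits -/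

/-- The state `s` with the bit on wire `x` XORed with `b`. -/
def toggle (s : W → Bool) (x : W) (b : Bool) : W → Bool :=
  fun w => if w = x then xor (s w) b else s w

theorem toggle_self (s : W → Bool) (x : W) (b : Bool) : toggle s x b x = xor (s x) b := by
  simp [toggle]

theorem toggle_ne {s : W → Bool} {x w : W} (h : w ≠ x) (b : Bool) : toggle s x b w = s w := by
  simp [toggle, h]

@[simp] theorem toggle_false (s : W → Bool) (x : W) : toggle s x false = s := by
  funext w; simp [toggle]

theorem toggle_toggle (s : W → Bool) (x : W) (a b : Bool) :
    toggle (toggle s x a) x b = toggle s x (xor a b) := by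
  funext w; simp only [toggle]; split_ifs <;> simp

theorem toggle_comm (s : W → Bool) (x y : W) (a b : Bool) :
    toggle (toggle s x a) y b = toggle (toggle s y b) x a := by
  funext w; simp only [toggle]; split_ifs <;> simp [Bool.xor_left_comm, Bool.xor_comm]

@[simp] theorem run_nil (s : W → Bool) : run ([] : Circuit W) s = s := rfl

theorem run_append (C D : Circuit W) (s : W → Bool) : run (C ++ D) s = run D (run C s) := by
  simp [run, List.foldl_append]

theorem run_inverse_of_run {C : Circuit W} {s t : W → Bool} (h : run C s = t) :
    run C.inverse t = s := by
  rw [← h, run_inverse_run]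

theorem run_run_inverse (C : Circuit W) (s : W → Bool) : run C (run C.inverse s) = s := by
  have h := run_inverse_run C.inverse s
  simpa [inverse] using h

@[simp] theorem toffoliCount_nil : toffoliCount ([] : Circuit W) = 0 := rfl

@[simp] theorem toffoliCount_append (C D : Circuit W) :
    toffoliCount (C ++ D) = toffoliCount C + toffoliCount D := by
  simp [toffoliCount]

@[simp] theorem toffoliCount_inverse (C : Circuit W) :
    toffoliCount C.inverse = toffoliCount C := by
  simp [toffoliCount, inverse]

/-- The NOT gate. -/
def X (a : W) : Circuit W := [.not a]

/-- The CNOT gate, and the empty circuit if the two wires coincide. -/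
def CX (c t : W) : Circuit W := if h : c ≠ t then [.cnot c t h] else []

/-- The Toffoli gate, and the empty circuit if the three wires are not distinct. -/
def CCX (c d t : W) : Circuit W :=
  if h : c ≠ d ∧ c ≠ t ∧ d ≠ t then [.toffoli c d t h.1 h.2.1 h.2.2] else []

theorem run_X (a : W) (s : W → Bool) : run (X a) s = toggle s a true := by
  funext w
  by_cases hw : w = a <;> simp [run, X, Gate.apply, toggle, Function.update, hw]

theorem run_CX {c t : W} (h : c ≠ t) (s : W → Bool) : run (CX c t) s = toggle s t (s c) := by
  funext w
  by_cases hw : w = t <;> simp [run, CX, Gate.apply, toggle, Function.update, hw, h]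

theorem run_CCX {c d t : W} (h₁ : c ≠ d) (h₂ : c ≠ t) (h₃ : d ≠ t) (s : W → Bool) :
    run (CCX c d t) s = toggle s t (s c && s d) := by
  funext w
  by_cases hw : w = t <;> simp [run, CCX, Gate.apply, toggle, Function.update, hw, h₁, h₂, h₃]

@[simp] theorem toffoliCount_X (a : W) : toffoliCount (X a) = 0 := by
  simp [toffoliCount, X, Gate.isToffoli]

@[simp] theorem toffoliCount_CX (c t : W) : toffoliCount (CX c t) = 0 := by
  unfold CX; split_ifs <;> simp [toffoliCount, Gate.isToffoli]

theorem toffoliCount_CCX (c d t : W) : toffoliCount (CCX c d t) ≤ 1 := by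
  unfold CCX; split_ifs <;> simp [toffoliCount, Gate.isToffoli]

/-- The circuits `f 0, …, f (k - 1)`, one after the other. -/
def seq (k : ℕ) (f : ℕ → Circuit W) : Circuit W := ((List.range k).map f).flatten

@[simp] theorem seq_zero (f : ℕ → Circuit W) : seq 0 f = [] := rfl

theorem seq_succ (k : ℕ) (f : ℕ → Circuit W) : seq (k + 1) f = seq k f ++ f k := by
  simp [seq, List.range_succ]

theorem toffoliCount_seq_le {k c : ℕ} {f : ℕ → Circuit W}
    (h : ∀ i < k, toffoliCount (f i) ≤ c) : toffoliCount (seq k f) ≤ k * c := by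
  induction k with
  | zero => simp
  | succ k ih =>
    rw [seq_succ, toffoliCount_append, Nat.succ_mul]
    exact Nat.add_le_add (ih fun i hi => h i (by omega)) (h k (by omega))

/-- The XOR of `f 0, …, f (k - 1)`. -/
def xsum : ℕ → (ℕ → Bool) → Bool
  | 0, _ => false
  | k + 1, f => xor (xsum k f) (f k)

theorem xsum_congr {k : ℕ} {f g : ℕ → Bool} (h : ∀ i < k, f i = g i) : xsum k f = xsum k g := by
  induction k with
  | zero => rfl
  | succ k ih => simp only [xsum]; rw [ih fun i hi => h i (by omega), h k (by omega)]

theorem xsum_xor (k : ℕ) (f g : ℕ → Bool) :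
    xsum k (fun i => xor (f i) (g i)) = xor (xsum k f) (xsum k g) := by
  induction k with
  | zero => rfl
  | succ k ih => simp only [xsum, ih]; cases xsum k f <;> cases xsum k g <;> simp

theorem xsum_eq_false {k : ℕ} {f : ℕ → Bool} (h : ∀ i < k, f i = false) : xsum k f = false := by
  induction k with
  | zero => rfl
  | succ k ih => simp only [xsum]; rw [ih fun i hi => h i (by omega), h k (by omega)]; rfl

theorem xsum_single {k v : ℕ} (hv : v < k) (f : ℕ → Bool) :
    xsum k (fun i => decide (i = v) && f i) = f v := by
  induction k with
  | zero => omega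
  | succ k ih =>
    simp only [xsum]
    by_cases h : v = k
    · subst h
      rw [xsum_eq_false fun i hi => by simp [Nat.ne_of_lt hi]]; simp
    · rw [ih (by omega)]; simp [Ne.symm h]

/-- Circuits that toggle one common wire accumulate their values there. -/
theorem run_seq_acc {k : ℕ} {f : ℕ → Circuit W} {x : W} {g : ℕ → (W → Bool) → Bool}
    (hf : ∀ i < k, ∀ s, run (f i) s = toggle s x (g i s))
    (hg : ∀ i < k, ∀ s b, g i (toggle s x b) = g i s) (s : W → Bool) :
    run (seq k f) s = toggle s x (xsum k fun i => g i s) := by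
  induction k with
  | zero => simp [xsum]
  | succ k ih =>
    rw [seq_succ, run_append, ih (fun i hi => hf i (by omega)) (fun i hi => hg i (by omega)),
      hf k (by omega), hg k (by omega), toggle_toggle]
    rfl

/-- Circuits that toggle distinct wires act independently if no value depends on a toggled wire. -/
theorem run_seq_disjoint {k : ℕ} {f : ℕ → Circuit W} {t : ℕ → W} {g : ℕ → (W → Bool) → Bool}
    (hf : ∀ i < k, ∀ s, run (f i) s = toggle s (t i) (g i s))
    (hg : ∀ i < k, ∀ j < k, ∀ s b, g i (toggle s (t j) b) = g i s)
    (ht : ∀ i < k, ∀ j < k, t i = t j → i = j) (s : W → Bool) :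
    (∀ i < k, run (seq k f) s (t i) = xor (s (t i)) (g i s)) ∧
      (∀ w, (∀ i < k, w ≠ t i) → run (seq k f) s w = s w) ∧
      ∀ i < k, g i (run (seq k f) s) = g i s := by
  suffices H : ∀ m ≤ k, (∀ i < m, run (seq m f) s (t i) = xor (s (t i)) (g i s)) ∧
      (∀ w, (∀ i < m, w ≠ t i) → run (seq m f) s w = s w) ∧
      ∀ i < k, g i (run (seq m f) s) = g i s from H k le_rfl
  intro m
  induction m with
  | zero => intro _; simp
  | succ m ih =>
    intro hm
    obtain ⟨h1, h2, h3⟩ := ih (by omega)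
    rw [seq_succ, run_append, hf m (by omega)]
    refine ⟨fun i hi => ?_, fun w hw => ?_, fun i hi => ?_⟩
    · rcases Nat.lt_succ_iff_lt_or_eq.1 hi with hi | rfl
      · rw [toggle_ne fun h => by have := ht i (by omega) m (by omega) h; omega, h1 i hi]
      · rw [toggle_self, h3 i (by omega), h2]
        intro j hj h
        have := ht i (by omega) j (by omega) h
        omega
    · rw [toggle_ne (hw m (by omega)), h2 w fun i hi => hw i (by omega)]
    · rw [hg i hi m (by omega), h3 i hi]

/-! ### Controlled permutations of wires -/

/-- The swap of the wires `x` and `y`, controlled by `c`. -/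
def cswap (c x y : W) : Circuit W := CX y x ++ CCX c x y ++ CX y x

theorem run_cswap {c x y : W} (hx : c ≠ x) (hy : c ≠ y) (hxy : x ≠ y) (s : W → Bool) :
    run (cswap c x y) s = if s c then s ∘ Equiv.swap x y else s := by
  simp only [cswap, run_append, run_CX hxy.symm, run_CCX hx hy hxy]
  funext w
  by_cases h1 : w = x
  · subst h1
    cases h : s c <;> simp [toggle, h, hx, hxy, hxy.symm]
  · by_cases h2 : w = y
    · subst h2
      cases h : s c <;> simp [toggle, h, hx, hxy.symm]
      cases s w <;> cases s x <;> rfl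
    · cases h : s c <;> simp [toggle, h1, h2, Equiv.swap_apply_of_ne_of_ne]

theorem toffoliCount_cswap (c x y : W) : toffoliCount (cswap c x y) ≤ 1 := by
  simpa [cswap] using toffoliCount_CCX c x y

/-- A permutation of the wires that fixes `c` can be applied under the control of `c`, with at most
one Toffoli gate for every wire that it moves. -/
theorem exists_controlled_perm [Fintype W] (c : W) (σ : Equiv.Perm W) (hc : σ c = c) :
    ∃ C : Circuit W, toffoliCount C ≤ σ.support.card ∧
      ∀ s, run C s = if s c then s ∘ σ else s := by
  induction h : σ.support.card using Nat.strong_induction_on generalizing σ with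
  | _ m ih =>
    by_cases h1 : σ = 1
    · subst h1
      exact ⟨[], by simp, fun s => by simp⟩
    · obtain ⟨x, hx⟩ : ∃ x, σ x ≠ x := by
        by_contra! hcon
        exact h1 (Equiv.ext hcon)
      have hcx : c ≠ x := fun h => hx (h ▸ hc)
      have hcy : c ≠ σ x := fun h => hcx (σ.injective (hc.trans h))
      have hlt := Equiv.Perm.card_support_swap_mul hx
      -- Splitting off one swap leaves a permutation that moves fewer wires.
      obtain ⟨C, hC, hrun⟩ := ih _ (h ▸ hlt) (Equiv.swap x (σ x) * σ)
        (by rw [Equiv.Perm.mul_apply, hc, Equiv.swap_apply_of_ne_of_ne hcx hcy]) rfl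
      refine ⟨cswap c x (σ x) ++ C, ?_, fun s => ?_⟩
      · have := toffoliCount_cswap c x (σ x)
        rw [toffoliCount_append]
        omega
      · rw [run_append, run_cswap hcx hcy hx.symm, hrun]
        cases hs : s c
        · simp [hs]
        · have : Equiv.swap x (σ x) c = c := Equiv.swap_apply_of_ne_of_ne hcx hcy
          simp only [↓reduceIte, Function.comp_apply, this, hs]
          funext w
          simp

/-- A circuit for the permutation `σ` of the wires, controlled by `c`; it is empty if `σ` moves
`c`. -/
noncomputable def cperm [Fintype W] (c : W) (σ : Equiv.Perm W) : Circuit W :=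
  open Classical in if h : σ c = c then (exists_controlled_perm c σ h).choose else []

theorem run_cperm [Fintype W] {c : W} {σ : Equiv.Perm W} (h : σ c = c) (s : W → Bool) :
    run (cperm c σ) s = if s c then s ∘ σ else s := by
  rw [cperm, dif_pos h]
  exact (exists_controlled_perm c σ h).choose_spec.2 s

theorem toffoliCount_cperm [Fintype W] (c : W) (σ : Equiv.Perm W) :
    toffoliCount (cperm c σ) ≤ σ.support.card := by
  unfold cperm
  split_ifs with h
  · exact (exists_controlled_perm c σ h).choose_spec.1
  · simp

/-- Applies `σ ^ v`, where `v` is the number with the binary digits on the wires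
`b 0, …, b (k - 1)`. -/
noncomputable def barrel [Fintype W] (σ : Equiv.Perm W) (b : ℕ → W) (k : ℕ) : Circuit W :=
  seq k fun j => cperm (b j) (σ ^ 2 ^ j)

theorem run_barrel [Fintype W] {σ : Equiv.Perm W} {b : ℕ → W} {k v : ℕ} {s : W → Bool}
    (hσ : ∀ j < k, σ (b j) = b j) (hb : ∀ j < k, s (b j) = v.testBit j) :
    run (barrel σ b k) s = s ∘ ⇑(σ ^ (v % 2 ^ k)) := by
  have hfix : ∀ j < k, ∀ e : ℕ, (σ ^ e) (b j) = b j := fun j hj e =>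
    Equiv.Perm.pow_apply_eq_self_of_apply_eq_self (hσ j hj) e
  suffices H : ∀ m ≤ k, run (barrel σ b m) s = s ∘ ⇑(σ ^ (v % 2 ^ m)) from H k le_rfl
  intro m
  induction m with
  | zero => intro _; simp [barrel, Nat.mod_one]
  | succ m ih =>
    intro hm
    rw [barrel, seq_succ, run_append, ← barrel, ih (by omega), run_cperm (hfix m (by omega) _)]
    simp only [Function.comp_apply, hfix m (show m < k by omega), hb m (by omega)]
    rw [Nat.mod_pow_succ, ← Nat.toNat_testBit, pow_add]
    cases v.testBit m <;> simp [Function.comp_assoc]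

theorem toffoliCount_barrel [Fintype W] (σ : Equiv.Perm W) (b : ℕ → W) (k : ℕ) :
    toffoliCount (barrel σ b k) ≤ k * σ.support.card :=
  toffoliCount_seq_le fun _ _ => (toffoliCount_cperm _ _).trans
    (Finset.card_le_card (Equiv.Perm.support_pow_le _ _))

/-! ### Conditions on few wires -/

/-- A Toffoli gate whose first control is the literal `l`: the wire `l.1` with required value
`l.2`. -/
def litCCX (l : W × Bool) (d t : W) : Circuit W :=
  (if l.2 then [] else X l.1) ++ CCX l.1 d t ++ (if l.2 then [] else X l.1)

theorem run_litCCX {l : W × Bool} {d t : W} (h₁ : l.1 ≠ d) (h₂ : l.1 ≠ t) (h₃ : d ≠ t)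
    (s : W → Bool) : run (litCCX l d t) s = toggle s t ((s l.1 == l.2) && s d) := by
  obtain ⟨x, b⟩ := l
  simp only at h₁ h₂
  cases b
  · simp only [litCCX, run_append, run_CCX h₁ h₂ h₃, run_X, Bool.false_eq_true, if_false]
    funext w
    by_cases hw : w = x
    · subst hw; simp [toggle, h₂]
    · simp [toggle, hw, h₁.symm]
  · simp [litCCX, run_CCX h₁ h₂ h₃]

theorem toffoliCount_litCCX (l : W × Bool) (d t : W) : toffoliCount (litCCX l d t) ≤ 1 := by
  have := toffoliCount_CCX l.1 d t
  unfold litCCX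
  split_ifs <;> simpa using this

/-- Toggles `t` if all literals in `L` hold, with the help of one borrowed wire `d`, which may be
in any state and is restored.  The wires `t` and `d` change roles in the recursion, since the
recursive calls may borrow the target.  The cost is exponential in the number of literals, which is
only about `log n` for a test of a length register. -/
def mcx : List (W × Bool) → W → W → Circuit W
  | [], t, _ => X t
  | l :: L, t, d => litCCX l d t ++ mcx L d t ++ litCCX l d t ++ mcx L d t

/-- All literals in `L` hold in the state `s`. -/
def allLits (s : W → Bool) (L : List (W × Bool)) : Bool := L.all fun l => s l.1 == l.2

@[simp] theorem allLits_nil (s : W → Bool) : allLits s [] = true := rfl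

@[simp] theorem allLits_cons (s : W → Bool) (l : W × Bool) (L : List (W × Bool)) :
    allLits s (l :: L) = ((s l.1 == l.2) && allLits s L) := rfl

theorem allLits_toggle {s : W → Bool} {L : List (W × Bool)} {t : W} (h : ∀ l ∈ L, l.1 ≠ t)
    (b : Bool) : allLits (toggle s t b) L = allLits s L := by
  induction L with
  | nil => rfl
  | cons l L ih =>
    simp only [List.mem_cons, forall_eq_or_imp] at h
    rw [allLits_cons, allLits_cons, toggle_ne h.1, ih h.2]

theorem run_mcx {L : List (W × Bool)} {t d : W} (hL : ∀ l ∈ L, l.1 ≠ t ∧ l.1 ≠ d) (htd : t ≠ d)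
    (s : W → Bool) : run (mcx L t d) s = toggle s t (allLits s L) := by
  induction L generalizing t d s with
  | nil => simp [mcx, run_X]
  | cons l L ih =>
    simp only [List.mem_cons, forall_eq_or_imp] at hL
    obtain ⟨⟨h1, h2⟩, hL⟩ := hL
    have ih' := fun s => ih (t := d) (d := t) (fun l hl => (hL l hl).symm) htd.symm s
    simp only [mcx, run_append, run_litCCX h2 h1 htd.symm, ih']
    funext w
    rw [allLits_toggle (fun l hl => (hL l hl).1), allLits_toggle (fun l hl => (hL l hl).1),
      allLits_toggle (fun l hl => (hL l hl).2), allLits_toggle (fun l hl => (hL l hl).1),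
      allLits_cons]
    by_cases hw : w = t
    · subst hw
      simp only [toggle, htd, h1, h2, htd.symm, if_true, if_false]
      cases s w <;> cases s d <;> cases (s l.1 == l.2) <;> cases allLits s L <;> rfl
    · by_cases hd : w = d
      · subst hd
        simp only [toggle, htd.symm, if_true, if_false]
        cases s w <;> cases allLits s L <;> rfl
      · simp [toggle, hw, hd]

theorem toffoliCount_mcx (L : List (W × Bool)) (t d : W) :
    toffoliCount (mcx L t d) + 2 ≤ 2 * 2 ^ L.length := by
  induction L generalizing t d with
  | nil => simp [mcx]
  | cons l L ih =>
    have h1 := toffoliCount_litCCX l d t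
    have h2 := ih d t
    simp only [mcx, toffoliCount_append, List.length_cons, pow_succ]
    omega

/-- A conjunction of literals, split into two parts; the cost of testing it is exponential in the
length of the parts only. -/
abbrev Term (W : Type) : Type := List (W × Bool) × List (W × Bool)

/-- Whether the term `m` holds in the state `s`. -/
def Term.val (s : W → Bool) (m : Term W) : Bool := allLits s m.1 && allLits s m.2

/-- No literal of the term is on the wire `t`. -/
def Term.Avoids (m : Term W) (t : W) : Prop := (∀ l ∈ m.1, l.1 ≠ t) ∧ ∀ l ∈ m.2, l.1 ≠ t

theorem Term.val_toggle {m : Term W} {t : W} (h : m.Avoids t) (s : W → Bool) (b : Bool) :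
    m.val (toggle s t b) = m.val s := by
  rw [Term.val, allLits_toggle h.1, allLits_toggle h.2, Term.val]

/-- Toggles `t` if the term `m` holds, with two borrowed wires `d` and `e`: the value of the second
part is XORed onto `d` between two tests of the first part and `d`, so that the unknown old value of
`d` cancels. -/
def termFlip (m : Term W) (t d e : W) : Circuit W :=
  mcx ((d, true) :: m.1) t e ++ mcx m.2 d t ++ mcx ((d, true) :: m.1) t e ++ mcx m.2 d t

theorem run_termFlip {m : Term W} {t d e : W} (ht : m.Avoids t) (hd : m.Avoids d)
    (he : m.Avoids e) (htd : t ≠ d) (hte : t ≠ e) (hde : d ≠ e) (s : W → Bool) :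
    run (termFlip m t d e) s = toggle s t (m.val s) := by
  have h1 : ∀ l ∈ (d, true) :: m.1, l.1 ≠ t ∧ l.1 ≠ e := by
    simp only [List.mem_cons, forall_eq_or_imp]
    exact ⟨⟨htd.symm, hde⟩, fun l hl => ⟨ht.1 l hl, he.1 l hl⟩⟩
  have h2 : ∀ l ∈ m.2, l.1 ≠ d ∧ l.1 ≠ t := fun l hl => ⟨hd.2 l hl, ht.2 l hl⟩
  simp only [termFlip, run_append, run_mcx h1 hte, run_mcx h2 htd.symm, allLits_cons]
  funext w
  rw [allLits_toggle ht.2, allLits_toggle ht.2, allLits_toggle hd.2, allLits_toggle ht.2,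
    allLits_toggle hd.1, allLits_toggle ht.1]
  by_cases hw : w = t
  · subst hw
    simp only [toggle, htd, htd.symm, if_true, if_false, Term.val]
    cases s w <;> cases s d <;> cases allLits s m.1 <;> cases allLits s m.2 <;> rfl
  · by_cases hw' : w = d
    · subst hw'
      simp only [toggle, htd.symm, if_true, if_false]
      cases s w <;> cases allLits s m.2 <;> rfl
    · simp [toggle, hw, hw']

theorem toffoliCount_termFlip (m : Term W) (t d e : W) :
    toffoliCount (termFlip m t d e) ≤ 8 * 2 ^ m.1.length + 4 * 2 ^ m.2.length := by
  have h1 := toffoliCount_mcx ((d, true) :: m.1) t e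
  have h2 := toffoliCount_mcx m.2 d t
  simp only [termFlip, toffoliCount_append, List.length_cons, pow_succ] at *
  omega

/-- The XOR of the terms in `F`. -/
def formula (s : W → Bool) : List (Term W) → Bool
  | [] => false
  | m :: F => xor (m.val s) (formula s F)

/-- Toggles `t` if the XOR of the terms in `F` is true, with two borrowed wires `d` and `e`. -/
def cflip : List (Term W) → W → W → W → Circuit W
  | [], _, _, _ => []
  | m :: F, t, d, e => termFlip m t d e ++ cflip F t d e

theorem formula_toggle {F : List (Term W)} {t : W} (h : ∀ m ∈ F, m.Avoids t) (s : W → Bool)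
    (b : Bool) : formula (toggle s t b) F = formula s F := by
  induction F with
  | nil => rfl
  | cons m F ih =>
    simp only [List.mem_cons, forall_eq_or_imp] at h
    rw [formula, formula, ih h.2, Term.val_toggle h.1]

theorem run_cflip {F : List (Term W)} {t d e : W}
    (hF : ∀ m ∈ F, m.Avoids t ∧ m.Avoids d ∧ m.Avoids e) (htd : t ≠ d) (hte : t ≠ e) (hde : d ≠ e)
    (s : W → Bool) : run (cflip F t d e) s = toggle s t (formula s F) := by
  induction F generalizing s with
  | nil => simp [cflip, formula]
  | cons m F ih =>
    simp only [List.mem_cons, forall_eq_or_imp] at hF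
    rw [cflip, run_append, run_termFlip hF.1.1 hF.1.2.1 hF.1.2.2 htd hte hde, ih hF.2, formula,
      formula_toggle fun m hm => (hF.2 m hm).1, toggle_toggle]

/-- Adds `1` modulo `2 ^ k` to the number on the wires `b 0, …, b (k - 1)` if the literals in `L`
hold, from the highest place down, with two borrowed wires `d` and `e`. -/
def inc (L : List (W × Bool)) (b : ℕ → W) (d e : W) : ℕ → Circuit W
  | 0 => []
  | k + 1 => termFlip (L, (List.range k).map fun i => (b i, true)) (b k) d e ++ inc L b d e k

theorem run_inc {L : List (W × Bool)} {b : ℕ → W} {d e : W} {k v : ℕ} {s : W → Bool}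
    (hd : ∀ l ∈ L, l.1 ≠ d) (he : ∀ l ∈ L, l.1 ≠ e) (hL : ∀ l ∈ L, ∀ i < k, l.1 ≠ b i)
    (hbd : ∀ i < k, b i ≠ d) (hbe : ∀ i < k, b i ≠ e) (hde : d ≠ e)
    (hb : ∀ i < k, ∀ j < k, b i = b j → i = j) (hv : ∀ i < k, s (b i) = v.testBit i) :
    (∀ i < k, run (inc L b d e k) s (b i) = (if allLits s L then v + 1 else v).testBit i) ∧
      ∀ w, (∀ i < k, w ≠ b i) → run (inc L b d e k) s w = s w := by
  induction k generalizing s with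
  | zero => simp [inc]
  | succ k ih =>
    have hav : ∀ x, (∀ l ∈ L, l.1 ≠ x) → (∀ i < k, b i ≠ x) →
        Term.Avoids (L, (List.range k).map fun i => (b i, true)) x := by
      intro x h1 h2
      refine ⟨h1, fun l hl => ?_⟩
      simp only [List.mem_map, List.mem_range] at hl
      obtain ⟨i, hi, rfl⟩ := hl
      exact h2 i hi
    have hbk : ∀ i < k, b i ≠ b k := fun i hi h => by
      have := hb i (by omega) k (by omega) h
      omega
    rw [inc, run_append, run_termFlip (hav _ (fun l hl => hL l hl k (by omega)) hbk)
      (hav _ hd fun i hi => hbd i (by omega)) (hav _ he fun i hi => hbe i (by omega))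
      (hbd k (by omega)) (hbe k (by omega)) hde]
    set s₁ := toggle s (b k) (Term.val s (L, (List.range k).map fun i => (b i, true))) with hs₁
    obtain ⟨h1, h2⟩ := ih (s := s₁) (fun l hl i hi => hL l hl i (by omega))
      (fun i hi => hbd i (by omega)) (fun i hi => hbe i (by omega))
      (fun i hi j hj => hb i (by omega) j (by omega))
      (fun i hi => by rw [hs₁, toggle_ne (hbk i hi), hv i (by omega)])
    have hall : allLits s₁ L = allLits s L := allLits_toggle (fun l hl => hL l hl k (by omega)) _
    rw [hall] at h1
    refine ⟨fun i hi => ?_, fun w hw => ?_⟩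
    · rcases Nat.lt_succ_iff_lt_or_eq.1 hi with hi | rfl
      · exact h1 i hi
      · rw [h2 _ fun j hj => (hbk j hj).symm, hs₁, toggle_self, hv i (by omega), Term.val]
        cases allLits s L
        · simp
        · have hlow : allLits s ((List.range i).map fun j => (b j, true)) =
              decide (v % 2 ^ i = 2 ^ i - 1) := by
            rw [Bool.eq_iff_iff]
            simp only [allLits, List.all_map, List.all_eq_true, List.mem_range, Function.comp_apply,
              beq_iff_eq, decide_eq_true_eq]
            constructor
            · intro h
              apply Nat.eq_of_testBit_eq
              intro j
              rw [Nat.testBit_mod_two_pow, Nat.testBit_two_pow_sub_one]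
              by_cases hj : j < i
              · simp [hj, ← hv j (by omega), h j hj]
              · simp [hj]
            · intro h j hj
              rw [hv j (by omega)]
              have := congrArg (fun u => u.testBit j) h
              simpa [Nat.testBit_mod_two_pow, Nat.testBit_two_pow_sub_one, hj] using this
          simp only [hlow, Bool.true_and, if_true]
          have hp : 0 < 2 ^ i := by positivity
          have hlt := Nat.mod_lt v hp
          have hdm := Nat.div_add_mod v (2 ^ i)
          rw [Nat.testBit_eq_decide_div_mod_eq, Nat.testBit_eq_decide_div_mod_eq]
          by_cases hc : v % 2 ^ i = 2 ^ i - 1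
          · have hq : (v + 1) / 2 ^ i = v / 2 ^ i + 1 := by
              rw [show v + 1 = 2 ^ i * (v / 2 ^ i + 1) by rw [mul_add]; omega]
              exact Nat.mul_div_cancel_left _ hp
            rw [hq]
            simp only [hc, decide_true, Bool.xor_true]
            rw [← decide_not, decide_eq_decide]
            omega
          · have hq : (v + 1) / 2 ^ i = v / 2 ^ i := by
              rw [Nat.div_eq_iff hp]
              constructor
              · rw [mul_comm]; omega
              · rw [mul_comm]; omega
            simp [hq, hc]
    · rw [h2 w fun i hi => hw i (by omega), hs₁, toggle_ne (hw k (by omega))]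

theorem toffoliCount_inc (L : List (W × Bool)) (b : ℕ → W) (d e : W) (k : ℕ) :
    toffoliCount (inc L b d e k) ≤ 8 * k * 2 ^ L.length + 4 * 2 ^ k := by
  induction k with
  | zero => simp [inc]
  | succ k ih =>
    have h := toffoliCount_termFlip (L, (List.range k).map fun i => (b i, true)) (b k) d e
    simp only [List.length_map, List.length_range] at h
    rw [inc, toffoliCount_append, pow_succ, mul_add, add_mul]
    omega

/-! ### Ripple-carry addition and comparison -/

theorem xsum_succ_left (k : ℕ) (f : ℕ → Bool) :
    xsum (k + 1) f = xor (f 0) (xsum k fun i => f (i + 1)) := by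
  induction k with
  | zero => simp [xsum]
  | succ k ih => rw [xsum, ih]; simp [xsum]

/-- The majority of three bits, in the form in which a circuit computes it. -/
def maj (x y z : Bool) : Bool := xor x (xor x z && xor x y)

/-- The carry into place `i` in the sum of the digit sequences `a` and `b` with initial carry
`c`. -/
def carry (a b : ℕ → Bool) (c : Bool) : ℕ → Bool
  | 0 => c
  | i + 1 => maj (a i) (b i) (carry a b c i)

theorem carry_succ_left (a b : ℕ → Bool) (c : Bool) (i : ℕ) :
    carry a b c (i + 1) =
      carry (fun j => a (j + 1)) (fun j => b (j + 1)) (maj (a 0) (b 0) c) i := by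
  induction i with
  | zero => rfl
  | succ i ih => rw [carry, ih]; rfl

theorem carry_congr {a b a' b' : ℕ → Bool} {c : Bool} {i : ℕ} (ha : ∀ j < i, a j = a' j)
    (hb : ∀ j < i, b j = b' j) : carry a b c i = carry a' b' c i := by
  induction i with
  | zero => rfl
  | succ i ih =>
    simp only [carry]
    rw [ih (fun j hj => ha j (by omega)) (fun j hj => hb j (by omega)), ha i (by omega),
      hb i (by omega)]

/-- Replaces `a` by the majority of `a`, `b`, `z`, and adds the old `a` to `b` and `z`. -/
def majGate (z b a : W) : Circuit W := CX a b ++ CX a z ++ CCX z b a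

theorem run_majGate {z b a : W} (hab : a ≠ b) (haz : a ≠ z) (hzb : z ≠ b) (s : W → Bool) :
    run (majGate z b a) s = fun w =>
      if w = a then maj (s a) (s b) (s z) else
        if w = b then xor (s b) (s a) else if w = z then xor (s z) (s a) else s w := by
  simp only [majGate, run_append, run_CX hab, run_CX haz, run_CCX hzb haz.symm hab.symm]
  funext w
  by_cases h1 : w = a
  · subst h1
    simp only [toggle, hab, haz, hzb, hzb.symm, if_true, if_false, maj]
    cases s w <;> cases s b <;> cases s z <;> rfl
  · by_cases h2 : w = b
    · subst h2
      simp [toggle, h1, hzb.symm]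
    · by_cases h3 : w = z
      · subst h3; simp [toggle, h1, h2, hab]
      · simp [toggle, h1, h2, h3]

theorem run_majGate_toggle {z b a x : W} (hab : a ≠ b) (haz : a ≠ z) (hzb : z ≠ b) (hxa : x ≠ a)
    (hxb : x ≠ b) (hxz : x ≠ z) (s : W → Bool) (c : Bool) :
    run (majGate z b a) (toggle s x c) = toggle (run (majGate z b a) s) x c := by
  rw [run_majGate hab haz hzb, run_majGate hab haz hzb]
  funext w
  by_cases hw : w = x
  · subst hw; simp [toggle, hxa, hxb, hxz]
  · simp [toggle, hw, hxa.symm, hxb.symm, hxz.symm]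

theorem toffoliCount_majGate (z b a : W) : toffoliCount (majGate z b a) ≤ 1 := by
  simpa [majGate] using toffoliCount_CCX z b a

/-- The wires of a ripple-carry circuit with carry-in wire `z` are distinct. -/
structure AddWires (z : W) (a b : ℕ → W) (k : ℕ) : Prop where
  za : ∀ i < k, z ≠ a i
  zb : ∀ i < k, z ≠ b i
  ab : ∀ i < k, ∀ j < k, a i ≠ b j
  aa : ∀ i < k, ∀ j < k, a i = a j → i = j
  bb : ∀ i < k, ∀ j < k, b i = b j → i = j

theorem AddWires.tail {z : W} {a b : ℕ → W} {k : ℕ} (h : AddWires z a b (k + 1)) :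
    AddWires (a 0) (fun i => a (i + 1)) (fun i => b (i + 1)) k where
  za i hi he := by have := h.aa 0 (by omega) (i + 1) (by omega) he; omega
  zb i hi := h.ab 0 (by omega) (i + 1) (by omega)
  ab i hi j hj := h.ab _ (by omega) _ (by omega)
  aa i hi j hj he := by have := h.aa _ (by omega) _ (by omega) he; omega
  bb i hi j hj he := by have := h.bb _ (by omega) _ (by omega) he; omega

/-- Adds the number on the wires `a 0, …, a (k - 1)` and the bit on `z` to the number on the wires
`b 0, …, b (k - 1)`, modulo `2 ^ k`.  The carries replace the digits of `a` on the way up and are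
undone on the way down, so that no further wires are needed. -/
def add (z : W) (a b : ℕ → W) : ℕ → Circuit W
  | 0 => []
  | k + 1 => majGate z (b 0) (a 0) ++ add (a 0) (fun i => a (i + 1)) (fun i => b (i + 1)) k ++
      (CCX z (b 0) (a 0) ++ CX (a 0) z ++ CX z (b 0))

theorem run_add {z : W} {a b : ℕ → W} {k : ℕ} (h : AddWires z a b k) (s : W → Bool) :
    (∀ i < k, run (add z a b k) s (b i) =
      xor (s (b i)) (xor (s (a i)) (carry (fun j => s (a j)) (fun j => s (b j)) (s z) i))) ∧
    ∀ w, (∀ i < k, w ≠ b i) → run (add z a b k) s w = s w := by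
  induction k generalizing z a b s with
  | zero => simp [add]
  | succ k ih =>
    have hab := h.ab 0 (by omega) 0 (by omega)
    have hza := h.za 0 (by omega)
    have hzb := h.zb 0 (by omega)
    have hbb : ∀ i < k, b (i + 1) ≠ b 0 := fun i hi he => by
      have := h.bb _ (by omega) _ (by omega) he; omega
    have haa : ∀ i < k, a (i + 1) ≠ a 0 := fun i hi he => by
      have := h.aa _ (by omega) _ (by omega) he; omega
    simp only [add, run_append, run_majGate hab hza.symm hzb]
    set s₁ : W → Bool := fun w => if w = a 0 then maj (s (a 0)) (s (b 0)) (s z) else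
        if w = b 0 then xor (s (b 0)) (s (a 0)) else if w = z then xor (s z) (s (a 0)) else s w
      with hs₁
    obtain ⟨h1, h2⟩ := ih h.tail s₁
    set s₂ := run (add (a 0) (fun i => a (i + 1)) (fun i => b (i + 1)) k) s₁
    have e1 : s₂ (a 0) = maj (s (a 0)) (s (b 0)) (s z) := by
      rw [h2 _ fun i hi => h.ab 0 (by omega) (i + 1) (by omega)]; simp [hs₁]
    have e2 : s₂ (b 0) = xor (s (b 0)) (s (a 0)) := by
      rw [h2 _ fun i hi => (hbb i hi).symm]; simp [hs₁, hab.symm]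
    have e3 : s₂ z = xor (s z) (s (a 0)) := by
      rw [h2 _ fun i hi => h.zb (i + 1) (by omega)]; simp [hs₁, hza, hzb]
    rw [run_CCX hzb hza hab.symm, run_CX hza.symm, run_CX hzb]
    have e4 : ∀ w, w ≠ a 0 → w ≠ z → w ≠ b 0 → s₁ w = s w := fun w w1 w2 w3 => by
      simp [hs₁, w1, w2, w3]
    constructor
    · intro i hi
      rcases i with _ | i
      · simp only [toggle, hab.symm, hza, hzb.symm, if_true, if_false, e1, e2,
          e3, carry, maj]
        cases s (a 0) <;> cases s (b 0) <;> cases s z <;> rfl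
      · have hi' : i < k := by omega
        rw [toggle_ne (hbb i hi'), toggle_ne (h.zb _ hi).symm,
          toggle_ne (h.ab 0 (by omega) _ hi).symm, h1 i hi', carry_succ_left,
          e4 _ (h.ab 0 (by omega) _ hi).symm (h.zb _ hi).symm (hbb i hi'),
          e4 _ (haa i hi') (h.za _ hi).symm (h.ab _ hi 0 (by omega))]
        have hs₁a : s₁ (a 0) = maj (s (a 0)) (s (b 0)) (s z) := by simp [hs₁]
        rw [hs₁a]
        congr 2
        apply carry_congr
        · intro j hj
          exact e4 _ (haa j (by omega)) (h.za _ (by omega)).symm (h.ab _ (by omega) 0 (by omega))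
        · intro j hj
          exact e4 _ (h.ab 0 (by omega) _ (by omega)).symm (h.zb _ (by omega)).symm
            (hbb j (by omega))
    · intro w hw
      have hwb := hw 0 (by omega)
      rw [toggle_ne hwb]
      by_cases w1 : w = a 0
      · subst w1
        simp only [toggle, hza.symm, if_true, if_false, e1, e2,
          e3, maj]
        cases s (a 0) <;> cases s (b 0) <;> cases s z <;> rfl
      · by_cases w2 : w = z
        · subst w2
          simp only [toggle, hza, if_true, if_false, e1, e2, e3, maj]
          cases s (a 0) <;> cases s (b 0) <;> cases s w <;> rfl
        · rw [toggle_ne w2, toggle_ne w1, h2 w fun i hi => hw _ (by omega), e4 w w1 w2 hwb]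

theorem toffoliCount_add (z : W) (a b : ℕ → W) (k : ℕ) : toffoliCount (add z a b k) ≤ 2 * k := by
  induction k generalizing z a b with
  | zero => simp [add]
  | succ k ih =>
    have h1 := toffoliCount_majGate z (b 0) (a 0)
    have h2 := toffoliCount_CCX z (b 0) (a 0)
    have h3 := ih (a 0) (fun i => a (i + 1)) (fun i => b (i + 1))
    simp only [add, toffoliCount_append, toffoliCount_CX]
    omega

/-- Toggles `x` by the XOR of the bits `h i ∧ c`, where `c` is the carry out of place `i` in the
addition of `a` and `b`. -/
def carryXor (x z : W) (h a b : ℕ → W) : ℕ → Circuit W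
  | 0 => []
  | k + 1 => majGate z (b 0) (a 0) ++ (CCX (h 0) (a 0) x ++
      carryXor x (a 0) (fun i => h (i + 1)) (fun i => a (i + 1)) (fun i => b (i + 1)) k) ++
      (majGate z (b 0) (a 0)).inverse

theorem run_carryXor {x z : W} {h a b : ℕ → W} {k : ℕ} (H : AddWires z a b k) (hxz : x ≠ z)
    (hx : ∀ i < k, x ≠ a i ∧ x ≠ b i ∧ x ≠ h i)
    (hh : ∀ i < k, h i ≠ z ∧ ∀ j < k, h i ≠ a j ∧ h i ≠ b j) (s : W → Bool) :
    run (carryXor x z h a b k) s = toggle s x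
      (xsum k fun i => s (h i) && carry (fun j => s (a j)) (fun j => s (b j)) (s z) (i + 1)) := by
  induction k generalizing z h a b s with
  | zero => simp [carryXor, xsum]
  | succ k ih =>
    have hab := H.ab 0 (by omega) 0 (by omega)
    have hza := H.za 0 (by omega)
    have hzb := H.zb 0 (by omega)
    obtain ⟨hxa, hxb, hxh⟩ := hx 0 (by omega)
    have hbb : ∀ i < k, b (i + 1) ≠ b 0 := fun i hi he => by
      have := H.bb _ (by omega) _ (by omega) he; omega
    have haa : ∀ i < k, a (i + 1) ≠ a 0 := fun i hi he => by
      have := H.aa _ (by omega) _ (by omega) he; omega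
    rw [carryXor, run_append, run_append]
    apply run_inverse_of_run
    rw [run_majGate_toggle hab hza.symm hzb hxa hxb hxz]
    set s₁ := run (majGate z (b 0) (a 0)) s with hs₁
    rw [run_majGate hab hza.symm hzb] at hs₁
    have e4 : ∀ w, w ≠ a 0 → w ≠ z → w ≠ b 0 → s₁ w = s w := fun w w1 w2 w3 => by
      simp [hs₁, w1, w2, w3]
    have ea : s₁ (a 0) = maj (s (a 0)) (s (b 0)) (s z) := by simp [hs₁]
    have eh : ∀ i < k + 1, s₁ (h i) = s (h i) := fun i hi =>
      e4 _ ((hh i hi).2 0 (by omega)).1 (hh i hi).1 ((hh i hi).2 0 (by omega)).2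
    rw [run_append, run_CCX ((hh 0 (by omega)).2 0 (by omega)).1 hxh.symm hxa.symm,
      ih H.tail hxa (fun i hi => hx (i + 1) (by omega))
        (fun i hi => ⟨((hh (i + 1) (by omega)).2 0 (by omega)).1,
          fun j hj => (hh (i + 1) (by omega)).2 (j + 1) (by omega)⟩), toggle_toggle,
      xsum_succ_left]
    congr 2
    · rw [eh 0 (by omega), ea]; rfl
    · apply xsum_congr
      intro i hi
      rw [toggle_ne (hx (i + 1) (by omega)).2.2.symm, toggle_ne hxa.symm, eh _ (by omega),
        carry_succ_left (fun j => s (a j)) (fun j => s (b j)) (s z)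
          (i + 1), ea]
      congr 1
      apply carry_congr
      · intro j hj
        rw [toggle_ne (hx (j + 1) (by omega)).1.symm,
          e4 _ (haa j (by omega)) (H.za _ (by omega)).symm (H.ab _ (by omega) 0 (by omega))]
      · intro j hj
        rw [toggle_ne (hx (j + 1) (by omega)).2.1.symm,
          e4 _ (H.ab 0 (by omega) _ (by omega)).symm (H.zb _ (by omega)).symm (hbb j (by omega))]

theorem toffoliCount_carryXor (x z : W) (h a b : ℕ → W) (k : ℕ) :
    toffoliCount (carryXor x z h a b k) ≤ 3 * k := by
  induction k generalizing z h a b with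
  | zero => simp [carryXor]
  | succ k ih =>
    have h1 := toffoliCount_majGate z (b 0) (a 0)
    have h2 := toffoliCount_CCX (h 0) (a 0) x
    have h3 := ih (a 0) (fun i => h (i + 1)) (fun i => a (i + 1)) (fun i => b (i + 1))
    simp only [carryXor, toffoliCount_append, toffoliCount_inverse]
    omega

/-! ### Prefix masks and bit lengths -/

/-- Toggles `b i` by the XOR of the bits on `h 0, …, h i`, for `i ≤ k`.  A mark on the single wire
`h v` thus complements the cells from place `v` on, without a Toffoli gate. -/
def maskXor (h b : ℕ → W) : ℕ → Circuit W
  | 0 => CX (h 0) (b 0)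
  | k + 1 => CX (h 0) (b 0) ++ CX (h 0) (h 1) ++
      maskXor (fun i => h (i + 1)) (fun i => b (i + 1)) k ++ CX (h 0) (h 1)

theorem run_maskXor {h b : ℕ → W} {k : ℕ} (hhb : ∀ i ≤ k, ∀ j ≤ k, h i ≠ b j)
    (hh : ∀ i ≤ k, ∀ j ≤ k, h i = h j → i = j) (hb : ∀ i ≤ k, ∀ j ≤ k, b i = b j → i = j)
    (s : W → Bool) :
    (∀ i ≤ k, run (maskXor h b k) s (b i) = xor (s (b i)) (xsum (i + 1) fun j => s (h j))) ∧
      ∀ w, (∀ i ≤ k, w ≠ b i) → run (maskXor h b k) s w = s w := by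
  induction k generalizing h b s with
  | zero =>
    rw [maskXor, run_CX (hhb 0 le_rfl 0 le_rfl)]
    refine ⟨fun i hi => ?_, fun w hw => toggle_ne (hw 0 le_rfl) _⟩
    obtain rfl : i = 0 := by omega
    simp [toggle, xsum]
  | succ k ih =>
    have h01 : h 0 ≠ h 1 := fun he => by
      have := hh 0 (by omega) 1 (by omega) he; omega
    have hb0 : ∀ i ≤ k, b (i + 1) ≠ b 0 := fun i hi he => by
      have := hb _ (by omega) _ (by omega) he; omega
    simp only [maskXor, run_append, run_CX (hhb 0 (by omega) 0 (by omega)), run_CX h01]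
    set s₁ := toggle (toggle s (b 0) (s (h 0))) (h 1)
      (toggle s (b 0) (s (h 0)) (h 0)) with hs₁
    obtain ⟨h1, h2⟩ := ih (h := fun i => h (i + 1)) (b := fun i => b (i + 1))
      (fun i hi j hj => hhb _ (by omega) _ (by omega))
      (fun i hi j hj he => by have := hh _ (by omega) _ (by omega) he; omega)
      (fun i hi j hj he => by have := hb _ (by omega) _ (by omega) he; omega) s₁
    have e0 : s₁ (h 0) = s (h 0) := by
      rw [hs₁, toggle_ne h01, toggle_ne (hhb 0 (by omega) 0 (by omega))]
    have e1 : s₁ (h 1) = xor (s (h 1)) (s (h 0)) := by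
      rw [hs₁, toggle_self, toggle_ne (hhb 1 (by omega) 0 (by omega)),
        toggle_ne (hhb 0 (by omega) 0 (by omega))]
    have e2 : ∀ i ≤ k, i ≠ 0 → s₁ (h (i + 1)) = s (h (i + 1)) := fun i hi hi0 => by
      rw [hs₁, toggle_ne fun he => hi0 (by have := hh _ (by omega) _ (by omega) he; omega),
        toggle_ne (hhb _ (by omega) 0 (by omega))]
    have ex : ∀ i ≤ k, (xsum (i + 1) fun j => s₁ (h (j + 1))) = xsum (i + 2) fun j => s (h j) := by
      intro i hi
      rw [xsum_succ_left, e1, xsum_succ_left, xsum_succ_left, Bool.xor_comm (s (h 1)),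
        Bool.xor_assoc]
      congr 2
      exact xsum_congr fun j hj => e2 (j + 1) (by omega) (by omega)
    have e3 := h2 (h 0) fun i hi => hhb 0 (by omega) _ (by omega)
    constructor
    · intro i hi
      rw [toggle_ne (hhb 1 (by omega) i hi).symm]
      rcases i with _ | i
      · rw [h2 _ fun i hi => (hb0 i hi).symm, hs₁, toggle_ne (hhb 1 (by omega) 0 hi).symm,
          toggle_self]
        simp [xsum]
      · rw [h1 i (by omega), ex i (by omega), hs₁, toggle_ne (hhb 1 (by omega) _ hi).symm,
          toggle_ne (hb0 i (by omega))]
    · intro w hw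
      by_cases hw1 : w = h 1
      · subst hw1
        rw [toggle_self, h2 _ fun i hi => hw _ (by omega), e3, e0, e1]
        simp
      · rw [toggle_ne hw1, h2 _ fun i hi => hw _ (by omega), hs₁, toggle_ne hw1,
          toggle_ne (hw 0 (by omega))]

theorem toffoliCount_maskXor (h b : ℕ → W) (k : ℕ) : toffoliCount (maskXor h b k) = 0 := by
  induction k generalizing h b with
  | zero => simp [maskXor]
  | succ k ih => simp [maskXor, ih]

/-- With start marks `y`, place `i` is active if a start mark has been met at a place `j ≤ i` and no
digit `1` of `w` at the places `j, …, i - 1`; for several marks the contributions are XORed. -/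
def active (y w : ℕ → Bool) : ℕ → Bool
  | 0 => y 0
  | i + 1 => xor (y (i + 1)) (active y w i && !w i)

theorem active_tail {y w y' w' : ℕ → Bool} {k : ℕ} (h0 : y' 0 = active y w 1)
    (hy : ∀ i, i + 1 ≤ k → y' (i + 1) = y (i + 2)) (hw : ∀ i < k, w' i = w (i + 1)) :
    ∀ i ≤ k, active y' w' i = active y w (i + 1) := by
  intro i hi
  induction i with
  | zero => exact h0
  | succ i ih => rw [active, ih (by omega), hy i hi, hw i (by omega)]; rfl

/-- Toggles the wires `T 0, …, T (m - 1)` by the binary digits of the number `v` if the wires `y`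
and `x` both hold `1`; the wire `c` holds `0`. -/
def andXorConst (y x c : W) (v : ℕ) (T : ℕ → W) (m : ℕ) : Circuit W :=
  CCX y x c ++ seq m (fun l => if v.testBit l then CX c (T l) else []) ++ CCX y x c

theorem run_andXorConst {y x c : W} {v : ℕ} {T : ℕ → W} {m : ℕ} {s : W → Bool} (hyx : y ≠ x)
    (hyc : y ≠ c) (hxc : x ≠ c) (hT : ∀ l < m, T l ≠ y ∧ T l ≠ x ∧ T l ≠ c)
    (hTT : ∀ i < m, ∀ j < m, T i = T j → i = j) (hc : s c = false) :
    (∀ l < m, run (andXorConst y x c v T m) s (T l) =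
      xor (s (T l)) (s y && s x && v.testBit l)) ∧
      ∀ w, (∀ l < m, w ≠ T l) → run (andXorConst y x c v T m) s w = s w := by
  have hseq := run_seq_disjoint (k := m) (t := T) (g := fun l s => v.testBit l && s c)
    (f := fun l => if v.testBit l then CX c (T l) else [])
    (fun l hl s => by
      cases v.testBit l
      · simp
      · simp [run_CX (hT l hl).2.2.symm])
    (fun i hi j hj s b => by
      show (v.testBit i && toggle s (T j) b c) = _
      rw [toggle_ne (hT j hj).2.2.symm]) hTT (toggle s c (s y && s x))
  simp only [andXorConst, run_append, run_CCX hyx hyc hxc]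
  obtain ⟨h1, h2, -⟩ := hseq
  set s₁ := run (seq m fun l => if v.testBit l then CX c (T l) else []) (toggle s c (s y && s x))
  rw [h2 y fun l hl => (hT l hl).1.symm, h2 x fun l hl => (hT l hl).2.1.symm, toggle_ne hyc,
    toggle_ne hxc]
  constructor
  · intro l hl
    rw [toggle_ne (hT l hl).2.2, h1 l hl, toggle_ne (hT l hl).2.2, toggle_self, hc]
    cases s y <;> cases s x <;> simp
  · intro w hw
    by_cases hwc : w = c
    · subst hwc
      rw [toggle_self, h2 w hw, toggle_self]; simp
    · rw [toggle_ne hwc, h2 w hw, toggle_ne hwc]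

/-- Toggles the number on the wires `T` by the XOR of the numbers `v i` over the active places `i`
with digit `1`.  For a single start mark this is the number `v i` of the first digit `1` of `w` from
the mark on. -/
def firstOne (y w : ℕ → W) (v : ℕ → ℕ) (T : ℕ → W) (m : ℕ) (c : W) : ℕ → Circuit W
  | 0 => andXorConst (y 0) (w 0) c (v 0) T m
  | k + 1 => andXorConst (y 0) (w 0) c (v 0) T m ++ litCCX (w 0, false) (y 0) (y 1) ++
      firstOne (fun i => y (i + 1)) (fun i => w (i + 1)) (fun i => v (i + 1)) T m c k ++
      litCCX (w 0, false) (y 0) (y 1)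

theorem run_firstOne {y w : ℕ → W} {v : ℕ → ℕ} {T : ℕ → W} {m : ℕ} {c : W} {k : ℕ} {s : W → Bool}
    (hyw : ∀ i ≤ k, ∀ j ≤ k, y i ≠ w j) (hyc : ∀ i ≤ k, y i ≠ c) (hwc : ∀ i ≤ k, w i ≠ c)
    (hT : ∀ l < m, T l ≠ c ∧ ∀ i ≤ k, T l ≠ y i ∧ T l ≠ w i)
    (hTT : ∀ i < m, ∀ j < m, T i = T j → i = j) (hyy : ∀ i ≤ k, ∀ j ≤ k, y i = y j → i = j)
    (hc : s c = false) :
    (∀ l < m, run (firstOne y w v T m c k) s (T l) = xor (s (T l)) (xsum (k + 1) fun i =>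
        active (fun j => s (y j)) (fun j => s (w j)) i && s (w i) && (v i).testBit l)) ∧
      ∀ x, (∀ l < m, x ≠ T l) → run (firstOne y w v T m c k) s x = s x := by
  induction k generalizing y w v s with
  | zero =>
    have H := run_andXorConst (v := v 0) (hyw 0 le_rfl 0 le_rfl) (hyc 0 le_rfl) (hwc 0 le_rfl)
      (fun l hl => ⟨((hT l hl).2 0 le_rfl).1, ((hT l hl).2 0 le_rfl).2, (hT l hl).1⟩) hTT hc
    refine ⟨fun l hl => ?_, H.2⟩
    rw [firstOne, H.1 l hl]
    simp [xsum, active]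
  | succ k ih =>
    have h01 : y 0 ≠ y 1 := fun he => by
      have := hyy 0 (by omega) 1 (by omega) he; omega
    have h10 := (hyw 1 (by omega) 0 (by omega)).symm
    have h00 := hyw 0 (by omega) 0 (by omega)
    obtain ⟨a1, a2⟩ := run_andXorConst (v := v 0) h00 (hyc 0 (by omega)) (hwc 0 (by omega))
      (fun l hl => ⟨((hT l hl).2 0 (by omega)).1, ((hT l hl).2 0 (by omega)).2, (hT l hl).1⟩) hTT hc
    simp only [firstOne, run_append, run_litCCX (l := (w 0, false)) h00.symm h10 h01]
    set s₁ := run (andXorConst (y 0) (w 0) c (v 0) T m) s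
    have nT : ∀ i ≤ k + 1, s₁ (y i) = s (y i) ∧ s₁ (w i) = s (w i) := fun i hi =>
      ⟨a2 _ fun l hl => ((hT l hl).2 i hi).1.symm, a2 _ fun l hl => ((hT l hl).2 i hi).2.symm⟩
    have nc : s₁ c = s c := a2 _ fun l hl => (hT l hl).1.symm
    set s₂ := toggle s₁ (y 1) ((s₁ (w 0) == false) && s₁ (y 0)) with hs₂
    obtain ⟨h1, h2⟩ := ih (y := fun i => y (i + 1)) (w := fun i => w (i + 1))
      (v := fun i => v (i + 1)) (s := s₂) (fun i hi j hj => hyw _ (by omega) _ (by omega))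
      (fun i hi => hyc _ (by omega)) (fun i hi => hwc _ (by omega))
      (fun l hl => ⟨(hT l hl).1, fun i hi => (hT l hl).2 _ (by omega)⟩)
      (fun i hi j hj he => by have := hyy _ (by omega) _ (by omega) he; omega)
      (by rw [hs₂, toggle_ne (hyc 1 (by omega)).symm, nc, hc])
    have ew : ∀ i ≤ k + 1, s₂ (w i) = s (w i) := fun i hi => by
      rw [hs₂, toggle_ne (hyw 1 (by omega) i hi).symm, (nT i hi).2]
    have e1 : s₂ (y 1) = xor (s (y 1)) (s (y 0) && !s (w 0)) := by
      rw [hs₂, toggle_self, (nT 1 (by omega)).1, (nT 0 (by omega)).1, (nT 0 (by omega)).2]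
      cases s (w 0) <;> simp
    have e0 : s₂ (y 0) = s (y 0) := by rw [hs₂, toggle_ne h01, (nT 0 (by omega)).1]
    have ey : ∀ i ≤ k + 1, 2 ≤ i → s₂ (y i) = s (y i) := fun i hi hi2 => by
      rw [hs₂, toggle_ne fun he => by have := hyy _ hi 1 (by omega) he; omega, (nT i hi).1]
    have f0 := h2 (y 0) fun l hl => ((hT l hl).2 0 (by omega)).1.symm
    have fw := h2 (w 0) fun l hl => ((hT l hl).2 0 (by omega)).2.symm
    constructor
    · intro l hl
      have hTy := ((hT l hl).2 1 (by omega)).1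
      rw [toggle_ne hTy, h1 l hl, hs₂, toggle_ne hTy, a1 l hl, ← hs₂, xsum_succ_left (k + 1),
        Bool.xor_assoc]
      congr 2
      apply xsum_congr
      intro i hi
      rw [ew (i + 1) (by omega), active_tail (k := k) (y := fun j => s (y j)) (w := fun j => s (w
          j))
        e1 (fun j hj => ey (j + 2) (by omega) (by omega)) (fun j hj => ew (j + 1) (by omega)) i
        (by omega)]
    · intro x hx
      by_cases hx1 : x = y 1
      · subst hx1
        rw [toggle_self, h2 _ hx, f0, fw, e0, e1, ew 0 (by omega)]
        cases s (w 0) <;> simp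
      · rw [toggle_ne hx1, h2 _ hx, hs₂, toggle_ne hx1, a2 _ hx]

theorem toffoliCount_firstOne (y w : ℕ → W) (v : ℕ → ℕ) (T : ℕ → W) (m : ℕ) (c : W) (k : ℕ) :
    toffoliCount (firstOne y w v T m c k) ≤ 4 * k + 2 := by
  have hh : ∀ (y x : W) (v : ℕ), toffoliCount (andXorConst y x c v T m) ≤ 2 := by
    intro y x v
    have h1 := toffoliCount_CCX y x c
    have h2 : toffoliCount (seq m fun l => if v.testBit l then CX c (T l) else []) ≤ m * 0 :=
      toffoliCount_seq_le fun l _ => by split_ifs <;> simp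
    simp only [andXorConst, toffoliCount_append]
    omega
  induction k generalizing y w v with
  | zero => simpa [firstOne] using hh _ _ _
  | succ k ih =>
    have h1 := hh (y 0) (w 0) (v 0)
    have h2 := toffoliCount_litCCX (w 0, false) (y 0) (y 1)
    have h3 := ih (fun i => y (i + 1)) (fun i => w (i + 1)) (fun i => v (i + 1))
    simp only [firstOne, toffoliCount_append]
    omega

/-! ### Marking the position given by a binary number -/

/-- Moves a mark from `pos i` to `pos (i + 2 ^ j)` if the bit on `b j` is `1`, provided that both
positions exist. -/
def decOp (b pos : ℕ → W) (P j i : ℕ) : Circuit W :=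
  if i + 2 ^ j < P then CCX (pos i) (b j) (pos (i + 2 ^ j)) ++ CX (pos (i + 2 ^ j)) (pos i) else []

/-- A map on the wires `pos 0, …, pos (P - 1)`, linear over `𝔽₂`, that takes a mark on `pos 0` to a
mark on `pos v`, where `v` is the number on the wires `b 0, …, b (k - 1)`. -/
def dec (b pos : ℕ → W) (P : ℕ) : ℕ → Circuit W
  | 0 => []
  | k + 1 => dec b pos P k ++ seq (2 ^ k) (decOp b pos P k)

/-- The wires `pos` are distinct and disjoint from the wires `b`. -/
structure PosWires (b pos : ℕ → W) (P k : ℕ) : Prop where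
  bp : ∀ j < k, ∀ i < P, b j ≠ pos i
  pp : ∀ i < P, ∀ j < P, pos i = pos j → i = j

section dec

variable {b pos : ℕ → W} {P k : ℕ}

theorem PosWires.pos_ne (h : PosWires b pos P k) {i j : ℕ} (hi : i < P) (hj : j < P) (hij : i ≠ j) :
    pos i ≠ pos j := fun he => hij (h.pp i hi j hj he)

theorem run_decOp_frame (h : PosWires b pos P k) {j i : ℕ} (hj : j < k) {w : W}
    (hw : ∀ i < P, w ≠ pos i) (s : W → Bool) : run (decOp b pos P j i) s w = s w := by
  unfold decOp
  split_ifs with hi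
  · have hp : 0 < 2 ^ j := by positivity
    rw [run_append, run_CCX (h.bp j hj i (by omega)).symm
      (h.pos_ne (by omega) hi (by omega)) (h.bp j hj _ hi), run_CX (h.pos_ne hi (by omega)
        (by omega)),
      toggle_ne (hw _ (by omega)), toggle_ne (hw _ hi)]
  · rfl

theorem run_dec_frame (h : PosWires b pos P k) {w : W} (hw : ∀ i < P, w ≠ pos i) (s : W → Bool) :
    run (dec b pos P k) s w = s w := by
  suffices H : ∀ m ≤ k, ∀ s, run (dec b pos P m) s w = s w from H k le_rfl s
  intro m
  induction m with
  | zero => intro _ s; rfl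
  | succ m ih =>
    intro hm s
    have hseq : ∀ l s, run (seq l (decOp b pos P m)) s w = s w := by
      intro l
      induction l with
      | zero => intro s; rfl
      | succ l ihl => intro s; rw [seq_succ, run_append, run_decOp_frame h (by omega) hw, ihl]
    rw [dec, run_append, hseq, ih (by omega)]

theorem run_decOp_toggle_other (h : PosWires b pos P k) {j i l : ℕ} (hj : j < k) (hl : l < P)
    (h1 : l ≠ i) (h2 : l ≠ i + 2 ^ j) (s : W → Bool) (c : Bool) :
    run (decOp b pos P j i) (toggle s (pos l) c) = toggle (run (decOp b pos P j i) s) (pos l) c :=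
      by
  unfold decOp
  split_ifs with hi
  · have hp : 0 < 2 ^ j := by positivity
    have hib := (h.bp j hj i (by omega)).symm
    have hii := h.pos_ne (i := i) (by omega) hi (by omega)
    rw [run_append, run_append, run_CCX hib hii (h.bp j hj _ hi), run_CCX hib hii (h.bp j hj _ hi),
      run_CX hii.symm, run_CX hii.symm]
    rw [toggle_ne (s := s) (h.pos_ne (by omega) hl h1.symm), toggle_ne (s := s) (h.bp j hj l hl),
      toggle_comm s (pos l), toggle_ne (s := toggle s _ _) (h.pos_ne hi hl h2.symm),
      toggle_comm _ (pos l)]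
  · rfl

/-- An additional mark on `pos i` is moved by the operation independently of the marks in `s`. -/
theorem run_decOp_toggle (h : PosWires b pos P k) {j i : ℕ} (hj : j < k) (hi : i < P)
    {s : W → Bool} (hs : s (b j) = true → i + 2 ^ j < P) (c : Bool) :
    run (decOp b pos P j i) (toggle s (pos i) c) =
      toggle (run (decOp b pos P j i) s) (pos (if s (b j) then i + 2 ^ j else i)) c := by
  unfold decOp
  split_ifs with hi' hb hb
  · have hp : 0 < 2 ^ j := by positivity
    have hib := (h.bp j hj i (by omega)).symm
    have hii := h.pos_ne (i := i) (by omega) hi' (by omega)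
    have hbi := h.bp j hj _ hi'
    rw [run_append, run_append, run_CCX hib hii hbi, run_CCX hib hii hbi, run_CX hii.symm,
      run_CX hii.symm]
    funext w
    simp only [toggle, hib.symm, hii.symm, if_true, if_false, hb]
    by_cases w1 : w = pos i
    · subst w1; simp [hii]
      cases s (pos i) <;> cases s (pos (i + 2 ^ j)) <;> cases c <;> rfl
    · by_cases w2 : w = pos (i + 2 ^ j)
      · subst w2; simp [hii.symm]
      · simp [w1, w2]
  · have hp : 0 < 2 ^ j := by positivity
    have hib := (h.bp j hj i (by omega)).symm
    have hii := h.pos_ne (i := i) (by omega) hi' (by omega)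
    have hbi := h.bp j hj _ hi'
    rw [run_append, run_append, run_CCX hib hii hbi, run_CCX hib hii hbi, run_CX hii.symm,
      run_CX hii.symm]
    funext w
    simp only [Bool.not_eq_true] at hb
    simp only [toggle, hib.symm, hii.symm, if_true, if_false, hb]
    by_cases w1 : w = pos i
    · subst w1; simp [hii]
      cases s (pos i) <;> cases s (pos (i + 2 ^ j)) <;> cases c <;> rfl
    · by_cases w2 : w = pos (i + 2 ^ j)
      · subst w2; simp [hii.symm]
      · simp [w1, w2]
  · exact absurd (hs hb) hi'
  · rfl

theorem run_seq_decOp_toggle (h : PosWires b pos P k) {j i m : ℕ} (hj : j < k) (hi : i < P)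
    (hi2 : i < 2 ^ j) (hm : m ≤ 2 ^ j) {s : W → Bool} (hs : s (b j) = true → i + 2 ^ j < P)
    (c : Bool) : run (seq m (decOp b pos P j)) (toggle s (pos i) c) =
      toggle (run (seq m (decOp b pos P j)) s)
        (pos (if s (b j) ∧ i < m then i + 2 ^ j else i)) c := by
  induction m with
  | zero => simp
  | succ m ih =>
    have hseq : ∀ l s, run (seq l (decOp b pos P j)) s (b j) = s (b j) := by
      intro l
      induction l with
      | zero => intro s; rfl
      | succ l ihl =>
        intro s; rw [seq_succ, run_append, run_decOp_frame h hj (h.bp j hj), ihl]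
    rw [seq_succ, run_append, run_append, ih (by omega)]
    by_cases him : i = m
    · subst him
      have := run_decOp_toggle h hj hi (s := run (seq i (decOp b pos P j)) s)
        (by rw [hseq]; exact hs) c
      simp only [lt_irrefl, and_false, if_false, this, hseq, Nat.lt_succ_self, and_true]
    · have hiff : i < m + 1 ↔ i < m := by omega
      simp only [hiff]
      split_ifs with hc
      · exact run_decOp_toggle_other h hj (hs hc.1) (by omega) (by omega) _ _
      · exact run_decOp_toggle_other h hj hi him (by omega) _ _

theorem run_dec_toggle (h : PosWires b pos P k) {v : ℕ} {s : W → Bool} (hv : v < P)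
    (hb : ∀ j < k, s (b j) = v.testBit j) (c : Bool) :
    run (dec b pos P k) (toggle s (pos 0) c) =
      toggle (run (dec b pos P k) s) (pos (v % 2 ^ k)) c := by
  suffices H : ∀ m ≤ k, run (dec b pos P m) (toggle s (pos 0) c) =
      toggle (run (dec b pos P m) s) (pos (v % 2 ^ m)) c from H k le_rfl
  intro m
  induction m with
  | zero => intro _; simp [dec, Nat.mod_one]
  | succ m ih =>
    intro hm
    have hbm : run (dec b pos P m) s (b m) = v.testBit m := by
      rw [run_dec_frame (k := m) ⟨fun j hj => h.bp j (by omega), h.pp⟩ (h.bp m (by omega)), hb m hm]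
    have hle := Nat.mod_le v (2 ^ m)
    have hmod : v % 2 ^ (m + 1) = v % 2 ^ m + 2 ^ m * (v.testBit m).toNat := by
      rw [Nat.mod_pow_succ, ← Nat.toNat_testBit]
    have hle' := Nat.mod_le v (2 ^ (m + 1))
    rw [dec, run_append, run_append, ih (by omega), run_seq_decOp_toggle h (by omega) (by omega)
      (Nat.mod_lt _ (by positivity)) le_rfl, hbm, hmod]
    · have := Nat.mod_lt v (show 0 < 2 ^ m by positivity)
      cases v.testBit m <;> simp [this]
    · rw [hbm]
      intro hvm
      rw [hvm] at hmod
      simp at hmod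
      omega

theorem toffoliCount_dec (b pos : ℕ → W) (P k : ℕ) : toffoliCount (dec b pos P k) ≤ 2 ^ k := by
  induction k with
  | zero => simp [dec]
  | succ k ih =>
    have : toffoliCount (seq (2 ^ k) (decOp b pos P k)) ≤ 2 ^ k * 1 := by
      apply toffoliCount_seq_le
      intro i _
      unfold decOp
      split_ifs
      · simpa using toffoliCount_CCX _ _ _
      · simp
    rw [dec, toffoliCount_append, pow_succ]
    omega

theorem formula_congr {F : List (Term W)} {s s' : W → Bool} {p : W → Prop}
    (hF : ∀ m ∈ F, ∀ x, p x → m.Avoids x) (hs : ∀ w, ¬ p w → s w = s' w) :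
    formula s F = formula s' F := by
  have hlits : ∀ L : List (W × Bool), (∀ l ∈ L, ¬ p l.1) → allLits s L = allLits s' L := by
    intro L hL
    induction L with
    | nil => rfl
    | cons l L ih =>
      simp only [List.mem_cons, forall_eq_or_imp] at hL
      rw [allLits_cons, allLits_cons, hs _ hL.1, ih hL.2]
  induction F with
  | nil => rfl
  | cons m F ih =>
    simp only [List.mem_cons, forall_eq_or_imp] at hF
    rw [formula, formula, ih hF.2, Term.val, Term.val,
      hlits m.1 fun l hl hp => (hF.1 _ hp).1 l hl rfl, hlits m.2 fun l hl hp => (hF.1 _ hp).2 l hl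
        rfl]

/-- Toggles `pos v` if `F` holds, where `v` is the number on the wires `b`.  The wires `pos` are
borrowed: they may be in any state.  This works because the decoder is linear: conjugating the
toggle of `pos 0` with it toggles the image of `pos 0`, whatever the other contents are. -/
def mark (F : List (Term W)) (b pos : ℕ → W) (P k : ℕ) (d e : W) : Circuit W :=
  (dec b pos P k).inverse ++ cflip F (pos 0) d e ++ dec b pos P k

theorem run_mark {F : List (Term W)} {d e : W} (h : PosWires b pos P k) (hP : 0 < P)
    (hF : ∀ m ∈ F, (∀ i < P, m.Avoids (pos i)) ∧ m.Avoids d ∧ m.Avoids e)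
    (hd : ∀ i < P, pos i ≠ d) (he : ∀ i < P, pos i ≠ e) (hde : d ≠ e) {v : ℕ} {s : W → Bool}
    (hb : ∀ j < k, s (b j) = v.testBit j) (hv : formula s F = true → v < P ∧ v < 2 ^ k) :
    run (mark F b pos P k d e) s = toggle s (pos v) (formula s F) := by
  rw [mark, run_append, run_append]
  set s₁ := run (dec b pos P k).inverse s with hs₁
  have hback : run (dec b pos P k) s₁ = s := run_run_inverse _ _
  have hfr : ∀ w, (∀ i < P, w ≠ pos i) → s₁ w = s w := fun w hw => by
    rw [← hback, run_dec_frame h hw]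
  have hform : formula s₁ F = formula s F :=
    formula_congr (p := fun w => ∃ i < P, w = pos i)
      (fun m hm x ⟨i, hi, hx⟩ => hx ▸ (hF m hm).1 i hi) (fun w hw => hfr w (by
        intro i hi he; exact hw ⟨i, hi, he⟩))
  rw [run_cflip (fun m hm => ⟨(hF m hm).1 0 hP, (hF m hm).2⟩) (hd 0 hP) (he 0 hP) hde, hform]
  cases hc : formula s F
  · simp [hback]
  · obtain ⟨hvP, hvk⟩ := hv hc
    rw [run_dec_toggle h hvP (fun j hj => (hfr _ (h.bp j hj)).trans (hb j hj)), hback,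
      Nat.mod_eq_of_lt hvk]

end dec

/-! ### Digit sequences of sums and differences -/

theorem carry_testBit {a b : ℕ → Bool} {A B i : ℕ} (ha : ∀ j < i, a j = A.testBit j)
    (hb : ∀ j < i, b j = B.testBit j) :
    carry a b false i = decide (2 ^ i ≤ A % 2 ^ i + B % 2 ^ i) := by
  induction i with
  | zero => simp [carry, Nat.mod_one]
  | succ i ih =>
    rw [carry, ih (fun j hj => ha j (by omega)) (fun j hj => hb j (by omega)), ha i (by omega),
      hb i (by omega), Nat.mod_pow_succ, Nat.mod_pow_succ, ← Nat.toNat_testBit,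
      ← Nat.toNat_testBit, pow_succ]
    have h1 := Nat.mod_lt A (show 0 < 2 ^ i by positivity)
    have h2 := Nat.mod_lt B (show 0 < 2 ^ i by positivity)
    rw [Bool.eq_iff_iff]
    cases A.testBit i <;> cases B.testBit i <;>
      by_cases hc : 2 ^ i ≤ A % 2 ^ i + B % 2 ^ i <;> simp [maj, hc] <;> omega

/-- The digits of the sum of the digit sequences `a` and `b`. -/
def addBits (a b : ℕ → Bool) (i : ℕ) : Bool := xor (b i) (xor (a i) (carry a b false i))

theorem addBits_testBit {a b : ℕ → Bool} {A B i : ℕ} (ha : ∀ j ≤ i, a j = A.testBit j)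
    (hb : ∀ j ≤ i, b j = B.testBit j) : addBits a b i = (A + B).testBit i := by
  rw [addBits, ha i le_rfl, hb i le_rfl, carry_testBit (fun j hj => ha j hj.le)
    (fun j hj => hb j hj.le)]
  have h1 := Nat.mod_lt A (show 0 < 2 ^ i by positivity)
  have h2 := Nat.mod_lt B (show 0 < 2 ^ i by positivity)
  have hA := Nat.div_add_mod A (2 ^ i)
  have hB := Nat.div_add_mod B (2 ^ i)
  have hp : 0 < 2 ^ i := by positivity
  rw [Nat.testBit_eq_decide_div_mod_eq, Nat.testBit_eq_decide_div_mod_eq,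
    Nat.testBit_eq_decide_div_mod_eq, Nat.add_div hp]
  split_ifs with hc
  · simp only [hc, decide_true]
    rcases Nat.mod_two_eq_zero_or_one (A / 2 ^ i) with e1 | e1 <;>
    rcases Nat.mod_two_eq_zero_or_one (B / 2 ^ i) with e2 | e2 <;>
    rw [Nat.add_mod, Nat.add_mod (A / 2 ^ i), e1, e2] <;> simp
  · simp only [hc, decide_false]
    rcases Nat.mod_two_eq_zero_or_one (A / 2 ^ i) with e1 | e1 <;>
    rcases Nat.mod_two_eq_zero_or_one (B / 2 ^ i) with e2 | e2 <;>
    rw [Nat.add_zero, Nat.add_mod (A / 2 ^ i), e1, e2] <;> simp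

theorem testBit_compl {B L i : ℕ} (hB : B < 2 ^ L) (hi : i < L) :
    (2 ^ L - 1 - B).testBit i = !B.testBit i := by
  rw [show 2 ^ L - 1 - B = 2 ^ L - (B + 1) by omega, Nat.testBit_two_pow_sub_succ hB]
  simp [hi]

/-- The carry out of place `i` of `a + ¬b` compares the lower parts of `a` and `b`. -/
theorem carry_not_testBit {a b : ℕ → Bool} {A B i : ℕ} (ha : ∀ j < i, a j = A.testBit j)
    (hb : ∀ j < i, b j = !B.testBit j) (hA : A < 2 ^ i) (hB : B < 2 ^ i) :
    carry a b false i = decide (B < A) := by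
  rw [carry_testBit (B := 2 ^ i - 1 - B) ha fun j hj => by rw [hb j hj, testBit_compl hB hj],
    Nat.mod_eq_of_lt hA, Nat.mod_eq_of_lt (by omega), decide_eq_decide]
  omega

/-- Adding `a` between two complementations of the low `L` places, and then subtracting `a`,
subtracts `2 * a` in the low places and does nothing in the high places. -/
theorem addBits_condSub {a b : ℕ → Bool} {A B L : ℕ} (ha : ∀ j < L, a j = A.testBit j)
    (hb : ∀ j < L, b j = B.testBit j) (hB : B < 2 ^ L) (hAB : 2 * A ≤ B) (i : ℕ) :
    addBits a (fun j => if j < L then (B - 2 * A).testBit j else b j) i =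
      xor (addBits a (fun j => xor (b j) (decide (j < L))) i) (decide (i < L)) := by
  set e : ℕ → Bool := fun j => if j < L then (B - 2 * A).testBit j else b j with he
  set u : ℕ → Bool := fun j => xor (b j) (decide (j < L)) with hu
  have hel : ∀ j < L, e j = (B - 2 * A).testBit j := fun j hj => by simp [he, hj]
  have hul : ∀ j < L, u j = (2 ^ L - 1 - B).testBit j := fun j hj => by
    simp [hu, hj, testBit_compl hB, hb]
  by_cases hi : i < L
  · rw [addBits_testBit (fun j hj => ha j (by omega)) (fun j hj => hel j (by omega)),
      addBits_testBit (fun j hj => ha j (by omega)) (fun j hj => hul j (by omega))]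
    have := testBit_compl (B := A + (2 ^ L - 1 - B)) (L := L) (by omega) hi
    simp only [hi, decide_true, Bool.xor_true, ← this]
    congr 1
    omega
  · have hc : ∀ d, carry a e false (L + d) = carry a u false (L + d) := by
      intro d
      induction d with
      | zero =>
        rw [Nat.add_zero, carry_testBit ha hel, carry_testBit ha hul, Nat.mod_eq_of_lt (by omega),
          Nat.mod_eq_of_lt (by omega), Nat.mod_eq_of_lt (by omega), decide_eq_decide]
        omega
      | succ d ih =>
        rw [← Nat.add_assoc, carry, carry, ih]
        simp [he, hu]
    have := hc (i - L)
    rw [Nat.add_sub_cancel' (by omega)] at this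
    simp only [addBits, this]
    simp [he, hu, hi]

end Circuit

open Circuit

namespace Inversion

/-! ### Contents of the registers -/

instance width_neZero (n : ℕ) [NeZero n] (R : Reg) : NeZero (R.width n) :=
  ⟨by cases R <;> simp [Reg.width, NeZero.ne n]⟩

/-- The qubit with index `i` modulo the width in the register `R`. -/
def qubit (n : ℕ) [NeZero n] (R : Reg) (i : ℕ) : Qubit n := ⟨R, Fin.ofNat (R.width n) i⟩

/-- Contents of all registers: cells of the work and output registers, numbers in the length
registers, and the control bits. -/
structure Conf where
  w1 : ℕ → Bool
  w2 : ℕ → Bool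
  out : ℕ → Bool
  lt : ℕ
  lq : ℕ
  lr : ℕ
  ls : ℕ
  p1 : Bool
  p2 : Bool
  it : Bool
  sg : Bool
  ct : Bool

/-- The bit in place `i` of a register. -/
def Conf.bit (c : Conf) : Reg → ℕ → Bool
  | .work1, i => c.w1 i
  | .work2, i => c.w2 i
  | .output, i => c.out i
  | .lenT, i => c.lt.testBit i
  | .lenQ, i => c.lq.testBit i
  | .lenR, i => c.lr.testBit i
  | .lenS, i => c.ls.testBit i
  | .phase1, _ => c.p1
  | .phase2, _ => c.p2
  | .iter, _ => c.it
  | .sign, _ => c.sg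
  | .ctrl, _ => c.ct

/-- The basis state with the contents `c`; lengths are reduced modulo the size of their register. -/
def Conf.enc (n : ℕ) (c : Conf) : Qubit n → Bool := fun w => c.bit w.1 w.2

section

variable {n : ℕ} [NeZero n]

@[simp] theorem qubit_fst (R : Reg) (i : ℕ) : (qubit n R i).1 = R := rfl

theorem enc_qubit (c : Conf) (R : Reg) (i : ℕ) :
    c.enc n (qubit n R i) = c.bit R (i % R.width n) := rfl

theorem enc_qubit_of_lt (c : Conf) {R : Reg} {i : ℕ} (h : i < R.width n) :
    c.enc n (qubit n R i) = c.bit R i := by rw [enc_qubit, Nat.mod_eq_of_lt h]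

theorem qubit_ne_of_reg {R R' : Reg} (h : R ≠ R') (i j : ℕ) : qubit n R i ≠ qubit n R' j :=
  fun he => h (congrArg Sigma.fst he)

theorem mod_eq_of_qubit_eq {R : Reg} {i j : ℕ} (h : qubit n R i = qubit n R j) :
    i % R.width n = j % R.width n := by
  have := eq_of_heq (Sigma.mk.inj h).2
  exact congrArg Fin.val this

theorem eq_of_qubit_eq {R : Reg} {i j : ℕ} (hi : i < R.width n) (hj : j < R.width n)
    (h : qubit n R i = qubit n R j) : i = j := by
  have := mod_eq_of_qubit_eq h
  rwa [Nat.mod_eq_of_lt hi, Nat.mod_eq_of_lt hj] at this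

theorem qubit_ne {R : Reg} {i j : ℕ} (hi : i < R.width n) (hj : j < R.width n) (h : i ≠ j) :
    qubit n R i ≠ qubit n R j := fun he => h (eq_of_qubit_eq hi hj he)

theorem exists_eq_qubit (w : Qubit n) : ∃ i < w.1.width n, w = qubit n w.1 i := by
  obtain ⟨R, i⟩ := w
  refine ⟨i, i.2, ?_⟩
  simp only [qubit]
  congr 1
  exact Fin.ext (Nat.mod_eq_of_lt i.2).symm

theorem eq_enc {s : Qubit n → Bool} {c : Conf}
    (h : ∀ R, ∀ i < R.width n, s (qubit n R i) = c.bit R i) : s = c.enc n := by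
  funext w
  obtain ⟨i, hi, hw⟩ := exists_eq_qubit w
  rw [hw, h _ i hi, enc_qubit_of_lt c hi]

theorem enc_congr {c c' : Conf} (h : ∀ R, ∀ i < R.width n, c.bit R i = c'.bit R i) :
    c.enc n = c'.enc n :=
  eq_enc fun R i hi => by rw [enc_qubit_of_lt c hi, h R i hi]

/-- A state that differs from `c` only on an array of wires of one register. -/
theorem eq_enc_of_array {s : Qubit n → Bool} {c c' : Conf} {R : Reg} {f : ℕ → ℕ} {k : ℕ}
    (hf : ∀ i < k, f i < R.width n) (hother : ∀ R' ≠ R, c'.bit R' = c.bit R')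
    (hval : ∀ i < k, s (qubit n R (f i)) = c'.bit R (f i))
    (hrest : ∀ j < R.width n, (∀ i < k, j ≠ f i) → c'.bit R j = c.bit R j)
    (hframe : ∀ w, (∀ i < k, w ≠ qubit n R (f i)) → s w = c.enc n w) : s = c'.enc n := by
  apply eq_enc
  intro R' j hj
  by_cases hR : R' = R
  · subst hR
    by_cases hex : ∃ i < k, j = f i
    · obtain ⟨i, hi, rfl⟩ := hex
      exact hval i hi
    · push Not at hex
      rw [hframe _ fun i hi he => hex i hi (eq_of_qubit_eq hj (hf i hi) he), enc_qubit_of_lt c hj,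
        hrest j hj hex]
  · rw [hframe _ fun i hi => qubit_ne_of_reg hR _ _, enc_qubit_of_lt c hj, hother R' hR]

theorem toggle_enc {c c' : Conf} {R : Reg} {i : ℕ} {b : Bool} (hi : i < R.width n)
    (hother : ∀ R' ≠ R, c'.bit R' = c.bit R')
    (h : ∀ j < R.width n, c'.bit R j = if j = i then xor (c.bit R j) b else c.bit R j) :
    toggle (c.enc n) (qubit n R i) b = c'.enc n := by
  apply eq_enc
  intro R' j hj
  by_cases hR : R' = R
  · subst hR
    rw [h j hj]
    split_ifs with hji
    · rw [hji, toggle_self, enc_qubit_of_lt c hi]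
    · rw [toggle_ne (qubit_ne hj hi hji), enc_qubit_of_lt c hj]
  · rw [toggle_ne (qubit_ne_of_reg hR _ _), enc_qubit_of_lt c hj, hother R' hR]

theorem toggle_phase1 (c : Conf) (b : Bool) :
    toggle (c.enc n) (qubit n .phase1 0) b = { c with p1 := xor c.p1 b }.enc n :=
  toggle_enc Nat.zero_lt_one (fun R hR => by cases R <;> first | rfl | exact absurd rfl hR)
    fun j hj => by have : j = 0 := Nat.lt_one_iff.1 hj
                   simp [this, Conf.bit]

theorem toggle_phase2 (c : Conf) (b : Bool) :
    toggle (c.enc n) (qubit n .phase2 0) b = { c with p2 := xor c.p2 b }.enc n :=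
  toggle_enc Nat.zero_lt_one (fun R hR => by cases R <;> first | rfl | exact absurd rfl hR)
    fun j hj => by have : j = 0 := Nat.lt_one_iff.1 hj
                   simp [this, Conf.bit]

theorem toggle_iter (c : Conf) (b : Bool) :
    toggle (c.enc n) (qubit n .iter 0) b = { c with it := xor c.it b }.enc n :=
  toggle_enc Nat.zero_lt_one (fun R hR => by cases R <;> first | rfl | exact absurd rfl hR)
    fun j hj => by have : j = 0 := Nat.lt_one_iff.1 hj
                   simp [this, Conf.bit]

theorem toggle_sign (c : Conf) (b : Bool) :
    toggle (c.enc n) (qubit n .sign 0) b = { c with sg := xor c.sg b }.enc n :=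
  toggle_enc Nat.zero_lt_one (fun R hR => by cases R <;> first | rfl | exact absurd rfl hR)
    fun j hj => by have : j = 0 := Nat.lt_one_iff.1 hj
                   simp [this, Conf.bit]

theorem toggle_ctrl (c : Conf) (b : Bool) :
    toggle (c.enc n) (qubit n .ctrl 0) b = { c with ct := xor c.ct b }.enc n :=
  toggle_enc Nat.zero_lt_one (fun R hR => by cases R <;> first | rfl | exact absurd rfl hR)
    fun j hj => by have : j = 0 := Nat.lt_one_iff.1 hj
                   simp [this, Conf.bit]

theorem toggle_output (c : Conf) {i : ℕ} (hi : i < n) (b : Bool) :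
    toggle (c.enc n) (qubit n .output i) b =
      { c with out := fun j => if j = i then xor (c.out j) b else c.out j }.enc n :=
  toggle_enc hi (fun R hR => by cases R <;> first | rfl | exact absurd rfl hR) fun j _ => rfl

/-! ### Conditions on the control bits and the length registers -/

/-- All literals of `F` are in the registers in `S`. -/
def Uses (F : List (Term (Qubit n))) (S : List Reg) : Prop :=
  ∀ m ∈ F, (∀ l ∈ m.1, l.1.1 ∈ S) ∧ ∀ l ∈ m.2, l.1.1 ∈ S

theorem Uses.avoids {F : List (Term (Qubit n))} {S : List Reg} (h : Uses F S) {x : Qubit n}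
    (hx : x.1 ∉ S) : ∀ m ∈ F, m.Avoids x := fun m hm =>
  ⟨fun l hl he => hx (he ▸ (h m hm).1 l hl), fun l hl he => hx (he ▸ (h m hm).2 l hl)⟩

theorem Uses.formula_eq {F : List (Term (Qubit n))} {S : List Reg} (h : Uses F S) {c c' : Conf}
    (hc : ∀ R ∈ S, c.bit R = c'.bit R) : formula (c.enc n) F = formula (c'.enc n) F :=
  formula_congr (p := fun w => w.1 ∉ S) (fun m hm x hx => h.avoids hx m hm) fun w hw => by
    rw [not_not] at hw
    simp only [Conf.enc, hc _ hw]

/-- Toggles `x` if `F` holds; two cells of the first work register are borrowed. -/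
def flip (F : List (Term (Qubit n))) (x : Qubit n) : Circuit (Qubit n) :=
  cflip F x (qubit n .work1 1) (qubit n .work1 2)

theorem run_flip {F : List (Term (Qubit n))} {S : List Reg} (h : Uses F S) (hS : Reg.work1 ∉ S)
    {x : Qubit n} (hx : x.1 ∉ S) (h1 : x ≠ qubit n .work1 1) (h2 : x ≠ qubit n .work1 2)
    (s : Qubit n → Bool) : run (flip F x) s = toggle s x (formula s F) :=
  run_cflip (fun m hm => ⟨h.avoids hx m hm, h.avoids (by exact hS) m hm,
    h.avoids (by exact hS) m hm⟩) h1 h2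
    (qubit_ne (by simp [Reg.width]) (by have := NeZero.pos n; simp [Reg.width]) (by omega)) s

/-- The literals that say that the low `k` bits of a register are `0`. -/
def zeroLits (n : ℕ) [NeZero n] (R : Reg) (k : ℕ) : List (Qubit n × Bool) :=
  (List.range k).map fun i => (qubit n R i, false)

theorem length_zeroLits (R : Reg) (k : ℕ) : (zeroLits n R k).length = k := by simp [zeroLits]

theorem fst_of_mem_zeroLits {R : Reg} {k : ℕ} {l : Qubit n × Bool} (h : l ∈ zeroLits n R k) :
    l.1.1 = R := by
  simp only [zeroLits, List.mem_map] at h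
  obtain ⟨i, -, rfl⟩ := h
  rfl

theorem allLits_zeroLits {c : Conf} {R : Reg} {k v : ℕ} (hk : k ≤ R.width n)
    (hb : ∀ i < k, c.bit R i = v.testBit i) (hv : v < 2 ^ k) :
    allLits (c.enc n) (zeroLits n R k) = decide (v = 0) := by
  rw [Bool.eq_iff_iff, decide_eq_true_iff]
  simp only [allLits, zeroLits, List.all_map, List.all_eq_true, List.mem_range,
    Function.comp_apply, beq_iff_eq]
  constructor
  · intro h
    apply Nat.eq_of_testBit_eq
    intro i
    by_cases hi : i < k
    · rw [← hb i hi, ← enc_qubit_of_lt c (hi.trans_le hk), h i hi]; simp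
    · rw [Nat.testBit_lt_two_pow (hv.trans_le (Nat.pow_le_pow_right (by omega) (by omega)))]; simp
  · rintro rfl i hi
    rw [enc_qubit_of_lt c (hi.trans_le hk), hb i hi]; simp

/-! ### Arithmetic in the length registers -/

/-- Increments the register `R` if the literals in `L` hold. -/
def incReg (L : List (Qubit n × Bool)) (R : Reg) : Circuit (Qubit n) :=
  inc L (qubit n R) (qubit n .work1 1) (qubit n .work1 2) (R.width n)

theorem run_incReg {L : List (Qubit n × Bool)} {R : Reg} {c c' : Conf} {v : ℕ}
    (hL : ∀ l ∈ L, l.1.1 ≠ R ∧ l.1.1 ≠ .work1) (hR : R ≠ .work1)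
    (hv : ∀ i, c.bit R i = v.testBit i)
    (hv' : ∀ i, c'.bit R i = (if allLits (c.enc n) L then v + 1 else v).testBit i)
    (hother : ∀ R' ≠ R, c'.bit R' = c.bit R') : run (incReg L R) (c.enc n) = c'.enc n := by
  obtain ⟨h1, h2⟩ := run_inc (L := L) (b := qubit n R) (d := qubit n .work1 1)
    (e := qubit n .work1 2) (k := R.width n) (v := v) (s := c.enc n)
    (fun l hl he => (hL l hl).2 (congrArg Sigma.fst he))
    (fun l hl he => (hL l hl).2 (congrArg Sigma.fst he))
    (fun l hl i _ he => (hL l hl).1 (congrArg Sigma.fst he))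
    (fun i _ => qubit_ne_of_reg hR _ _) (fun i _ => qubit_ne_of_reg hR _ _)
    (qubit_ne (by simp [Reg.width]) (by have := NeZero.pos n; simp [Reg.width]) (by omega))
    (fun i hi j hj => eq_of_qubit_eq hi hj) (fun i hi => by rw [enc_qubit_of_lt c hi, hv])
  refine eq_enc_of_array (f := fun i => i) (k := R.width n) (fun i hi => hi) hother
    (fun i hi => ?_) (fun j hj h => absurd rfl (h j hj)) h2
  rw [incReg, h1 i hi, hv']

/-- Adds the number in the register `A` to the number in the register `R`, modulo
`2 ^ R.width n`. -/
def addReg (n : ℕ) [NeZero n] (A R : Reg) : Circuit (Qubit n) :=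
  add (qubit n .ctrl 0) (qubit n A) (qubit n R) (R.width n)

theorem run_addReg {A R : Reg} {c c' : Conf} {a v : ℕ} (hA : A ≠ .ctrl) (hR : R ≠ .ctrl)
    (hAR : A ≠ R) (hw : R.width n ≤ A.width n) (hc : c.ct = false)
    (ha : ∀ i, c.bit A i = a.testBit i) (hv : ∀ i, c.bit R i = v.testBit i)
    (hv' : ∀ i, c'.bit R i = (a + v).testBit i)
    (hother : ∀ R' ≠ R, c'.bit R' = c.bit R') : run (addReg n A R) (c.enc n) = c'.enc n := by
  obtain ⟨h1, h2⟩ := run_add (z := qubit n .ctrl 0) (a := qubit n A) (b := qubit n R)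
    (k := R.width n) ⟨fun i _ => qubit_ne_of_reg hA.symm _ _, fun i _ => qubit_ne_of_reg hR.symm _
      _,
      fun i _ j _ => qubit_ne_of_reg hAR _ _,
      fun i hi j hj => eq_of_qubit_eq (hi.trans_le hw) (hj.trans_le hw),
      fun i hi j hj => eq_of_qubit_eq hi hj⟩ (c.enc n)
  refine eq_enc_of_array (f := fun i => i) (k := R.width n) (fun i hi => hi) hother
    (fun i hi => ?_) (fun j hj h => absurd rfl (h j hj)) h2
  have hct : c.enc n (qubit n .ctrl 0) = false := hc
  rw [addReg, h1 i hi, hv', hct]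
  rw [← addBits_testBit (a := fun j => c.enc n (qubit n A j)) (b := fun j => c.enc n (qubit n R j))
    (fun j hj => by rw [enc_qubit_of_lt c (by omega), ha])
    (fun j hj => by rw [enc_qubit_of_lt c (by omega), hv]), addBits]

/-! ### Rotations and the exchange of the work registers -/

/-- The rotation of `work2`, register by register. -/
def rotate1 (n : ℕ) : (R : Reg) → Equiv.Perm (Fin (R.width n))
  | .work2 => finRotate (n + 3)
  | _ => 1

/-- The rotation of both work registers, register by register. -/
def rotateBoth (n : ℕ) : (R : Reg) → Equiv.Perm (Fin (R.width n))
  | .work1 => finRotate (n + 3)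
  | .work2 => finRotate (n + 3)
  | _ => 1

/-- The rotation of the second work register by one cell. -/
def rotPerm (n : ℕ) : Equiv.Perm (Qubit n) := Equiv.sigmaCongrRight (rotate1 n)

/-- The simultaneous rotation of both work registers by one cell. -/
def rotBothPerm (n : ℕ) : Equiv.Perm (Qubit n) := Equiv.sigmaCongrRight (rotateBoth n)

/-- The exchange of the work registers. -/
def swapPerm (n : ℕ) : Equiv.Perm (Qubit n) :=
  Function.Involutive.toPerm
    (fun | ⟨.work1, i⟩ => ⟨.work2, i⟩ | ⟨.work2, i⟩ => ⟨.work1, i⟩ | w => w)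
    (by rintro ⟨R, i⟩; cases R <;> rfl)

theorem card_support_le {σ : Equiv.Perm (Qubit n)}
    (h : ∀ w : Qubit n, w.1 ≠ .work1 → w.1 ≠ .work2 → σ w = w) : σ.support.card ≤ 2 * (n + 3) := by
  have hsub : σ.support ⊆ (Finset.univ.image fun i : Fin (n + 3) => (⟨.work1, i⟩ : Qubit n)) ∪
      Finset.univ.image fun i : Fin (n + 3) => (⟨.work2, i⟩ : Qubit n) := by
    intro w hw
    rw [Equiv.Perm.mem_support] at hw
    obtain ⟨R, i⟩ := w
    by_cases h1 : R = .work1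
    · subst h1
      exact Finset.mem_union_left _ (Finset.mem_image_of_mem _ (Finset.mem_univ i))
    · by_cases h2 : R = .work2
      · subst h2
        exact Finset.mem_union_right _ (Finset.mem_image_of_mem _ (Finset.mem_univ i))
      · exact absurd (h _ h1 h2) hw
  refine (Finset.card_le_card hsub).trans ((Finset.card_union_le _ _).trans ?_)
  have h1 := Finset.card_image_le (s := Finset.univ) (f := fun i : Fin (n + 3) =>
    (⟨.work1, i⟩ : Qubit n))
  have h2 := Finset.card_image_le (s := Finset.univ) (f := fun i : Fin (n + 3) =>
    (⟨.work2, i⟩ : Qubit n))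
  simp only [Finset.card_univ, Fintype.card_fin] at h1 h2
  omega

theorem finRotate_pow_val (m v : ℕ) (i : Fin (m + 1)) :
    (((finRotate (m + 1)) ^ v) i : ℕ) = (i + v) % (m + 1) := by
  induction v with
  | zero => simp [Nat.mod_eq_of_lt i.2]
  | succ v ih =>
    rw [pow_succ', Equiv.Perm.mul_apply, finRotate_apply, Fin.val_add, ih, Fin.val_one',
      ← Nat.add_mod, Nat.add_assoc]

theorem rotBothPerm_pow (v : ℕ) (R : Reg) (i : Fin (R.width n)) :
    ((rotBothPerm n) ^ v) ⟨R, i⟩ = ⟨R, (rotateBoth n R ^ v) i⟩ := by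
  induction v with
  | zero => rfl
  | succ v ih => rw [pow_succ', Equiv.Perm.mul_apply, ih, pow_succ', Equiv.Perm.mul_apply]; rfl

/-- Rotates both work registers to the left by the number in `lenS`. -/
noncomputable def rotate (n : ℕ) [NeZero n] : Circuit (Qubit n) :=
  barrel (rotBothPerm n) (qubit n .lenS) (Nat.log 2 n + 3)

theorem run_rotate {c : Conf} (hs : c.ls < 2 ^ (Nat.log 2 n + 3)) :
    run (rotate n) (c.enc n) = { c with
      w1 := fun i => c.w1 ((i + c.ls) % (n + 3))
      w2 := fun i => c.w2 ((i + c.ls) % (n + 3)) }.enc n := by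
  rw [rotate, run_barrel (k := Nat.log 2 n + 3) (v := c.ls) (fun j _ => rfl) (fun j hj =>
      enc_qubit_of_lt c hj),
    Nat.mod_eq_of_lt hs]
  funext ⟨R, i⟩
  rw [Function.comp_apply, rotBothPerm_pow]
  by_cases h1 : R = .work1
  · subst h1
    exact congrArg c.w1 (finRotate_pow_val (n + 2) c.ls i)
  · by_cases h2 : R = .work2
    · subst h2
      exact congrArg c.w2 (finRotate_pow_val (n + 2) c.ls i)
    · have hone : rotateBoth n R = 1 := by
        cases R <;> first | rfl | exact absurd rfl h1 | exact absurd rfl h2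
      rw [hone, one_pow, Equiv.Perm.one_apply]
      cases R <;> first | rfl | exact absurd rfl h1 | exact absurd rfl h2

theorem toffoliCount_rotate : toffoliCount (rotate n) ≤ (Nat.log 2 n + 3) * (2 * (n + 3)) :=
  (toffoliCount_barrel _ _ _).trans (Nat.mul_le_mul_left _ (card_support_le fun w h1 h2 => by
    obtain ⟨R, i⟩ := w
    cases R <;> first | rfl | exact absurd rfl h1 | exact absurd rfl h2))

/-- Rotates the second work register to the left by one cell if `F` holds. -/
noncomputable def rotateOne (F : List (Term (Qubit n))) : Circuit (Qubit n) :=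
  flip F (qubit n .ctrl 0) ++ cperm (qubit n .ctrl 0) (rotPerm n) ++ flip F (qubit n .ctrl 0)

theorem run_rotateOne {F : List (Term (Qubit n))} {S : List Reg} (h : Uses F S)
    (h1 : Reg.work1 ∉ S) (h2 : Reg.work2 ∉ S) (hct : Reg.ctrl ∉ S) {c : Conf} (hc : c.ct = false) :
    run (rotateOne F) (c.enc n) = { c with
      w2 := fun i => if formula (c.enc n) F then c.w2 ((i + 1) % (n + 3)) else c.w2 i }.enc n := by
  have hf := fun s => run_flip h h1 (x := qubit n .ctrl 0) hct (qubit_ne_of_reg (by decide) _ _)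
    (qubit_ne_of_reg (by decide) _ _) s
  rw [rotateOne, run_append, run_append, hf (c.enc n), toggle_ctrl, run_cperm rfl]
  have hrot : ∀ c : Conf, c.enc n ∘ ⇑(rotPerm n) =
      { c with w2 := fun i => c.w2 ((i + 1) % (n + 3)) }.enc n := by
    intro c
    funext ⟨R, i⟩
    cases R
    case work2 =>
      show c.w2 ((finRotate (n + 3)) i : ℕ) = _
      have := finRotate_pow_val (n + 2) 1 i
      rw [pow_one] at this
      rw [this]; rfl
    all_goals rfl
  set b := formula (c.enc n) F with hb
  have hct' : ({ c with ct := xor c.ct b }.enc n) (qubit n .ctrl 0) = b := by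
    show xor c.ct b = b
    simp [hc]
  rw [hct', hrot, hf]
  cases hbv : b
  · simp only [Bool.false_eq_true, if_false]
    have : formula (Conf.enc n { c with ct := xor c.ct false }) F = b := by
      rw [hb]
      exact h.formula_eq fun R hR => by
        cases R <;> first | rfl | exact absurd hR hct
    rw [this, hbv]
    simp
  · simp only [if_true]
    rw [h.formula_eq (c' := c) fun R hR => by
      cases R <;> first | rfl | exact absurd hR hct | exact absurd hR h2, ← hb, hbv, toggle_ctrl]
    simp

theorem card_support_rotPerm : (rotPerm n).support.card ≤ 2 * (n + 3) :=
  card_support_le fun w h1 h2 => by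
    obtain ⟨R, i⟩ := w
    cases R <;> first | rfl | exact absurd rfl h1 | exact absurd rfl h2

/-- Exchanges the work registers if `F` holds. -/
noncomputable def swapWork (F : List (Term (Qubit n))) : Circuit (Qubit n) :=
  flip F (qubit n .ctrl 0) ++ cperm (qubit n .ctrl 0) (swapPerm n) ++ flip F (qubit n .ctrl 0)

theorem run_swapWork {F : List (Term (Qubit n))} {S : List Reg} (h : Uses F S)
    (h1 : Reg.work1 ∉ S) (h2 : Reg.work2 ∉ S) (hct : Reg.ctrl ∉ S) {c : Conf} (hc : c.ct = false) :
    run (swapWork F) (c.enc n) = { c with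
      w1 := if formula (c.enc n) F then c.w2 else c.w1
      w2 := if formula (c.enc n) F then c.w1 else c.w2 }.enc n := by
  have hf := fun s => run_flip h h1 (x := qubit n .ctrl 0) hct (qubit_ne_of_reg (by decide) _ _)
    (qubit_ne_of_reg (by decide) _ _) s
  rw [swapWork, run_append, run_append, hf (c.enc n), toggle_ctrl, run_cperm rfl]
  have hrot : ∀ c : Conf, c.enc n ∘ ⇑(swapPerm n) = { c with w1 := c.w2, w2 := c.w1 }.enc n := by
    intro c
    funext ⟨R, i⟩
    cases R <;> rfl
  set b := formula (c.enc n) F with hb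
  have hct' : ({ c with ct := xor c.ct b }.enc n) (qubit n .ctrl 0) = b := by
    show xor c.ct b = b
    simp [hc]
  rw [hct', hrot, hf]
  cases hbv : b
  · simp only [Bool.false_eq_true, if_false]
    have : formula (Conf.enc n { c with ct := xor c.ct false }) F = b := by
      rw [hb]
      exact h.formula_eq fun R hR => by
        cases R <;> first | rfl | exact absurd hR hct
    rw [this, hbv]
    simp
  · simp only [if_true]
    rw [h.formula_eq (c' := c) fun R hR => by
      cases R <;> first | rfl | exact absurd hR hct | exact absurd hR h1 | exact absurd hR h2,
      ← hb, hbv, toggle_ctrl]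
    simp

theorem card_support_swapPerm : (swapPerm n).support.card ≤ 2 * (n + 3) :=
  card_support_le fun w h1 h2 => by
    obtain ⟨R, i⟩ := w
    cases R <;> first | rfl | exact absurd rfl h1 | exact absurd rfl h2

/-! ### Operations at a position given by a length register -/

/-- The borrowed qubits on which positions `0, …, n` are marked: the output register and `iter`. -/
def pos (n : ℕ) [NeZero n] (i : ℕ) : Qubit n :=
  if i < n then qubit n .output i else qubit n .iter 0

theorem pos_fst (i : ℕ) : (pos n i).1 = .output ∨ (pos n i).1 = .iter := by
  unfold pos; split_ifs
  · exact Or.inl rfl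
  · exact Or.inr rfl

theorem pos_ne {R : Reg} (h1 : R ≠ .output) (h2 : R ≠ .iter) (i j : ℕ) : pos n i ≠ qubit n R j := by
  intro he
  have := congrArg Sigma.fst he
  rw [qubit_fst] at this
  rcases pos_fst (n := n) i with h | h
  · exact h1 (this.symm.trans h)
  · exact h2 (this.symm.trans h)

theorem pos_inj {i j : ℕ} (hi : i ≤ n) (hj : j ≤ n) (h : pos n i = pos n j) : i = j := by
  unfold pos at h
  split_ifs at h with h1 h2 h2
  · exact eq_of_qubit_eq (R := .output) h1 h2 h
  · exact absurd h (qubit_ne_of_reg (by decide) _ _)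
  · exact absurd h (qubit_ne_of_reg (by decide) _ _)
  · omega

/-- The bit at the marking position `i`. -/
def Conf.pos (n : ℕ) (c : Conf) (i : ℕ) : Bool := if i < n then c.out i else c.it

theorem enc_pos (c : Conf) (i : ℕ) : c.enc n (pos n i) = c.pos n i := by
  unfold Inversion.pos Conf.pos
  split_ifs with h
  · exact enc_qubit_of_lt c h
  · rfl

/-- The contents with the bit at position `v` XORed with `b`. -/
def Conf.mark (n : ℕ) (c : Conf) (v : ℕ) (b : Bool) : Conf :=
  { c with
    out := fun i => if i = v then xor (c.out i) b else c.out i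
    it := if v = n then xor c.it b else c.it }

theorem Conf.pos_mark {c : Conf} {v i : ℕ} {b : Bool} (hi : i ≤ n) :
    (c.mark n v b).pos n i = xor (c.pos n i) (b && decide (i = v)) := by
  simp only [Conf.pos, Conf.mark]
  rcases hi.lt_or_eq with h | rfl
  · by_cases hv : i = v
    · subst hv; simp [h]
    · simp [h, hv]
  · by_cases hv : i = v
    · simp [hv]
    · simp [hv, Ne.symm hv]

theorem Conf.mark_mark (c : Conf) (v : ℕ) (b : Bool) : (c.mark n v b).mark n v b = c := by
  obtain ⟨w1, w2, out, lt, lq, lr, ls, p1, p2, it, sg, ct⟩ := c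
  simp only [Conf.mark, Conf.mk.injEq, true_and, and_true]
  constructor
  · funext i; split_ifs <;> simp
  · split_ifs <;> simp

theorem Conf.mark_false (c : Conf) (v : ℕ) : c.mark n v false = c := by
  simp [Conf.mark]

theorem Conf.bit_mark {c : Conf} {v : ℕ} {b : Bool} {R : Reg} (h1 : R ≠ .output) (h2 : R ≠ .iter) :
    (c.mark n v b).bit R = c.bit R := by
  cases R <;> first | rfl | exact absurd rfl h1 | exact absurd rfl h2

/-- Toggles the position given by the number in the register `R` if `F` holds. -/
def markReg (F : List (Term (Qubit n))) (R : Reg) : Circuit (Qubit n) :=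
  mark F (qubit n R) (pos n) (n + 1) (Nat.log 2 n + 2) (qubit n .work1 1) (qubit n .work1 2)

/-- The registers on which conditions may depend while positions are marked.  The bit `iter` is
missing, because it is borrowed as a marking position. -/
def ctlRegs : List Reg := [.lenT, .lenQ, .lenR, .lenS, .phase1, .phase2, .sign]

theorem run_markReg {F : List (Term (Qubit n))} (hF : Uses F ctlRegs) {R : Reg}
    (hR : R = .lenT ∨ R = .lenR) {c : Conf} {v : ℕ} (hv : ∀ i, c.bit R i = v.testBit i)
    (hle : formula (c.enc n) F = true → v ≤ n) :
    run (markReg F R) (c.enc n) = (c.mark n v (formula (c.enc n) F)).enc n := by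
  have hw : R.width n = Nat.log 2 n + 2 := by rcases hR with rfl | rfl <;> rfl
  have ho : R ≠ .output := by rcases hR with rfl | rfl <;> decide
  have hi : R ≠ .iter := by rcases hR with rfl | rfl <;> decide
  have hpos : ∀ i, (pos n i).1 ∉ ctlRegs := fun i => by
    rcases pos_fst (n := n) i with h | h <;> rw [h] <;> decide
  rw [markReg, run_mark (v := v) ⟨fun j _ i _ => (pos_ne ho hi _ _).symm,
    fun i hi j hj => pos_inj (by omega) (by omega)⟩ (by omega)
    (fun m hm => ⟨fun i _ => hF.avoids (hpos i) m hm,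
      hF.avoids (show Reg.work1 ∉ ctlRegs by decide) m hm,
      hF.avoids (show Reg.work1 ∉ ctlRegs by decide) m hm⟩)
    (fun i _ => pos_ne (by decide) (by decide) _ _) (fun i _ => pos_ne (by decide) (by decide) _ _)
    (qubit_ne (by simp [Reg.width]) (by have := NeZero.pos n; simp [Reg.width]) (by omega))
    (fun j hj => by rw [enc_qubit_of_lt c (by omega), hv])
    (fun h => ⟨by have := hle h; omega, (hle h).trans_lt
      ((Nat.lt_pow_succ_log_self (by omega) n).trans_le (Nat.pow_le_pow_right (by omega)
        (by omega)))⟩)]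
  cases hb : formula (c.enc n) F
  · rw [toggle_false, Conf.mark_false]
  · unfold pos
    split_ifs with hvn
    · rw [toggle_output c hvn, Conf.mark, if_neg (by omega)]
    · have : v = n := by have := hle hb; omega
      rw [toggle_iter, Conf.mark, if_pos this]
      apply enc_congr
      intro R' i hi'
      cases R' <;> first | rfl | skip
      have : i < n := hi'
      simp [Conf.bit, show i ≠ v by omega]

/-- The commutator of `B` with the marking of a position.  If `B` XORs linear functions of the
position bits onto other wires, this has the effect of `B` for the position bits that vanish except
at the marked position: the unknown contents of the borrowed positions contribute to both runs of
`B` and cancel.  This is how an operation acts at a place given by a length register without clean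
auxiliary qubits. -/
def marked (B : Circuit (Qubit n)) (F : List (Term (Qubit n))) (R : Reg) : Circuit (Qubit n) :=
  B ++ markReg F R ++ B ++ markReg F R

/-- The run of `B` before the marking may lead to an arbitrary `c₁`; what counts is that the run
after the marking leads to the desired contents `c₂`, up to the mark. -/
theorem run_marked {B : Circuit (Qubit n)} {F : List (Term (Qubit n))} {S : List Reg}
    (hF : Uses F S) (hS : S ⊆ ctlRegs) {R : Reg} (hR : R = .lenT ∨ R = .lenR) {c c₁ c₂ : Conf}
    {v : ℕ} (hv : ∀ i, c.bit R i = v.testBit i) (hle : formula (c.enc n) F = true → v ≤ n)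
    (h₁ : ∀ R' ∈ R :: S, c₁.bit R' = c.bit R') (h₂ : ∀ R' ∈ R :: S, c₂.bit R' = c.bit R')
    (hB₁ : run B (c.enc n) = c₁.enc n)
    (hB₂ : run B ((c₁.mark n v (formula (c.enc n) F)).enc n) =
      (c₂.mark n v (formula (c.enc n) F)).enc n) :
    run (marked B F R) (c.enc n) = c₂.enc n := by
  have hF' : Uses F ctlRegs := fun m hm =>
    ⟨fun l hl => hS ((hF m hm).1 l hl), fun l hl => hS ((hF m hm).2 l hl)⟩
  have hbit : ∀ (c : Conf) (b : Bool), ∀ R' ∈ R :: S, (c.mark n v b).bit R' = c.bit R' := by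
    intro c b R' hR'
    have : R' ∈ ctlRegs := by
      rcases List.mem_cons.1 hR' with rfl | h
      · rcases hR with rfl | rfl <;> decide
      · exact hS h
    exact Conf.bit_mark (by rintro rfl; exact absurd this (by decide))
      (by rintro rfl; exact absurd this (by decide))
  have e₁ : formula (c₁.enc n) F = formula (c.enc n) F :=
    hF.formula_eq fun R' hR' => h₁ R' (List.mem_cons_of_mem _ hR')
  have e₂ : formula ((c₂.mark n v (formula (c.enc n) F)).enc n) F = formula (c.enc n) F :=
    hF.formula_eq fun R' hR' =>
      (hbit _ _ R' (List.mem_cons_of_mem _ hR')).trans (h₂ R' (List.mem_cons_of_mem _ hR'))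
  rw [marked, run_append, run_append, run_append, hB₁,
    run_markReg hF' hR (v := v) (fun i => by rw [h₁ R List.mem_cons_self, hv])
      (by rw [e₁]; exact hle), e₁, hB₂,
    run_markReg hF' hR (v := v) (fun i => by
      rw [hbit _ _ R List.mem_cons_self, h₂ R List.mem_cons_self, hv])
      (by rw [e₂]; exact hle), e₂, Conf.mark_mark]

/-- The case of `run_marked` in which only the sign bit changes. -/
theorem run_marked_sign {B : Circuit (Qubit n)} {F : List (Term (Qubit n))} {S : List Reg}
    (hF : Uses F S) (hS : S ⊆ ctlRegs) (hsg : Reg.sign ∉ S) {R : Reg}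
    (hR : R = .lenT ∨ R = .lenR) {c : Conf} {v k i₀ : ℕ} {f : ℕ → ℕ} {κ : ℕ → Bool}
    (hv : ∀ i, c.bit R i = v.testBit i) (hf : ∀ i < k, f i ≤ n)
    (hle : formula (c.enc n) F = true → v ≤ n ∧ i₀ < k ∧ ∀ i < k, f i = v ↔ i = i₀)
    (hB : ∀ c' : Conf, c'.w1 = c.w1 → c'.w2 = c.w2 → c'.ct = c.ct → run B (c'.enc n) =
      { c' with sg := xor c'.sg (xsum k fun i => c'.pos n (f i) && κ i) }.enc n) :
    run (marked B F R) (c.enc n) =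
      { c with sg := xor c.sg (formula (c.enc n) F && κ i₀) }.enc n := by
  have hbit : ∀ b, ∀ R' ∈ R :: S, ({ c with sg := b } : Conf).bit R' = c.bit R' := by
    intro b R' hR'
    have : R' ≠ .sign := by
      rintro rfl
      rcases List.mem_cons.1 hR' with h | h
      · rcases hR with h' | h' <;> rw [h'] at h <;> exact absurd h (by decide)
      · exact hsg h
    cases R' <;> first | rfl | exact absurd rfl this
  refine run_marked hF hS hR hv (fun h => (hle h).1) (hbit _) (hbit _) (hB c rfl rfl rfl) ?_
  have hB' := hB (Conf.mark n { c with sg := xor c.sg (xsum k fun i => c.pos n (f i) && κ i) } v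
    (formula (c.enc n) F)) rfl rfl rfl
  rw [hB']
  have hx : (xsum k fun i => Conf.pos n (Conf.mark n
      { c with sg := xor c.sg (xsum k fun i => c.pos n (f i) && κ i) } v (formula (c.enc n) F))
        (f i) && κ i) =
      xor (xsum k fun i => c.pos n (f i) && κ i) (formula (c.enc n) F && κ i₀) := by
    rw [show (formula (c.enc n) F && κ i₀) =
        xsum k fun i => (formula (c.enc n) F && decide (f i = v)) && κ i by
      cases hbv : formula (c.enc n) F
      · simp [xsum_eq_false]
      · obtain ⟨-, hi₀, huniq⟩ := hle hbv
        rw [Bool.true_and, ← xsum_single hi₀ κ]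
        exact (xsum_congr fun i hi => by simp [huniq i hi]), ← xsum_xor]
    apply xsum_congr
    intro i hi
    rw [Conf.pos_mark (hf i hi)]
    change ((c.pos n (f i) ^^ _) && κ i) = _
    cases κ i <;> simp
  rw [hx]
  apply enc_congr
  intro R' i _
  cases R' <;> first | rfl | skip
  simp only [Conf.bit, Conf.mark]
  cases c.sg <;> cases (xsum k fun i => c.pos n (f i) && κ i) <;> simp

/-- Adds the bit of the first work register right of the marked position to the sign bit. -/
def readCell (F : List (Term (Qubit n))) (R : Reg) : Circuit (Qubit n) :=
  marked (seq (n + 1) fun j => CCX (pos n j) (qubit n .work1 (j + 1)) (qubit n .sign 0)) F R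

theorem run_readCell {F : List (Term (Qubit n))} {S : List Reg} (hF : Uses F S) (hS : S ⊆ ctlRegs)
    (hsg : Reg.sign ∉ S) {R : Reg} (hR : R = .lenT ∨ R = .lenR) {c : Conf} {v : ℕ}
    (hv : ∀ i, c.bit R i = v.testBit i) (hle : formula (c.enc n) F = true → v ≤ n) :
    run (readCell F R) (c.enc n) =
      { c with sg := xor c.sg (formula (c.enc n) F && c.w1 (v + 1)) }.enc n := by
  refine run_marked_sign (k := n + 1) (f := fun i => i) (κ := fun i => c.w1 (i + 1)) hF hS hsg hR hv
    (fun i hi => by omega) (fun h => ⟨hle h, by have := hle h; omega, fun i _ => Iff.rfl⟩) ?_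
  intro c' h1 h2 h3
  rw [run_seq_acc (x := qubit n .sign 0)
    (g := fun j s => s (pos n j) && s (qubit n .work1 (j + 1)))
    (fun i hi s => run_CCX (pos_ne (by decide) (by decide) _ _) (pos_ne (by decide) (by decide) _ _)
      (qubit_ne_of_reg (by decide) _ _) s)
    (fun i hi s b => by
      rw [toggle_ne (pos_ne (by decide) (by decide) _ _), toggle_ne (qubit_ne_of_reg (by decide) _
          _)]),
    toggle_sign]
  congr 3
  apply xsum_congr
  intro i hi
  rw [enc_pos, enc_qubit_of_lt c' (by simp only [Reg.width]; omega), ← h1]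
  rfl

/-- Toggles the cell of the first work register right of the marked position. -/
def writeCell (F : List (Term (Qubit n))) (R : Reg) : Circuit (Qubit n) :=
  marked (seq (n + 1) fun j => CX (pos n j) (qubit n .work1 (j + 1))) F R

theorem run_writeCell {F : List (Term (Qubit n))} {S : List Reg} (hF : Uses F S) (hS : S ⊆ ctlRegs)
    {R : Reg} (hR : R = .lenT ∨ R = .lenR) {c : Conf} {v : ℕ}
    (hv : ∀ i, c.bit R i = v.testBit i) (hle : formula (c.enc n) F = true → v ≤ n) :
    run (writeCell F R) (c.enc n) =
      { c with
        w1 := fun i => if i = v + 1 then xor (c.w1 i) (formula (c.enc n) F) else c.w1 i }.enc n :=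
          by
  have hB : ∀ c : Conf, run (seq (n + 1) fun j => CX (pos n j) (qubit n .work1 (j + 1))) (c.enc n) =
      { c with
        w1 := fun i => if 1 ≤ i ∧ i ≤ n + 1 then xor (c.w1 i) (c.pos n (i - 1)) else c.w1 i }.enc n
          := by
    intro c
    obtain ⟨h1, h2, -⟩ := run_seq_disjoint (k := n + 1) (t := fun j => qubit n .work1 (j + 1))
      (f := fun j => CX (pos n j) (qubit n .work1 (j + 1))) (g := fun j s => s (pos n j))
      (fun i hi s => run_CX (pos_ne (by decide) (by decide) _ _) s)
      (fun i hi j hj s b => toggle_ne (pos_ne (by decide) (by decide) _ _) _)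
      (fun i hi j hj h => by
        have := eq_of_qubit_eq (by simp only [Reg.width]; omega) (by simp only [Reg.width]; omega) h
        omega) (c.enc n)
    refine eq_enc_of_array (R := .work1) (c := c) (f := fun j => j + 1) (k := n + 1)
      (fun i hi => by simp only [Reg.width]; omega)
      (fun R hR => by cases R <;> first | rfl | exact absurd rfl hR) (fun i hi => ?_)
      (fun j hj h => ?_) h2
    · rw [h1 i hi, enc_qubit_of_lt c (by simp only [Reg.width]; omega), enc_pos]
      simp only [Conf.bit]
      rw [if_pos (by omega), Nat.add_sub_cancel]
    · simp only [Conf.bit]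
      rw [if_neg]
      intro hj'
      exact h (j - 1) (by omega) (by omega)
  have hbit : ∀ w, ∀ R' ∈ R :: S, ({ c with w1 := w } : Conf).bit R' = c.bit R' := by
    intro b R' hR'
    have : R' ≠ .work1 := by
      rintro rfl
      rcases List.mem_cons.1 hR' with h | h
      · rcases hR with h' | h' <;> rw [h'] at h <;> exact absurd h (by decide)
      · exact absurd (hS h) (by decide)
    cases R' <;> first | rfl | exact absurd rfl this
  refine run_marked hF hS hR hv hle (hbit _) (hbit _) (hB c) ?_
  rw [hB]
  apply enc_congr
  intro R' i hi
  cases R' <;> first | rfl | skip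
  simp only [Conf.bit]
  show (if 1 ≤ i ∧ i ≤ n + 1 then _ else _) = if i = v + 1 then _ else _
  by_cases h : 1 ≤ i ∧ i ≤ n + 1
  · rw [if_pos h, Conf.pos_mark (by omega)]
    show xor (if 1 ≤ i ∧ i ≤ n + 1 then _ else _) _ = _
    rw [if_pos h]
    have : (i - 1 = v) ↔ i = v + 1 := by omega
    show xor (xor (c.w1 i) (c.pos n (i - 1))) (xor (c.pos n (i - 1)) _) = _
    by_cases hiv : i = v + 1
    · rw [if_pos hiv]
      simp only [hiv]
      cases c.w1 (v + 1) <;> cases c.pos n (v + 1 - 1) <;> simp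
    · rw [if_neg hiv]
      simp only [this, hiv, decide_false, Bool.and_false]
      cases c.w1 i <;> cases c.pos n (i - 1) <;> simp
  · rw [if_neg h]
    show (if 1 ≤ i ∧ i ≤ n + 1 then _ else _) = _
    rw [if_neg h]
    split_ifs with hiv
    · cases hb : formula (c.enc n) F
      · simp
      · have := hle hb; omega
    · rfl

/-- Complements all cells of the work register `R`. -/
def notReg (n : ℕ) [NeZero n] (R : Reg) : Circuit (Qubit n) := seq (n + 3) fun i => X (qubit n R i)

/-- The contents with new cells in a work register. -/
def Conf.setWork (c : Conf) (R : Reg) (w : ℕ → Bool) : Conf :=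
  match R with
  | .work1 => { c with w1 := w }
  | .work2 => { c with w2 := w }
  | _ => c

theorem Conf.bit_setWork_self {c : Conf} {R : Reg} (hR : R = .work1 ∨ R = .work2) (w : ℕ → Bool) :
    (c.setWork R w).bit R = w := by rcases hR with rfl | rfl <;> rfl

theorem Conf.bit_setWork_ne {c : Conf} {R R' : Reg} (h : R' ≠ R) (w : ℕ → Bool) :
    (c.setWork R w).bit R' = c.bit R' := by
  cases R <;> cases R' <;> first | rfl | exact absurd rfl h

theorem Conf.setWork_setWork {c : Conf} (R : Reg) (w w' : ℕ → Bool) :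
    (c.setWork R w).setWork R w' = c.setWork R w' := by cases R <;> rfl

theorem Conf.setWork_self {c : Conf} (R : Reg) : c.setWork R (c.bit R) = c := by cases R <;> rfl

theorem width_work {R : Reg} (hR : R = .work1 ∨ R = .work2) : R.width n = n + 3 := by
  rcases hR with rfl | rfl <;> rfl

theorem run_notReg {R : Reg} (hR : R = .work1 ∨ R = .work2) (c : Conf) :
    run (notReg n R) (c.enc n) = (c.setWork R fun i => !c.bit R i).enc n := by
  have hw := width_work (n := n) hR
  obtain ⟨h1, h2, -⟩ := run_seq_disjoint (k := n + 3) (t := fun i => qubit n R i)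
    (f := fun i => X (qubit n R i)) (g := fun _ _ => true) (fun i hi s => run_X _ s)
    (fun i hi j hj s b => rfl) (fun i hi j hj h => eq_of_qubit_eq (by omega) (by omega) h) (c.enc n)
  refine eq_enc_of_array (R := R) (c := c) (f := fun j => j) (k := n + 3) (fun i hi => by omega)
    (fun R' hR' => Conf.bit_setWork_ne hR' _) (fun i hi => ?_)
    (fun j hj h => absurd rfl (h j (by omega))) h2
  rw [notReg, h1 i hi, enc_qubit_of_lt c (by omega), Conf.bit_setWork_self hR]
  simp

/-- Compares the numbers in the cells `g 0, g 1, …` of the work registers `A` and `B`, up to the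
place `i` for which the position `f i` is marked: toggles the sign bit if the number in `B` is
smaller.  This is the carry out of that place in the sum of `A` and the complement of `B`. -/
def compare (A B : Reg) (g f : ℕ → ℕ) (k : ℕ) (F : List (Term (Qubit n))) (R : Reg) :
    Circuit (Qubit n) :=
  notReg n B ++ marked (carryXor (qubit n .sign 0) (qubit n .ctrl 0) (fun i => pos n (f i))
    (fun i => qubit n A (g i)) (fun i => qubit n B (g i)) k) F R ++ notReg n B

theorem run_compare {A B : Reg} (hA : A = .work1 ∨ A = .work2) (hB : B = .work1 ∨ B = .work2)
    (hAB : A ≠ B) {g f : ℕ → ℕ} {k : ℕ} {F : List (Term (Qubit n))} {S : List Reg} (hF : Uses F S)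
    (hS : S ⊆ ctlRegs) (hsg : Reg.sign ∉ S) {R : Reg} (hR : R = .lenT ∨ R = .lenR) {c : Conf}
    {v i₀ a b : ℕ} (hv : ∀ i, c.bit R i = v.testBit i) (hf : ∀ i < k, f i ≤ n)
    (hle : formula (c.enc n) F = true → v ≤ n ∧ i₀ < k ∧ ∀ i < k, f i = v ↔ i = i₀)
    (hg : ∀ i < k, g i < n + 3) (hgg : ∀ i < k, ∀ j < k, g i = g j → i = j) (hct : c.ct = false)
    (ha : formula (c.enc n) F = true →
      a < 2 ^ (i₀ + 1) ∧ ∀ j ≤ i₀, c.bit A (g j) = a.testBit j)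
    (hb : formula (c.enc n) F = true →
      b < 2 ^ (i₀ + 1) ∧ ∀ j ≤ i₀, c.bit B (g j) = b.testBit j) :
    run (compare A B g f k F R) (c.enc n) =
      { c with sg := xor c.sg (formula (c.enc n) F && decide (b < a)) }.enc n := by
  have hwA := width_work (n := n) hA
  have hwB := width_work (n := n) hB
  have hBR : ∀ R' ∈ ctlRegs, R' ≠ B := by
    rintro R' hR' rfl
    rcases hB with rfl | rfl <;> exact absurd hR' (by decide)
  have hRc : R ∈ ctlRegs := by rcases hR with rfl | rfl <;> decide
  have hAo : A ≠ .output ∧ A ≠ .iter ∧ A ≠ .ctrl ∧ A ≠ .sign := by rcases hA with rfl | rfl <;>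
      decide
  have hBo : B ≠ .output ∧ B ≠ .iter ∧ B ≠ .ctrl ∧ B ≠ .sign := by rcases hB with rfl | rfl <;>
      decide
  set c₁ := c.setWork B fun i => !c.bit B i with hc₁
  have hform : formula (c₁.enc n) F = formula (c.enc n) F :=
    hF.formula_eq fun R' hR' => Conf.bit_setWork_ne (hBR R' (hS hR')) _
  have hmain := run_marked_sign (c := c₁) (v := v) (k := k) (i₀ := i₀) (f := f)
    (κ := fun i => carry (fun j => c₁.enc n (qubit n A (g j))) (fun j => c₁.enc n (qubit n B (g j)))
      false (i + 1))
    (B := carryXor (qubit n .sign 0) (qubit n .ctrl 0) (fun i => pos n (f i))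
      (fun i => qubit n A (g i)) (fun i => qubit n B (g i)) k) hF hS hsg hR
    (fun i => by rw [hc₁, Conf.bit_setWork_ne (hBR R hRc), hv]) hf (by rw [hform]; exact hle) (by
      intro c' h1 h2 h3
      have hbitc : ∀ X : Reg, X = .work1 ∨ X = .work2 → c'.bit X = c₁.bit X := by
        rintro X (rfl | rfl)
        · exact h1
        · exact h2
      rw [run_carryXor ⟨fun i _ => qubit_ne_of_reg hAo.2.2.1.symm _ _,
        fun i _ => qubit_ne_of_reg hBo.2.2.1.symm _ _, fun i _ j _ => qubit_ne_of_reg hAB _ _,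
        fun i hi j hj h => hgg i hi j hj (eq_of_qubit_eq (hwA ▸ hg i hi) (hwA ▸ hg j hj) h),
        fun i hi j hj h => hgg i hi j hj (eq_of_qubit_eq (hwB ▸ hg i hi) (hwB ▸ hg j hj) h)⟩
        (qubit_ne_of_reg (by decide) _ _)
        (fun i _ => ⟨qubit_ne_of_reg hAo.2.2.2.symm _ _, qubit_ne_of_reg hBo.2.2.2.symm _ _,
          (pos_ne (by decide) (by decide) _ _).symm⟩)
        (fun i _ => ⟨pos_ne (by decide) (by decide) _ _, fun j _ =>
          ⟨pos_ne hAo.1 hAo.2.1 _ _, pos_ne hBo.1 hBo.2.1 _ _⟩⟩), toggle_sign]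
      congr 3
      have hct' : c'.enc n (qubit n .ctrl 0) = false := by
        show c'.ct = false
        rw [h3, hc₁]
        rcases hB with rfl | rfl <;> exact hct
      rw [hct']
      apply xsum_congr
      intro i hi
      rw [enc_pos]
      congr 1
      apply carry_congr <;> intro j hj
      · rw [enc_qubit, enc_qubit, hbitc A hA]
      · rw [enc_qubit, enc_qubit, hbitc B hB])
  rw [compare, run_append, run_append, run_notReg hB, hmain, run_notReg hB, hform]
  congr 1
  have hval : (formula (c.enc n) F && carry (fun j => c₁.enc n (qubit n A (g j)))
      (fun j => c₁.enc n (qubit n B (g j))) false (i₀ + 1)) =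
      (formula (c.enc n) F && decide (b < a)) := by
    cases hfv : formula (c.enc n) F
    · rfl
    · obtain ⟨ha1, ha2⟩ := ha hfv
      obtain ⟨hb1, hb2⟩ := hb hfv
      have hi₀ := (hle hfv).2.1
      rw [carry_not_testBit (A := a) (B := b) (fun j hj => ?_) (fun j hj => ?_) ha1 hb1]
      · rw [enc_qubit_of_lt _ (hwA ▸ hg j (by omega)), hc₁, Conf.bit_setWork_ne hAB,
          ha2 j (by omega)]
      · rw [enc_qubit_of_lt _ (hwB ▸ hg j (by omega)), hc₁, Conf.bit_setWork_self hB,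
          hb2 j (by omega)]
  simp only [hval]
  rcases hB with rfl | rfl <;> simp [hc₁, Conf.setWork, Conf.bit]

/-! ### Conditional subtraction in a part of a work register -/

/-- The function `w`, with the value at `b i` replaced by `g i` for `i < k`. -/
def overwrite (k : ℕ) (b : ℕ → ℕ) (w g : ℕ → Bool) (j : ℕ) : Bool :=
  match (List.range k).find? fun i => b i == j with
  | some i => g i
  | none => w j

theorem overwrite_self {k : ℕ} {b : ℕ → ℕ} (hb : ∀ i < k, ∀ j < k, b i = b j → i = j)
    (w g : ℕ → Bool) {i : ℕ} (hi : i < k) : overwrite k b w g (b i) = g i := by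
  unfold overwrite
  split
  · rename_i i' h
    have h1 := List.find?_some h
    have h2 := List.mem_of_find?_eq_some h
    rw [List.mem_range] at h2
    rw [hb _ h2 _ hi (by simpa using h1)]
  · rename_i h
    rw [List.find?_eq_none] at h
    exact absurd (by simp) (h i (List.mem_range.2 hi))

theorem overwrite_of_ne {k : ℕ} {b : ℕ → ℕ} (w g : ℕ → Bool) {j : ℕ} (hj : ∀ i < k, j ≠ b i) :
    overwrite k b w g j = w j := by
  unfold overwrite
  split
  · rename_i i' h
    have h1 := List.find?_some h
    have h2 := List.mem_of_find?_eq_some h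
    rw [List.mem_range] at h2
    exact absurd (beq_iff_eq.1 h1).symm (hj _ h2)
  · rfl

theorem eq_overwrite {k : ℕ} {b : ℕ → ℕ} (hb : ∀ i < k, ∀ j < k, b i = b j → i = j)
    {w g f : ℕ → Bool} (h1 : ∀ i < k, f (b i) = g i) (h2 : ∀ j, (∀ i < k, j ≠ b i) → f j = w j) :
    f = overwrite k b w g := by
  funext j
  by_cases hj : ∃ i < k, j = b i
  · obtain ⟨i, hi, rfl⟩ := hj
    rw [overwrite_self hb w g hi, h1 i hi]
  · push Not at hj
    rw [overwrite_of_ne w g hj, h2 j hj]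

/-- Adds the number in the cells `a 0, a 1, …` of `A` to the number in the cells `b 0, b 1, …` of
`B`, modulo `2 ^ k`. -/
def addWork (n : ℕ) [NeZero n] (A B : Reg) (a b : ℕ → ℕ) (k : ℕ) : Circuit (Qubit n) :=
  add (qubit n .ctrl 0) (fun i => qubit n A (a i)) (fun i => qubit n B (b i)) k

theorem addBits_congr {a b a' b' : ℕ → Bool} {i : ℕ} (ha : ∀ j ≤ i, a j = a' j)
    (hb : ∀ j ≤ i, b j = b' j) : addBits a b i = addBits a' b' i := by
  rw [addBits, addBits, ha i le_rfl, hb i le_rfl, carry_congr (fun j hj => ha j hj.le)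
    (fun j hj => hb j hj.le)]

/-- The registers and cells on which `addWork` can act. -/
structure AddCells (n : ℕ) (A B : Reg) (a b : ℕ → ℕ) (k : ℕ) : Prop where
  hA : A = .work1 ∨ A = .work2
  hB : B = .work1 ∨ B = .work2
  hAB : A ≠ B
  ha : ∀ i < k, a i < n + 3
  hb : ∀ i < k, b i < n + 3
  aa : ∀ i < k, ∀ j < k, a i = a j → i = j
  bb : ∀ i < k, ∀ j < k, b i = b j → i = j

theorem run_addWork {A B : Reg} {a b : ℕ → ℕ} {k : ℕ} (h : AddCells n A B a b k) {c : Conf}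
    (hc : c.ct = false) : run (addWork n A B a b k) (c.enc n) =
      (c.setWork B (overwrite k b (c.bit B)
        (addBits (fun i => c.bit A (a i)) fun i => c.bit B (b i)))).enc n := by
  have hwA := width_work (n := n) h.hA
  have hwB := width_work (n := n) h.hB
  have hAc : Reg.ctrl ≠ A := by rcases h.hA with h | h <;> rw [h] <;> decide
  have hBc : Reg.ctrl ≠ B := by rcases h.hB with h | h <;> rw [h] <;> decide
  obtain ⟨h1, h2⟩ := run_add (z := qubit n .ctrl 0) (a := fun i => qubit n A (a i))
    (b := fun i => qubit n B (b i)) (k := k) ⟨fun i _ => qubit_ne_of_reg hAc _ _,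
      fun i _ => qubit_ne_of_reg hBc _ _, fun i _ j _ => qubit_ne_of_reg h.hAB _ _,
      fun i hi j hj he => h.aa i hi j hj (eq_of_qubit_eq (hwA ▸ h.ha i hi) (hwA ▸ h.ha j hj) he),
      fun i hi j hj he => h.bb i hi j hj (eq_of_qubit_eq (hwB ▸ h.hb i hi) (hwB ▸ h.hb j hj) he)⟩
      (c.enc n)
  refine eq_enc_of_array (R := B) (c := c) (f := b) (k := k) (fun i hi => hwB ▸ h.hb i hi)
    (fun R hR => Conf.bit_setWork_ne hR _) (fun i hi => ?_) (fun j hj hne => ?_) h2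
  · have hct : c.enc n (qubit n .ctrl 0) = false := hc
    rw [addWork, h1 i hi, Conf.bit_setWork_self h.hB, overwrite_self h.bb _ _ hi, hct]
    have hAe : ∀ j < k, c.enc n (qubit n A (a j)) = c.bit A (a j) := fun j hj =>
      enc_qubit_of_lt c (hwA ▸ h.ha j hj)
    have hBe : ∀ j < k, c.enc n (qubit n B (b j)) = c.bit B (b j) := fun j hj =>
      enc_qubit_of_lt c (hwB ▸ h.hb j hj)
    rw [← addBits_congr (i := i) (fun j hj => hAe j (by omega)) (fun j hj => hBe j (by omega))]
    rfl
  · rw [Conf.bit_setWork_self h.hB, overwrite_of_ne _ _ hne]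

/-- With `M` complementing the low places of the target, subtracts twice the addend there: the
addition between the complementations subtracts, and the inverse addition at the end subtracts once
more.  The effects on the high places, where nothing is complemented, cancel, so the extent of the
subtraction is controlled by the extent of the complementation. -/
def condSub (M : Circuit (Qubit n)) (A B : Reg) (a b : ℕ → ℕ) (k : ℕ) : Circuit (Qubit n) :=
  M ++ addWork n A B a b k ++ M ++ (addWork n A B a b k).inverse

theorem run_condSub {M : Circuit (Qubit n)} {A B : Reg} {a b : ℕ → ℕ} {k : ℕ}
    (h : AddCells n A B a b k) {c : Conf} (hc : c.ct = false) {f : Bool} {m : ℕ → Bool} {L x y : ℕ}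
    (hM : ∀ w, run M ((c.setWork B w).enc n) =
      (c.setWork B fun j => xor (w j) (f && m j)).enc n)
    (hm : f = true → ∀ i < k, m (b i) = decide (i < L))
    (hLk : f = true → L ≤ k)
    (hx : f = true → ∀ i < L, c.bit A (a i) = x.testBit i)
    (hy : f = true → ∀ i < L, c.bit B (b i) = y.testBit i)
    (hle : f = true → y < 2 ^ L ∧ 2 * x ≤ y) :
    run (condSub M A B a b k) (c.enc n) = (c.setWork B (if f then overwrite k b (c.bit B)
      (fun i => if i < L then (y - 2 * x).testBit i else c.bit B (b i)) else c.bit B)).enc n := by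
  have hadd : ∀ w, run (addWork n A B a b k) ((c.setWork B w).enc n) =
      (c.setWork B (overwrite k b w (addBits (fun i => c.bit A (a i)) fun i => w (b i)))).enc n :=
        by
    intro w
    have hct : (c.setWork B w).ct = false := by
      rcases h.hB with h' | h' <;> rw [h'] <;> exact hc
    rw [run_addWork h hct, Conf.setWork_setWork, Conf.bit_setWork_self h.hB,
      Conf.bit_setWork_ne h.hAB]
  rw [condSub, run_append, run_append, run_append, ← Conf.setWork_self (c := c) B, hM, hadd, hM]
  rw [Conf.setWork_self]
  apply run_inverse_of_run
  rw [hadd]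
  congr 2
  cases f
  · simp
  · simp only [if_true, Bool.true_and]
    replace hm := hm rfl
    replace hx := hx rfl
    replace hy := hy rfl
    replace hle := hle rfl
    replace hLk := hLk rfl
    refine (eq_overwrite h.bb (fun i hi => ?_) fun j hj => ?_).symm
    · rw [overwrite_self h.bb _ _ hi, hm i hi]
      have := addBits_condSub hx hy hle.1 hle.2 i
      have e₁ : addBits (fun i => c.bit A (a i)) (fun j => xor (c.bit B (b j)) (m (b j))) i =
          addBits (fun i => c.bit A (a i)) (fun j => xor (c.bit B (b j)) (decide (j < L))) i :=
        addBits_congr (fun _ _ => rfl) fun j hj => by rw [hm j (by omega)]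
      have e₂ : addBits (fun i => c.bit A (a i)) (fun i => overwrite k b (c.bit B)
          (fun i => if i < L then (y - 2 * x).testBit i else c.bit B (b i)) (b i)) i =
          addBits (fun i => c.bit A (a i))
            (fun j => if j < L then (y - 2 * x).testBit j else c.bit B (b j)) i :=
        addBits_congr (fun _ _ => rfl) fun j hj => overwrite_self h.bb _ _ (by omega)
      rw [e₁, e₂, this]
    · rw [overwrite_of_ne _ _ hj, overwrite_of_ne _ _ hj]
      cases c.bit B j <;> simp

theorem Conf.mark_setWork (c : Conf) (R : Reg) (w : ℕ → Bool) (v : ℕ) (b : Bool) :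
    (c.setWork R w).mark n v b = (c.mark n v b).setWork R w := by
  cases R <;> rfl

theorem xsum_mark {k i₀ v : ℕ} {h : ℕ → ℕ} {b : Bool} (hi₀ : h i₀ = v)
    (hh : ∀ i < k, h i = v → i = i₀) :
    (xsum k fun j => b && decide (h j = v)) = (b && decide (i₀ < k)) := by
  cases b
  · simp [xsum_eq_false]
  · simp only [Bool.true_and]
    by_cases hk : i₀ < k
    · rw [show (xsum k fun j => decide (h j = v)) = xsum k fun j => decide (j = i₀) && true from
        xsum_congr fun j hj => by
          rw [Bool.and_true, decide_eq_decide]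
          exact ⟨hh j hj, fun he => he ▸ hi₀⟩, xsum_single hk fun _ => true]
      simp [hk]
    · rw [xsum_eq_false fun j hj => ?_]
      · simp [hk]
      · rw [decide_eq_false_iff_not]
        intro he
        have := hh j hj he
        omega

/-- Complements the cells `g i` of the register `B` for which `i` is not before the marked
position `h i`, and one further cell. -/
def regionFlip (B : Reg) (h g : ℕ → ℕ) (guard : ℕ) (F : List (Term (Qubit n))) (R : Reg) :
    Circuit (Qubit n) :=
  marked (maskXor (fun j => pos n (h j)) (fun j => qubit n B (g j)) n) F R ++
    flip F (qubit n B guard)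

theorem run_regionFlip {B : Reg} (hB : B = .work1 ∨ B = .work2) {h g : ℕ → ℕ} {guard : ℕ}
    {F : List (Term (Qubit n))} {S : List Reg} (hF : Uses F S) (hS : S ⊆ ctlRegs) {R : Reg}
    (hR : R = .lenT ∨ R = .lenR) {c : Conf} {v i₀ : ℕ} {m : ℕ → Bool}
    (hv : ∀ i, c.bit R i = v.testBit i)
    (hh : ∀ i ≤ n, h i ≤ n) (hhh : ∀ i ≤ n, ∀ j ≤ n, h i = h j → i = j)
    (hg : ∀ i ≤ n, g i < n + 3) (hgg : ∀ i ≤ n, ∀ j ≤ n, g i = g j → i = j)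
    (hguard : guard < n + 3 ∧ (B = .work1 → guard ≠ 1 ∧ guard ≠ 2))
    (hgg' : ∀ i ≤ n, formula (c.enc n) F = true → i₀ ≤ i → g i ≠ guard)
    (hle : formula (c.enc n) F = true → v ≤ n ∧ i₀ ≤ n ∧ h i₀ = v)
    (hm : formula (c.enc n) F = true → ∀ j < n + 3, m j = true ↔ j = guard ∨ ∃ i, i ≤ n ∧ i₀ ≤ i ∧
      j = g i) :
    run (regionFlip B h g guard F R) (c.enc n) =
      (c.setWork B fun j => xor (c.bit B j) (formula (c.enc n) F && m j)).enc n := by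
  have hwB := width_work (n := n) hB
  have hBo : B ≠ .output ∧ B ≠ .iter := by rcases hB with h | h <;> rw [h] <;> decide
  have hBS : B ∉ ctlRegs := by rcases hB with h | h <;> rw [h] <;> decide
  have hRB : ∀ R' ∈ R :: S, R' ≠ B := by
    rintro R' hR' rfl
    rcases List.mem_cons.1 hR' with h | h
    · rcases hR with h' | h' <;> rw [h'] at h <;> rw [h] at hB <;> revert hB <;> decide
    · exact hBS (hS h)
  have hbody : ∀ (c : Conf) (w : ℕ → Bool), run (maskXor (fun j => pos n (h j))
      (fun j => qubit n B (g j)) n) ((c.setWork B w).enc n) =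
      (c.setWork B (overwrite (n + 1) g w fun i =>
        xor (w (g i)) (xsum (i + 1) fun j => c.pos n (h j)))).enc n := by
    intro c w
    obtain ⟨h1, h2⟩ := run_maskXor (h := fun j => pos n (h j)) (b := fun j => qubit n B (g j))
      (k := n) (fun i _ j _ => pos_ne hBo.1 hBo.2 _ _)
      (fun i hi j hj he => hhh i hi j hj (pos_inj (hh i hi) (hh j hj) he))
      (fun i hi j hj he => hgg i hi j hj (eq_of_qubit_eq (hwB ▸ hg i hi) (hwB ▸ hg j hj) he))
      ((c.setWork B w).enc n)
    refine eq_enc_of_array (R := B) (c := c.setWork B w) (f := g) (k := n + 1)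
      (fun i hi => hwB ▸ hg i (by omega))
      (fun R' hR' => by rw [Conf.bit_setWork_ne hR', Conf.bit_setWork_ne hR'])
      (fun i hi => ?_) (fun j hj hne => ?_) fun w hw => h2 w fun i hi => hw i (by omega)
    · rw [h1 i (by omega), Conf.bit_setWork_self hB,
        overwrite_self (fun i hi j hj => hgg i (by omega) j (by omega)) _ _ hi,
        enc_qubit_of_lt _ (hwB ▸ hg i (by omega)), Conf.bit_setWork_self hB]
      congr 2
      funext j
      rw [enc_pos]
      rcases hB with h | h <;> rw [h] <;> rfl
    · rw [Conf.bit_setWork_self hB, Conf.bit_setWork_self hB, overwrite_of_ne _ _ hne]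
  set b := formula (c.enc n) F with hb
  have hbit : ∀ w, ∀ R' ∈ R :: S, (c.setWork B w).bit R' = c.bit R' := fun w R' hR' =>
    Conf.bit_setWork_ne (hRB R' hR') w
  have hmarked : run (marked (maskXor (fun j => pos n (h j)) (fun j => qubit n B (g j)) n) F R)
      (c.enc n) = (c.setWork B (overwrite (n + 1) g (c.bit B) fun i =>
        xor (c.bit B (g i)) (b && decide (i₀ ≤ i)))).enc n := by
    refine run_marked hF hS hR hv (fun h => (hle h).1) (hbit _) (hbit _)
      (c₁ := c.setWork B (overwrite (n + 1) g (c.bit B) fun i =>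
        xor (c.bit B (g i)) (xsum (i + 1) fun j => c.pos n (h j)))) ?_ ?_
    · have := hbody c (c.bit B)
      rwa [Conf.setWork_self] at this
    · rw [← hb, Conf.mark_setWork, hbody, Conf.mark_setWork]
      congr 2
      refine (eq_overwrite (fun i hi j hj => hgg i (by omega) j (by omega)) (fun i hi => ?_)
        fun j hj => ?_).symm
      · rw [overwrite_self (fun i hi j hj => hgg i (by omega) j (by omega)) _ _ hi,
          overwrite_self (fun i hi j hj => hgg i (by omega) j (by omega)) _ _ hi,
          xsum_congr (g := fun j => xor (c.pos n (h j)) (b && decide (h j = v))) fun j hj =>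
            Conf.pos_mark (hh j (by omega)), xsum_xor]
        have : (xsum (i + 1) fun j => b && decide (h j = v)) = (b && decide (i₀ ≤ i)) := by
          cases hbv : b
          · simp [xsum_eq_false]
          · obtain ⟨-, h2, h3⟩ := hle hbv
            rw [xsum_mark h3 fun j hj he => hhh j (by omega) i₀ h2 (he.trans h3.symm)]
            simp
        rw [this]
        cases c.bit B (g i) <;> cases (xsum (i + 1) fun j => c.pos n (h j)) <;> simp
      · rw [overwrite_of_ne _ _ hj, overwrite_of_ne _ _ hj]
  have hw1S : Reg.work1 ∉ S := fun h => absurd (hS h) (by decide)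
  have hne : ∀ i, i = 1 ∨ i = 2 → qubit n B guard ≠ qubit n .work1 i := by
    intro i hi
    rcases hB with rfl | rfl
    · have := NeZero.pos n
      have := hguard.2 rfl
      exact qubit_ne hguard.1 (by simp only [Reg.width]; omega) (by omega)
    · exact qubit_ne_of_reg (by decide) _ _
  rw [regionFlip, run_append, hmarked, run_flip hF hw1S (fun h => hBS (hS h)) (hne 1 (Or.inl rfl))
    (hne 2 (Or.inr rfl)), hF.formula_eq fun R' hR' => hbit _ R' (List.mem_cons_of_mem _ hR'), ← hb]
  apply toggle_enc (hwB ▸ hguard.1) (fun R' hR' => by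
    rw [Conf.bit_setWork_ne hR', Conf.bit_setWork_ne hR'])
  intro j hj
  rw [hwB] at hj
  rw [Conf.bit_setWork_self hB, Conf.bit_setWork_self hB]
  have hover : overwrite (n + 1) g (c.bit B) (fun i => xor (c.bit B (g i)) (b && decide (i₀ ≤ i))) j
      = xor (c.bit B j) (b && decide (∃ i, i ≤ n ∧ i₀ ≤ i ∧ j = g i)) := by
    by_cases hex : ∃ i < n + 1, j = g i
    · obtain ⟨i, hi, rfl⟩ := hex
      rw [overwrite_self (fun i hi j hj => hgg i (by omega) j (by omega)) _ _ hi]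
      congr 2
      rw [decide_eq_decide]
      exact ⟨fun h => ⟨i, by omega, h, rfl⟩, fun ⟨i', h1, h2, h3⟩ => by
        rw [hgg i (by omega) i' h1 h3]; exact h2⟩
    · push Not at hex
      rw [overwrite_of_ne _ _ hex]
      have : ¬ ∃ i, i ≤ n ∧ i₀ ≤ i ∧ j = g i := fun ⟨i, h1, _, h3⟩ => hex i (by omega) h3
      simp [this]
  rw [hover]
  clear_value b
  cases b
  · simp
  · have hmj := hm rfl j hj
    have hgj := hgg'
    by_cases hjg : j = guard
    · have h1 : ¬ ∃ i, i ≤ n ∧ i₀ ≤ i ∧ j = g i := fun ⟨i, h1, h2, h3⟩ =>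
        hgg' i h1 rfl h2 (h3.symm.trans hjg)
      have h2 : m j = true := hmj.2 (Or.inl hjg)
      rw [if_pos hjg, h2, decide_eq_false h1]
      simp
    · have h2 : m j = decide (∃ i, i ≤ n ∧ i₀ ≤ i ∧ j = g i) := by
        rw [Bool.eq_iff_iff, hmj, decide_eq_true_iff]
        exact or_iff_right hjg
      simp [h2, hjg]

theorem Uses.formula_setWork {F : List (Term (Qubit n))} {S : List Reg} (hF : Uses F S)
    (hS : S ⊆ ctlRegs) {B : Reg} (hB : B = .work1 ∨ B = .work2) (c : Conf) (w : ℕ → Bool) :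
    formula ((c.setWork B w).enc n) F = formula (c.enc n) F :=
  hF.formula_eq fun R hR => Conf.bit_setWork_ne (by
    rintro rfl
    rcases hB with rfl | rfl <;> exact absurd (hS hR) (by decide)) w

/-- Subtracts the number in the right-most cells of the second work register from the number in the
cells of the first one to the right of the position that is given by `lenT`.  The factor `2` in
`condSub` is compensated by taking the cell `0` as an additional lowest digit of the minuend: its
content is arbitrary and stays unchanged. -/
def condSubR (F : List (Term (Qubit n))) : Circuit (Qubit n) :=
  condSub (regionFlip .work1 (fun j => if j = n then 0 else j + 1) (fun j => j + 2) 0 F .lenT)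
    .work2 .work1
    (fun i => n + 2 - i) (fun i => if i = 0 then 0 else n + 3 - i) (n + 2)

theorem run_condSubR {F : List (Term (Qubit n))} {S : List Reg} (hF : Uses F S) (hS : S ⊆ ctlRegs)
    {c : Conf} {x y : ℕ} (hc : c.ct = false)
    (hle : formula (c.enc n) F = true → 1 ≤ c.lt ∧ c.lt ≤ n ∧ y < 2 ^ (n + 2 - c.lt) ∧ x ≤ y)
    (hy : formula (c.enc n) F = true → ∀ i < n + 2 - c.lt, c.w1 (n + 2 - i) = y.testBit i)
    (hx : formula (c.enc n) F = true → ∀ i < n + 3 - c.lt, c.w2 (n + 2 - i) = x.testBit i) :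
    run (condSubR F) (c.enc n) =
      { c with
        w1 := fun j => if formula (c.enc n) F = true ∧ c.lt + 1 ≤ j ∧ j ≤ n + 2 then
          (y - x).testBit (n + 2 - j) else c.w1 j }.enc n := by
  have hcells : AddCells n .work2 .work1 (fun i => n + 2 - i)
      (fun i => if i = 0 then 0 else n + 3 - i) (n + 2) := by
    refine ⟨Or.inr rfl, Or.inl rfl, by decide, fun i hi => by omega, fun i hi => ?_,
      fun i hi j hj h => by omega, fun i hi j hj h => ?_⟩
    · split_ifs <;> omega
    · split_ifs at h <;> omega
  set g := (c.w1 0).toNat with hg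
  rw [condSubR, run_condSub hcells (c := c) hc (f := formula (c.enc n) F)
    (m := fun j => decide (j = 0 ∨ c.lt + 1 ≤ j ∧ j ≤ n + 2)) (L := n + 3 - c.lt) (x := x)
    (y := Nat.bit (c.w1 0) y) (fun w => ?_) (fun h i hi => ?_) (fun h => ?_) hx
    (fun h i hi => ?_) (fun h => ?_)]
  · apply enc_congr
    intro R i hi
    cases R <;> first | rfl | skip
    change i < n + 3 at hi
    show (if _ then _ else _ : ℕ → Bool) i = if _ then _ else _
    cases hf : formula (c.enc n) F
    · simp
      rfl
    · obtain ⟨h1, h2, h3, h4⟩ := hle hf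
      simp only [if_true, true_and]
      have hsub : Nat.bit (c.w1 0) y - 2 * x = Nat.bit (c.w1 0) (y - x) := by
        cases c.w1 0 <;> simp [Nat.bit] <;> omega
      rw [hsub]
      by_cases hi0 : i = 0
      · have := overwrite_self hcells.bb (c.bit .work1) (fun i => if i < n + 3 - c.lt then
          (Nat.bit (c.w1 0) (y - x)).testBit i else c.bit .work1 (if i = 0 then 0 else n + 3 - i))
          (i := 0) (by omega)
        simp only [if_true] at this
        rw [hi0, this, if_pos (by omega), if_neg (by omega), Nat.testBit_bit_zero]
      · by_cases hi3 : 2 ≤ i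
        · have := overwrite_self hcells.bb (c.bit .work1) (fun i => if i < n + 3 - c.lt then
            (Nat.bit (c.w1 0) (y - x)).testBit i else c.bit .work1 (if i = 0 then 0 else n + 3 - i))
            (i := n + 2 - i + 1) (by omega)
          simp only [Nat.add_eq_zero_iff, one_ne_zero, and_false, if_false] at this
          rw [show n + 3 - (n + 2 - i + 1) = i by omega] at this
          rw [this, Nat.testBit_bit_succ]
          by_cases h : c.lt + 1 ≤ i ∧ i ≤ n + 2
          · rw [if_pos h, if_pos (by omega)]
          · rw [if_neg h, if_neg (by omega)]; rfl
        · rw [overwrite_of_ne, if_neg (by omega)]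
          · rfl
          · intro j hj; split_ifs <;> omega
  · have hform := hF.formula_setWork hS (B := .work1) (Or.inl rfl) c w
    have := run_regionFlip (c := c.setWork .work1 w) (B := .work1) (Or.inl rfl) hF hS (Or.inl rfl)
      (h := fun j => if j = n then 0 else j + 1) (g := fun j => j + 2) (guard := 0) (v := c.lt)
      (i₀ := c.lt - 1)
      (m := fun j => decide (j = 0 ∨ c.lt + 1 ≤ j ∧ j ≤ n + 2)) (fun i => rfl)
      (fun i hi => by split_ifs <;> omega) (fun i _ j _ h => by split_ifs at h <;> omega)
      (fun i hi => by omega) (fun i hi j hj h => by omega)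
      ⟨by omega, fun _ => ⟨by omega, by omega⟩⟩ (fun i _ _ _ => by omega)
      (fun h => by
        rw [hform] at h
        have := hle h
        exact ⟨this.2.1, by omega, by rw [if_neg (by omega)]; omega⟩)
      (fun h j hj => by
        rw [hform] at h
        have := hle h
        rw [decide_eq_true_iff]
        constructor
        · rintro (h | h)
          · exact Or.inl h
          · exact Or.inr ⟨j - 2, by omega, by omega, by omega⟩
        · rintro (h | ⟨i, h1, h2, h3⟩)
          · exact Or.inl h
          · exact Or.inr (by omega))
    rw [this, hform, Conf.setWork_setWork]
    rfl
  · obtain ⟨h1, h2, -⟩ := hle h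
    rw [decide_eq_decide]
    split_ifs <;> omega
  · have := hle h; omega
  · have := hle h
    cases i with
    | zero => simp [Conf.bit]
    | succ i =>
      rw [Nat.testBit_bit_succ, ← hy h i (by omega)]
      simp only [Nat.add_eq_zero_iff, one_ne_zero, and_false, if_false]
      rw [show n + 3 - (i + 1) = n + 2 - i by omega]
      rfl
  · obtain ⟨h1, h2, h3, h4⟩ := hle h
    rw [show n + 3 - c.lt = n + 2 - c.lt + 1 by omega, pow_succ]
    constructor
    · cases c.w1 0 <;> simp [Nat.bit] <;> omega
    · cases c.w1 0 <;> simp [Nat.bit] <;> omega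

/-- Subtracts the number in the left-most cells of the first work register from the number in the
second one, up to the position that is given by `lenT`.  The cell `n + 2` of the second register
serves as additional lowest digit of the minuend. -/
def condSubT (F : List (Term (Qubit n))) : Circuit (Qubit n) :=
  condSub (regionFlip .work2 (fun j => n - j) (fun j => n - j) (n + 2) F .lenT) .work1 .work2
    (fun i => i) (fun i => if i = 0 then n + 2 else i - 1) (n + 2)

theorem run_condSubT {F : List (Term (Qubit n))} {S : List Reg} (hF : Uses F S) (hS : S ⊆ ctlRegs)
    {c : Conf} {x y : ℕ} (hc : c.ct = false)
    (hle : formula (c.enc n) F = true → c.lt ≤ n ∧ y < 2 ^ (c.lt + 1) ∧ x ≤ y)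
    (hy : formula (c.enc n) F = true → ∀ i < c.lt + 1, c.w2 i = y.testBit i)
    (hx : formula (c.enc n) F = true → ∀ i < c.lt + 2, c.w1 i = x.testBit i) :
    run (condSubT F) (c.enc n) =
      { c with
        w2 := fun j => if formula (c.enc n) F = true ∧ j ≤ c.lt then (y - x).testBit j
          else c.w2 j }.enc n := by
  have hcells : AddCells n .work1 .work2 (fun i => i)
      (fun i => if i = 0 then n + 2 else i - 1) (n + 2) := by
    refine ⟨Or.inl rfl, Or.inr rfl, by decide, fun i hi => by omega, fun i hi => ?_,
      fun i hi j hj h => by omega, fun i hi j hj h => ?_⟩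
    · split_ifs <;> omega
    · split_ifs at h <;> omega
  rw [condSubT, run_condSub hcells (c := c) hc (f := formula (c.enc n) F)
    (m := fun j => decide (j = n + 2 ∨ j ≤ c.lt)) (L := c.lt + 2) (x := x)
    (y := Nat.bit (c.w2 (n + 2)) y) (fun w => ?_) (fun h i hi => ?_) (fun h => ?_) hx
    (fun h i hi => ?_) (fun h => ?_)]
  · apply enc_congr
    intro R i hi
    cases R <;> first | rfl | skip
    change i < n + 3 at hi
    show (if _ then _ else _ : ℕ → Bool) i = if _ then _ else _
    cases hf : formula (c.enc n) F
    · simp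
      rfl
    · obtain ⟨h1, h3, h4⟩ := hle hf
      simp only [if_true, true_and]
      have hsub : Nat.bit (c.w2 (n + 2)) y - 2 * x = Nat.bit (c.w2 (n + 2)) (y - x) := by
        cases c.w2 (n + 2) <;> simp [Nat.bit] <;> omega
      rw [hsub]
      by_cases hi0 : i = n + 2
      · have := overwrite_self hcells.bb (c.bit .work2) (fun i => if i < c.lt + 2 then
          (Nat.bit (c.w2 (n + 2)) (y - x)).testBit i else
            c.bit .work2 (if i = 0 then n + 2 else i - 1)) (i := 0) (by omega)
        simp only [if_true] at this
        rw [hi0, this, if_pos (by omega), if_neg (by omega), Nat.testBit_bit_zero]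
      · by_cases hi3 : i ≤ n
        · have := overwrite_self hcells.bb (c.bit .work2) (fun i => if i < c.lt + 2 then
            (Nat.bit (c.w2 (n + 2)) (y - x)).testBit i else
              c.bit .work2 (if i = 0 then n + 2 else i - 1)) (i := i + 1) (by omega)
          simp only [Nat.add_eq_zero_iff, one_ne_zero, and_false, if_false] at this
          rw [show i + 1 - 1 = i by omega] at this
          rw [this, Nat.testBit_bit_succ]
          by_cases h : i ≤ c.lt
          · rw [if_pos h, if_pos (by omega)]
          · rw [if_neg h, if_neg (by omega)]; rfl
        · rw [overwrite_of_ne, if_neg (by omega)]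
          · rfl
          · intro j hj; split_ifs <;> omega
  · have hform := hF.formula_setWork hS (B := .work2) (Or.inr rfl) c w
    have := run_regionFlip (c := c.setWork .work2 w) (B := .work2) (Or.inr rfl) hF hS (Or.inl rfl)
      (h := fun j => n - j) (g := fun j => n - j) (guard := n + 2) (v := c.lt) (i₀ := n - c.lt)
      (m := fun j => decide (j = n + 2 ∨ j ≤ c.lt)) (fun i => rfl) (fun i hi => by omega)
      (fun i _ j _ h => by omega) (fun i hi => by omega) (fun i hi j hj h => by omega)
      ⟨by omega, fun h => absurd h (by decide)⟩ (fun i _ _ _ => by omega)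
      (fun h => by rw [hform] at h; have := hle h; exact ⟨this.1, by omega, by omega⟩)
      (fun h j hj => by
        rw [hform] at h
        have := hle h
        rw [decide_eq_true_iff]
        constructor
        · rintro (h | h)
          · exact Or.inl h
          · exact Or.inr ⟨n - j, by omega, by omega, by omega⟩
        · rintro (h | ⟨i, h1, h2, h3⟩)
          · exact Or.inl h
          · exact Or.inr (by omega))
    rw [this, hform, Conf.setWork_setWork]
    rfl
  · obtain ⟨h1, h2, -⟩ := hle h
    rw [decide_eq_decide]
    split_ifs <;> omega
  · have := hle h; omega
  · have := hle h
    cases i with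
    | zero => simp [Conf.bit]
    | succ i =>
      rw [Nat.testBit_bit_succ, ← hy h i (by omega)]
      simp only [Nat.add_eq_zero_iff, one_ne_zero, and_false, if_false]
      rw [show i + 1 - 1 = i by omega]
      rfl
  · obtain ⟨h1, h3, h4⟩ := hle h
    rw [pow_succ] at h3 ⊢
    constructor
    · cases c.w2 (n + 2) <;> simp [Nat.bit] <;> omega
    · cases c.w2 (n + 2) <;> simp [Nat.bit] <;> omega

/-- The inverse of `condSubT` adds. -/
theorem run_condSubT_inverse {F : List (Term (Qubit n))} {S : List Reg} (hF : Uses F S)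
    (hS : S ⊆ ctlRegs) {c : Conf} {x y : ℕ} (hc : c.ct = false)
    (hle : formula (c.enc n) F = true → c.lt ≤ n ∧ x + y < 2 ^ (c.lt + 1))
    (hy : formula (c.enc n) F = true → ∀ i < c.lt + 1, c.w2 i = y.testBit i)
    (hx : formula (c.enc n) F = true → ∀ i < c.lt + 2, c.w1 i = x.testBit i) :
    run (condSubT F).inverse (c.enc n) =
      { c with
        w2 := fun j => if formula (c.enc n) F = true ∧ j ≤ c.lt then (x + y).testBit j
          else c.w2 j }.enc n := by
  apply run_inverse_of_run
  set c' : Conf := { c with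
        w2 := fun j => if formula (c.enc n) F = true ∧ j ≤ c.lt then (x + y).testBit j
          else c.w2 j } with hc'
  have hform : formula (c'.enc n) F = formula (c.enc n) F :=
    hF.formula_setWork hS (Or.inr rfl) c _
  rw [run_condSubT (c := c') hF hS (x := x) (y := x + y) hc
    (fun h => by rw [hform] at h; have := hle h; exact ⟨this.1, this.2, by omega⟩)
    (fun h i hi => ?_) (fun h => by rw [hform] at h; exact hx h), hform]
  · apply enc_congr
    intro R i hi
    cases R <;> first | rfl | skip
    show (if _ then _ else _) = c.w2 i
    simp only [hc']
    by_cases h : formula (c.enc n) F = true ∧ i ≤ c.lt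
    · rw [if_pos h, hy h.1 i (by omega), Nat.add_sub_cancel_left]
    · rw [if_neg h, if_neg h]
  · rw [hform] at h
    exact if_pos ⟨h, Nat.lt_succ_iff.1 hi⟩

/-! ### Bit lengths -/

theorem active_xor (y y' w : ℕ → Bool) (i : ℕ) :
    active (fun j => xor (y j) (y' j)) w i = xor (active y w i) (active y' w i) := by
  induction i with
  | zero => rfl
  | succ i ih =>
    simp only [active, ih]
    cases y (i + 1) <;> cases y' (i + 1) <;> cases active y w i <;> cases active y' w i <;>
      cases w i <;> rfl

theorem active_congr {y y' w w' : ℕ → Bool} {i : ℕ} (h : ∀ j ≤ i, y j = y' j)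
    (hw : ∀ j < i, w j = w' j) : active y w i = active y' w' i := by
  induction i with
  | zero => exact h 0 le_rfl
  | succ i ih =>
    rw [active, active, h _ le_rfl, hw i (by omega), ih (fun j hj => h j (by omega))
      fun j hj => hw j (by omega)]

theorem active_single (w : ℕ → Bool) (v i : ℕ) :
    active (fun j => decide (j = v)) w i = decide (v ≤ i ∧ ∀ j, v ≤ j → j < i → w j = false) := by
  induction i with
  | zero =>
    rw [active, decide_eq_decide]
    exact ⟨fun h => ⟨h.symm.le, fun j _ hj => absurd hj (by omega)⟩, fun h => by omega⟩
  | succ i ih =>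
    rw [active, ih, Bool.eq_iff_iff]
    rcases lt_trichotomy (i + 1) v with h | h | h
    · simp [show i + 1 ≠ v by omega, show ¬ v ≤ i by omega, show ¬ v ≤ i + 1 by omega]
    · subst h
      have : ∀ j, i + 1 ≤ j → j < i + 1 → w j = false := fun j h1 h2 => by omega
      simp only [decide_true, Bool.true_xor, le_refl, true_and, decide_eq_true_iff,
        show ¬ i + 1 ≤ i by omega, false_and, decide_false, Bool.false_and, Bool.not_false]
      simp
      omega
    · simp only [show i + 1 ≠ v by omega, decide_false, Bool.false_xor, Bool.and_eq_true,
        decide_eq_true_iff, Bool.not_eq_true']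
      constructor
      · rintro ⟨⟨h1, h2⟩, h3⟩
        refine ⟨by omega, fun j hj hj' => ?_⟩
        rcases Nat.lt_succ_iff_lt_or_eq.1 hj' with h | rfl
        · exact h2 j hj h
        · exact h3
      · rintro ⟨h1, h2⟩
        exact ⟨⟨by omega, fun j hj hj' => h2 j hj (by omega)⟩, h2 i (by omega) (by omega)⟩

/-- The length that a scan from place `v` finds: `m` if the first digit `1` of `w` at a place
`≥ v` is at the place `k + 1 - m`, and `0` if there is none. -/
theorem xsum_active_single {w : ℕ → Bool} {k v m : ℕ} (hm : m ≤ k + 1 - v)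
    (h0 : ∀ i ≤ k, v ≤ i → m < k + 1 - i → w i = false) (h1 : 0 < m → w (k + 1 - m) = true)
    (l : ℕ) : (xsum (k + 1) fun i => active (fun j => decide (j = v)) w i && w i &&
      (k + 1 - i).testBit l) = m.testBit l := by
  rcases Nat.eq_zero_or_pos m with rfl | hpos
  · rw [xsum_eq_false]
    · simp
    · intro i hi
      rw [active_single]
      by_cases hv : v ≤ i
      · rw [h0 i (by omega) hv (by omega)]; simp
      · simp [hv]
  · rw [show m.testBit l = (k + 1 - (k + 1 - m)).testBit l by congr 1; omega,
      ← xsum_single (k := k + 1) (v := k + 1 - m) (by omega) fun i => (k + 1 - i).testBit l]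
    apply xsum_congr
    intro i hi
    congr 1
    rw [active_single, Bool.eq_iff_iff]
    simp only [Bool.and_eq_true, decide_eq_true_iff]
    constructor
    · rintro ⟨⟨hv, hz⟩, hw⟩
      by_contra hne
      rcases Nat.lt_or_gt_of_ne hne with hlt | hgt
      · rw [h0 i (by omega) hv (by omega)] at hw
        exact absurd hw (by decide)
      · rw [hz (k + 1 - m) (by omega) hgt] at h1
        exact absurd (h1 hpos) (by decide)
    · rintro rfl
      exact ⟨⟨by omega, fun j hj hj' => h0 j (by omega) hj (by omega)⟩, h1 hpos⟩

/-- The bitwise XOR of the numbers `f 0, …, f (k - 1)`. -/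
def natXor : ℕ → (ℕ → ℕ) → ℕ
  | 0, _ => 0
  | k + 1, f => natXor k f ^^^ f k

theorem testBit_natXor (k : ℕ) (f : ℕ → ℕ) (l : ℕ) :
    (natXor k f).testBit l = xsum k fun i => (f i).testBit l := by
  induction k with
  | zero => simp [natXor, xsum]
  | succ k ih => rw [natXor, Nat.testBit_xor, ih]; rfl

/-- The contents with `x` XORed to the number in a length register `R`. -/
def Conf.xorLen (c : Conf) (R : Reg) (x : ℕ) : Conf :=
  match R with
  | .lenT => { c with lt := c.lt ^^^ x }
  | .lenR => { c with lr := c.lr ^^^ x }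
  | _ => c

theorem Conf.bit_xorLen_self {c : Conf} {R : Reg} (hR : R = .lenT ∨ R = .lenR) (x l : ℕ) :
    (c.xorLen R x).bit R l = xor (c.bit R l) (x.testBit l) := by
  rcases hR with rfl | rfl <;> exact Nat.testBit_xor ..

theorem Conf.bit_xorLen_ne {c : Conf} {R R' : Reg} (h : R' ≠ R) (x : ℕ) :
    (c.xorLen R x).bit R' = c.bit R' := by
  cases R <;> cases R' <;> first | rfl | exact absurd rfl h

/-- Adds to the register `T`, bitwise, the length `n + 1 - i`, where the cell `g i` of `W` is the
first one that holds `1`, starting from the place `i` given by the number in the register `R`. -/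
def sizeXor (W : Reg) (g : ℕ → ℕ) (F : List (Term (Qubit n))) (R T : Reg) : Circuit (Qubit n) :=
  marked (firstOne (pos n) (fun i => qubit n W (g i)) (fun i => n + 1 - i) (qubit n T)
    (Nat.log 2 n + 2) (qubit n .ctrl 0) n) F R

theorem run_sizeXor {W : Reg} (hW : W = .work1 ∨ W = .work2) {g : ℕ → ℕ}
    (hg : ∀ i ≤ n, g i < n + 3) {F : List (Term (Qubit n))} {S : List Reg} (hF : Uses F S)
    (hS : S ⊆ ctlRegs) {R T : Reg} (hR : R = .lenT ∨ R = .lenR) (hT : T = .lenT ∨ T = .lenR)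
    (hRT : R ≠ T) (hTS : T ∉ S) {c : Conf} {v m : ℕ} (hc : c.ct = false)
    (hv : ∀ i, c.bit R i = v.testBit i)
    (hle : formula (c.enc n) F = true → v ≤ n ∧ m ≤ n + 1 - v ∧
      (∀ i ≤ n, v ≤ i → m < n + 1 - i → c.bit W (g i) = false) ∧
      (0 < m → c.bit W (g (n + 1 - m)) = true)) :
    run (sizeXor W g F R T) (c.enc n) =
      (c.xorLen T (if formula (c.enc n) F then m else 0)).enc n := by
  have hwW := width_work (n := n) hW
  have hwT : T.width n = Nat.log 2 n + 2 := by rcases hT with rfl | rfl <;> rfl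
  have hWo : W ≠ .output ∧ W ≠ .iter ∧ W ≠ .ctrl ∧ T ≠ W := by
    rcases hW with rfl | rfl <;> rcases hT with rfl | rfl <;> decide
  have hTo : T ≠ .output ∧ T ≠ .iter ∧ T ≠ .ctrl := by rcases hT with rfl | rfl <;> decide
  have hbody : ∀ (c : Conf), c.ct = false → run (firstOne (pos n) (fun i => qubit n W (g i))
      (fun i => n + 1 - i) (qubit n T) (Nat.log 2 n + 2) (qubit n .ctrl 0) n) (c.enc n) =
      (c.xorLen T (natXor (n + 1) fun i => if active (c.pos n) (fun j => c.bit W (g j)) i &&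
        c.bit W (g i) then n + 1 - i else 0)).enc n := by
    intro c hc
    obtain ⟨h1, h2⟩ := run_firstOne (y := pos n) (w := fun i => qubit n W (g i))
      (v := fun i => n + 1 - i) (T := qubit n T) (m := Nat.log 2 n + 2) (c := qubit n .ctrl 0)
      (k := n) (s := c.enc n) (fun i _ j _ => pos_ne hWo.1 hWo.2.1 _ _)
      (fun i _ => pos_ne (by decide) (by decide) _ _) (fun i _ => qubit_ne_of_reg hWo.2.2.1 _ _)
      (fun l _ => ⟨qubit_ne_of_reg hTo.2.2 _ _, fun i _ =>
        ⟨(pos_ne hTo.1 hTo.2.1 _ _).symm, qubit_ne_of_reg hWo.2.2.2 _ _⟩⟩)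
      (fun i hi j hj => eq_of_qubit_eq (by omega) (by omega))
      (fun i hi j hj => pos_inj hi hj) hc
    refine eq_enc_of_array (R := T) (c := c) (f := fun i => i) (k := Nat.log 2 n + 2)
      (fun i hi => by omega) (fun R' hR' => Conf.bit_xorLen_ne hR' _) (fun l hl => ?_)
      (fun j hj hne => absurd rfl (hne j (by omega))) h2
    rw [h1 l hl, Conf.bit_xorLen_self hT, enc_qubit_of_lt c (by omega), testBit_natXor]
    congr 1
    apply xsum_congr
    intro i hi
    rw [enc_qubit_of_lt c (hwW ▸ hg i (by omega)), active_congr (w' := fun j => c.bit W (g j))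
      (fun j _ => enc_pos c j) fun j hj => enc_qubit_of_lt c (hwW ▸ hg j (by omega))]
    cases active (c.pos n) (fun j => c.bit W (g j)) i && c.bit W (g i) <;> simp
  have hbit : ∀ x, ∀ R' ∈ R :: S, (c.xorLen T x).bit R' = c.bit R' := by
    intro x R' hR'
    apply Conf.bit_xorLen_ne
    rintro rfl
    rcases List.mem_cons.1 hR' with h | h
    · exact hRT h.symm
    · exact hTS h
  have hmx : ∀ (c : Conf) (x v : ℕ) (b : Bool),
      (c.xorLen T x).mark n v b = (c.mark n v b).xorLen T x := by
    intro c x v b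
    rcases hT with rfl | rfl <;> rfl
  have hxx : ∀ (c : Conf) (x y : ℕ), (c.xorLen T x).xorLen T y = c.xorLen T (x ^^^ y) := by
    intro c x y
    rcases hT with rfl | rfl <;> simp [Conf.xorLen, Nat.xor_assoc]
  set b := formula (c.enc n) F with hb
  refine run_marked hF hS hR hv (fun h => (hle h).1) (hbit _) (hbit _) (hbody c hc) ?_
  rw [← hb, hbody _ (by rcases hT with rfl | rfl <;> exact hc), hmx, hmx, hxx]
  congr 2
  apply Nat.eq_of_testBit_eq
  intro l
  rw [Nat.testBit_xor, testBit_natXor, testBit_natXor, ← xsum_xor]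
  have hWb : ∀ (x v : ℕ) (b : Bool), ((c.mark n v b).xorLen T x).bit W = c.bit W := by
    intro x v b
    rw [Conf.bit_xorLen_ne hWo.2.2.2.symm, Conf.bit_mark hWo.1 hWo.2.1]
  simp only [hWb]
  have hact : ∀ i < n + 1, ∀ x, active (((c.mark n v b).xorLen T x).pos n)
      (fun j => c.bit W (g j)) i = xor (active (c.pos n) (fun j => c.bit W (g j)) i)
        (active (fun j => b && decide (j = v)) (fun j => c.bit W (g j)) i) := by
    intro i hi x
    rw [← active_xor]
    refine active_congr (fun j hj => ?_) fun _ _ => rfl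
    rw [← Conf.pos_mark (n := n) (c := c) (v := v) (b := b) (by omega : j ≤ n)]
    rcases hT with rfl | rfl <;> rfl
  rw [xsum_congr (g := fun i => active (fun j => b && decide (j = v)) (fun j => c.bit W (g j)) i &&
    c.bit W (g i) && (n + 1 - i).testBit l) fun i hi => by
      rw [hact i hi]
      cases active (c.pos n) (fun j => c.bit W (g j)) i <;>
        cases active (fun j => b && decide (j = v)) (fun j => c.bit W (g j)) i <;>
        cases c.bit W (g i) <;> simp]
  cases hbv : b
  · rw [xsum_eq_false]
    · simp
    · intro i hi
      have : active (fun j => false && decide (j = v)) (fun j => c.bit W (g j)) i = false := by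
        simp only [Bool.false_and]
        induction i with
        | zero => rfl
        | succ i ih => rw [active, ih (by omega)]; rfl
      rw [this]; simp
  · obtain ⟨h1, h2, h3, h4⟩ := hle hbv
    simp only [Bool.true_and, if_true]
    exact xsum_active_single h2 h3 h4 l

/-! ### The circuit of one step -/

/-- The literal that the first qubit of the register `R` holds the bit `b`. -/
def lit (n : ℕ) [NeZero n] (R : Reg) (b : Bool) : Qubit n × Bool := (qubit n R 0, b)

/-- The condition that the phase bits are `a` and `b`. -/
def onPhase (n : ℕ) [NeZero n] (a b : Bool) : List (Term (Qubit n)) :=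
  [([lit n .phase1 a, lit n .phase2 b], [])]

/-- The condition that the phase bits are `a` and `b` and the sign bit is `1`. -/
def onPhaseSign (n : ℕ) [NeZero n] (a b : Bool) : List (Term (Qubit n)) :=
  [([lit n .phase1 a, lit n .phase2 b, lit n .sign true], [])]

/-- The condition that the first phase bit is `1`. -/
def onPhase1 (n : ℕ) [NeZero n] : List (Term (Qubit n)) := [([lit n .phase1 true], [])]

/-- The condition that exactly one phase bit is `1`. -/
def onPhaseXor (n : ℕ) [NeZero n] : List (Term (Qubit n)) :=
  [([lit n .phase1 true], []), ([lit n .phase2 true], [])]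

/-- The condition that the first phase bit is `0` and `lenR` is positive. -/
def onSearch (n : ℕ) [NeZero n] : List (Term (Qubit n)) :=
  [([lit n .phase1 false], []), ([lit n .phase1 false], zeroLits n .lenR (Nat.log 2 n + 2))]

/-- The condition that the phase bits are `1` and `0` and `lenQ` is positive.  As in similar
conditions below, positivity is encoded by the XOR of a term without and a term with the literals
that say that the number is `0`. -/
def onDigits (n : ℕ) [NeZero n] : List (Term (Qubit n)) :=
  [([lit n .phase1 true, lit n .phase2 false], []),
    ([lit n .phase1 true, lit n .phase2 false], zeroLits n .lenQ (Nat.log 2 n + 2))]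

/-- The condition that the bit in `R` is `1`, `lenQ` is `0` and `lenR` is positive. -/
def onEmpty (n : ℕ) [NeZero n] (R : Reg) : List (Term (Qubit n)) :=
  [(lit n R true :: zeroLits n .lenQ (Nat.log 2 n + 2), []),
    (lit n R true :: zeroLits n .lenQ (Nat.log 2 n + 2), zeroLits n .lenR (Nat.log 2 n + 2))]

/-- The condition that `lenS` is `0`. -/
def onUnshifted (n : ℕ) [NeZero n] : List (Term (Qubit n)) :=
  [([], zeroLits n .lenS (Nat.log 2 n + 3))]

/-- The condition that `lenQ` and `lenS` are `0`. -/
def onEnd (n : ℕ) [NeZero n] : List (Term (Qubit n)) :=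
  [(zeroLits n .lenQ (Nat.log 2 n + 2), zeroLits n .lenS (Nat.log 2 n + 3))]

theorem uses_onPhase (a b : Bool) : Uses (onPhase n a b) [.phase1, .phase2] := by
  intro m hm
  simp only [onPhase, List.mem_singleton] at hm
  subst hm
  simp [lit]

theorem uses_onPhaseSign (a b : Bool) : Uses (onPhaseSign n a b) [.phase1, .phase2, .sign] := by
  intro m hm
  simp only [onPhaseSign, List.mem_singleton] at hm
  subst hm
  simp [lit]

theorem uses_onPhase1 : Uses (onPhase1 n) [.phase1] := by
  intro m hm
  simp only [onPhase1, List.mem_singleton] at hm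
  subst hm
  simp [lit]

theorem uses_onPhaseXor : Uses (onPhaseXor n) [.phase1, .phase2] := by
  intro m hm
  simp only [onPhaseXor, List.mem_cons, List.not_mem_nil, or_false] at hm
  rcases hm with rfl | rfl <;> simp [lit]

theorem uses_onSearch : Uses (onSearch n) [.phase1, .lenR] := by
  intro m hm
  simp only [onSearch, List.mem_cons, List.not_mem_nil, or_false] at hm
  rcases hm with rfl | rfl
  · simp [lit]
  · exact ⟨by simp [lit], fun l hl => by simp [fst_of_mem_zeroLits hl]⟩

theorem uses_onDigits : Uses (onDigits n) [.phase1, .phase2, .lenQ] := by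
  intro m hm
  simp only [onDigits, List.mem_cons, List.not_mem_nil, or_false] at hm
  rcases hm with rfl | rfl
  · simp [lit]
  · exact ⟨by simp [lit], fun l hl => by simp [fst_of_mem_zeroLits hl]⟩

theorem uses_onEmpty (R : Reg) : Uses (onEmpty n R) [R, .lenQ, .lenR] := by
  have h : ∀ l ∈ lit n R true :: zeroLits n .lenQ (Nat.log 2 n + 2), l.1.1 ∈ [R, .lenQ, .lenR] := by
    intro l hl
    rcases List.mem_cons.1 hl with rfl | hl
    · simp [lit]
    · simp [fst_of_mem_zeroLits hl]
  intro m hm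
  simp only [onEmpty, List.mem_cons, List.not_mem_nil, or_false] at hm
  rcases hm with rfl | rfl
  · exact ⟨h, by simp⟩
  · exact ⟨h, fun l hl => by simp [fst_of_mem_zeroLits hl]⟩

theorem uses_onUnshifted : Uses (onUnshifted n) [.lenS] := by
  intro m hm
  simp only [onUnshifted, List.mem_singleton] at hm
  subst hm
  exact ⟨by simp, fun l hl => by simp [fst_of_mem_zeroLits hl]⟩

theorem uses_onEnd : Uses (onEnd n) [.lenQ, .lenS] := by
  intro m hm
  simp only [onEnd, List.mem_singleton] at hm
  subst hm
  exact ⟨fun l hl => by simp [fst_of_mem_zeroLits hl],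
    fun l hl => by simp [fst_of_mem_zeroLits hl]⟩

theorem enc_phase1 (c : Conf) : c.enc n (qubit n .phase1 0) = c.p1 := rfl
theorem enc_phase2 (c : Conf) : c.enc n (qubit n .phase2 0) = c.p2 := rfl
theorem enc_sign (c : Conf) : c.enc n (qubit n .sign 0) = c.sg := rfl

theorem formula_onPhase (c : Conf) (a b : Bool) :
    formula (c.enc n) (onPhase n a b) = ((c.p1 == a) && (c.p2 == b)) := by
  simp [formula, onPhase, Term.val, lit, enc_phase1, enc_phase2]

theorem formula_onPhaseSign (c : Conf) (a b : Bool) :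
    formula (c.enc n) (onPhaseSign n a b) = ((c.p1 == a) && ((c.p2 == b) && c.sg)) := by
  simp [formula, onPhaseSign, Term.val, lit, enc_phase1, enc_phase2, enc_sign]

theorem formula_onPhase1 (c : Conf) : formula (c.enc n) (onPhase1 n) = c.p1 := by
  simp [formula, onPhase1, Term.val, lit, enc_phase1]

theorem formula_onPhaseXor (c : Conf) : formula (c.enc n) (onPhaseXor n) = xor c.p1 c.p2 := by
  simp [formula, onPhaseXor, Term.val, lit, enc_phase1, enc_phase2]

theorem allLits_lenR {c : Conf} (h : c.lr < 2 ^ (Nat.log 2 n + 2)) :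
    allLits (c.enc n) (zeroLits n .lenR (Nat.log 2 n + 2)) = decide (c.lr = 0) :=
  allLits_zeroLits le_rfl (fun _ _ => rfl) h

theorem allLits_lenQ {c : Conf} (h : c.lq < 2 ^ (Nat.log 2 n + 2)) :
    allLits (c.enc n) (zeroLits n .lenQ (Nat.log 2 n + 2)) = decide (c.lq = 0) :=
  allLits_zeroLits le_rfl (fun _ _ => rfl) h

theorem allLits_lenS {c : Conf} (h : c.ls < 2 ^ (Nat.log 2 n + 3)) :
    allLits (c.enc n) (zeroLits n .lenS (Nat.log 2 n + 3)) = decide (c.ls = 0) :=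
  allLits_zeroLits le_rfl (fun _ _ => rfl) h

theorem formula_onSearch {c : Conf} (h : c.lr < 2 ^ (Nat.log 2 n + 2)) :
    formula (c.enc n) (onSearch n) = (!c.p1 && decide (0 < c.lr)) := by
  have : decide (0 < c.lr) = !decide (c.lr = 0) := by
    rw [← decide_not, decide_eq_decide]; exact Nat.pos_iff_ne_zero
  simp only [formula, onSearch, Term.val, lit, allLits_lenR h, allLits_cons, allLits_nil,
    enc_phase1, this]
  cases c.p1 <;> cases decide (c.lr = 0) <;> rfl

theorem formula_onDigits {c : Conf} (h : c.lq < 2 ^ (Nat.log 2 n + 2)) :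
    formula (c.enc n) (onDigits n) = (c.p1 && (!c.p2 && decide (0 < c.lq))) := by
  have : decide (0 < c.lq) = !decide (c.lq = 0) := by
    rw [← decide_not, decide_eq_decide]; exact Nat.pos_iff_ne_zero
  simp only [formula, onDigits, Term.val, lit, allLits_lenQ h, allLits_cons, allLits_nil,
    enc_phase1, enc_phase2, this]
  cases c.p1 <;> cases c.p2 <;> cases decide (c.lq = 0) <;> rfl

theorem formula_onEmpty {c : Conf} {R : Reg} (hq : c.lq < 2 ^ (Nat.log 2 n + 2))
    (hr : c.lr < 2 ^ (Nat.log 2 n + 2)) : formula (c.enc n) (onEmpty n R) =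
      (decide (c.lq = 0 ∧ 0 < c.lr) && c.enc n (qubit n R 0)) := by
  have : decide (c.lq = 0 ∧ 0 < c.lr) = (decide (c.lq = 0) && !decide (c.lr = 0)) := by
    rw [← decide_not, ← Bool.decide_and, decide_eq_decide, Nat.pos_iff_ne_zero]
  simp only [formula, onEmpty, Term.val, lit, allLits_lenQ hq, allLits_lenR hr, allLits_cons,
    allLits_nil, this]
  cases c.enc n (qubit n R 0) <;> cases decide (c.lq = 0) <;> cases decide (c.lr = 0) <;> rfl

theorem formula_onUnshifted {c : Conf} (h : c.ls < 2 ^ (Nat.log 2 n + 3)) :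
    formula (c.enc n) (onUnshifted n) = decide (c.ls = 0) := by
  simp [formula, onUnshifted, Term.val, allLits_lenS h]

theorem formula_onEnd {c : Conf} (hq : c.lq < 2 ^ (Nat.log 2 n + 2))
    (hs : c.ls < 2 ^ (Nat.log 2 n + 3)) :
    formula (c.enc n) (onEnd n) = decide (c.lq = 0 ∧ c.ls = 0) := by
  simp [formula, onEnd, Term.val, allLits_lenS hs, allLits_lenQ hq]

/-- In the phases with first bit `a`, changes `lenS` and rotates the second work register
accordingly: one place to the left if the second phase bit is `0`, one place to the right
otherwise. -/
noncomputable def shift (n : ℕ) [NeZero n] (a : Bool) : Circuit (Qubit n) :=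
  incReg [lit n .phase1 a, lit n .phase2 false] .lenS ++
    (incReg [lit n .phase1 a, lit n .phase2 true] .lenS).inverse ++
    rotateOne (onPhase n a false) ++ (rotateOne (onPhase n a true)).inverse

/-- Moves the fields beyond `q` to the right end of both registers, adds `lenQ + lenS - 1` to `lenT`
so that it points to the last digit of `q`, applies `C`, and undoes the preparation. -/
noncomputable def aligned (C : Circuit (Qubit n)) : Circuit (Qubit n) :=
  (rotate n).inverse ++ addReg n .lenQ .lenT ++ addReg n .lenS .lenT ++
    (incReg [] .lenT).inverse ++ C ++ incReg [] .lenT ++ (addReg n .lenS .lenT).inverse ++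
    (addReg n .lenQ .lenT).inverse ++ rotate n

/-- The part of a step that acts on `r` and on the last digit of `q`, for aligned registers.  The
cell of a new digit may still hold the first digit of `r`, so it takes part in the comparison and in
the subtraction, which clears it. -/
def quotientStage (n : ℕ) [NeZero n] : Circuit (Qubit n) :=
  compare .work2 .work1 (fun i => n + 2 - i) (fun i => if i = 0 then 0 else n + 1 - i) (n + 1)
    (onSearch n) .lenT ++
    flip (onPhase n false true) (qubit n .sign 0) ++
    condSubR (onPhaseSign n false true) ++ writeCell (onPhaseSign n false true) .lenT ++
    readCell (onPhaseXor n) .lenT ++ writeCell (onPhaseSign n true false) .lenT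

/-- The part of a step that acts on `t'`.  The first digit of `q` is removed during the addition,
because the addition extends over its cell. -/
def productStage (n : ℕ) [NeZero n] : Circuit (Qubit n) :=
  (incReg [lit n .phase1 true, lit n .phase2 false] .lenQ).inverse ++
    writeCell (onDigits n) .lenT ++ (condSubT (onPhaseSign n true false)).inverse ++
    compare .work1 .work2 (fun i => i) (fun i => i) (n + 1) (onPhase n true false) .lenT ++
    writeCell (onDigits n) .lenT ++
    (addReg n .lenS .lenR ++ (incReg [] .lenR).inverse ++
      compare .work1 .work2 (fun i => i) (fun i => n - i) n (onPhase n true true) .lenR ++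
      incReg [] .lenR ++ (addReg n .lenS .lenR).inverse) ++
    flip (onPhase1 n) (qubit n .sign 0)

/-- The phase updates. -/
def phaseStage (n : ℕ) [NeZero n] : Circuit (Qubit n) :=
  flip (onEmpty n .sign) (qubit n .phase2 0) ++ flip (onEmpty n .phase1) (qubit n .phase2 0) ++
    flip (onEmpty n .phase2) (qubit n .sign 0) ++
    flip (onUnshifted n) (qubit n .phase1 0) ++ flip (onUnshifted n) (qubit n .phase2 0)

/-- The end of an iteration: the lengths of `t` and `r'` are erased, those of `t'` and `r` are
written, and the work registers are exchanged. -/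
noncomputable def endStage (n : ℕ) [NeZero n] : Circuit (Qubit n) :=
  sizeXor .work1 (fun i => n - i) (onEnd n) .lenR .lenT ++
    sizeXor .work2 (fun i => n - i) (onEnd n) .lenR .lenT ++
    sizeXor .work2 (fun i => i + 2) (onEnd n) .lenT .lenR ++
    sizeXor .work1 (fun i => i + 2) (onEnd n) .lenT .lenR ++
    swapWork (onEnd n) ++ flip (onEnd n) (qubit n .iter 0)

/-- The circuit of one step. -/
noncomputable def stepCircuit (n : ℕ) [NeZero n] : Circuit (Qubit n) :=
  shift n false ++ incReg [lit n .phase1 false, lit n .phase2 true] .lenQ ++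
    aligned (quotientStage n) ++ productStage n ++ shift n true ++ phaseStage n ++ endStage n

/-! ### Shifts and alignment -/

theorem run_incReg_lenS (c : Conf) (L : List (Qubit n × Bool))
    (hL : ∀ l ∈ L, l.1.1 ≠ .lenS ∧ l.1.1 ≠ .work1) :
    run (incReg L .lenS) (c.enc n) =
      { c with ls := if allLits (c.enc n) L then c.ls + 1 else c.ls }.enc n :=
  run_incReg hL (by decide) (fun _ => rfl) (fun i => rfl)
    fun R' h => by cases R' <;> first | rfl | exact absurd rfl h

theorem run_incReg_lenQ (c : Conf) (L : List (Qubit n × Bool))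
    (hL : ∀ l ∈ L, l.1.1 ≠ .lenQ ∧ l.1.1 ≠ .work1) :
    run (incReg L .lenQ) (c.enc n) =
      { c with lq := if allLits (c.enc n) L then c.lq + 1 else c.lq }.enc n :=
  run_incReg hL (by decide) (fun _ => rfl) (fun i => rfl)
    fun R' h => by cases R' <;> first | rfl | exact absurd rfl h

theorem run_incReg_lenT (c : Conf) :
    run (incReg [] .lenT) (c.enc n) = { c with lt := c.lt + 1 }.enc n :=
  run_incReg (by simp) (by decide) (fun _ => rfl) (fun i => rfl)
    fun R' h => by cases R' <;> first | rfl | exact absurd rfl h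

theorem run_incReg_lenR (c : Conf) :
    run (incReg [] .lenR) (c.enc n) = { c with lr := c.lr + 1 }.enc n :=
  run_incReg (by simp) (by decide) (fun _ => rfl) (fun i => rfl)
    fun R' h => by cases R' <;> first | rfl | exact absurd rfl h

theorem allLits_phases (c : Conf) (a b : Bool) :
    allLits (c.enc n) [lit n .phase1 a, lit n .phase2 b] = ((c.p1 == a) && (c.p2 == b)) := by
  simp [lit, enc_phase1, enc_phase2]

theorem mem_phases {a b : Bool} {l : Qubit n × Bool}
    (hl : l ∈ [lit n .phase1 a, lit n .phase2 b]) : l.1.1 = .phase1 ∨ l.1.1 = .phase2 := by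
  simp only [List.mem_cons, List.not_mem_nil, or_false] at hl
  rcases hl with rfl | rfl
  · exact Or.inl rfl
  · exact Or.inr rfl

theorem phases_ne {a b : Bool} {R : Reg} (h1 : Reg.phase1 ≠ R) (h2 : Reg.phase2 ≠ R) :
    ∀ l ∈ [lit n .phase1 a, lit n .phase2 b], l.1.1 ≠ R ∧ l.1.1 ≠ .work1 := by
  intro l hl
  rcases mem_phases hl with h | h <;> rw [h]
  · exact ⟨h1, by decide⟩
  · exact ⟨h2, by decide⟩

/-- The contents with the second work register rotated to the left by the number in `lenS`. -/
def Conf.rot (n : ℕ) (c : Conf) : Conf := { c with w2 := fun i => c.w2 ((i + c.ls) % (n + 3)) }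

theorem run_trans {C D : Circuit (Qubit n)} {s t u : Qubit n → Bool} (h₁ : run C s = t)
    (h₂ : run D t = u) : run (C ++ D) s = u := by rw [run_append, h₁, h₂]

theorem run_incReg_lenS_on {c : Conf} {a b : Bool} (h1 : c.p1 = a) (h2 : c.p2 = b) :
    run (incReg [lit n .phase1 a, lit n .phase2 b] .lenS) (c.enc n) =
      { c with ls := c.ls + 1 }.enc n := by
  rw [run_incReg_lenS c _ (phases_ne (by decide) (by decide)), allLits_phases]
  simp [h1, h2]

theorem run_incReg_lenS_off {c : Conf} {a b : Bool} (h : c.p1 ≠ a ∨ c.p2 ≠ b) :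
    run (incReg [lit n .phase1 a, lit n .phase2 b] .lenS) (c.enc n) = c.enc n := by
  rw [run_incReg_lenS c _ (phases_ne (by decide) (by decide)), allLits_phases]
  rcases h with h | h <;> simp [h]

theorem run_incReg_lenQ_on {c : Conf} {a b : Bool} (h1 : c.p1 = a) (h2 : c.p2 = b) :
    run (incReg [lit n .phase1 a, lit n .phase2 b] .lenQ) (c.enc n) =
      { c with lq := c.lq + 1 }.enc n := by
  rw [run_incReg_lenQ c _ (phases_ne (by decide) (by decide)), allLits_phases]
  simp [h1, h2]

theorem run_incReg_lenQ_off {c : Conf} {a b : Bool} (h : c.p1 ≠ a ∨ c.p2 ≠ b) :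
    run (incReg [lit n .phase1 a, lit n .phase2 b] .lenQ) (c.enc n) = c.enc n := by
  rw [run_incReg_lenQ c _ (phases_ne (by decide) (by decide)), allLits_phases]
  rcases h with h | h <;> simp [h]

theorem run_rotateOne_on {c : Conf} {a b : Bool} (hc : c.ct = false) (h1 : c.p1 = a)
    (h2 : c.p2 = b) : run (rotateOne (onPhase n a b)) (c.enc n) =
      { c with w2 := fun i => c.w2 ((i + 1) % (n + 3)) }.enc n := by
  rw [run_rotateOne (uses_onPhase a b) (by decide) (by decide) (by decide) hc, formula_onPhase]
  simp [h1, h2]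

theorem run_rotateOne_off {c : Conf} {a b : Bool} (hc : c.ct = false) (h : c.p1 ≠ a ∨ c.p2 ≠ b) :
    run (rotateOne (onPhase n a b)) (c.enc n) = c.enc n := by
  rw [run_rotateOne (uses_onPhase a b) (by decide) (by decide) (by decide) hc, formula_onPhase]
  rcases h with h | h <;> simp [h]

theorem run_shift_idle {c : Conf} {a : Bool} (hc : c.ct = false) (h : c.p1 ≠ a) :
    run (shift n a) (c.enc n) = c.enc n :=
  run_trans (run_trans (run_trans (run_incReg_lenS_off (Or.inl h))
    (run_inverse_of_run (run_incReg_lenS_off (Or.inl h)))) (run_rotateOne_off hc (Or.inl h)))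
    (run_inverse_of_run (run_rotateOne_off hc (Or.inl h)))

theorem run_shift_up {c : Conf} {a : Bool} (hc : c.ct = false) (h1 : c.p1 = a)
    (h2 : c.p2 = false) : run (shift n a) ((c.rot n).enc n) =
      (Conf.rot n { c with ls := c.ls + 1 }).enc n := by
  have h2' : c.p2 ≠ true := by simp [h2]
  set c₁ : Conf := { c.rot n with ls := c.ls + 1 } with hc₁
  set c₂ : Conf := Conf.rot n { c with ls := c.ls + 1 } with hc₂
  have e₁ : run (incReg [lit n .phase1 a, lit n .phase2 false] .lenS) ((c.rot n).enc n) =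
      c₁.enc n := run_incReg_lenS_on (c := c.rot n) h1 h2
  have e₂ : run (incReg [lit n .phase1 a, lit n .phase2 true] .lenS) (c₁.enc n) = c₁.enc n :=
    run_incReg_lenS_off (c := c₁) (Or.inr h2')
  have e₃ : run (rotateOne (onPhase n a false)) (c₁.enc n) = c₂.enc n := by
    rw [run_rotateOne_on (c := c₁) hc h1 h2]
    apply enc_congr
    intro R i _
    cases R <;> first | rfl | skip
    simp only [Conf.bit, Conf.rot, Nat.mod_add_mod, hc₁, hc₂]
    congr 2
    ring
  have e₄ : run (rotateOne (onPhase n a true)) (c₂.enc n) = c₂.enc n :=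
    run_rotateOne_off (c := c₂) hc (Or.inr h2')
  exact run_trans (run_trans (run_trans e₁ (run_inverse_of_run e₂)) e₃) (run_inverse_of_run e₄)

theorem run_shift_down {c : Conf} {a : Bool} (hc : c.ct = false) (h1 : c.p1 = a)
    (h2 : c.p2 = true) : run (shift n a) ((Conf.rot n { c with ls := c.ls + 1 }).enc n) =
      (c.rot n).enc n := by
  have h2' : c.p2 ≠ false := by simp [h2]
  set c₁ : Conf := { Conf.rot n { c with ls := c.ls + 1 } with ls := c.ls } with hc₁
  set c₂ : Conf := Conf.rot n { c with ls := c.ls + 1 } with hc₂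
  have e₁ : run (incReg [lit n .phase1 a, lit n .phase2 false] .lenS) (c₂.enc n) = c₂.enc n :=
    run_incReg_lenS_off (c := c₂) (Or.inr h2')
  have e₂ : run (incReg [lit n .phase1 a, lit n .phase2 true] .lenS) (c₁.enc n) = c₂.enc n :=
    run_incReg_lenS_on (c := c₁) h1 h2
  have e₃ : run (rotateOne (onPhase n a false)) (c₁.enc n) = c₁.enc n :=
    run_rotateOne_off (c := c₁) hc (Or.inr h2')
  have e₄ : run (rotateOne (onPhase n a true)) ((c.rot n).enc n) = c₁.enc n := by
    rw [run_rotateOne_on (c := c.rot n) hc h1 h2]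
    apply enc_congr
    intro R i _
    cases R <;> first | rfl | skip
    simp only [Conf.bit, Conf.rot, Nat.mod_add_mod, hc₁, hc₂]
    congr 2
    ring
  exact run_trans (run_trans (run_trans e₁ (run_inverse_of_run e₂)) e₃) (run_inverse_of_run e₄)

/-- The contents with both work registers rotated to the left by the number in `lenS`, and with `x`
in `lenT`. -/
def Conf.unaligned (n : ℕ) (c : Conf) (x : ℕ) : Conf :=
  { c with
    w1 := fun i => c.w1 ((i + c.ls) % (n + 3))
    w2 := fun i => c.w2 ((i + c.ls) % (n + 3))
    lt := x }

theorem run_addReg_lenT_lenQ {c : Conf} (hc : c.ct = false) : run (addReg n .lenQ .lenT) (c.enc n) =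
    { c with lt := c.lq + c.lt }.enc n :=
  run_addReg (by decide) (by decide) (by decide) le_rfl hc (fun _ => rfl) (fun _ => rfl)
    (fun _ => rfl) fun R' h => by cases R' <;> first | rfl | exact absurd rfl h

theorem run_addReg_lenT_lenS {c : Conf} (hc : c.ct = false) : run (addReg n .lenS .lenT) (c.enc n) =
    { c with lt := c.ls + c.lt }.enc n :=
  run_addReg (by decide) (by decide) (by decide) (by simp [Reg.width]) hc (fun _ => rfl)
    (fun _ => rfl) (fun _ => rfl) fun R' h => by cases R' <;> first | rfl | exact absurd rfl h

theorem run_addReg_lenR_lenS {c : Conf} (hc : c.ct = false) : run (addReg n .lenS .lenR) (c.enc n) =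
    { c with lr := c.ls + c.lr }.enc n :=
  run_addReg (by decide) (by decide) (by decide) (by simp [Reg.width]) hc (fun _ => rfl)
    (fun _ => rfl) (fun _ => rfl) fun R' h => by cases R' <;> first | rfl | exact absurd rfl h

theorem run_aligned {C : Circuit (Qubit n)} {c d : Conf} {x : ℕ} (hrun : run C (c.enc n) = d.enc n)
    (hc : c.ct = false) (hd : d.ct = false) (hx : x + c.lq + c.ls = c.lt + 1) (hlt : d.lt = c.lt)
    (hlq : d.lq = c.lq) (hls : d.ls = c.ls) (hs : c.ls < 2 ^ (Nat.log 2 n + 3)) :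
    run (aligned C) ((c.unaligned n x).enc n) = (d.unaligned n x).enc n := by
  have hrot : ∀ c : Conf, c.ls < 2 ^ (Nat.log 2 n + 3) →
      run (rotate n) ({ c with lt := x }.enc n) = (c.unaligned n x).enc n := fun c h =>
    run_rotate (c := { c with lt := x }) h
  have hq : ∀ c : Conf, c.ct = false → run (addReg n .lenQ .lenT) ({ c with lt := x }.enc n) =
      { c with lt := c.lq + x }.enc n := fun c h => run_addReg_lenT_lenQ (c := { c with lt := x }) h
  have hs' : ∀ c : Conf, c.ct = false → run (addReg n .lenS .lenT) ({ c with lt := c.lq + x }.enc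
      n) =
      { c with lt := c.ls + (c.lq + x) }.enc n := fun c h =>
    run_addReg_lenT_lenS (c := { c with lt := c.lq + x }) h
  have hi : ∀ c : Conf, x + c.lq + c.ls = c.lt + 1 → run (incReg [] .lenT) (c.enc n) =
      { c with lt := c.ls + (c.lq + x) }.enc n := fun c h => by
    rw [run_incReg_lenT, ← h, show x + c.lq + c.ls = c.ls + (c.lq + x) by ring]
  exact run_trans (run_trans (run_trans (run_trans (run_trans (run_trans (run_trans (run_trans
    (run_inverse_of_run (hrot c hs)) (hq c hc)) (hs' c hc)) (run_inverse_of_run (hi c hx))) hrun)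
    (hi d (by rw [hlt, hlq, hls, hx]))) (run_inverse_of_run (hs' d hd)))
    (run_inverse_of_run (hq d hd))) (hrot d (hls ▸ hs))

/-! ### The stages of a step -/

theorem run_compare_off {A B : Reg} (hA : A = .work1 ∨ A = .work2) (hB : B = .work1 ∨ B = .work2)
    (hAB : A ≠ B) {g f : ℕ → ℕ} {k : ℕ} {F : List (Term (Qubit n))} {S : List Reg} (hF : Uses F S)
    (hS : S ⊆ ctlRegs) (hsg : Reg.sign ∉ S) {R : Reg} (hR : R = .lenT ∨ R = .lenR) {c : Conf}
    (hf : ∀ i < k, f i ≤ n) (hg : ∀ i < k, g i < n + 3)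
    (hgg : ∀ i < k, ∀ j < k, g i = g j → i = j) (hct : c.ct = false)
    (h : formula (c.enc n) F = false) : run (compare A B g f k F R) (c.enc n) = c.enc n := by
  have h' : ∀ {p : Prop}, formula (c.enc n) F = true → p := fun h'' => absurd (h.symm.trans h'')
    (by decide)
  obtain ⟨v, hv⟩ : ∃ v : ℕ, ∀ i, c.bit R i = v.testBit i := by
    rcases hR with rfl | rfl
    · exact ⟨c.lt, fun _ => rfl⟩
    · exact ⟨c.lr, fun _ => rfl⟩
  rw [run_compare hA hB hAB hF hS hsg hR hv hf h' hg hgg hct (a := 0) (b := 0) (i₀ := 0) h' h', h]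
  simp

theorem run_writeCell_off {F : List (Term (Qubit n))} {S : List Reg} (hF : Uses F S)
    (hS : S ⊆ ctlRegs) {c : Conf} (h : formula (c.enc n) F = false) :
    run (writeCell F .lenT) (c.enc n) = c.enc n := by
  rw [run_writeCell hF hS (Or.inl rfl) (v := c.lt) (fun _ => rfl)
    (fun h' => absurd (h.symm.trans h') (by decide)), h]
  simp

theorem run_condSubR_off {F : List (Term (Qubit n))} {S : List Reg} (hF : Uses F S)
    (hS : S ⊆ ctlRegs) {c : Conf} (hc : c.ct = false) (h : formula (c.enc n) F = false) :
    run (condSubR F) (c.enc n) = c.enc n := by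
  have h' : ∀ {p : Prop}, formula (c.enc n) F = true → p := fun h'' => absurd (h.symm.trans h'')
    (by decide)
  rw [run_condSubR hF hS hc (x := 0) (y := 0) h' h' h', h]
  simp

theorem run_condSubT_inverse_off {F : List (Term (Qubit n))} {S : List Reg} (hF : Uses F S)
    (hS : S ⊆ ctlRegs) {c : Conf} (hc : c.ct = false) (h : formula (c.enc n) F = false) :
    run (condSubT F).inverse (c.enc n) = c.enc n := by
  have h' : ∀ {p : Prop}, formula (c.enc n) F = true → p := fun h'' => absurd (h.symm.trans h'')
    (by decide)
  rw [run_condSubT_inverse hF hS hc (x := 0) (y := 0) h' h' h', h]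
  simp

theorem run_flip_sign {F : List (Term (Qubit n))} {S : List Reg} (hF : Uses F S)
    (hS : Reg.work1 ∉ S) (hsg : Reg.sign ∉ S) (c : Conf) :
    run (flip F (qubit n .sign 0)) (c.enc n) =
      { c with sg := xor c.sg (formula (c.enc n) F) }.enc n := by
  rw [run_flip hF hS hsg (qubit_ne_of_reg (by decide) _ _) (qubit_ne_of_reg (by decide) _ _),
    toggle_sign]

theorem run_flip_phase1 {F : List (Term (Qubit n))} {S : List Reg} (hF : Uses F S)
    (hS : Reg.work1 ∉ S) (hsg : Reg.phase1 ∉ S) (c : Conf) :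
    run (flip F (qubit n .phase1 0)) (c.enc n) =
      { c with p1 := xor c.p1 (formula (c.enc n) F) }.enc n := by
  rw [run_flip hF hS hsg (qubit_ne_of_reg (by decide) _ _) (qubit_ne_of_reg (by decide) _ _),
    toggle_phase1]

theorem run_flip_phase2 {F : List (Term (Qubit n))} {S : List Reg} (hF : Uses F S)
    (hS : Reg.work1 ∉ S) (hsg : Reg.phase2 ∉ S) (c : Conf) :
    run (flip F (qubit n .phase2 0)) (c.enc n) =
      { c with p2 := xor c.p2 (formula (c.enc n) F) }.enc n := by
  rw [run_flip hF hS hsg (qubit_ne_of_reg (by decide) _ _) (qubit_ne_of_reg (by decide) _ _),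
    toggle_phase2]

theorem run_flip_iter {F : List (Term (Qubit n))} {S : List Reg} (hF : Uses F S)
    (hS : Reg.work1 ∉ S) (hsg : Reg.iter ∉ S) (c : Conf) :
    run (flip F (qubit n .iter 0)) (c.enc n) =
      { c with it := xor c.it (formula (c.enc n) F) }.enc n := by
  rw [run_flip hF hS hsg (qubit_ne_of_reg (by decide) _ _) (qubit_ne_of_reg (by decide) _ _),
    toggle_iter]

theorem run_compareR {c : Conf} {a b : ℕ} (hc : c.ct = false)
    (hr : c.lr < 2 ^ (Nat.log 2 n + 2))
    (h : c.p1 = false → 0 < c.lr → 1 ≤ c.lt ∧ c.lt ≤ n ∧ a < 2 ^ (n + 2 - c.lt) ∧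
      b < 2 ^ (n + 2 - c.lt) ∧ (∀ j < n + 2 - c.lt, c.w2 (n + 2 - j) = a.testBit j) ∧
      ∀ j < n + 2 - c.lt, c.w1 (n + 2 - j) = b.testBit j) :
    run (compare .work2 .work1 (fun i => n + 2 - i) (fun i => if i = 0 then 0 else n + 1 - i)
      (n + 1) (onSearch n) .lenT) (c.enc n) = { c with sg := xor c.sg (!c.p1 && decide (0 < c.lr)
        && decide (b < a)) }.enc n := by
  have hform := formula_onSearch (n := n) hr
  have h' : formula (c.enc n) (onSearch n) = true → c.p1 = false ∧ 0 < c.lr := by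
    rw [hform]; simp
  rw [run_compare (Or.inr rfl) (Or.inl rfl) (by decide) uses_onSearch (by decide) (by decide)
    (Or.inl rfl) (v := c.lt) (i₀ := n + 1 - c.lt) (a := a) (b := b) (fun _ => rfl)
    (fun i _ => by split_ifs <;> omega) (fun hf => ?_) (fun i hi => by omega)
    (fun i hi j hj h => by omega) hc (fun hf => ?_) (fun hf => ?_), hform]
  · obtain ⟨h1, h2, -⟩ := h (h' hf).1 (h' hf).2
    exact ⟨h2, by omega, fun i hi => by split_ifs <;> omega⟩
  · obtain ⟨h1, h2, h3, h4, h5, h6⟩ := h (h' hf).1 (h' hf).2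
    rw [show n + 1 - c.lt + 1 = n + 2 - c.lt by omega]
    exact ⟨h3, fun j hj => h5 j (by omega)⟩
  · obtain ⟨h1, h2, h3, h4, h5, h6⟩ := h (h' hf).1 (h' hf).2
    rw [show n + 1 - c.lt + 1 = n + 2 - c.lt by omega]
    exact ⟨h4, fun j hj => h6 j (by omega)⟩

/-- In phase `(0, 0)` only the comparison takes effect.  In the application `a` is `r'` and `b` is
`r / 2 ^ ls`, whose comparison decides whether `r < 2 ^ ls * r'`. -/
theorem run_quotientStage_search {c : Conf} {a b : ℕ} (hc : c.ct = false) (h1 : c.p1 = false)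
    (h2 : c.p2 = false) (hr : c.lr < 2 ^ (Nat.log 2 n + 2))
    (h : 0 < c.lr → 1 ≤ c.lt ∧ c.lt ≤ n ∧ a < 2 ^ (n + 2 - c.lt) ∧
      b < 2 ^ (n + 2 - c.lt) ∧ (∀ j < n + 2 - c.lt, c.w2 (n + 2 - j) = a.testBit j) ∧
      ∀ j < n + 2 - c.lt, c.w1 (n + 2 - j) = b.testBit j) :
    run (quotientStage n) (c.enc n) =
      { c with sg := xor c.sg (decide (0 < c.lr) && decide (b < a)) }.enc n := by
  set d : Conf := { c with sg := xor c.sg (decide (0 < c.lr) && decide (b < a)) } with hd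
  have e₁ : run (compare .work2 .work1 (fun i => n + 2 - i)
      (fun i => if i = 0 then 0 else n + 1 - i) (n + 1) (onSearch n) .lenT) (c.enc n) = d.enc n := by
    rw [run_compareR hc hr fun _ => h]
    simp [hd, h1]
  have e₂ : run (flip (onPhase n false true) (qubit n .sign 0)) (d.enc n) = d.enc n := by
    rw [run_flip_sign (uses_onPhase _ _) (by decide) (by decide), formula_onPhase]
    simp [hd, h2]
  have e₃ := run_writeCell_off (n := n) (c := d) (uses_onPhaseSign false true) (by decide)
    (by rw [formula_onPhaseSign]; simp [hd, h2])
  have e₄ := run_condSubR_off (n := n) (c := d) (uses_onPhaseSign false true) (by decide) hc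
    (by rw [formula_onPhaseSign]; simp [hd, h2])
  have hx : formula (d.enc n) (onPhaseXor n) = false := by
    rw [formula_onPhaseXor]; simp [hd, h1, h2]
  have e₅ : run (readCell (onPhaseXor n) .lenT) (d.enc n) = d.enc n := by
    rw [run_readCell uses_onPhaseXor (by decide) (by decide) (Or.inl rfl) (v := d.lt)
      (fun _ => rfl) (fun hf => absurd (hx.symm.trans hf) (by decide)), hx]
    simp
  have e₆ := run_writeCell_off (n := n) (c := d) (uses_onPhaseSign true false) (by decide)
    (by rw [formula_onPhaseSign]; simp [hd, h1])
  exact run_trans (run_trans (run_trans (run_trans (run_trans e₁ e₂) e₄) e₃) e₅) e₆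

/-- Phase `(1, 1)`. -/
theorem run_quotientStage_idle {c : Conf} (hc : c.ct = false) (h1 : c.p1 = true)
    (h2 : c.p2 = true) (hr : c.lr < 2 ^ (Nat.log 2 n + 2)) :
    run (quotientStage n) (c.enc n) = c.enc n := by
  have e₁ : run (compare .work2 .work1 (fun i => n + 2 - i)
      (fun i => if i = 0 then 0 else n + 1 - i) (n + 1) (onSearch n) .lenT) (c.enc n) = c.enc n := by
    rw [run_compareR hc hr (a := 0) (b := 0) (fun h => by rw [h1] at h; cases h)]
    apply enc_congr
    intro R i _
    cases R <;> simp [Conf.bit, h1]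
  have e₂ : run (flip (onPhase n false true) (qubit n .sign 0)) (c.enc n) = c.enc n := by
    rw [run_flip_sign (uses_onPhase _ _) (by decide) (by decide), formula_onPhase]
    apply enc_congr
    intro R i _
    cases R <;> simp [Conf.bit, h1]
  have e₃ := run_writeCell_off (n := n) (c := c) (uses_onPhaseSign false true) (by decide)
    (by rw [formula_onPhaseSign]; simp [h1])
  have e₄ := run_condSubR_off (n := n) (c := c) (uses_onPhaseSign false true) (by decide) hc
    (by rw [formula_onPhaseSign]; simp [h1])
  have hx : formula (c.enc n) (onPhaseXor n) = false := by
    rw [formula_onPhaseXor]; simp [h1, h2]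
  have e₅ : run (readCell (onPhaseXor n) .lenT) (c.enc n) = c.enc n := by
    rw [run_readCell uses_onPhaseXor (by decide) (by decide) (Or.inl rfl) (v := c.lt)
      (fun _ => rfl) (fun hf => absurd (hx.symm.trans hf) (by decide)), hx]
    simp
  have e₆ := run_writeCell_off (n := n) (c := c) (uses_onPhaseSign true false) (by decide)
    (by rw [formula_onPhaseSign]; simp [h2])
  exact run_trans (run_trans (run_trans (run_trans (run_trans e₁ e₂) e₄) e₃) e₅) e₆

/-- In phase `(0, 1)` the stage performs one step of long division of `b` by `a`.  The cell
`c.lt + 1`, which is empty after the conditional subtraction, receives the new digit of the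
quotient, and the sign bit is then cleared by means of this digit. -/
theorem run_quotientStage_divide {c : Conf} {a b : ℕ} (hc : c.ct = false) (h1 : c.p1 = false)
    (h2 : c.p2 = true) (hsg : c.sg = false) (hr : c.lr < 2 ^ (Nat.log 2 n + 2)) (hr0 : 0 < c.lr)
    (ht1 : 1 ≤ c.lt) (htn : c.lt ≤ n) (ha : a < 2 ^ (n + 1 - c.lt)) (hb : b < 2 ^ (n + 2 - c.lt))
    (hba : b < 2 * a)
    (hwa : ∀ j < n + 3 - c.lt, c.w2 (n + 2 - j) = a.testBit j)
    (hwb : ∀ j < n + 2 - c.lt, c.w1 (n + 2 - j) = b.testBit j) :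
    run (quotientStage n) (c.enc n) =
      { c with
        w1 := fun j => if j = c.lt + 1 then decide (a ≤ b)
          else if a ≤ b ∧ c.lt + 2 ≤ j ∧ j ≤ n + 2 then (b - a).testBit (n + 2 - j)
          else c.w1 j }.enc n := by
  have hpow : 2 ^ (n + 2 - c.lt) = 2 ^ (n + 1 - c.lt) * 2 := by
    rw [← pow_succ, show n + 1 - c.lt + 1 = n + 2 - c.lt by omega]
  set s := decide (a ≤ b) with hs
  have hs' : (!decide (b < a)) = s := by
    rw [hs, ← decide_not, decide_eq_decide]; exact not_lt
  set c₁ : Conf := { c with sg := decide (b < a) } with hc₁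
  set c₂ : Conf := { c with sg := s } with hc₂
  set c₃ : Conf := { c with
    sg := s
    w1 := fun j => if s = true ∧ c.lt + 1 ≤ j ∧ j ≤ n + 2 then (b - a).testBit (n + 2 - j)
      else c.w1 j } with hc₃
  set c₅ : Conf := { c with
        w1 := fun j => if j = c.lt + 1 then s
          else if a ≤ b ∧ c.lt + 2 ≤ j ∧ j ≤ n + 2 then (b - a).testBit (n + 2 - j)
          else c.w1 j } with hc₅
  set c₄ : Conf := { c₅ with sg := s } with hc₄
  have e₁ : run (compare .work2 .work1 (fun i => n + 2 - i)
      (fun i => if i = 0 then 0 else n + 1 - i) (n + 1) (onSearch n) .lenT) (c.enc n) =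
      c₁.enc n := by
    rw [run_compareR hc hr fun _ _ => ⟨ht1, htn, by omega, hb, fun j hj => hwa j (by omega), hwb⟩]
    apply enc_congr
    intro R i _
    cases R <;> simp [Conf.bit, hr0, hc₁, h1, hsg]
  have e₂ : run (flip (onPhase n false true) (qubit n .sign 0)) (c₁.enc n) = c₂.enc n := by
    rw [run_flip_sign (uses_onPhase _ _) (by decide) (by decide), formula_onPhase]
    apply enc_congr
    intro R i _
    cases R <;> simp [Conf.bit, hc₁, h1, h2, hc₂, ← hs']
  have hf₂ : formula (c₂.enc n) (onPhaseSign n false true) = s := by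
    rw [formula_onPhaseSign]; simp [hc₂, h1, h2]
  have e₃ : run (condSubR (onPhaseSign n false true)) (c₂.enc n) = c₃.enc n := by
    rw [run_condSubR (c := c₂) (uses_onPhaseSign _ _) (by decide) (x := a) (y := b) hc
      (fun hf => ?_) (fun hf => hwb) (fun hf => hwa), hf₂]
    rw [hf₂, hs, decide_eq_true_iff] at hf
    exact ⟨ht1, htn, hb, hf⟩
  -- The subtraction has cleared the digit cell: if `b` reached into it, then `a ≤ b`.
  have hz : c₃.w1 (c.lt + 1) = false := by
    simp only [hc₃]
    by_cases hab : a ≤ b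
    · rw [if_pos ⟨by simp [hs, hab], by omega, by omega⟩]
      exact Nat.testBit_lt_two_pow (by
        rw [show n + 2 - (c.lt + 1) = n + 1 - c.lt by omega]; omega)
    · rw [if_neg (by simp [hs, hab]), show c.lt + 1 = n + 2 - (n + 1 - c.lt) by omega,
        hwb _ (by omega)]
      exact Nat.testBit_lt_two_pow (by omega)
  have e₄ : run (writeCell (onPhaseSign n false true) .lenT) (c₃.enc n) = c₄.enc n := by
    rw [run_writeCell (c := c₃) (uses_onPhaseSign _ _) (by decide) (Or.inl rfl) (v := c.lt)
      (fun _ => rfl) (fun _ => htn), formula_onPhaseSign]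
    apply enc_congr
    intro R i _
    cases R <;> first | rfl | skip
    show (if i = c.lt + 1 then _ else _) = c₄.w1 i
    by_cases hi : i = c.lt + 1
    · rw [if_pos hi, hi, hz]
      simp [hc₃, hc₄, hc₅, h1, h2]
    · rw [if_neg hi]
      simp only [hc₃, hc₄, hc₅]
      rw [if_neg hi]
      by_cases hcond : a ≤ b ∧ c.lt + 2 ≤ i ∧ i ≤ n + 2
      · rw [if_pos hcond, if_pos ⟨by simp [hs, hcond.1], by omega, by omega⟩]
      · rw [if_neg hcond, if_neg]
        rintro ⟨h, h', h''⟩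
        rw [hs, decide_eq_true_iff] at h
        exact hcond ⟨h, by omega, h''⟩
  have e₅ : run (readCell (onPhaseXor n) .lenT) (c₄.enc n) = c₅.enc n := by
    rw [run_readCell (c := c₄) uses_onPhaseXor (by decide) (by decide) (Or.inl rfl) (v := c.lt)
      (fun _ => rfl) (fun _ => htn), formula_onPhaseXor]
    apply enc_congr
    intro R i _
    cases R <;> simp [Conf.bit, hc₄, hc₅, h1, h2, hsg]
  have e₆ := run_writeCell_off (n := n) (c := c₅) (uses_onPhaseSign true false) (by decide)
    (by rw [formula_onPhaseSign]; simp [hc₅, h1])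
  exact run_trans (run_trans (run_trans (run_trans (run_trans e₁ e₂) e₃) e₄) e₅) e₆

/-- In phase `(1, 0)` the last digit of the quotient is moved to the sign bit. -/
theorem run_quotientStage_read {c : Conf} (hc : c.ct = false) (h1 : c.p1 = true)
    (h2 : c.p2 = false) (hsg : c.sg = false) (hr : c.lr < 2 ^ (Nat.log 2 n + 2)) (htn : c.lt ≤ n) :
    run (quotientStage n) (c.enc n) =
      { c with
        w1 := fun j => if j = c.lt + 1 then false else c.w1 j
        sg := c.w1 (c.lt + 1) }.enc n := by
  have e₁ : run (compare .work2 .work1 (fun i => n + 2 - i)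
      (fun i => if i = 0 then 0 else n + 1 - i) (n + 1) (onSearch n) .lenT) (c.enc n) = c.enc n := by
    rw [run_compareR hc hr (a := 0) (b := 0) (fun h => by rw [h1] at h; cases h)]
    apply enc_congr
    intro R i _
    cases R <;> simp [Conf.bit, h1]
  have e₂ : run (flip (onPhase n false true) (qubit n .sign 0)) (c.enc n) = c.enc n := by
    rw [run_flip_sign (uses_onPhase _ _) (by decide) (by decide), formula_onPhase]
    apply enc_congr
    intro R i _
    cases R <;> simp [Conf.bit, h1]
  have e₃ := run_writeCell_off (n := n) (c := c) (uses_onPhaseSign false true) (by decide)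
    (by rw [formula_onPhaseSign]; simp [h1])
  have e₄ := run_condSubR_off (n := n) (c := c) (uses_onPhaseSign false true) (by decide) hc
    (by rw [formula_onPhaseSign]; simp [h1])
  set d : Conf := { c with sg := c.w1 (c.lt + 1) } with hd
  have e₅ : run (readCell (onPhaseXor n) .lenT) (c.enc n) = d.enc n := by
    rw [run_readCell uses_onPhaseXor (by decide) (by decide) (Or.inl rfl) (v := c.lt)
      (fun _ => rfl) (fun _ => htn), formula_onPhaseXor]
    apply enc_congr
    intro R i _
    cases R <;> simp [Conf.bit, hd, h1, h2, hsg]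
  refine run_trans (run_trans (run_trans (run_trans (run_trans e₁ e₂) e₄) e₃) e₅) ?_
  rw [run_writeCell (c := d) (uses_onPhaseSign _ _) (by decide) (Or.inl rfl) (v := c.lt) (fun _ =>
      rfl)
    (fun _ => htn), formula_onPhaseSign]
  apply enc_congr
  intro R i _
  cases R <;> first | rfl | skip
  simp only [Conf.bit, hd, h1, h2]
  split_ifs with hi
  · rw [hi]; simp
  · rfl

theorem run_product_compare_off {c : Conf} (hc : c.ct = false) (h : c.p1 = false ∨ c.p2 = false)
    (hrs : 0 < c.lr + c.ls) :
    run (addReg n .lenS .lenR ++ (incReg [] .lenR).inverse ++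
      compare .work1 .work2 (fun i => i) (fun i => n - i) n (onPhase n true true) .lenR ++
      incReg [] .lenR ++ (addReg n .lenS .lenR).inverse) (c.enc n) = c.enc n := by
  set c₁ : Conf := { c with lr := c.ls + c.lr } with hc₁
  set c₂ : Conf := { c with lr := c.ls + c.lr - 1 } with hc₂
  have e₁ : run (addReg n .lenS .lenR) (c.enc n) = c₁.enc n := run_addReg_lenR_lenS hc
  have e₂ : run (incReg [] .lenR) (c₂.enc n) = c₁.enc n := by
    rw [run_incReg_lenR, hc₂, hc₁]
    simp only [show c.ls + c.lr - 1 + 1 = c.ls + c.lr by omega]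
  have e₃ : run (compare .work1 .work2 (fun i => i) (fun i => n - i) n (onPhase n true true) .lenR)
      (c₂.enc n) = c₂.enc n :=
    run_compare_off (Or.inl rfl) (Or.inr rfl) (by decide) (uses_onPhase _ _) (by decide)
      (by decide) (Or.inr rfl) (fun i _ => Nat.sub_le _ _) (fun i hi => by omega)
      (fun i hi j hj h => h) hc (by
        rw [formula_onPhase]
        rcases h with h | h <;> simp [hc₂, h])
  exact run_trans (run_trans (run_trans (run_trans e₁ (run_inverse_of_run e₂)) e₃) e₂)
    (run_inverse_of_run e₁)

theorem run_compareT_off {c : Conf} (hc : c.ct = false) (h : c.p1 = false ∨ c.p2 = true) :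
    run (compare .work1 .work2 (fun i => i) (fun i => i) (n + 1) (onPhase n true false) .lenT)
      (c.enc n) = c.enc n :=
  run_compare_off (Or.inl rfl) (Or.inr rfl) (by decide) (uses_onPhase _ _) (by decide)
    (by decide) (Or.inl rfl) (fun i hi => by omega) (fun i hi => by omega)
    (fun i hi j hj h => h) hc (by
      rw [formula_onPhase]
      rcases h with h | h <;> simp [h])

/-- The phases `(0, 0)` and `(0, 1)`. -/
theorem run_productStage_idle {c : Conf} (hc : c.ct = false) (h1 : c.p1 = false)
    (hq : c.lq < 2 ^ (Nat.log 2 n + 2)) (hrs : 0 < c.lr + c.ls) :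
    run (productStage n) (c.enc n) = c.enc n := by
  have e₁ := run_inverse_of_run (run_incReg_lenQ_off (n := n) (c := c) (a := true) (b := false)
    (Or.inl (by simp [h1])))
  have e₂ := run_writeCell_off (n := n) (c := c) (uses_onDigits (n := n)) (by decide)
    (by rw [formula_onDigits hq]; simp [h1])
  have e₃ := run_condSubT_inverse_off (n := n) (c := c) (uses_onPhaseSign (n := n) true false)
      (by decide) hc
    (by rw [formula_onPhaseSign]; simp [h1])
  have e₇ : run (flip (onPhase1 n) (qubit n .sign 0)) (c.enc n) = c.enc n := by
    rw [run_flip_sign uses_onPhase1 (by decide) (by decide), formula_onPhase1]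
    apply enc_congr
    intro R i _
    cases R <;> simp [Conf.bit, h1]
  exact run_trans (run_trans (run_trans (run_trans (run_trans (run_trans e₁ e₂) e₃)
    (run_compareT_off hc (Or.inl h1))) e₂) (run_product_compare_off hc (Or.inl h1) hrs)) e₇

/-- In phase `(1, 0)` the stage adds `x` to `y` if the sign bit is `1`.  Since `y < x` before the
addition and `x ≤ x + y` after it, a comparison of the new content with `x` tells whether the
addition has taken place, and so clears the sign bit.  The cell `c.lt + 1`, which is read as the
leading digit of `x`, holds the first digit of the quotient; this digit is `1` unless the quotient
is used up, so it can be cleared and restored by means of `lenQ`. -/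
theorem run_productStage_accumulate {c : Conf} {x y : ℕ} (hc : c.ct = false) (h1 : c.p1 = true)
    (h2 : c.p2 = false) (hq : c.lq < 2 ^ (Nat.log 2 n + 2)) (hrs : 0 < c.lr + c.ls)
    (htn : c.lt ≤ n) (hy : y < x) (hxy : x + y < 2 ^ (c.lt + 1))
    (hwx : ∀ i < c.lt + 1, c.w1 i = x.testBit i) (hwy : ∀ i < c.lt + 1, c.w2 i = y.testBit i)
    (hwq : c.w1 (c.lt + 1) = decide (0 < c.lq)) :
    run (productStage n) ({ c with lq := c.lq + 1 }.enc n) =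
      { c with
        w2 := fun j => if c.sg = true ∧ j ≤ c.lt then (x + y).testBit j else c.w2 j
        sg := false }.enc n := by
  set w : ℕ → Bool := fun j => if c.sg = true ∧ j ≤ c.lt then (x + y).testBit j else c.w2 j with hw
  set u : ℕ → Bool := fun j => if j = c.lt + 1 then false else c.w1 j with hu
  set c₁ : Conf := { c with w1 := u } with hc₁
  set c₂ : Conf := { c with w1 := u, w2 := w } with hc₂
  set c₄ : Conf := { c with w2 := w, sg := true } with hc₄
  set c₃ : Conf := { c₄ with w1 := u } with hc₃
  have e₁ := run_inverse_of_run (run_incReg_lenQ_on (n := n) (c := c) h1 h2)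
  have hwr : ∀ c' : Conf, c'.p1 = true → c'.p2 = false → c'.lq = c.lq → c'.lt = c.lt →
      c'.w1 = c.w1 → run (writeCell (onDigits n) .lenT) (c'.enc n) = { c' with w1 := u }.enc n := by
    intro c' hp1 hp2 hlq hlt hw1
    rw [run_writeCell (c := c') uses_onDigits (by decide) (Or.inl rfl) (v := c.lt)
      (fun _ => hlt ▸ rfl) (fun _ => htn), formula_onDigits (hlq ▸ hq)]
    apply enc_congr
    intro R i _
    cases R <;> first | rfl | skip
    simp only [Conf.bit, hu, hp1, hp2, hlq, hw1]
    split_ifs with hi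
    · rw [hi, hwq]; simp
    · rfl
  have hwr' : ∀ c' : Conf, c'.p1 = true → c'.p2 = false → c'.lq = c.lq → c'.lt = c.lt →
      c'.w1 = c.w1 → run (writeCell (onDigits n) .lenT) ({ c' with w1 := u }.enc n) = c'.enc n := by
    intro c' hp1 hp2 hlq hlt hw1
    rw [run_writeCell (c := { c' with w1 := u }) uses_onDigits (by decide) (Or.inl rfl) (v := c.lt)
      (fun _ => hlt ▸ rfl) (fun _ => htn), formula_onDigits (c := { c' with w1 := u }) (hlq ▸ hq)]
    apply enc_congr
    intro R i _
    cases R <;> first | rfl | skip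
    simp only [Conf.bit, hu, hp1, hp2, hlq, hw1]
    split_ifs with hi
    · rw [hi, hwq]; simp
    · rfl
  have e₂ : run (writeCell (onDigits n) .lenT) (c.enc n) = c₁.enc n := hwr c h1 h2 rfl rfl rfl
  have hf : formula (c₁.enc n) (onPhaseSign n true false) = c.sg := by
    rw [formula_onPhaseSign]; simp [hc₁, h1, h2]
  have hux : ∀ i < c.lt + 2, u i = x.testBit i := by
    intro i hi
    simp only [hu]
    split_ifs with h
    · rw [h, Nat.testBit_lt_two_pow (by omega)]
    · exact hwx i (by omega)
  have e₃ : run (condSubT (onPhaseSign n true false)).inverse (c₁.enc n) = c₂.enc n := by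
    rw [run_condSubT_inverse (c := c₁) (uses_onPhaseSign _ _) (by decide) (x := x) (y := y) hc
      (fun _ => ⟨htn, hxy⟩) (fun _ => hwy) (fun _ => hux), hf]
  have e₄ : run (compare .work1 .work2 (fun i => i) (fun i => i) (n + 1) (onPhase n true false)
      .lenT) (c₂.enc n) = c₃.enc n := by
    rw [run_compare (c := c₂) (Or.inl rfl) (Or.inr rfl) (by decide) (uses_onPhase _ _) (by decide)
      (by decide) (Or.inl rfl) (v := c.lt) (i₀ := c.lt) (a := x)
      (b := if c.sg = true then x + y else y) (fun _ => rfl) (fun i hi => by omega)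
      (fun _ => ⟨htn, by omega, fun i hi => Iff.rfl⟩) (fun i hi => by omega)
      (fun i hi j hj h => h) hc (fun _ => ⟨by omega, fun j hj => hux j (by omega)⟩)
      (fun _ => ⟨by split_ifs <;> omega, fun j hj => ?_⟩), formula_onPhase]
    · simp only [hc₂, hc₃, hc₄, h1, h2]
      cases c.sg
      · simp [hy]
      · simp
    · show w j = _
      simp only [hw]
      by_cases hs : c.sg = true
      · rw [if_pos ⟨hs, hj⟩, if_pos hs]
      · rw [if_neg fun h => hs h.1, if_neg hs, hwy j (by omega)]
  have e₅ : run (writeCell (onDigits n) .lenT) (c₃.enc n) = c₄.enc n := hwr' c₄ h1 h2 rfl rfl rfl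
  have e₆ := run_product_compare_off (n := n) (c := c₄) hc (Or.inr h2) hrs
  refine run_trans (run_trans (run_trans (run_trans (run_trans (run_trans e₁ e₂) e₃) e₄) e₅) e₆) ?_
  rw [run_flip_sign uses_onPhase1 (by decide) (by decide), formula_onPhase1]
  simp [hc₄, h1]

/-- In phase `(1, 1)` only the comparison takes effect.  In the application `x` is `t` and `y` is
`t' / 2 ^ ls`, and the cells up to `n + 1 - lr - ls` all belong to `t'`. -/
theorem run_productStage_compare {c : Conf} {x y : ℕ} (hc : c.ct = false) (h1 : c.p1 = true)
    (h2 : c.p2 = true) (hq : c.lq < 2 ^ (Nat.log 2 n + 2)) (hr : 0 < c.lr) (hs : 0 < c.ls)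
    (hrs : c.lr + c.ls ≤ n + 1) (hx : x < 2 ^ (n + 2 - c.lr - c.ls))
    (hy : y < 2 ^ (n + 2 - c.lr - c.ls)) (hwx : ∀ i < n + 2 - c.lr - c.ls, c.w1 i = x.testBit i)
    (hwy : ∀ i < n + 2 - c.lr - c.ls, c.w2 i = y.testBit i) :
    run (productStage n) (c.enc n) = { c with sg := xor c.sg (decide (x ≤ y)) }.enc n := by
  have h2' : c.p2 ≠ false := by simp [h2]
  have e₁ := run_inverse_of_run (run_incReg_lenQ_off (n := n) (c := c) (a := true) (b := false)
    (Or.inr h2'))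
  have e₂ := run_writeCell_off (n := n) (c := c) (uses_onDigits (n := n)) (by decide)
    (by rw [formula_onDigits hq]; simp [h2])
  have e₃ := run_condSubT_inverse_off (n := n) (c := c) (uses_onPhaseSign (n := n) true false)
      (by decide) hc
    (by rw [formula_onPhaseSign]; simp [h2])
  set c₁ : Conf := { c with lr := c.ls + c.lr } with hc₁
  set c₂ : Conf := { c with lr := c.ls + c.lr - 1 } with hc₂
  set d : Conf := { c with sg := xor c.sg (decide (y < x)) } with hd
  set d₁ : Conf := { d with lr := c.ls + c.lr } with hd₁
  set d₂ : Conf := { d with lr := c.ls + c.lr - 1 } with hd₂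
  have f₁ : run (addReg n .lenS .lenR) (c.enc n) = c₁.enc n := run_addReg_lenR_lenS hc
  have f₂ : run (incReg [] .lenR) (c₂.enc n) = c₁.enc n := by
    rw [run_incReg_lenR, hc₂, hc₁]
    simp only [show c.ls + c.lr - 1 + 1 = c.ls + c.lr by omega]
  have g₁ : run (addReg n .lenS .lenR) (d.enc n) = d₁.enc n := run_addReg_lenR_lenS hc
  have g₂ : run (incReg [] .lenR) (d₂.enc n) = d₁.enc n := by
    rw [run_incReg_lenR, hd₂, hd₁]
    simp only [show c.ls + c.lr - 1 + 1 = c.ls + c.lr by omega]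
  have hlr : c₂.lr = c.ls + c.lr - 1 := rfl
  have f₃ : run (compare .work1 .work2 (fun i => i) (fun i => n - i) n (onPhase n true true) .lenR)
      (c₂.enc n) = d₂.enc n := by
    rw [run_compare (c := c₂) (Or.inl rfl) (Or.inr rfl) (by decide) (uses_onPhase _ _) (by decide)
      (by decide) (Or.inr rfl) (v := c₂.lr) (i₀ := n - c₂.lr) (a := x) (b := y) (fun _ => rfl)
      (fun i hi => Nat.sub_le _ _) (fun _ => ⟨by omega, by omega, fun i hi => by omega⟩)
      (fun i hi => by omega) (fun i hi j hj h => h) hc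
      (fun _ => ⟨?_, fun j hj => hwx j (by omega)⟩)
      (fun _ => ⟨?_, fun j hj => hwy j (by omega)⟩), formula_onPhase]
    · simp [hc₂, hd₂, hd, h1, h2]
    · rwa [show n - c₂.lr + 1 = n + 2 - c.lr - c.ls by omega]
    · rwa [show n - c₂.lr + 1 = n + 2 - c.lr - c.ls by omega]
  have e₆ := run_trans (run_trans (run_trans (run_trans f₁ (run_inverse_of_run f₂)) f₃) g₂)
    (run_inverse_of_run g₁)
  refine run_trans (run_trans (run_trans (run_trans (run_trans (run_trans e₁ e₂) e₃)
    (run_compareT_off hc (Or.inr h2))) e₂) e₆) ?_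
  rw [run_flip_sign uses_onPhase1 (by decide) (by decide), formula_onPhase1]
  have : decide (x ≤ y) = !decide (y < x) := by
    rw [← decide_not, decide_eq_decide]; exact not_lt.symm
  simp only [hd, h1, this]
  cases c.sg <;> cases decide (y < x) <;> rfl

/-- The contents after the phase updates. -/
def Conf.updatePhases (c : Conf) : Conf :=
  { c with
    p1 := xor c.p1 (decide (c.ls = 0))
    p2 := xor (xor c.p2 (decide (c.lq = 0 ∧ 0 < c.lr) && xor c.sg c.p1)) (decide (c.ls = 0))
    sg := xor c.sg (decide (c.lq = 0 ∧ 0 < c.lr) && xor c.p2 (xor c.sg c.p1)) }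

theorem run_phaseStage {c : Conf} (hq : c.lq < 2 ^ (Nat.log 2 n + 2))
    (hr : c.lr < 2 ^ (Nat.log 2 n + 2)) (hs : c.ls < 2 ^ (Nat.log 2 n + 3)) :
    run (phaseStage n) (c.enc n) = c.updatePhases.enc n := by
  set b := decide (c.lq = 0 ∧ 0 < c.lr) with hb
  set c₁ : Conf := { c with p2 := xor c.p2 (b && c.sg) } with hc₁
  set c₂ : Conf := { c with p2 := xor (xor c.p2 (b && c.sg)) (b && c.p1) } with hc₂
  set c₃ : Conf := { c₂ with sg := xor c.sg (b && c₂.p2) } with hc₃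
  set c₄ : Conf := { c₃ with p1 := xor c.p1 (decide (c.ls = 0)) } with hc₄
  have e₁ : run (flip (onEmpty n .sign) (qubit n .phase2 0)) (c.enc n) = c₁.enc n := by
    rw [run_flip_phase2 (uses_onEmpty _) (by decide) (by decide), formula_onEmpty hq hr]; rfl
  have e₂ : run (flip (onEmpty n .phase1) (qubit n .phase2 0)) (c₁.enc n) = c₂.enc n := by
    rw [run_flip_phase2 (uses_onEmpty _) (by decide) (by decide),
      formula_onEmpty (c := c₁) hq hr]; rfl
  have e₃ : run (flip (onEmpty n .phase2) (qubit n .sign 0)) (c₂.enc n) = c₃.enc n := by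
    rw [run_flip_sign (uses_onEmpty _) (by decide) (by decide),
      formula_onEmpty (c := c₂) hq hr]; rfl
  have e₄ : run (flip (onUnshifted n) (qubit n .phase1 0)) (c₃.enc n) = c₄.enc n := by
    rw [run_flip_phase1 uses_onUnshifted (by decide) (by decide),
      formula_onUnshifted (c := c₃) hs]
  have e₅ : run (flip (onUnshifted n) (qubit n .phase2 0)) (c₄.enc n) = c.updatePhases.enc n := by
    rw [run_flip_phase2 uses_onUnshifted (by decide) (by decide),
      formula_onUnshifted (c := c₄) hs]
    simp only [hc₄, hc₃, hc₂, Conf.updatePhases, ← hb]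
    cases b <;> cases c.p2 <;> cases c.sg <;> cases c.p1 <;> simp
  exact run_trans (run_trans (run_trans (run_trans e₁ e₂) e₃) e₄) e₅

theorem run_endStage_idle {c : Conf} (hc : c.ct = false) (hq : c.lq < 2 ^ (Nat.log 2 n + 2))
    (hs : c.ls < 2 ^ (Nat.log 2 n + 3)) (h : ¬ (c.lq = 0 ∧ c.ls = 0)) :
    run (endStage n) (c.enc n) = c.enc n := by
  have hf : formula (c.enc n) (onEnd n) = false := by
    rw [formula_onEnd hq hs]; simpa using h
  have hf' : ∀ {p : Prop}, formula (c.enc n) (onEnd n) = true → p := fun h' =>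
    absurd (hf.symm.trans h') (by decide)
  have e₁ : ∀ W : Reg, W = .work1 ∨ W = .work2 →
      run (sizeXor W (fun i => n - i) (onEnd n) .lenR .lenT) (c.enc n) = c.enc n := fun W hW => by
    rw [run_sizeXor hW (fun i hi => by omega) uses_onEnd (by decide) (Or.inr rfl) (Or.inl rfl)
      (by decide) (by decide) hc (v := c.lr) (m := 0) (fun _ => rfl) hf', hf]
    simp [Conf.xorLen]
  have e₂ : ∀ W : Reg, W = .work1 ∨ W = .work2 →
      run (sizeXor W (fun i => i + 2) (onEnd n) .lenT .lenR) (c.enc n) = c.enc n := fun W hW => by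
    rw [run_sizeXor hW (fun i hi => by omega) uses_onEnd (by decide) (Or.inl rfl) (Or.inr rfl)
      (by decide) (by decide) hc (v := c.lt) (m := 0) (fun _ => rfl) hf', hf]
    simp [Conf.xorLen]
  have e₅ : run (swapWork (onEnd n)) (c.enc n) = c.enc n := by
    rw [run_swapWork uses_onEnd (by decide) (by decide) (by decide) hc, hf]
    simp
  have e₆ : run (flip (onEnd n) (qubit n .iter 0)) (c.enc n) = c.enc n := by
    rw [run_flip_iter uses_onEnd (by decide) (by decide), hf]
    simp
  exact run_trans (run_trans (run_trans (run_trans (run_trans (e₁ _ (Or.inl rfl))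
    (e₁ _ (Or.inr rfl))) (e₂ _ (Or.inr rfl))) (e₂ _ (Or.inl rfl))) e₅) e₆

/-- The old lengths are erased by computing them a second time from the cells, and the new ones are
computed in the same way.  Each scan is confined by the length register that is not being changed:
the cells of `t` and `t'` end before those of `r'`, which `lenR` bounds, and the digits of `r` and
`r'` lie to the right of those of `t'`, which the new content of `lenT` bounds. -/
theorem run_endStage {c : Conf} {t t' : ℕ} {r r' : ℕ} (hc : c.ct = false) (hq : c.lq = 0)
    (hs : c.ls = 0) (hlt : c.lt = Nat.size t) (hlr : c.lr = Nat.size r') (hn : c.lr ≤ n)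
    (htr : Nat.size t + Nat.size r' ≤ n + 1) (htr' : Nat.size t' + Nat.size r' ≤ n + 1)
    (hrr : Nat.size r ≤ Nat.size r') (hr0 : 0 < Nat.size r')
    (ht1 : ∀ i ≤ n - c.lr, c.w1 i = t.testBit i) (ht2 : ∀ i ≤ n - c.lr, c.w2 i = t'.testBit i)
    (hr1 : ∀ i ≤ n, Nat.size t' ≤ i → c.w1 (i + 2) = r.testBit (n - i))
    (hr2 : ∀ i ≤ n, Nat.size t' ≤ i → c.w2 (i + 2) = r'.testBit (n - i)) :
    run (endStage n) (c.enc n) =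
      { c with w1 := c.w2, w2 := c.w1, lt := Nat.size t', lr := Nat.size r, it := !c.it }.enc n :=
        by
  have hf : ∀ c' : Conf, c'.lq = 0 → c'.ls = 0 → formula (c'.enc n) (onEnd n) = true := by
    intro c' h h'
    rw [formula_onEnd (by rw [h]; positivity) (by rw [h']; positivity)]
    simp [h, h']
  have hsz0 : ∀ (m i : ℕ), Nat.size m ≤ i → m.testBit i = false := fun m i h =>
    Nat.testBit_lt_two_pow (Nat.size_le.1 h)
  have hszt : ∀ m : ℕ, 0 < Nat.size m → m.testBit (Nat.size m - 1) = true := by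
    intro m hm
    have h1 : 2 ^ (Nat.size m - 1) ≤ m := Nat.lt_size.1 (by omega)
    have h2 : m < 2 ^ (Nat.size m - 1) * 2 := by
      rw [← pow_succ, show Nat.size m - 1 + 1 = Nat.size m by omega]
      exact Nat.lt_size_self m
    rw [Nat.testBit_eq_decide_div_mod_eq, Nat.div_eq_of_lt_le (k := 1) (by omega) (by omega)]
    rfl
  -- `lenT` is erased and set to the size of `t'`, then `lenR` to that of `r`.
  set c₁ : Conf := { c with lt := 0 } with hc₁
  set c₂ : Conf := { c with lt := Nat.size t' } with hc₂
  set c₃ : Conf := { c₂ with lr := 0 } with hc₃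
  set c₄ : Conf := { c₂ with lr := Nat.size r } with hc₄
  set c₅ : Conf := { c₄ with w1 := c.w2, w2 := c.w1 } with hc₅
  have e₁ : run (sizeXor .work1 (fun i => n - i) (onEnd n) .lenR .lenT) (c.enc n) = c₁.enc n := by
    rw [run_sizeXor (Or.inl rfl) (fun i hi => by omega) uses_onEnd (by decide) (Or.inr rfl)
      (Or.inl rfl) (by decide) (by decide) hc (v := c.lr) (m := Nat.size t) (fun _ => rfl)
      (fun _ => ⟨hn, by omega, fun i hi h1 h2 => (ht1 _ (by omega)).trans (hsz0 _ _ (by omega)),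
        fun h => (ht1 _ (by omega)).trans ?_⟩), hf c hq hs]
    · simp [Conf.xorLen, hlt, hc₁]
    · rw [show n - (n + 1 - Nat.size t) = Nat.size t - 1 by omega]
      exact hszt t h
  have e₂ : run (sizeXor .work2 (fun i => n - i) (onEnd n) .lenR .lenT) (c₁.enc n) = c₂.enc n := by
    rw [run_sizeXor (c := c₁) (Or.inr rfl) (fun i hi => by omega) uses_onEnd (by decide) (Or.inr
        rfl)
      (Or.inl rfl) (by decide) (by decide) hc (v := c.lr) (m := Nat.size t') (fun _ => rfl)
      (fun _ => ⟨hn, by omega, fun i hi h1 h2 => (ht2 _ (by omega)).trans (hsz0 _ _ (by omega)),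
        fun h => (ht2 _ (by omega)).trans ?_⟩), hf c₁ hq hs]
    · simp [Conf.xorLen, hc₁, hc₂]
    · rw [show n - (n + 1 - Nat.size t') = Nat.size t' - 1 by omega]
      exact hszt t' h
  have e₃ : run (sizeXor .work2 (fun i => i + 2) (onEnd n) .lenT .lenR) (c₂.enc n) = c₃.enc n := by
    rw [run_sizeXor (c := c₂) (Or.inr rfl) (fun i hi => by omega) uses_onEnd (by decide) (Or.inl
        rfl)
      (Or.inr rfl) (by decide) (by decide) hc (v := Nat.size t') (m := Nat.size r') (fun _ => rfl)
      (fun _ => ⟨by omega, by omega, fun i hi h1 h2 => (hr2 _ hi h1).trans (hsz0 _ _ (by omega)),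
        fun h => (hr2 _ (by omega) (by omega)).trans ?_⟩), hf c₂ hq hs]
    · simp [Conf.xorLen, hc₂, hc₃, hlr]
    · rw [show n - (n + 1 - Nat.size r') = Nat.size r' - 1 by omega]
      exact hszt r' h
  have e₄ : run (sizeXor .work1 (fun i => i + 2) (onEnd n) .lenT .lenR) (c₃.enc n) = c₄.enc n := by
    rw [run_sizeXor (c := c₃) (Or.inl rfl) (fun i hi => by omega) uses_onEnd (by decide) (Or.inl
        rfl)
      (Or.inr rfl) (by decide) (by decide) hc (v := Nat.size t') (m := Nat.size r) (fun _ => rfl)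
      (fun _ => ⟨by omega, by omega, fun i hi h1 h2 => (hr1 _ hi h1).trans (hsz0 _ _ (by omega)),
        fun h => (hr1 _ (by omega) (by omega)).trans ?_⟩), hf c₃ hq hs]
    · simp [Conf.xorLen, hc₄, hc₃]
    · rw [show n - (n + 1 - Nat.size r) = Nat.size r - 1 by omega]
      exact hszt r h
  have e₅ : run (swapWork (onEnd n)) (c₄.enc n) = c₅.enc n := by
    rw [run_swapWork (c := c₄) uses_onEnd (by decide) (by decide) (by decide) hc, hf c₄ hq hs]
    simp [hc₄, hc₅, hc₂]
  refine run_trans (run_trans (run_trans (run_trans (run_trans e₁ e₂) e₃) e₄) e₅) ?_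
  rw [run_flip_iter uses_onEnd (by decide) (by decide), hf c₅ hq hs]
  simp [hc₅, hc₄, hc₂]

/-! ### The arithmetic of a step -/

/-- The contents of the registers for a state of the algorithm, before the second work register is
shifted. -/
def raw (n : ℕ) (s : EEAState) (y : ℕ) : Conf where
  w1 := s.work1Cell n
  w2 := s.work2Cell n
  out := y.testBit
  lt := s.lt
  lq := s.lq
  lr := s.lr
  ls := s.ls
  p1 := s.phase1
  p2 := s.phase2
  it := s.iter
  sg := s.sign
  ct := false

theorem basis_eq (s : EEAState) (y : ℕ) : s.basis n y = ((raw n s y).rot n).enc n := by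
  funext ⟨R, i⟩
  cases R <;> rfl

theorem enc_ext {c d : Conf} (hw1 : ∀ i < n + 3, c.w1 i = d.w1 i)
    (hw2 : ∀ i < n + 3, c.w2 i = d.w2 i) (hout : c.out = d.out) (hlt : c.lt = d.lt)
    (hlq : c.lq = d.lq) (hlr : c.lr = d.lr) (hls : c.ls = d.ls) (hp1 : c.p1 = d.p1)
    (hp2 : c.p2 = d.p2) (hit : c.it = d.it) (hsg : c.sg = d.sg) (hct : c.ct = d.ct) :
    c.enc n = d.enc n := by
  apply enc_congr
  intro R i hi
  cases R <;> simp only [Conf.bit, *]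
  · exact hw1 i hi
  · exact hw2 i hi

theorem testBit_of_size_le {m i : ℕ} (h : Nat.size m ≤ i) : m.testBit i = false :=
  Nat.testBit_lt_two_pow (Nat.size_le.1 h)

/-- The contents on which `aligned` lets a circuit act. -/
def align (n : ℕ) (c : Conf) (v : ℕ) : Conf :=
  { c with w1 := fun i => c.w1 ((i + (n + 3 - c.ls % (n + 3))) % (n + 3)), lt := v }

theorem align_index {i m l : ℕ} (hi : i < m) : ((i + l) % m + (m - l % m)) % m = i := by
  have hm : l % m < m := Nat.mod_lt _ (by omega)
  have := Nat.div_add_mod l m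
  rw [Nat.mod_add_mod, show i + l + (m - l % m) = i + m * (l / m + 1) by
    rw [mul_add]; omega, Nat.add_mul_mod_self_left, Nat.mod_eq_of_lt hi]

theorem align_w1 {c : Conf} {v j : ℕ} (h : c.ls ≤ j) (hj : j < n + 3) :
    (align n c v).w1 j = c.w1 (j - c.ls) := by
  simp only [align]
  rw [Nat.mod_eq_of_lt (show c.ls < n + 3 by omega),
    show j + (n + 3 - c.ls) = j - c.ls + (n + 3) by omega, Nat.add_mod_right,
    Nat.mod_eq_of_lt (by omega)]

theorem align_w1_wrap {c : Conf} {v i : ℕ} (hi : i < n + 3) :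
    (align n c v).w1 ((i + c.ls) % (n + 3)) = c.w1 i := by
  simp only [align]
  rw [align_index hi]

theorem run_aligned_align {C : Circuit (Qubit n)} {c : Conf} {v : ℕ} {w w' : ℕ → Bool} {b : Bool}
    (hrun : run C ((align n c v).enc n) = { align n c v with w1 := w, sg := b }.enc n)
    (hc : c.ct = false) (hx : c.lt + c.lq + c.ls = v + 1) (hs : c.ls < 2 ^ (Nat.log 2 n + 3))
    (hw : ∀ i < n + 3, w ((i + c.ls) % (n + 3)) = w' i) :
    run (aligned C) ((c.rot n).enc n) = (Conf.rot n { c with w1 := w', sg := b }).enc n := by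
  have h := run_aligned (x := c.lt) hrun hc hc hx rfl rfl rfl hs
  have h₁ : ((align n c v).unaligned n c.lt).enc n = (c.rot n).enc n := by
    exact enc_ext (fun i hi => align_w1_wrap (v := v) hi) (fun _ _ => rfl) rfl rfl rfl rfl rfl rfl
      rfl
      rfl rfl rfl
  have h₂ : (Conf.unaligned n { align n c v with w1 := w, sg := b } c.lt).enc n =
      (Conf.rot n { c with w1 := w', sg := b }).enc n := by
    exact enc_ext (fun i hi => hw i hi) (fun _ _ => rfl) rfl rfl rfl rfl rfl rfl rfl rfl rfl rfl
  rwa [h₁, h₂] at h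

/-- The part of a step that carries out the arithmetic. -/
noncomputable def arithCircuit (n : ℕ) [NeZero n] : Circuit (Qubit n) :=
  shift n false ++ incReg [lit n .phase1 false, lit n .phase2 true] .lenQ ++
    aligned (quotientStage n) ++ productStage n ++ shift n true

theorem work2Cell_right {s : EEAState} {i : ℕ} (hlr : s.lr = Nat.size s.r')
    (ht' : s.t' < 2 ^ i) (hi : i ≤ n + 2) : s.work2Cell n i = s.r'.testBit (n + 2 - i) := by
  unfold EEAState.work2Cell
  split_ifs with h
  · rw [Nat.testBit_lt_two_pow ht', testBit_of_size_le (by omega)]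
  · rfl

theorem pow_le_pow_two {a b : ℕ} (h : a ≤ b) : 2 ^ a ≤ 2 ^ b := Nat.pow_le_pow_right (by omega) h

/-- Phase `(0, 0)`. -/
theorem run_arith_search {s : EEAState} {y : ℕ} (h1 : s.phase1 = false) (h2 : s.phase2 = false)
    (hq : s.q = 0) (hlq : s.lq = 0) (hls : s.ls + 1 < 2 ^ (Nat.log 2 n + 3))
    (hlr' : s.lr < 2 ^ (Nat.log 2 n + 2)) (hlr : s.lr = Nat.size s.r')
    (h : 0 < s.lr → 1 ≤ s.lt ∧ s.lt + (s.ls + 1) + s.lr ≤ n + 2 ∧ s.t < 2 ^ s.lt ∧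
      s.t' < 2 ^ s.lt ∧ s.lt + Nat.size s.r ≤ n + 2) :
    run (arithCircuit n) (s.basis n y) = s.arith.basis n y := by
  set c : Conf := { raw n s y with ls := s.ls + 1 } with hc
  have hcls : c.ls = s.ls + 1 := rfl
  have hclt : c.lt = s.lt := rfl
  have e₁ : run (shift n false) (((raw n s y).rot n).enc n) = (c.rot n).enc n :=
    run_shift_up rfl h1 h2
  have e₂ : run (incReg [lit n .phase1 false, lit n .phase2 true] .lenQ) ((c.rot n).enc n) =
      (c.rot n).enc n := run_incReg_lenQ_off (c := c.rot n) (Or.inr (by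
        show s.phase2 ≠ true
        simp [h2]))
  set b : Bool := xor s.sign (decide (s.r < 2 ^ (s.ls + 1) * s.r')) with hb
  set d : Conf := Conf.rot n { c with sg := b } with hd
  have e₃ : run (aligned (quotientStage n)) ((c.rot n).enc n) = d.enc n := by
    refine run_aligned_align (v := s.lt + s.ls) (w := (align n c (s.lt + s.ls)).w1)
      (w' := c.w1) ?_ rfl (by rw [hclt, hcls, show c.lq = 0 from hlq]; ring) hls
      (fun i hi => align_w1_wrap hi)
    rw [run_quotientStage_search (c := align n c (s.lt + s.ls)) (a := s.r')
      (b := s.r / 2 ^ (s.ls + 1)) rfl h1 h2 hlr' (fun h0 => ?_)]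
    · refine enc_ext (fun _ _ => rfl) (fun _ _ => rfl) rfl rfl rfl rfl rfl rfl rfl rfl ?_ rfl
      show xor s.sign (decide (0 < s.lr) && decide (s.r / 2 ^ (s.ls + 1) < s.r')) = b
      rw [hb, ← Bool.decide_and]
      refine congrArg _ (decide_eq_decide.2 ?_)
      rw [Nat.div_lt_iff_lt_mul (by positivity), mul_comm]
      constructor
      · exact fun h => h.2
      · intro h
        refine ⟨?_, h⟩
        rw [hlr, Nat.size_pos]
        by_contra h0
        rw [show s.r' = 0 by omega] at h
        omega
    · obtain ⟨g1, g2, g3, g4, g5⟩ := h h0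
      have h0' : 0 < s.lr := h0
      have hlt : (align n c (s.lt + s.ls)).lt = s.lt + s.ls := rfl
      rw [hlt]
      have hr' : s.r' < 2 ^ s.lr := hlr ▸ Nat.lt_size_self _
      have hr : s.r < 2 ^ Nat.size s.r := Nat.lt_size_self _
      refine ⟨by omega, by omega, hr'.trans_le (pow_le_pow_two (by omega)), ?_, fun j hj => ?_,
        fun j hj => ?_⟩
      · rw [Nat.div_lt_iff_lt_mul (by positivity), ← pow_add]
        exact hr.trans_le (pow_le_pow_two (by omega))
      · show s.work2Cell n (n + 2 - j) = _
        rw [work2Cell_right hlr (g4.trans_le (pow_le_pow_two (by omega))) (by omega)]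
        exact congrArg _ (by omega)
      · rw [align_w1 (by omega) (by omega), Nat.testBit_div_two_pow]
        show s.work1Cell n (n + 2 - j - (s.ls + 1)) = _
        unfold EEAState.work1Cell
        rw [hlq]
        split_ifs with i1 i2
        · rw [show n + 2 - j - (s.ls + 1) = s.lt by omega, Nat.testBit_lt_two_pow g3,
            testBit_of_size_le (by omega)]
        · omega
        · exact congrArg _ (by omega)
  have hp1 : d.p1 = false := h1
  have e₄ : run (productStage n) (d.enc n) = d.enc n :=
    run_productStage_idle rfl h1 (by show s.lq < _; rw [hlq]; positivity) (by
      show 0 < s.lr + (s.ls + 1); omega)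
  have e₅ : run (shift n true) (d.enc n) = d.enc n := run_shift_idle rfl (by simp [hp1])
  rw [basis_eq, basis_eq]
  have hfin : ((raw n s.arith y).rot n).enc n = d.enc n := by
    have ha : s.arith = { s with ls := s.ls + 1, sign := b } := by
      unfold EEAState.arith; rw [h1, h2]
    rw [ha]
    exact enc_ext (fun i _ => by simp [Conf.rot, raw, hd, hc, EEAState.work1Cell, hq, hlq])
      (fun _ _ => rfl) rfl rfl rfl rfl rfl rfl rfl rfl rfl rfl
  rw [hfin]
  exact run_trans (run_trans (run_trans (run_trans e₁ e₂) e₃) e₄) e₅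

/-- Phase `(1, 1)`. -/
theorem run_arith_unshift {s : EEAState} {y l : ℕ} (h1 : s.phase1 = true) (h2 : s.phase2 = true)
    (hq : s.q = 0) (hlq : s.lq = 0) (hl : s.ls = l + 1) (hls : s.ls < 2 ^ (Nat.log 2 n + 3))
    (hlr' : s.lr < 2 ^ (Nat.log 2 n + 2)) (hlr0 : 0 < s.lr)
    (ht : s.t < 2 ^ s.lt) (hlt : s.lt + s.ls + s.lr ≤ n + 2) (ht1 : 1 ≤ s.lt)
    (ht' : Nat.size s.t' + s.lr ≤ n + 2) (hr : Nat.size s.r ≤ s.lr) :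
    run (arithCircuit n) (s.basis n y) = s.arith.basis n y := by
  set c : Conf := raw n s y with hc
  have hp1 : c.p1 = true := h1
  have hp2 : c.p2 = true := h2
  have e₁ : run (shift n false) ((c.rot n).enc n) = (c.rot n).enc n :=
    run_shift_idle (c := c.rot n) rfl (by
      show s.phase1 ≠ false
      simp [h1])
  have e₂ : run (incReg [lit n .phase1 false, lit n .phase2 true] .lenQ) ((c.rot n).enc n) =
      (c.rot n).enc n := run_incReg_lenQ_off (c := c.rot n) (Or.inl (by
        show s.phase1 ≠ false
        simp [h1]))
  have e₃ : run (aligned (quotientStage n)) ((c.rot n).enc n) = (c.rot n).enc n := by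
    refine run_aligned_align (v := s.lt + l) (w := (align n c (s.lt + l)).w1) (b := s.sign)
      (w' := c.w1) ?_ rfl (by
        show s.lt + s.lq + s.ls = _
        rw [hlq, hl]; ring) hls (fun i hi => align_w1_wrap hi)
    exact run_quotientStage_idle (c := align n c (s.lt + l)) rfl h1 h2 hlr'
  set b : Bool := xor s.sign (decide (2 ^ s.ls * s.t ≤ s.t')) with hb
  have e₄ : run (productStage n) ((c.rot n).enc n) = (Conf.rot n { c with sg := b }).enc n := by
    rw [run_productStage_compare (c := c.rot n) (x := s.t) (y := s.t' / 2 ^ s.ls) rfl h1 h2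
      (by show s.lq < _; rw [hlq]; positivity) hlr0 (by show 0 < s.ls; omega)
      (by show s.lr + s.ls ≤ _; omega)
      (ht.trans_le (pow_le_pow_two (by show s.lt ≤ n + 2 - s.lr - s.ls; omega))) ?_
      (fun i hi => ?_) (fun i hi => ?_)]
    · refine enc_ext (fun _ _ => rfl) (fun _ _ => rfl) rfl rfl rfl rfl rfl rfl rfl rfl ?_ rfl
      show xor s.sign (decide (s.t ≤ s.t' / 2 ^ s.ls)) = b
      rw [hb]
      refine congrArg _ (decide_eq_decide.2 ?_)
      rw [Nat.le_div_iff_mul_le (by positivity), mul_comm]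
    · show s.t' / 2 ^ s.ls < 2 ^ (n + 2 - s.lr - s.ls)
      rw [Nat.div_lt_iff_lt_mul (by positivity), ← pow_add]
      exact (Nat.lt_size_self _).trans_le (pow_le_pow_two (by omega))
    · have hi' : i < n + 2 - s.lr - s.ls := hi
      show s.work1Cell n i = _
      unfold EEAState.work1Cell
      rw [hlq]
      split_ifs with i1 i2
      · rfl
      · omega
      · rw [testBit_of_size_le (by omega),
          Nat.testBit_lt_two_pow (ht.trans_le (pow_le_pow_two (by omega)))]
    · have hi' : i < n + 2 - s.lr - s.ls := hi
      show s.work2Cell n ((i + s.ls) % (n + 3)) = _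
      rw [Nat.mod_eq_of_lt (by omega), Nat.testBit_div_two_pow]
      unfold EEAState.work2Cell
      rw [if_pos (by omega)]
  have e₅ : run (shift n true) ((Conf.rot n { c with sg := b }).enc n) =
      (Conf.rot n { c with sg := b, ls := l }).enc n := by
    refine Eq.trans ?_ (run_shift_down (n := n) (c := { c with sg := b, ls := l }) (a := true) rfl
      h1 h2)
    refine congrArg (run _) (?_ : Conf.enc n _ = Conf.enc n _)
    exact enc_ext (fun _ _ => rfl) (fun i _ => by
        show s.work2Cell n ((i + s.ls) % (n + 3)) = s.work2Cell n ((i + (l + 1)) % (n + 3))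
        rw [hl]) rfl rfl rfl rfl hl rfl rfl rfl rfl rfl
  rw [basis_eq, basis_eq]
  have hfin : ((raw n s.arith y).rot n).enc n = (Conf.rot n { c with sg := b, ls := l }).enc n := by
    have ha : s.arith = { s with ls := s.ls - 1, sign := b } := by
      unfold EEAState.arith; rw [h1, h2]
    rw [ha, show s.ls - 1 = l by omega]
    exact enc_ext (fun i _ => by simp [Conf.rot, raw, hc, EEAState.work1Cell, hq, hlq])
      (fun _ _ => rfl) rfl rfl rfl rfl rfl rfl rfl rfl rfl rfl
  rw [hfin]
  exact run_trans (run_trans (run_trans (run_trans e₁ e₂) e₃) e₄) e₅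

theorem testBit_sub_pow_mul {r l m e : ℕ} (h : 2 ^ l * m ≤ r) (he : e < l) :
    (r - 2 ^ l * m).testBit e = r.testBit e := by
  have h1 : ∀ a : ℕ, a.testBit e = (a % 2 ^ l).testBit e := fun a => by
    rw [Nat.testBit_mod_two_pow]; simp [he]
  rw [h1, h1 r]
  congr 1
  conv_rhs => rw [← Nat.sub_add_cancel h]
  simp

theorem testBit_add_pow_mul {r l m e : ℕ} (he : e < l) :
    (r + 2 ^ l * m).testBit e = r.testBit e := by
  have h1 : ∀ a : ℕ, a.testBit e = (a % 2 ^ l).testBit e := fun a => by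
    rw [Nat.testBit_mod_two_pow]; simp [he]
  rw [h1, h1 r]
  simp

/-- Phase `(0, 1)`. -/
theorem run_arith_divide {s : EEAState} {y l : ℕ} (h1 : s.phase1 = false) (h2 : s.phase2 = true)
    (hsg : s.sign = false) (hl : s.ls = l + 1) (hls : s.ls < 2 ^ (Nat.log 2 n + 3))
    (hlq' : s.lq + 1 < 2 ^ (Nat.log 2 n + 2))
    (hlr' : s.lr < 2 ^ (Nat.log 2 n + 2)) (hlr : s.lr = Nat.size s.r') (hlr0 : 0 < s.lr)
    (ht1 : 1 ≤ s.lt) (ht' : s.t' < 2 ^ s.lt) (hlt : s.lt + s.lq + s.ls + s.lr ≤ n + 2)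
    (hltr : s.lt + s.lq + Nat.size s.r ≤ n + 2) (hr : s.r < 2 ^ s.ls * s.r')
    (hq : 2 ^ s.ls ∣ s.q) :
    run (arithCircuit n) (s.basis n y) = s.arith.basis n y := by
  set c₀ : Conf := { raw n s y with ls := l } with hc₀
  set c : Conf := { raw n s y with ls := l, lq := s.lq + 1 } with hc
  set v := s.lt + s.lq + l with hv
  have e₁ : run (shift n false) (((raw n s y).rot n).enc n) = (c₀.rot n).enc n := by
    refine Eq.trans ?_ (run_shift_down (n := n) (c := c₀) (a := false) rfl h1 h2)
    refine congrArg (run _) (?_ : Conf.enc n _ = Conf.enc n _)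
    exact enc_ext (fun _ _ => rfl) (fun i _ => by
        show s.work2Cell n ((i + s.ls) % (n + 3)) = s.work2Cell n ((i + (l + 1)) % (n + 3))
        rw [hl]) rfl rfl rfl rfl hl rfl rfl rfl rfl rfl
  have e₂ : run (incReg [lit n .phase1 false, lit n .phase2 true] .lenQ) ((c₀.rot n).enc n) =
      (c.rot n).enc n := run_incReg_lenQ_on (c := c₀.rot n) h1 h2
  set w : ℕ → Bool := fun j => if j = v + 1 then decide (s.r' ≤ s.r / 2 ^ l)
          else if s.r' ≤ s.r / 2 ^ l ∧ v + 2 ≤ j ∧ j ≤ n + 2 then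
            (s.r / 2 ^ l - s.r').testBit (n + 2 - j)
          else (align n c v).w1 j with hw
  have hle : s.r' ≤ s.r / 2 ^ l ↔ 2 ^ l * s.r' ≤ s.r := by
    rw [Nat.le_div_iff_mul_le (by positivity), mul_comm]
  have hcls : c.ls = l := rfl
  have hr' : s.r' < 2 ^ s.lr := hlr ▸ Nat.lt_size_self _
  set d : Conf := Conf.rot n { c with w1 := s.arith.work1Cell n, sg := s.sign } with hd
  have ha : s.arith = { s with
      ls := l, lq := s.lq + 1
      r := if 2 ^ l * s.r' ≤ s.r then s.r - 2 ^ l * s.r' else s.r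
      q := if 2 ^ l * s.r' ≤ s.r then s.q + 2 ^ l else s.q } := by
    unfold EEAState.arith
    rw [h1, h2, show s.ls - 1 = l by omega]
    dsimp only
    split_ifs <;> rfl
  have e₃ : run (aligned (quotientStage n)) ((c.rot n).enc n) = d.enc n := by
    refine run_aligned_align (v := v) (w := w) (b := s.sign)
      (w' := s.arith.work1Cell n) ?_ rfl (by
        show s.lt + (s.lq + 1) + l = _
        omega) (by show l < _; omega) (fun i hi => ?_)
    · have := run_quotientStage_divide (c := align n c v) (a := s.r') (b := s.r / 2 ^ l) rfl h1 h2
        hsg hlr' hlr0 (by show 1 ≤ v; omega) (by show v ≤ n; omega)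
        (hr'.trans_le (pow_le_pow_two (by show s.lr ≤ n + 1 - v; omega))) ?_ ?_
        (fun j hj => ?_) (fun j hj => ?_)
      · exact this.trans (enc_ext (fun _ _ => rfl) (fun _ _ => rfl) rfl rfl rfl rfl rfl rfl rfl rfl
          rfl
          rfl)
      · show _ < 2 ^ (n + 2 - v)
        rw [Nat.div_lt_iff_lt_mul (by positivity), ← pow_add]
        exact (Nat.lt_size_self _).trans_le (pow_le_pow_two (by omega))
      · rw [Nat.div_lt_iff_lt_mul (by positivity)]
        rw [hl, pow_succ] at hr
        calc s.r < _ := hr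
          _ = _ := by ring
      · have hj' : j < n + 3 - v := hj
        show s.work2Cell n (n + 2 - j) = _
        rw [work2Cell_right hlr (ht'.trans_le (pow_le_pow_two (by omega))) (by omega)]
        exact congrArg _ (by omega)
      · have hj' : j < n + 2 - v := hj
        rw [align_w1 (by omega) (by omega), Nat.testBit_div_two_pow, hcls]
        show s.work1Cell n (n + 2 - j - l) = _
        unfold EEAState.work1Cell
        rw [if_neg (by omega), if_neg (by omega)]
        exact congrArg _ (by omega)
    · -- The cell `i` of the new contents is compared with the cell `i + l` of the aligned register.
      rw [hcls, ha]
      have hwrap := align_w1_wrap (n := n) (c := c) (v := v) hi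
      rw [hcls] at hwrap
      simp only [hw, hwrap]
      have hc1 : c.w1 i = s.work1Cell n i := rfl
      rw [hc1]
      unfold EEAState.work1Cell
      dsimp only
      rw [hl]
      rcases Nat.lt_or_ge (i + l) (n + 3) with hil | hil
      · rw [Nat.mod_eq_of_lt hil]
        by_cases i1 : i ≤ s.lt
        · rw [if_neg (by omega), if_neg (by omega), if_pos i1, if_pos i1]
        by_cases i2 : i ≤ s.lt + s.lq
        · rw [if_neg (by omega), if_neg (by omega), if_neg i1, if_neg i1, if_pos i2,
            if_pos (by omega), show s.lt + (s.lq + 1) - i = s.lt + s.lq - i + 1 by omega]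
          obtain ⟨q, hq⟩ := hq
          rw [hl] at hq
          split_ifs
          · rw [hq, pow_succ, show 2 ^ l * 2 * q + 2 ^ l = 2 ^ l * (2 * q + 1) by ring,
              Nat.mul_div_cancel_left _ (by positivity), Nat.testBit_succ,
              Nat.mul_div_cancel_left _ (by positivity)]
            exact congrArg (fun z => Nat.testBit z (s.lt + s.lq - i)) (by omega)
          · rw [hq, pow_succ, Nat.mul_div_cancel_left _ (by positivity), Nat.testBit_succ,
              mul_assoc, Nat.mul_div_cancel_left _ (by positivity)]
            exact congrArg (fun z => Nat.testBit z (s.lt + s.lq - i)) (by omega)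
        by_cases i3 : i = s.lt + s.lq + 1
        · rw [if_pos (by omega), if_neg i1, if_pos (by omega),
            show s.lt + (s.lq + 1) - i = 0 by omega]
          obtain ⟨q, hq⟩ := hq
          rw [hl] at hq
          split_ifs with i4
          · rw [hq, pow_succ, show 2 ^ l * 2 * q + 2 ^ l = 2 ^ l * (2 * q + 1) by ring,
              Nat.mul_div_cancel_left _ (by positivity)]
            simp [hle, i4]
          · rw [hq, pow_succ, mul_assoc, Nat.mul_div_cancel_left _ (by positivity)]
            simp [hle, i4]
        · simp only [if_neg (show ¬ i + l = v + 1 by omega), if_neg i1, if_neg i2,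
            if_neg (show ¬ i ≤ s.lt + (s.lq + 1) by omega)]
          split_ifs with i4 i5 i5
          · rw [← Nat.sub_mul_div, Nat.testBit_div_two_pow]
            exact congrArg _ (by omega)
          · exact absurd (hle.1 i4.1) i5
          · exact absurd ⟨hle.2 i5, by omega, by omega⟩ i4
          · rfl
      · rw [show (i + l) % (n + 3) = i + l - (n + 3) by
          rw [Nat.mod_eq_sub_mod hil, Nat.mod_eq_of_lt (by omega)]]
        rw [if_neg (by omega), if_neg (by omega), if_neg (by omega), if_neg (by omega),
          if_neg (by omega), if_neg (by omega)]
        split_ifs with i5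
        · rw [testBit_sub_pow_mul i5 (by omega)]
        · rfl
  have hp1 : d.p1 = false := h1
  have e₄ : run (productStage n) (d.enc n) = d.enc n :=
    run_productStage_idle rfl h1 hlq' (by
      show 0 < s.lr + l; omega)
  have e₅ : run (shift n true) (d.enc n) = d.enc n := run_shift_idle rfl (by simp [hp1])
  rw [basis_eq, basis_eq]
  have hfin : ((raw n s.arith y).rot n).enc n = d.enc n := by
    rw [hd, ha]
    exact enc_ext (fun _ _ => rfl) (fun _ _ => rfl) rfl rfl rfl rfl rfl rfl rfl rfl rfl rfl
  rw [hfin]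
  exact run_trans (run_trans (run_trans (run_trans e₁ e₂) e₃) e₄) e₅

/-- Phase `(1, 0)`. -/
theorem run_arith_accumulate {s : EEAState} {y : ℕ} (h1 : s.phase1 = true) (h2 : s.phase2 = false)
    (hsg : s.sign = false) (hls : s.ls < 2 ^ (Nat.log 2 n + 3))
    (hlq' : s.lq < 2 ^ (Nat.log 2 n + 2)) (hlq0 : 0 < s.lq)
    (hlr' : s.lr < 2 ^ (Nat.log 2 n + 2)) (hlr0 : 0 < s.lr)
    (ht1 : 1 ≤ s.lt) (ht : s.t < 2 ^ s.lt) (ht' : s.t' < 2 ^ s.ls * s.t)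
    (hlt : s.lt + s.lq + s.ls + s.lr ≤ n + 2) (hr : Nat.size s.r ≤ s.lr)
    (hq : (s.q / 2 ^ s.ls).testBit (s.lq - 1) = true) :
    run (arithCircuit n) (s.basis n y) = s.arith.basis n y := by
  set c : Conf := raw n s y with hc
  have hp1 : c.p1 = true := h1
  have hp2 : c.p2 = false := h2
  set v := s.lt + s.lq + s.ls - 1 with hv
  have e₁ : run (shift n false) ((c.rot n).enc n) = (c.rot n).enc n :=
    run_shift_idle (c := c.rot n) rfl (by
      show s.phase1 ≠ false
      simp [h1])
  have e₂ : run (incReg [lit n .phase1 false, lit n .phase2 true] .lenQ) ((c.rot n).enc n) =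
      (c.rot n).enc n := run_incReg_lenQ_off (c := c.rot n) (Or.inl (by
        show s.phase1 ≠ false
        simp [h1]))
  have hcls : c.ls = s.ls := rfl
  set b := s.q.testBit s.ls with hb
  set w : ℕ → Bool := fun j => if j = v + 1 then false else (align n c v).w1 j with hw
  set c₁ : Conf := { c with w1 := s.arith.work1Cell n, sg := b } with hc₁
  have ha : s.arith = { s with
      ls := s.ls + 1, lq := s.lq - 1
      t' := if b = true then s.t' + 2 ^ s.ls * s.t else s.t'
      q := if b = true then s.q - 2 ^ s.ls else s.q } := by
    unfold EEAState.arith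
    rw [h1, h2]
    dsimp only
    split_ifs <;> rfl
  have hqn : (if b = true then s.q - 2 ^ s.ls else s.q) / 2 ^ (s.ls + 1) = s.q / 2 ^ s.ls / 2 := by
    rw [pow_succ, ← Nat.div_div_eq_div_mul]
    split_ifs with hbt
    · have : s.q / 2 ^ s.ls % 2 = 1 := by
        rw [hb, Nat.testBit_eq_decide_div_mod_eq, decide_eq_true_iff] at hbt
        exact hbt
      have h2 := Nat.sub_mul_div s.q (2 ^ s.ls) 1
      rw [mul_one] at h2
      rw [h2]
      clear_value b
      clear * - this
      generalize s.q / 2 ^ s.ls = z at *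
      omega
    · rfl
  have e₃ : run (aligned (quotientStage n)) ((c.rot n).enc n) = (c₁.rot n).enc n := by
    refine run_aligned_align (v := v) (w := w) (b := b)
      (w' := s.arith.work1Cell n) ?_ rfl (by
        show s.lt + s.lq + s.ls = _
        omega) hls (fun i hi => ?_)
    · rw [run_quotientStage_read (c := align n c v) rfl h1 h2 hsg hlr' (by show v ≤ n; omega)]
      have hread : (align n c v).w1 (v + 1) = b := by
        rw [align_w1 (by omega) (by omega), hcls]
        show s.work1Cell n (v + 1 - s.ls) = _
        unfold EEAState.work1Cell
        rw [if_neg (by omega), if_pos (by omega), show s.lt + s.lq - (v + 1 - s.ls) = 0 by omega,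
          Nat.testBit_div_two_pow, Nat.zero_add]
      exact enc_ext (fun _ _ => rfl) (fun _ _ => rfl) rfl rfl rfl rfl rfl rfl rfl rfl hread rfl
    · have hwrap := align_w1_wrap (n := n) (c := c) (v := v) hi
      rw [hcls] at hwrap
      rw [hcls, ha]
      simp only [hw, hwrap]
      have hc1 : c.w1 i = s.work1Cell n i := rfl
      rw [hc1]
      unfold EEAState.work1Cell
      dsimp only
      rw [hqn]
      have hidx : (i + s.ls) % (n + 3) = v + 1 ↔ i = s.lt + s.lq := by
        rcases Nat.lt_or_ge (i + s.ls) (n + 3) with hil | hil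
        · rw [Nat.mod_eq_of_lt hil]; omega
        · rw [Nat.mod_eq_sub_mod hil, Nat.mod_eq_of_lt (by omega)]; omega
      simp only [hidx]
      by_cases i1 : i ≤ s.lt
      · rw [if_neg (by omega), if_pos i1, if_pos i1]
      by_cases i2 : i < s.lt + s.lq
      · rw [if_neg (by omega), if_neg i1, if_neg i1, if_pos (by omega), if_pos (by omega),
          ← Nat.testBit_succ]
        exact congrArg _ (by omega)
      by_cases i3 : i = s.lt + s.lq
      · rw [if_pos i3, if_neg i1, if_neg (by omega), testBit_of_size_le (by omega)]
      · rw [if_neg i3, if_neg i1, if_neg i1, if_neg (by omega), if_neg (by omega)]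
  set c₂ : Conf := { c₁.rot n with lq := s.lq - 1 } with hc₂
  set d : Conf := { c₁ with lq := s.lq - 1, w2 := s.arith.work2Cell n, sg := false } with hd
  have hdiv : s.t' / 2 ^ s.ls < s.t := by
    rw [Nat.div_lt_iff_lt_mul (by positivity), mul_comm]; exact ht'
  have hcell : ∀ i ≤ s.lt, i + s.ls < n + 3 - s.lr := fun i hi => by omega
  have e₄ : run (productStage n) ((c₁.rot n).enc n) = (d.rot n).enc n := by
    have hp := run_productStage_accumulate (c := c₂) (x := s.t) (y := s.t' / 2 ^ s.ls) rfl h1 h2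
      (show s.lq - 1 < 2 ^ (Nat.log 2 n + 2) by omega) (by show 0 < s.lr + s.ls; omega)
        (by show s.lt ≤ n; omega)
      hdiv (by show _ < 2 ^ (s.lt + 1); rw [pow_succ]; omega) (fun i hi => ?_) (fun i hi => ?_) ?_
    · have hpre : (c₁.rot n).enc n = { c₂ with lq := c₂.lq + 1 }.enc n := by
        refine enc_ext (fun _ _ => rfl) (fun _ _ => rfl) rfl rfl ?_ rfl rfl rfl rfl rfl rfl rfl
        show s.lq = s.lq - 1 + 1
        omega
      rw [hpre]
      refine hp.trans ?_
      refine enc_ext (fun _ _ => rfl) (fun j hj => ?_) rfl rfl rfl rfl rfl rfl rfl rfl rfl rfl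
      show (if b = true ∧ j ≤ s.lt then (s.t + s.t' / 2 ^ s.ls).testBit j
        else s.work2Cell n ((j + s.ls) % (n + 3))) = s.arith.work2Cell n ((j + s.ls) % (n + 3))
      rw [ha]
      unfold EEAState.work2Cell
      dsimp only
      by_cases hbt : b = true
      · simp only [hbt, if_true, true_and]
        by_cases i1 : j ≤ s.lt
        · rw [if_pos i1, Nat.mod_eq_of_lt (by omega), if_pos (hcell j i1), ←
            Nat.testBit_div_two_pow,
            Nat.add_mul_div_left _ _ (by positivity), add_comm]
        · rw [if_neg i1]
          rcases Nat.lt_or_ge (j + s.ls) (n + 3) with hil | hil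
          · rw [Nat.mod_eq_of_lt hil]
            split_ifs
            · rw [← Nat.testBit_div_two_pow, ← Nat.testBit_div_two_pow,
                Nat.add_mul_div_left _ _ (by positivity), Nat.testBit_lt_two_pow,
                Nat.testBit_lt_two_pow]
              · exact lt_of_lt_of_le (by omega : _ < 2 ^ s.lt * 2) (by
                  rw [← pow_succ]; exact pow_le_pow_two (by omega))
              · exact (hdiv.trans ht).trans_le (pow_le_pow_two (by omega))
            · rfl
          · rw [show (j + s.ls) % (n + 3) = j + s.ls - (n + 3) by
              rw [Nat.mod_eq_sub_mod hil, Nat.mod_eq_of_lt (by omega)]]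
            rw [testBit_add_pow_mul (by omega)]
      · simp only [hbt, if_false, false_and, Bool.false_eq_true]
    · have hi' : i < s.lt + 1 := hi
      show s.arith.work1Cell n i = _
      rw [ha]
      unfold EEAState.work1Cell
      rw [if_pos (by show i ≤ s.lt; omega)]
    · have hi' : i < s.lt + 1 := hi
      show s.work2Cell n ((i + s.ls) % (n + 3)) = _
      rw [Nat.mod_eq_of_lt (by omega), Nat.testBit_div_two_pow]
      unfold EEAState.work2Cell
      rw [if_pos (hcell i (by omega))]
    · show s.arith.work1Cell n (s.lt + 1) = decide (0 < s.lq - 1)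
      rw [ha]
      unfold EEAState.work1Cell
      dsimp only
      rw [hqn, if_neg (by omega)]
      by_cases hq1 : s.lq = 1
      · rw [if_neg (by omega), testBit_of_size_le (by omega)]
        simp [hq1]
      · rw [if_pos (by omega), ← Nat.testBit_succ,
          show (s.lt + (s.lq - 1) - (s.lt + 1)).succ = s.lq - 1 by omega, hq]
        simp
        omega
  have e₅ : run (shift n true) ((d.rot n).enc n) = (Conf.rot n { d with ls := s.ls + 1 }).enc n :=
    run_shift_up rfl h1 h2
  rw [basis_eq, basis_eq]
  have hfin : ((raw n s.arith y).rot n).enc n = (Conf.rot n { d with ls := s.ls + 1 }).enc n := by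
    rw [hd, hc₁, ha]
    exact enc_ext (fun _ _ => rfl) (fun _ _ => rfl) rfl rfl rfl rfl rfl rfl rfl rfl hsg rfl
  rw [hfin]
  exact run_trans (run_trans (run_trans (run_trans e₁ e₂) e₃) e₄) e₅

/-! ### The whole step -/

theorem run_phaseStage_basis {s : EEAState} {y : ℕ} (hq : s.lq < 2 ^ (Nat.log 2 n + 2))
    (hr : s.lr < 2 ^ (Nat.log 2 n + 2)) (hs : s.ls < 2 ^ (Nat.log 2 n + 3)) :
    run (phaseStage n) (s.basis n y) = s.updatePhase.flipPhases.basis n y := by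
  rw [basis_eq, basis_eq, run_phaseStage (c := (raw n s y).rot n) hq hr hs]
  rcases Classical.propComplete (s.lq = 0 ∧ 0 < s.lr) with h1 | h1 <;>
  rcases Classical.propComplete (s.ls = 0) with h2 | h2 <;>
  refine enc_ext (fun _ _ => ?_) (fun _ _ => ?_) ?_ ?_ ?_ ?_ ?_ ?_ ?_ ?_ ?_ ?_ <;>
  simp only [EEAState.updatePhase, EEAState.flipPhases, h1, h2, if_true, if_false,
    Conf.updatePhases, Conf.rot, raw, decide_true, decide_false] <;>
  (cases s.phase1 <;> cases s.phase2 <;> cases s.sign <;> rfl)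

theorem run_endStage_basis {s : EEAState} {y : ℕ} (hq : s.lq = 0) (hs : s.ls = 0)
    (hlt : s.lt = Nat.size s.t) (hlr : s.lr = Nat.size s.r') (hn : s.lr ≤ n)
    (htr : Nat.size s.t + Nat.size s.r' ≤ n + 1) (htr' : Nat.size s.t' + Nat.size s.r' ≤ n + 1)
    (hrr : Nat.size s.r ≤ Nat.size s.r') (hr0 : 0 < Nat.size s.r')
    (htt : Nat.size s.t ≤ Nat.size s.t') :
    run (endStage n) (s.basis n y) = s.endIteration.basis n y := by
  set c : Conf := (raw n s y).rot n with hc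
  have hw1 : ∀ i, c.w1 i = s.work1Cell n i := fun _ => rfl
  have hw2 : ∀ i < n + 3, c.w2 i = s.work2Cell n i := fun i hi => by
    show s.work2Cell n ((i + s.ls) % (n + 3)) = _
    rw [hs, Nat.add_zero, Nat.mod_eq_of_lt hi]
  have hlr' : c.lr = s.lr := rfl
  rw [basis_eq, basis_eq, run_endStage (c := c) (t := s.t) (t' := s.t') (r := s.r) (r' := s.r') rfl
    hq hs hlt hlr hn htr htr' hrr hr0 (fun i hi => ?_) (fun i hi => ?_) (fun i hi h => ?_)
    (fun i hi h => ?_)]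
  · unfold EEAState.endIteration
    rw [if_pos ⟨hq, hs⟩]
    refine enc_ext (fun i hi => ?_) (fun i hi => ?_) rfl rfl rfl rfl rfl rfl rfl rfl rfl rfl
    · refine (hw2 i hi).trans ?_
      simp only [raw, Conf.rot]
      unfold EEAState.work1Cell EEAState.work2Cell
      dsimp only
      rw [hq]
      split_ifs
      · rfl
      · omega
      · rw [testBit_of_size_le (by omega), testBit_of_size_le (by omega)]
      · omega
      · omega
      · rfl
    · refine (hw1 i).trans ?_
      simp only [raw, Conf.rot, hs]
      rw [Nat.add_zero, Nat.mod_eq_of_lt hi]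
      unfold EEAState.work1Cell EEAState.work2Cell
      dsimp only
      rw [hq]
      split_ifs
      · rfl
      · omega
      · omega
      · omega
      · rw [testBit_of_size_le (by omega), testBit_of_size_le (by omega)]
      · rfl
  · rw [hw1]
    unfold EEAState.work1Cell
    rw [hlr'] at hi
    split_ifs
    · rfl
    · omega
    · rw [testBit_of_size_le (by omega), testBit_of_size_le (by omega)]
  · rw [hlr'] at hi
    rw [hw2 i (by omega)]
    unfold EEAState.work2Cell
    rw [if_pos (by omega)]
  · rw [hw1]
    unfold EEAState.work1Cell
    rw [if_neg (by omega), if_neg (by omega)]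
    exact congrArg _ (by omega)
  · rw [hw2 _ (by omega)]
    unfold EEAState.work2Cell
    split_ifs
    · rw [testBit_of_size_le (by omega), testBit_of_size_le (by omega)]
    · exact congrArg _ (by omega)

theorem run_endStage_basis_idle {s : EEAState} {y : ℕ} (hq : s.lq < 2 ^ (Nat.log 2 n + 2))
    (hs : s.ls < 2 ^ (Nat.log 2 n + 3)) (h : ¬ (s.lq = 0 ∧ s.ls = 0)) :
    run (endStage n) (s.basis n y) = s.endIteration.basis n y := by
  have : s.endIteration = s := by
    unfold EEAState.endIteration
    rw [if_neg h]
  rw [this, basis_eq]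
  exact run_endStage_idle (c := (raw n s y).rot n) rfl hq hs h

theorem run_stepCircuit {s : EEAState} {y : ℕ}
    (ha : run (arithCircuit n) (s.basis n y) = s.arith.basis n y)
    (hq : s.arith.lq < 2 ^ (Nat.log 2 n + 2)) (hr : s.arith.lr < 2 ^ (Nat.log 2 n + 2))
    (hs : s.arith.ls < 2 ^ (Nat.log 2 n + 3))
    (he : run (endStage n) (s.arith.updatePhase.flipPhases.basis n y) = s.step.basis n y) :
    run (stepCircuit n) (s.basis n y) = s.step.basis n y :=
  run_trans (run_trans ha (run_phaseStage_basis hq hr hs)) he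

end

/-! ### The extended Euclidean algorithm -/

/-- The data of one iteration of the extended Euclidean algorithm, that is, the variables `t`, `t'`,
`r`, `r'` and `iter` at its beginning. -/
structure IterData where
  t : ℕ
  u : ℕ
  r : ℕ
  v : ℕ
  it : Bool

namespace IterData

/-- The quotient of the iteration. -/
def quot (D : IterData) : ℕ := D.r / D.v

/-- The number of binary digits of the quotient, which is the number of steps of each phase. -/
def len (D : IterData) : ℕ := Nat.size D.quot

/-- The data of the following iteration. -/
def next (D : IterData) : IterData where
  t := D.u + D.quot * D.t
  u := D.t
  r := D.v
  v := D.r % D.v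
  it := !D.it

/-- The state in the first phase, after `j` steps. -/
def search (D : IterData) (j : ℕ) : EEAState where
  t := D.t
  q := 0
  r := D.r
  t' := D.u
  r' := D.v
  lt := Nat.size D.t
  lq := 0
  lr := Nat.size D.v
  ls := j
  phase1 := false
  phase2 := false
  iter := D.it
  sign := false

/-- The state in the second phase, with `j` digits of the quotient still to be computed. -/
def divide (D : IterData) (j : ℕ) : EEAState where
  t := D.t
  q := 2 ^ j * (D.quot / 2 ^ j)
  r := D.r % (2 ^ j * D.v)
  t' := D.u
  r' := D.v
  lt := Nat.size D.t
  lq := D.len - j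
  lr := Nat.size D.v
  ls := j
  phase1 := false
  phase2 := true
  iter := D.it
  sign := false

/-- The state in the third phase, with `j` digits of the quotient already consumed. -/
def accumulate (D : IterData) (j : ℕ) : EEAState where
  t := D.t
  q := 2 ^ j * (D.quot / 2 ^ j)
  r := D.r % D.v
  t' := D.u + D.quot % 2 ^ j * D.t
  r' := D.v
  lt := Nat.size D.t
  lq := D.len - j
  lr := Nat.size D.v
  ls := j
  phase1 := true
  phase2 := false
  iter := D.it
  sign := false

/-- The state in the fourth phase, with a shift by `j`. -/
def unshift (D : IterData) (j : ℕ) : EEAState where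
  t := D.t
  q := 0
  r := D.r % D.v
  t' := D.u + D.quot * D.t
  r' := D.v
  lt := Nat.size D.t
  lq := 0
  lr := Nat.size D.v
  ls := j
  phase1 := true
  phase2 := true
  iter := D.it
  sign := decide (j = D.len)

variable {D : IterData}

theorem pow_le_quot_iff {j : ℕ} : 2 ^ j ≤ D.quot ↔ j < D.len := Nat.lt_size.symm

theorem quot_lt_pow (h : D.len ≤ j) : D.quot < 2 ^ j := Nat.size_le.1 h

theorem step_search (hv : 0 < D.v) {j : ℕ} (hj : j + 1 ≤ D.len) :
    (D.search j).step = if j + 1 = D.len then D.divide D.len else D.search (j + 1) := by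
  have hs : D.r < 2 ^ (j + 1) * D.v ↔ j + 1 = D.len := by
    rw [← Nat.div_lt_iff_lt_mul hv, ← not_le]
    show ¬ 2 ^ (j + 1) ≤ D.quot ↔ _
    rw [pow_le_quot_iff]
    omega
  have hsz := Nat.size_pos.2 hv
  have ha : (D.search j).arith = { D.search j with
      ls := j + 1, sign := decide (j + 1 = D.len) } := by
    simp only [EEAState.arith, search, hs, Bool.false_xor]
  unfold EEAState.step
  rw [ha]
  split_ifs with h
  · have hlt := quot_lt_pow (D := D) le_rfl
    have : D.r < 2 ^ D.len * D.v := (Nat.div_lt_iff_lt_mul hv).1 hlt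
    simp [EEAState.updatePhase, EEAState.flipPhases, EEAState.endIteration, search, divide, h, hsz,
      Nat.div_eq_of_lt hlt, Nat.mod_eq_of_lt this, show D.len ≠ 0 by omega]
  · simp [EEAState.updatePhase, EEAState.flipPhases, EEAState.endIteration, search, h, hsz]

theorem step_search_of_eq_zero (hv : D.v = 0) (j : ℕ) : (D.search j).step = D.search (j + 1) := by
  simp [EEAState.step, EEAState.arith, EEAState.updatePhase, EEAState.flipPhases,
    EEAState.endIteration, search, hv]

theorem arith_divide (hv : 0 < D.v) {j : ℕ} (hj : j + 1 ≤ D.len) :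
    (D.divide (j + 1)).arith = { D.divide j with ls := j } := by
  have hm : D.r % (2 ^ (j + 1) * D.v) =
      D.r % (2 ^ j * D.v) + 2 ^ j * D.v * (D.r / (2 ^ j * D.v) % 2) := by
    rw [← Nat.mod_mul]; congr 1; ring
  have hlt := Nat.mod_lt D.r (show 2 ^ j * D.v > 0 by positivity)
  have hq : D.r / (2 ^ j * D.v) = D.quot / 2 ^ j := by
    rw [quot, Nat.div_div_eq_div_mul, mul_comm]
  have hq2 : D.quot / 2 ^ (j + 1) = D.quot / 2 ^ j / 2 := by
    rw [pow_succ, Nat.div_div_eq_div_mul]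
  have hdm := Nat.div_add_mod (D.quot / 2 ^ j) 2
  have hl : D.len - (j + 1) + 1 = D.len - j := by omega
  rcases Nat.mod_two_eq_zero_or_one (D.quot / 2 ^ j) with h | h
  · rw [hq, h] at hm
    have hneg : ¬ 2 ^ j * D.v ≤ D.r % (2 ^ (j + 1) * D.v) := by omega
    have hqq : 2 ^ (j + 1) * (D.quot / 2 ^ (j + 1)) = 2 ^ j * (D.quot / 2 ^ j) := by
      rw [hq2, pow_succ, mul_assoc]
      congr 1
      omega
    simp only [EEAState.arith, divide, Nat.add_sub_cancel, if_neg hneg, hl, hqq]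
    rw [hm]
    simp
  · rw [hq, h] at hm
    have hpos : 2 ^ j * D.v ≤ D.r % (2 ^ (j + 1) * D.v) := by omega
    have hqq : 2 ^ (j + 1) * (D.quot / 2 ^ (j + 1)) + 2 ^ j = 2 ^ j * (D.quot / 2 ^ j) := by
      rw [hq2, pow_succ, mul_assoc, ← Nat.mul_succ]
      congr 1
      omega
    simp only [EEAState.arith, divide, Nat.add_sub_cancel, if_pos hpos, hl, hqq]
    rw [hm]
    simp

theorem step_divide (hv : 0 < D.v) {j : ℕ} (hj : j + 1 ≤ D.len) :
    (D.divide (j + 1)).step = if j = 0 then D.accumulate 0 else D.divide j := by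
  unfold EEAState.step
  rw [arith_divide hv hj]
  have h0 : D.len - j ≠ 0 := by omega
  split_ifs with h
  · subst h
    simp [EEAState.updatePhase, EEAState.flipPhases, EEAState.endIteration, divide, accumulate,
      Nat.mod_one, show D.len ≠ 0 by omega]
  · simp [EEAState.updatePhase, EEAState.flipPhases, EEAState.endIteration, divide, h, h0]

theorem arith_accumulate {j : ℕ} :
    (D.accumulate j).arith = { D.accumulate (j + 1) with ls := j + 1 } := by
  have hm : D.quot % 2 ^ (j + 1) = D.quot % 2 ^ j + 2 ^ j * (D.quot / 2 ^ j % 2) := by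
    rw [← Nat.mod_mul, pow_succ]
  have hq2 : D.quot / 2 ^ (j + 1) = D.quot / 2 ^ j / 2 := by
    rw [pow_succ, Nat.div_div_eq_div_mul]
  have hdm := Nat.div_add_mod (D.quot / 2 ^ j) 2
  have hl : D.len - j - 1 = D.len - (j + 1) := by omega
  have hb : (2 ^ j * (D.quot / 2 ^ j)).testBit j = decide (D.quot / 2 ^ j % 2 = 1) := by
    rw [Nat.testBit_eq_decide_div_mod_eq, Nat.mul_div_cancel_left _ (by positivity)]
  rcases Nat.mod_two_eq_zero_or_one (D.quot / 2 ^ j) with h | h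
  · have hqq : 2 ^ j * (D.quot / 2 ^ j) = 2 ^ (j + 1) * (D.quot / 2 ^ (j + 1)) := by
      rw [hq2, pow_succ, mul_assoc]
      congr 1
      omega
    simp only [EEAState.arith, accumulate, hb, h]
    simp [hl, hm, h, hqq]
  · have hqq : 2 ^ j * (D.quot / 2 ^ j) - 2 ^ j = 2 ^ (j + 1) * (D.quot / 2 ^ (j + 1)) := by
      rw [hq2, pow_succ, mul_assoc, ← Nat.mul_sub_one]
      congr 1
      omega
    simp only [EEAState.arith, accumulate, hb, h, hl, hm, hqq]
    simp only [decide_true, if_true, mul_one, add_mul, add_assoc]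

theorem step_accumulate (hv : 0 < D.v) {j : ℕ} (hj : j + 1 ≤ D.len) :
    (D.accumulate j).step = if j + 1 = D.len then D.unshift D.len else D.accumulate (j + 1) := by
  have hsz := Nat.size_pos.2 hv
  unfold EEAState.step
  rw [arith_accumulate]
  split_ifs with h
  · have hlt := quot_lt_pow (D := D) le_rfl
    simp [EEAState.updatePhase, EEAState.flipPhases, EEAState.endIteration, accumulate, unshift, h,
      hsz, Nat.mod_eq_of_lt hlt, Nat.div_eq_of_lt hlt, show D.len ≠ 0 by omega]
  · simp [EEAState.updatePhase, EEAState.flipPhases, EEAState.endIteration, accumulate,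
      show ¬ D.len - (j + 1) = 0 by omega]

theorem pow_mul_le_iff (h : D.u < D.t) (j : ℕ) :
    2 ^ j * D.t ≤ D.u + D.quot * D.t ↔ j < D.len := by
  rw [← pow_le_quot_iff]
  constructor
  · intro h1
    by_contra h2
    have := Nat.mul_le_mul_right D.t (show D.quot + 1 ≤ 2 ^ j by omega)
    rw [add_mul] at this
    omega
  · intro h1
    have := Nat.mul_le_mul_right D.t h1
    omega

theorem arith_unshift (h : D.u < D.t) {j : ℕ} (hj : j + 1 ≤ D.len) :
    (D.unshift (j + 1)).arith = { D.unshift j with sign := true } := by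
  simp only [EEAState.arith, unshift, pow_mul_le_iff h, Nat.add_sub_cancel]
  rcases Nat.lt_or_ge (j + 1) D.len with h1 | h1
  · simp [h1, h1.ne]
  · simp [show j + 1 = D.len by omega]

theorem updatePhase_unshift (hv : 0 < D.v) {j : ℕ} (hj : j + 1 ≤ D.len) :
    ({ D.unshift j with sign := true } : EEAState).updatePhase.flipPhases =
      if j = 0 then { D.unshift 0 with phase1 := false, phase2 := false, sign := false }
      else D.unshift j := by
  have hsz := Nat.size_pos.2 hv
  split_ifs with h
  · subst h
    simp [EEAState.updatePhase, EEAState.flipPhases, unshift, hsz]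
  · simp [EEAState.updatePhase, EEAState.flipPhases, unshift, h, hsz]
    omega

theorem step_unshift (h : D.u < D.t) (hv : 0 < D.v) {j : ℕ} (hj : j + 1 ≤ D.len) :
    (D.unshift (j + 1)).step = if j = 0 then D.next.search 0 else D.unshift j := by
  unfold EEAState.step
  rw [arith_unshift h hj, updatePhase_unshift hv hj]
  split_ifs with h0
  · simp [EEAState.endIteration, unshift, search, next]
  · simp [EEAState.endIteration, unshift, h0]

end IterData

/-! ### Invariants of the algorithm -/

/-- The invariants at the beginning of an iteration, for the modulus `p` and the input `x`, when `K`
is the total number of digits of the quotients so far.  The bound `grow` shows that the algorithm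
takes at least `4 * n` steps, and `pot` that it takes at most `8 * n`. -/
structure IterData.Valid (D : IterData) (n p x K : ℕ) : Prop where
  sum : D.t * D.r + D.u * D.v = p
  u_lt : D.u < D.t
  v_lt : D.v < D.r
  coprime : Nat.Coprime D.r D.v
  half : 2 * D.v ≤ p
  big : 0 < D.u ∨ (0 < D.v ∧ 2 * D.v ≤ D.r)
  t_mul : (D.t * x : ZMod p) = if D.it then -(D.v : ZMod p) else D.v
  u_mul : (D.u * x : ZMod p) = if D.it then (D.r : ZMod p) else -D.r
  grow : D.u + D.t ≤ 2 ^ K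
  pot : 2 ^ K * (D.r * (D.r + D.v)) < 2 ^ (2 * n + 1)

namespace IterData.Valid

variable {D : IterData} {n p x K : ℕ}

theorem quot_pos (h : D.Valid n p x K) (hv : 0 < D.v) : 0 < D.quot :=
  Nat.div_pos h.v_lt.le hv

theorem len_pos (h : D.Valid n p x K) (hv : 0 < D.v) : 0 < D.len := Nat.size_pos.2 (h.quot_pos hv)

theorem next (h : D.Valid n p x K) (hv : 0 < D.v) : D.next.Valid n p x (K + D.len) := by
  have hdm : D.v * D.quot + D.r % D.v = D.r := Nat.div_add_mod D.r D.v
  have hlt := Nat.mod_lt D.r hv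
  have hq := h.quot_pos hv
  have hQ := IterData.quot_lt_pow (D := D) le_rfl
  have hQ' : 2 ^ D.len ≤ 2 * D.quot := by
    have h1 : 2 ^ (D.len - 1) ≤ D.quot :=
      IterData.pow_le_quot_iff.2 (Nat.sub_one_lt (h.len_pos hv).ne')
    calc 2 ^ D.len = 2 * 2 ^ (D.len - 1) := by
          rw [← pow_succ', Nat.sub_add_cancel (h.len_pos hv)]
      _ ≤ _ := by omega
  have ht := h.u_lt
  constructor
  · show (D.u + D.quot * D.t) * D.v + D.t * (D.r % D.v) = p
    rw [← h.sum]
    conv_rhs => rw [← hdm]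
    ring
  -- If `u` is `0`, in the first iteration, the quotient is at least `2`, as `2 * v ≤ r`.
  · show D.t < D.u + D.quot * D.t
    rcases h.big with hu | ⟨_, h2⟩
    · have := Nat.mul_le_mul_right D.t (show 1 ≤ D.quot from hq)
      omega
    · have := Nat.mul_le_mul_right D.t (show 2 ≤ D.quot from (Nat.le_div_iff_mul_le hv).2 h2)
      omega
  · exact hlt
  · show Nat.Coprime D.v (D.r % D.v)
    rw [Nat.coprime_comm]
    have := h.coprime
    unfold Nat.Coprime at *
    rwa [← Nat.gcd_rec, Nat.gcd_comm]
  · have := h.half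
    show 2 * (D.r % D.v) ≤ p
    omega
  · left
    show 0 < D.t
    omega
  · have h1 := h.t_mul
    have h2 := h.u_mul
    have h3 : (D.v : ZMod p) * D.quot + (D.r % D.v : ℕ) = D.r := by exact_mod_cast congrArg _ hdm
    show (((D.u + D.quot * D.t : ℕ) : ZMod p) * x) = if !D.it then -((D.r % D.v : ℕ) : ZMod p)
      else (D.r % D.v : ℕ)
    push_cast
    rw [add_mul, h2, mul_assoc, h1, ← h3]
    cases D.it <;> simp <;> ring
  · have h1 := h.t_mul
    show ((D.t : ZMod p) * x) = if !D.it then (D.v : ZMod p) else -(D.v : ZMod p)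
    rw [h1]
    cases D.it <;> simp
  -- The sum `t + u` grows at most by the factor `quot + 1 ≤ 2 ^ len`.
  · show D.t + (D.u + D.quot * D.t) ≤ _
    rw [pow_add]
    calc D.t + (D.u + D.quot * D.t) ≤ (D.u + D.t) * (D.quot + 1) := by nlinarith
      _ ≤ _ := Nat.mul_le_mul h.grow hQ
  -- As `2 ^ len ≤ 2 * quot`, it suffices that `2 * quot * v * (v + w) ≤ r * (r + v)`, where `w` is
  -- the remainder.  This holds because `r = quot * v + w` and `v ≤ quot * v`.
  · refine lt_of_le_of_lt ?_ h.pot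
    show 2 ^ (K + D.len) * (D.v * (D.v + D.r % D.v)) ≤ _
    rw [pow_add, mul_assoc]
    refine Nat.mul_le_mul_left _ ?_
    refine (Nat.mul_le_mul_right _ hQ').trans ?_
    have h4 : D.v ≤ D.v * D.quot := Nat.le_mul_of_pos_right _ hq
    rw [show 2 * D.quot * (D.v * (D.v + D.r % D.v)) =
      D.v * D.quot * (2 * D.v + 2 * (D.r % D.v)) by ring]
    generalize D.r % D.v = w at *
    generalize D.v * D.quot = b at *
    rw [← hdm]
    have h5 := Nat.mul_le_mul_left b h4
    nlinarith [Nat.zero_le (w * w), Nat.zero_le (w * D.v)]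

theorem size_le_of_lt {m k : ℕ} (h : m < 2 ^ k) : Nat.size m ≤ k := Nat.size_le.2 h

theorem pow_size_le {m : ℕ} (h : 0 < m) : 2 ^ Nat.size m ≤ 2 * m := by
  have h0 := Nat.size_pos.2 h
  have h1 : 2 ^ (Nat.size m - 1) ≤ m := Nat.lt_size.1 (by omega)
  calc 2 ^ Nat.size m = 2 * 2 ^ (Nat.size m - 1) := by rw [← pow_succ', Nat.sub_add_cancel h0]
    _ ≤ _ := by omega

/-- Two factors of a number of `n` binary digits have at most `n + 1` digits together. -/
theorem size_add_size_le {a b : ℕ} (ha : 0 < a) (hb : 0 < b) (h : a * b < 2 ^ n) :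
    Nat.size a + Nat.size b ≤ n + 1 := by
  have h1 := Nat.mul_le_mul (pow_size_le ha) (pow_size_le hb)
  have h2 : 2 ^ (Nat.size a + Nat.size b) < 2 ^ (n + 2) := by
    rw [pow_add, pow_add]
    nlinarith
  have := (Nat.pow_lt_pow_iff_right (by omega : 1 < 2)).1 h2
  omega

theorem t_pos (h : D.Valid n p x K) : 0 < D.t := by have := h.u_lt; omega

theorem r_pos (h : D.Valid n p x K) : 0 < D.r := by have := h.v_lt; omega

theorem size_t_add_size_r (h : D.Valid n p x K) (hp : p < 2 ^ n) :
    Nat.size D.t + Nat.size D.r ≤ n + 1 :=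
  size_add_size_le h.t_pos h.r_pos (lt_of_le_of_lt (by have := h.sum; omega) hp)

theorem len_add_size_v (hv : 0 < D.v) (hl : 0 < D.len) : D.len + Nat.size D.v ≤ Nat.size D.r + 1 :=
    by
  have h1 : 2 ^ (D.len - 1) ≤ D.quot := IterData.pow_le_quot_iff.2 (by omega)
  have h2 : D.quot * D.v ≤ D.r := Nat.div_mul_le_self _ _
  have h3 := Nat.size_pos.2 hv
  have h4 : 2 ^ (Nat.size D.v - 1) ≤ D.v := Nat.lt_size.1 (by omega)
  have h5 : D.len - 1 + (Nat.size D.v - 1) < Nat.size D.r := by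
    rw [Nat.lt_size, pow_add]
    exact (Nat.mul_le_mul h1 h4).trans h2
  omega

theorem total_size (h : D.Valid n p x K) (hp : p < 2 ^ n) (hv : 0 < D.v) :
    Nat.size D.t + D.len + Nat.size D.v ≤ n + 2 := by
  have := h.size_t_add_size_r hp
  have := len_add_size_v hv (h.len_pos hv)
  omega

theorem size_next_t (h : D.Valid n p x K) (hp : p < 2 ^ n) (hv : 0 < D.v) :
    Nat.size (D.u + D.quot * D.t) + Nat.size D.v ≤ n + 1 :=
  size_add_size_le (h.next hv).t_pos hv (lt_of_le_of_lt (by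
    have := (h.next hv).sum
    simp only [IterData.next] at this
    omega) hp)

theorem size_v_lt (h : D.Valid n p x K) (hp : p < 2 ^ n) (hn : 0 < n) : Nat.size D.v + 1 ≤ n := by
  have : Nat.size D.v ≤ n - 1 := by
    refine size_le_of_lt ?_
    have h1 := h.half
    have h2 : 2 ^ n = 2 * 2 ^ (n - 1) := by rw [← pow_succ', Nat.sub_add_cancel hn]
    omega
  omega

theorem size_mod_le (hv : 0 < D.v) : Nat.size (D.r % D.v) ≤ Nat.size D.v :=
  Nat.size_le_size (Nat.mod_lt _ hv).le

/-- The invariant `pot` for the following iteration bounds the number of digits. -/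
theorem len_add_K_le (h : D.Valid n p x K) (hv : 0 < D.v) : K + D.len ≤ 2 * n := by
  have h1 := (h.next hv).pot
  have h2 : 1 ≤ D.next.r * (D.next.r + D.next.v) := by
    have := (h.next hv).r_pos
    nlinarith
  have h3 : 2 ^ (K + D.len) < 2 ^ (2 * n + 1) :=
    lt_of_le_of_lt (Nat.le_mul_of_pos_right _ h2) h1
  have := (Nat.pow_lt_pow_iff_right (by omega : 1 < 2)).1 h3
  omega

theorem r_eq_one (h : D.Valid n p x K) (hv : D.v = 0) : D.r = 1 := by
  have := h.coprime
  rwa [hv, Nat.coprime_zero_right] at this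

theorem t_eq (h : D.Valid n p x K) (hv : D.v = 0) : D.t = p := by
  have := h.sum
  rw [hv, h.r_eq_one hv] at this
  omega

/-- At termination `2 ^ (n - 1) < p + u = t + u ≤ 2 ^ K`. -/
theorem K_ge (h : D.Valid n p x K) (hv : D.v = 0) (hp : 2 ^ (n - 1) ≤ p) : n ≤ K := by
  have h1 := h.grow
  have h2 : 0 < D.u := by rcases h.big with h | ⟨h, _⟩ <;> omega
  rw [h.t_eq hv] at h1
  have := (Nat.pow_lt_pow_iff_right (by omega : 1 < 2)).1 (show 2 ^ (n - 1) < 2 ^ K by omega)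
  omega

theorem size_t (hn : 0 < n) (h : D.Valid n p x K) (hv : D.v = 0) (hp : 2 ^ (n - 1) ≤ p)
    (hp' : p < 2 ^ n) : Nat.size D.t = n := by
  rw [h.t_eq hv]
  refine le_antisymm (size_le_of_lt hp') ?_
  have := Nat.lt_size.2 hp
  omega

end IterData.Valid

/-- The state `s` occurs after `T` steps, in the iteration with the data `D` and with `K` digits of
quotients in the previous iterations. -/
inductive Occurs (D : IterData) (K : ℕ) : ℕ → EEAState → Prop
  | search (j : ℕ) (h : 0 < D.v → j < D.len) : Occurs D K (4 * K + j) (D.search j)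
  | divide (i j : ℕ) (hv : 0 < D.v) (h : i + (j + 1) = D.len) :
    Occurs D K (4 * K + D.len + i) (D.divide (j + 1))
  | accumulate (j : ℕ) (hv : 0 < D.v) (h : j < D.len) :
    Occurs D K (4 * K + 2 * D.len + j) (D.accumulate j)
  | unshift (i j : ℕ) (hv : 0 < D.v) (h : i + (j + 1) = D.len) :
    Occurs D K (4 * K + 3 * D.len + i) (D.unshift (j + 1))

/-- A step leads to the next step of the same phase, or to the next phase, or after the fourth phase
to the following iteration. -/
theorem Occurs.step {D : IterData} {n p x K T : ℕ} {s : EEAState} (h : D.Valid n p x K)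
    (hs : Occurs D K T s) :
    ∃ D' K', D'.Valid n p x K' ∧ Occurs D' K' (T + 1) s.step := by
  cases hs with
  | search j hj =>
    rcases Nat.eq_zero_or_pos D.v with hv | hv
    · refine ⟨D, K, h, ?_⟩
      rw [IterData.step_search_of_eq_zero hv]
      exact .search (j + 1) (fun h => by omega)
    · refine ⟨D, K, h, ?_⟩
      have := hj hv
      rw [IterData.step_search hv (by omega)]
      split_ifs with h1
      · have := Occurs.divide (D := D) (K := K) 0 j hv (by omega)
        rw [h1] at this
        rwa [add_assoc, h1]
      · exact .search (j + 1) (fun _ => by omega)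
  | divide i j hv hj =>
    refine ⟨D, K, h, ?_⟩
    rw [IterData.step_divide hv (by omega)]
    split_ifs with h1
    · have := Occurs.accumulate (D := D) (K := K) 0 hv (by omega)
      rwa [show 4 * K + 2 * D.len + 0 = 4 * K + D.len + i + 1 by omega] at this
    · obtain ⟨j, rfl⟩ := Nat.exists_eq_succ_of_ne_zero h1
      exact .divide (i + 1) j hv (by omega)
  | accumulate j hv hj =>
    refine ⟨D, K, h, ?_⟩
    rw [IterData.step_accumulate hv (by omega)]
    split_ifs with h1
    · have := Occurs.unshift (D := D) (K := K) 0 j hv (by omega)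
      rw [h1] at this
      rwa [show 4 * K + 2 * D.len + j + 1 = 4 * K + 3 * D.len + 0 by omega]
    · exact .accumulate (j + 1) hv (by omega)
  | unshift i j hv hj =>
    rw [IterData.step_unshift h.u_lt hv (by omega)]
    split_ifs with h1
    · refine ⟨D.next, K + D.len, h.next hv, ?_⟩
      have := Occurs.search (D := D.next) (K := K + D.len) 0 fun hv' => (h.next hv).len_pos hv'
      rwa [show 4 * (K + D.len) + 0 = 4 * K + 3 * D.len + i + 1 by omega] at this
    · refine ⟨D, K, h, ?_⟩
      obtain ⟨j, rfl⟩ := Nat.exists_eq_succ_of_ne_zero h1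
      exact .unshift (i + 1) j hv (by omega)

/-- The data of the first iteration. -/
def startData (p x : ℕ) : IterData where
  t := 1
  u := 0
  r := p
  v := if p < 2 * x then p - x else x
  it := decide (p < 2 * x)

theorem start_eq (p x : ℕ) : EEAState.start p x = (startData p x).search 0 := by
  simp [EEAState.start, startData, IterData.search]

theorem valid_start {n p x : ℕ} (hp : p.Prime) (hpn : p < 2 ^ n) (hx : 0 < x) (hxp : x < p) :
    (startData p x).Valid n p x 0 := by
  have h2 := hp.two_le
  set v := if p < 2 * x then p - x else x with hv
  have hv0 : 0 < v := by rw [hv]; split_ifs <;> omega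
  have hvp : 2 * v ≤ p := by rw [hv]; split_ifs <;> omega
  have hv' : (startData p x).v = v := rfl
  constructor
  · simp [startData]
  · simp [startData]
  · show v < p
    omega
  · show Nat.Coprime p v
    exact (Nat.Prime.coprime_iff_not_dvd hp).2 (Nat.not_dvd_of_pos_of_lt hv0 (by omega))
  · exact hvp
  · exact Or.inr ⟨hv0, hvp⟩
  · rw [hv', hv]
    simp only [startData, decide_eq_true_eq]
    split_ifs with h
    · rw [Nat.cast_sub (by omega)]
      simp
    · simp
  · simp [startData]
  · simp [startData]
  · rw [hv']
    show 2 ^ 0 * (p * (p + v)) < _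
    have h1 : p * (p + v) < 2 ^ n * (2 ^ n + 2 ^ n) := by
      apply Nat.mul_lt_mul'' hpn
      omega
    calc _ = p * (p + v) := by ring
      _ < _ := h1
      _ = _ := by rw [pow_succ, pow_mul']; ring

theorem occurs_after {n p x : ℕ} (hp : p.Prime) (hpn : p < 2 ^ n) (hx : 0 < x) (hxp : x < p)
    (T : ℕ) : ∃ D K, D.Valid n p x K ∧ Occurs D K T (EEAState.after p x T) := by
  induction T with
  | zero =>
    refine ⟨startData p x, 0, valid_start hp hpn hx hxp, ?_⟩
    show Occurs _ _ _ (EEAState.start p x)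
    rw [start_eq]
    exact .search 0 fun hv => (valid_start hp hpn hx hxp).len_pos hv
  | succ T ih =>
    obtain ⟨D, K, h, hs⟩ := ih
    unfold EEAState.after at *
    rw [Function.iterate_succ_apply']
    exact hs.step h

/-- After `8 * n` steps the algorithm has terminated. -/
theorem terminated {n p x : ℕ} (hp : p.Prime) (hpn : p < 2 ^ n) (hx : 0 < x) (hxp : x < p) :
    ∃ (D : IterData) (K j : ℕ), D.Valid n p x K ∧ D.v = 0 ∧ 4 * K + j = 8 * n ∧
      EEAState.after p x (8 * n) = D.search j := by
  obtain ⟨D, K, h, hs⟩ := occurs_after hp hpn hx hxp (8 * n)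
  generalize hT : 8 * n = T at hs
  generalize EEAState.after p x T = s at hs
  cases hs with
  | search j hj =>
    rcases Nat.eq_zero_or_pos D.v with hv | hv
    · exact ⟨D, K, j, h, hv, rfl, rfl⟩
    · have := h.len_add_K_le hv
      have := hj hv
      omega
  | divide i j hv hj =>
    have := h.len_add_K_le hv
    omega
  | accumulate j hv hj =>
    have := h.len_add_K_le hv
    omega
  | unshift i j hv hj =>
    have := h.len_add_K_le hv
    omega

/-- At termination `r = 1`, so the congruence for `u * x` says that `u` or `-u` is the inverse of
`x`. -/
theorem inverse_eq {D : IterData} {n p x K : ℕ} (hp : p.Prime)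
    (h : D.Valid n p x K) (hv : D.v = 0) :
    ((x : ZMod p)⁻¹).val = if D.it then D.u else p - D.u := by
  have := Fact.mk hp
  have hu : D.u < p := h.t_eq hv ▸ h.u_lt
  have hu0 : 0 < D.u := by rcases h.big with h | ⟨h, _⟩ <;> omega
  have h1 := h.u_mul
  rw [h.r_eq_one hv, Nat.cast_one] at h1
  split_ifs with hit
  · rw [if_pos hit] at h1
    rw [← eq_inv_of_mul_eq_one_left h1, ZMod.val_natCast, Nat.mod_eq_of_lt hu]
  · rw [if_neg hit] at h1
    have h2 : ((p - D.u : ℕ) : ZMod p) * x = 1 := by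
      rw [Nat.cast_sub hu.le]
      simp [h1]
    rw [← eq_inv_of_mul_eq_one_left h2, ZMod.val_natCast, Nat.mod_eq_of_lt (by omega)]

section

variable {n : ℕ} [NeZero n]

theorem lt_two_pow_log : n < 2 ^ (Nat.log 2 n + 1) := Nat.lt_pow_succ_log_self (by omega) n

theorem updatePhase_flipPhases_lq (s : EEAState) : s.updatePhase.flipPhases.lq = s.lq := by
  unfold EEAState.updatePhase EEAState.flipPhases
  split_ifs <;> rfl

theorem updatePhase_flipPhases_ls (s : EEAState) : s.updatePhase.flipPhases.ls = s.ls := by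
  unfold EEAState.updatePhase EEAState.flipPhases
  split_ifs <;> rfl

theorem run_stepCircuit_within {s : EEAState} {y lq lr ls : ℕ} (hlq : s.arith.lq = lq)
    (hlr : s.arith.lr = lr) (hls : s.arith.ls = ls)
    (ha : run (arithCircuit n) (s.basis n y) = s.arith.basis n y)
    (hq : lq < 2 ^ (Nat.log 2 n + 2)) (hr : lr < 2 ^ (Nat.log 2 n + 2))
    (hs : ls < 2 ^ (Nat.log 2 n + 3)) (h : ¬ (lq = 0 ∧ ls = 0)) :
    run (stepCircuit n) (s.basis n y) = s.step.basis n y := by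
  subst hlq hlr hls
  refine run_stepCircuit ha hq hr hs (run_endStage_basis_idle ?_ ?_ ?_) <;>
  simpa only [updatePhase_flipPhases_ls, updatePhase_flipPhases_lq]

/-- The bound `T < 8 * n` serves the idle steps after termination: there `4 * K + j = T` and
`n ≤ K`, so the shift `j` is less than `4 * n` and does not overflow. -/
theorem run_stepCircuit_occurs {D : IterData} {p x K T y : ℕ} {s : EEAState} (hp : 2 ^ (n - 1) ≤ p)
    (hpn : p < 2 ^ n) (h : D.Valid n p x K) (hs : Occurs D K T s) (hT : T < 8 * n) :
    run (stepCircuit n) (s.basis n y) = s.step.basis n y := by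
  have hn : 0 < n := Nat.pos_of_neZero n
  have hlog := lt_two_pow_log (n := n)
  have hlog2 : 2 ^ (Nat.log 2 n + 2) = 2 * 2 ^ (Nat.log 2 n + 1) := by rw [← pow_succ']
  have hlog3 : 2 ^ (Nat.log 2 n + 3) = 4 * 2 ^ (Nat.log 2 n + 1) := by
    rw [show Nat.log 2 n + 3 = 2 + (Nat.log 2 n + 1) by ring, pow_add]
    rfl
  have hL2 : ∀ {m : ℕ}, m ≤ 2 * n → m < 2 ^ (Nat.log 2 n + 2) := fun h => by omega
  have hL3 : ∀ {m : ℕ}, m ≤ 4 * n → m < 2 ^ (Nat.log 2 n + 3) := fun h => by omega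
  clear hlog hlog2 hlog3
  have htr := h.size_t_add_size_r hpn
  have hvn := h.size_v_lt hpn hn
  have ht1 : 1 ≤ Nat.size D.t := Nat.size_pos.2 h.t_pos
  have ht2 := Nat.lt_size_self D.t
  have hut := h.u_lt
  cases hs with
  | search j hj =>
    have hjs : j + 1 ≤ 4 * n := by
      rcases Nat.eq_zero_or_pos D.v with hv | hv
      · have := h.K_ge hv hp
        omega
      · have := hj hv
        have := h.total_size hpn hv
        omega
    refine run_stepCircuit_within (lq := 0) (lr := Nat.size D.v) (ls := j + 1) rfl rfl rfl
      (run_arith_search rfl rfl rfl rfl ?_ ?_ rfl fun h0 => ?_) ?_ ?_ ?_ (by omega)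
    · exact hL3 (by omega : j + 1 ≤ 4 * n)
    · exact hL2 (by omega : Nat.size D.v ≤ 2 * n)
    · have h0' : 0 < Nat.size D.v := h0
      have hv := Nat.size_pos.1 h0'
      have h1 := hj hv
      have h2 := h.total_size hpn hv
      exact ⟨ht1, (by omega : Nat.size D.t + (j + 1) + Nat.size D.v ≤ n + 2), ht2,
        (by omega : D.u < 2 ^ Nat.size D.t), (by omega : Nat.size D.t + Nat.size D.r ≤ n + 2)⟩
    · exact hL2 (by omega)
    · exact hL2 (by omega)
    · exact hL3 (by omega)
  | divide i j hv hj =>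
    have htot := h.total_size hpn hv
    have hv0 := Nat.size_pos.2 hv
    have hmod := Nat.mod_lt D.r (show 2 ^ (j + 1) * D.v > 0 by positivity)
    have hsr : Nat.size (D.r % (2 ^ (j + 1) * D.v)) ≤ j + 1 + Nat.size D.v := by
      refine Nat.size_le.2 (hmod.trans ?_)
      rw [pow_add 2 (j + 1)]
      exact Nat.mul_lt_mul_of_pos_left (Nat.lt_size_self _) (by positivity)
    refine run_stepCircuit_within (lq := D.len - j) (lr := Nat.size D.v) (ls := j) ?_ ?_ ?_
      (run_arith_divide (l := j) rfl rfl rfl rfl ?_ ?_ ?_ rfl hv0 ht1 ?_ ?_ ?_ hmod ?_)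
      ?_ ?_ ?_ (by omega)
    · rw [IterData.arith_divide hv (by omega)]; rfl
    · rw [IterData.arith_divide hv (by omega)]; rfl
    · rw [IterData.arith_divide hv (by omega)]
    · exact hL3 (by omega : j + 1 ≤ 4 * n)
    · exact hL2 (by omega : D.len - (j + 1) + 1 ≤ 2 * n)
    · exact hL2 (by omega : Nat.size D.v ≤ 2 * n)
    · exact (by omega : D.u < 2 ^ Nat.size D.t)
    · exact (by omega : Nat.size D.t + (D.len - (j + 1)) + (j + 1) + Nat.size D.v ≤ n + 2)
    · show Nat.size D.t + (D.len - (j + 1)) + Nat.size (D.r % (2 ^ (j + 1) * D.v)) ≤ n + 2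
      omega
    · exact Dvd.intro _ rfl
    · exact hL2 (by omega)
    · exact hL2 (by omega)
    · exact hL3 (by omega)
  | accumulate j hv hj =>
    have htot := h.total_size hpn hv
    have hv0 := Nat.size_pos.2 hv
    refine run_stepCircuit_within (lq := D.len - (j + 1)) (lr := Nat.size D.v) (ls := j + 1) ?_ ?_
        ?_
      (run_arith_accumulate rfl rfl rfl ?_ ?_ ?_ ?_ hv0 ht1 ht2 ?_ ?_
        (IterData.Valid.size_mod_le hv) ?_) ?_ ?_ ?_ (by omega)
    · rw [IterData.arith_accumulate]; rfl
    · rw [IterData.arith_accumulate]; rfl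
    · rw [IterData.arith_accumulate]
    · exact hL3 (by omega : j ≤ 4 * n)
    · exact hL2 (by omega : D.len - j ≤ 2 * n)
    · exact (by omega : 0 < D.len - j)
    · exact hL2 (by omega : Nat.size D.v ≤ 2 * n)
    · show D.u + D.quot % 2 ^ j * D.t < 2 ^ j * D.t
      have h1 := Nat.mod_lt D.quot (show 2 ^ j > 0 by positivity)
      have h2 := Nat.mul_le_mul_right D.t (show D.quot % 2 ^ j + 1 ≤ 2 ^ j from h1)
      rw [add_mul] at h2
      omega
    · exact (by omega : Nat.size D.t + (D.len - j) + j + Nat.size D.v ≤ n + 2)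
    · show (2 ^ j * (D.quot / 2 ^ j) / 2 ^ j).testBit (D.len - j - 1) = true
      rw [Nat.mul_div_cancel_left _ (by positivity), Nat.testBit_div_two_pow,
        show D.len - j - 1 + j = D.len - 1 by omega, Nat.testBit_eq_decide_div_mod_eq]
      have h1 : 2 ^ (D.len - 1) ≤ D.quot := IterData.pow_le_quot_iff.2 (by omega)
      have h2 : D.quot < 2 ^ (D.len - 1) * 2 := by
        rw [← pow_succ, Nat.sub_add_cancel (by omega)]
        exact IterData.quot_lt_pow le_rfl
      rw [Nat.div_eq_of_lt_le (k := 1) (by omega) (by omega)]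
      rfl
    · exact hL2 (by omega)
    · exact hL2 (by omega)
    · exact hL3 (by omega)
  | unshift i j hv hj =>
    have htot := h.total_size hpn hv
    have hnt := h.size_next_t hpn hv
    have hv0 := Nat.size_pos.2 hv
    have ha : run (arithCircuit n) ((D.unshift (j + 1)).basis n y) =
        (D.unshift (j + 1)).arith.basis n y := by
      refine run_arith_unshift (l := j) rfl rfl rfl rfl rfl ?_ ?_ hv0 ht2 ?_ ht1 ?_
        (IterData.Valid.size_mod_le hv)
      · exact hL3 (by omega : j + 1 ≤ 4 * n)
      · exact hL2 (by omega : Nat.size D.v ≤ 2 * n)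
      · exact (by omega : Nat.size D.t + (j + 1) + Nat.size D.v ≤ n + 2)
      · exact (by omega : Nat.size (D.u + D.quot * D.t) + Nat.size D.v ≤ n + 2)
    have har := IterData.arith_unshift (D := D) h.u_lt (j := j) (by omega)
    rcases Nat.eq_zero_or_pos j with rfl | hj0
    · refine run_stepCircuit ha ?_ ?_ ?_ ?_
      · rw [har]; exact hL2 (by omega : 0 ≤ 2 * n)
      · rw [har]; exact hL2 (by omega : Nat.size D.v ≤ 2 * n)
      · rw [har]; exact hL3 (by omega : 0 ≤ 4 * n)
      · unfold EEAState.step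
        rw [har, IterData.updatePhase_unshift hv (by omega), if_pos rfl]
        exact run_endStage_basis rfl rfl rfl rfl (by omega : Nat.size D.v ≤ n)
          (by omega : Nat.size D.t + Nat.size D.v ≤ n + 1) hnt (IterData.Valid.size_mod_le hv) hv0
          (Nat.size_le_size (h.next hv).u_lt.le)
    · refine run_stepCircuit_within (lq := 0) (lr := Nat.size D.v) (ls := j) ?_ ?_ ?_ ha ?_ ?_ ?_
        (by omega)
      · rw [har]; rfl
      · rw [har]; rfl
      · rw [har]; rfl
      · exact hL2 (by omega)
      · exact hL2 (by omega)
      · exact hL3 (by omega)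

theorem run_stepCircuit_after {p x T y : ℕ} (hp : p.Prime) (hpn' : 2 ^ (n - 1) ≤ p)
    (hpn : p < 2 ^ n) (hx : 0 < x) (hxp : x < p) (hT : T < 8 * n) :
    run (stepCircuit n) ((EEAState.after p x T).basis n y) =
      (EEAState.after p x (T + 1)).basis n y := by
  obtain ⟨D, K, h, hs⟩ := occurs_after hp hpn hx hxp T
  rw [run_stepCircuit_occurs hpn' hpn h hs hT]
  unfold EEAState.after
  rw [Function.iterate_succ_apply']

/-! ### Preparation and copying -/

/-- Adds the bits `f i` to the cells of the first work register. -/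
def xorConst (n : ℕ) [NeZero n] (f : ℕ → Bool) : Circuit (Qubit n) :=
  seq (n + 3) fun i => if f i then X (qubit n .work1 i) else []

theorem run_xorConst (f : ℕ → Bool) (c : Conf) : run (xorConst n f) (c.enc n) =
    { c with w1 := fun i => xor (c.w1 i) (f i) }.enc n := by
  obtain ⟨h1, h2, -⟩ := run_seq_disjoint (k := n + 3)
    (f := fun i => if f i then X (qubit n .work1 i) else []) (t := qubit n .work1)
    (g := fun i _ => f i)
    (fun i _ s => by by_cases h : f i = true <;> simp [h, run_X])
    (fun _ _ _ _ _ _ => rfl) (fun i hi j hj => eq_of_qubit_eq hi hj) (c.enc n)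
  refine eq_enc_of_array (R := .work1) (c := c) (f := fun i => i) (k := n + 3) (fun i hi => hi)
    (fun R hR => by cases R <;> first | rfl | exact absurd rfl hR) (fun i hi => ?_)
    (fun j hj h => absurd rfl (h j hj)) h2
  rw [xorConst, h1 i hi, enc_qubit_of_lt (R := .work1) c hi]
  rfl

/-- If `iter` is `1`, adds the bits `f i` to the cells `g i` of `R`, for `i < n`. -/
def xorIter (n : ℕ) [NeZero n] (R : Reg) (f : ℕ → Bool) (g : ℕ → ℕ) : Circuit (Qubit n) :=
  seq n fun i => if f i then CX (qubit n .iter 0) (qubit n R (g i)) else []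

theorem run_xorIter {R : Reg} (hR : R = .work1 ∨ R = .work2) (f : ℕ → Bool) {g : ℕ → ℕ}
    (hg : ∀ i < n, g i < n + 3) (hgg : ∀ i < n, ∀ j < n, g i = g j → i = j) (c : Conf) :
    run (xorIter n R f g) (c.enc n) = (c.setWork R (overwrite n g (c.bit R) fun i =>
      xor (c.bit R (g i)) (f i && c.it))).enc n := by
  have hw := width_work (n := n) hR
  have hne : ∀ i, qubit n .iter 0 ≠ qubit n R i := fun i =>
    qubit_ne_of_reg (by rcases hR with h | h <;> rw [h] <;> decide) _ _
  obtain ⟨h1, h2, -⟩ := run_seq_disjoint (k := n)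
    (f := fun i => if f i then CX (qubit n .iter 0) (qubit n R (g i)) else [])
    (t := fun i => qubit n R (g i)) (g := fun i s => f i && s (qubit n .iter 0))
    (fun i _ s => by by_cases h : f i = true <;> simp [h, run_CX (hne (g i))])
    (fun i _ j _ s b => by rw [toggle_ne (hne _)])
    (fun i hi j hj he => hgg i hi j hj (eq_of_qubit_eq (hw ▸ hg i hi) (hw ▸ hg j hj) he)) (c.enc n)
  refine eq_enc_of_array (R := R) (c := c) (f := g) (k := n) (fun i hi => hw ▸ hg i hi)
    (fun R' hR' => Conf.bit_setWork_ne hR' _) (fun i hi => ?_) (fun j hj hne => ?_) h2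
  · rw [xorIter, h1 i hi, enc_qubit_of_lt c (hw ▸ hg i hi), Conf.bit_setWork_self hR,
      overwrite_self hgg _ _ hi]
    rfl
  · rw [Conf.bit_setWork_self hR, overwrite_of_ne _ _ hne]

/-- If `iter` is `1`, replaces the number in the cells `g i` of the second work register by its
difference to `p`, using the first work register as clean memory: adding `2 ^ n - 1 - p` and
complementing all digits has this effect. -/
def negMod (n : ℕ) [NeZero n] (p : ℕ) (g : ℕ → ℕ) : Circuit (Qubit n) :=
  xorIter n .work1 (fun i => !p.testBit i) (fun i => i) ++
    addWork n .work1 .work2 (fun i => i) g n ++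
    xorIter n .work1 (fun i => !p.testBit i) (fun i => i) ++ xorIter n .work2 (fun _ => true) g

/-- Since `c.w1` vanishes and `A ≤ p`, the sum `2 ^ n - 1 - p + A` does not overflow, and its
complement is `p - A`. -/
theorem run_negMod {p A : ℕ} {g : ℕ → ℕ} (hg : ∀ i < n, g i < n + 3)
    (hgg : ∀ i < n, ∀ j < n, g i = g j → i = j) {c : Conf} (hc : c.ct = false)
    (hw1 : ∀ i, c.w1 i = false) (hA : A ≤ p) (hp : p < 2 ^ n)
    (hw2 : ∀ i < n, c.w2 (g i) = A.testBit i) : run (negMod n p g) (c.enc n) =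
      { c with w2 := overwrite n g c.w2 (if c.it then p - A else A).testBit }.enc n := by
  set u : ℕ → Bool := overwrite n (fun i => i) c.w1 (fun i => !p.testBit i && c.it) with hu
  set m : ℕ := if c.it then 2 ^ n - 1 - p else 0 with hm
  have hum : ∀ i < n, u i = m.testBit i := fun i hi => by
    rw [hu, hm]
    refine (overwrite_self (b := fun i => i) (fun i _ j _ h => h) _ _ hi).trans ?_
    cases c.it
    · simp
    · simp [testBit_compl hp hi]
  set w : ℕ → Bool := overwrite n g c.w2 (m + A).testBit with hw
  have e₁ : ∀ w' : ℕ → Bool, run (xorIter n .work1 (fun i => !p.testBit i) (fun i => i))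
      ({ c with w2 := w' }.enc n) = { c with w1 := u, w2 := w' }.enc n := fun w' => by
    rw [run_xorIter (Or.inl rfl) _ (fun i hi => by omega) (fun i _ j _ h => h)]
    refine enc_ext (fun i _ => ?_) (fun _ _ => rfl) rfl rfl rfl rfl rfl rfl rfl rfl rfl rfl
    show overwrite n (fun i => i) c.w1 (fun i => xor (c.w1 i) (!p.testBit i && c.it)) i = u i
    rw [hu]
    congr 1
    funext i
    rw [hw1, Bool.false_xor]
  have e₁' : ∀ w' : ℕ → Bool, run (xorIter n .work1 (fun i => !p.testBit i) (fun i => i))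
      ({ c with w1 := u, w2 := w' }.enc n) = { c with w2 := w' }.enc n := fun w' => by
    rw [run_xorIter (Or.inl rfl) _ (fun i hi => by omega) (fun i _ j _ h => h)]
    refine enc_ext (fun i _ => ?_) (fun _ _ => rfl) rfl rfl rfl rfl rfl rfl rfl rfl rfl rfl
    show overwrite n (fun i => i) u (fun i => xor (u i) (!p.testBit i && c.it)) i = c.w1 i
    rw [hw1]
    by_cases hi : i < n
    · refine (overwrite_self (b := fun i => i) (fun i _ j _ h => h) _ _ hi).trans ?_
      rw [hu, show overwrite n (fun i => i) c.w1 (fun i => !p.testBit i && c.it) i =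
        (!p.testBit i && c.it) from
          overwrite_self (b := fun i => i) (fun i _ j _ h => h) _ _ hi, Bool.xor_self]
    · rw [overwrite_of_ne _ _ (fun j hj => by omega), hu,
        overwrite_of_ne _ _ (fun j hj => by omega), hw1]
  have e₂ : run (addWork n .work1 .work2 (fun i => i) g n) ({ c with w1 := u, w2 := c.w2 }.enc n) =
      { c with w1 := u, w2 := w }.enc n := by
    rw [run_addWork (c := { c with w1 := u, w2 := c.w2 }) ⟨Or.inl rfl, Or.inr rfl, by decide,
      fun i hi => by omega, hg, fun i _ j _ h => h, hgg⟩ hc]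
    refine enc_ext (fun _ _ => rfl) (fun i _ => ?_) rfl rfl rfl rfl rfl rfl rfl rfl rfl rfl
    show overwrite n g c.w2 (addBits u fun i => c.w2 (g i)) i = w i
    rw [hw]
    by_cases hex : ∃ j < n, i = g j
    · obtain ⟨j, hj, rfl⟩ := hex
      rw [overwrite_self hgg _ _ hj, overwrite_self hgg _ _ hj]
      exact addBits_testBit (fun l hl => hum l (by omega)) (fun l hl => hw2 l (by omega))
    · push Not at hex
      rw [overwrite_of_ne _ _ hex, overwrite_of_ne _ _ hex]
  refine run_trans (run_trans (run_trans (e₁ c.w2) e₂) (e₁' w)) ?_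
  rw [run_xorIter (Or.inr rfl) _ hg hgg]
  refine enc_ext (fun _ _ => rfl) (fun i _ => ?_) rfl rfl rfl rfl rfl rfl rfl rfl rfl rfl
  show overwrite n g w (fun i => xor (w (g i)) (true && c.it)) i = overwrite n g c.w2 _ i
  by_cases hex : ∃ j < n, i = g j
  · obtain ⟨j, hj, rfl⟩ := hex
    rw [overwrite_self hgg _ _ hj, overwrite_self hgg _ _ hj, hw, overwrite_self hgg _ _ hj, hm]
    cases c.it
    · simp
    · simp only [if_true, Bool.and_true, Bool.xor_true]
      rw [← testBit_compl (by omega) hj]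
      exact congrArg (fun z => Nat.testBit z j) (by omega)
  · push Not at hex
    rw [overwrite_of_ne _ _ hex, overwrite_of_ne _ _ hex, hw, overwrite_of_ne _ _ hex]

/-- The cells of the first work register from which the input is compared with `p / 2`: the
complement of `p / 2`, and a mark. -/
def halfCell (n p i : ℕ) : Bool := if i < n then !(p / 2).testBit i else decide (i = n)

/-- Adds to `iter` whether twice the input exceeds `p`. -/
def compareHalf (n : ℕ) [NeZero n] (p : ℕ) : Circuit (Qubit n) :=
  xorConst n (halfCell n p) ++ carryXor (qubit n .iter 0) (qubit n .ctrl 0)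
    (fun i => qubit n .work1 (if i = n - 1 then n else n + 1))
    (fun i => qubit n .work2 (n + 2 - i)) (fun i => qubit n .work1 i) n ++ xorConst n (halfCell n p)

/-- The carry out of the sum of `x` and the complement of `p / 2` says whether `p / 2 < x`. -/
theorem run_compareHalf {p x : ℕ} {c : Conf} (hc : c.ct = false) (hw1 : ∀ i, c.w1 i = false)
    (hw2 : ∀ i < n, c.w2 (n + 2 - i) = x.testBit i) (hp : p < 2 ^ n) (hx : x < 2 ^ n) :
    run (compareHalf n p) (c.enc n) = { c with it := xor c.it (decide (p < 2 * x)) }.enc n := by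
  have hn : 0 < n := Nat.pos_of_neZero n
  have hw1w : Reg.work1.width n = n + 3 := rfl
  have hw2w : Reg.work2.width n = n + 3 := rfl
  set c₁ : Conf := { c with w1 := halfCell n p } with hc₁
  have e₁ : run (xorConst n (halfCell n p)) (c.enc n) = c₁.enc n := by
    rw [run_xorConst]
    exact enc_ext (fun i _ => by show xor (c.w1 i) _ = _; rw [hw1, Bool.false_xor]) (fun _ _ => rfl)
      rfl rfl rfl rfl rfl rfl rfl rfl rfl rfl
  refine run_trans (run_trans e₁ (u := { c₁ with it := xor c.it (decide (p < 2 * x)) }.enc n) ?_) ?_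
  · rw [run_carryXor ⟨fun i _ => qubit_ne_of_reg (by decide) _ _,
      fun i _ => qubit_ne_of_reg (by decide) _ _, fun i _ j _ => qubit_ne_of_reg (by decide) _ _,
      fun i hi j hj he => by
        have := eq_of_qubit_eq (R := .work2) (by omega) (by omega) he
        omega,
      fun i hi j hj he => eq_of_qubit_eq (R := .work1) (by omega) (by omega) he⟩
      (qubit_ne_of_reg (by decide) _ _)
      (fun i _ => ⟨qubit_ne_of_reg (by decide) _ _, qubit_ne_of_reg (by decide) _ _,
        qubit_ne_of_reg (by decide) _ _⟩)
      (fun i hi => ⟨qubit_ne_of_reg (by decide) _ _, fun j hj => ⟨qubit_ne_of_reg (by decide) _ _,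
        qubit_ne (by split_ifs <;> omega) (by omega) (by split_ifs <;> omega)⟩⟩)]
    have hmark : ∀ i < n, c₁.enc n (qubit n .work1 (if i = n - 1 then n else n + 1)) =
        decide (i = n - 1) := fun i hi => by
      rw [enc_qubit_of_lt c₁ (by split_ifs <;> omega)]
      show halfCell n p _ = _
      by_cases h : i = n - 1
      · simp [halfCell, h]
      · simp [halfCell, h]
    rw [xsum_congr (g := fun i => decide (i = n - 1) && _) (fun i hi => by rw [hmark i hi]),
      xsum_single (by omega), Nat.sub_add_cancel hn, toggle_iter]
    have hct : c₁.enc n (qubit n .ctrl 0) = false := hc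
    rw [hct, carry_not_testBit (A := x) (B := p / 2) (fun j hj => ?_) (fun j hj => ?_) hx
        (by omega)]
    · refine enc_ext (fun _ _ => rfl) (fun _ _ => rfl) rfl rfl rfl rfl rfl rfl rfl ?_ rfl rfl
      show xor c.it _ = xor c.it _
      refine congrArg _ (decide_eq_decide.2 ?_)
      omega
    · rw [enc_qubit_of_lt c₁ (by omega)]
      exact hw2 j hj
    · rw [enc_qubit_of_lt c₁ (by omega)]
      show halfCell n p j = _
      simp [halfCell, hj]
  · rw [run_xorConst]
    exact enc_ext (fun i _ => by
      show xor (halfCell n p i) _ = c.w1 i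
      rw [hw1, Bool.xor_self]) (fun _ _ => rfl) rfl rfl rfl rfl rfl rfl rfl rfl rfl rfl

/-- The cells of the first work register in the initial state, which do not depend on the input. -/
def startCell (n p i : ℕ) : Bool := if i ≤ 1 then (1 : ℕ).testBit i else p.testBit (n + 2 - i)

/-- Prepares the initial state of the algorithm. -/
def loadCircuit (n : ℕ) [NeZero n] (p : ℕ) : Circuit (Qubit n) :=
  compareHalf n p ++ negMod n p (fun i => n + 2 - i) ++ X (qubit n .lenT 0) ++
    sizeXor .work2 (fun i => i + 2) (onEnd n) .lenT .lenR ++ xorConst n (startCell n p)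

theorem toggle_lenT {c : Conf} (h : c.lt = 0) (b : Bool) :
    toggle (c.enc n) (qubit n .lenT 0) b = { c with lt := b.toNat }.enc n :=
  toggle_enc (by show 0 < Nat.log 2 n + 2; omega)
    (fun R hR => by cases R <;> first | rfl | exact absurd rfl hR) fun j _ => by
      simp only [Conf.bit, h]
      cases b <;> rcases j with _ | j <;> simp [Nat.testBit_succ]

theorem run_loadCircuit {p x y : ℕ} (hp : p < 2 ^ n) (hx : 0 < x) (hxp : x < p) :
    run (loadCircuit n p) (ioBasis n x y) = (EEAState.start p x).basis n y := by
  have hn : 0 < n := Nat.pos_of_neZero n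
  set v := if p < 2 * x then p - x else x with hv
  have hv0 : 0 < v := by rw [hv]; split_ifs <;> omega
  have hvn : v < 2 ^ n := by rw [hv]; split_ifs <;> omega
  have hvs : Nat.size v ≤ n := Nat.size_le.2 hvn
  set c : Conf := ⟨fun _ => false, fun i => x.testBit (n + 2 - i), y.testBit, 0, 0, 0, 0, false,
    false,
    false, false, false⟩ with hc
  set c₁ : Conf := { c with it := decide (p < 2 * x) } with hc₁
  set c₂ : Conf := { c₁ with w2 := fun i => v.testBit (n + 2 - i) } with hc₂
  set c₃ : Conf := { c₂ with lt := 1 } with hc₃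
  set c₄ : Conf := { c₃ with lr := Nat.size v } with hc₄
  have e₀ : ioBasis n x y = c.enc n := by
    funext ⟨R, i⟩
    cases R <;> simp [ioBasis, Conf.enc, Conf.bit, hc]
  have e₁ : run (compareHalf n p) (c.enc n) = c₁.enc n := by
    rw [run_compareHalf (x := x) rfl (fun _ => rfl) (fun i hi => ?_) hp (by omega)]
    · simp [hc₁, hc]
    · show x.testBit (n + 2 - (n + 2 - i)) = _
      exact congrArg _ (by omega)
  have hg : ∀ i < n, ∀ j < n, n + 2 - i = n + 2 - j → i = j := fun i hi j hj h => by omega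
  have e₂ : run (negMod n p (fun i => n + 2 - i)) (c₁.enc n) = c₂.enc n := by
    rw [run_negMod (A := x) (fun i hi => by omega) hg rfl (fun _ => rfl) hxp.le hp (fun i hi => ?_)]
    · refine enc_ext (fun _ _ => rfl) (fun i hi => ?_) rfl rfl rfl rfl rfl rfl rfl rfl rfl rfl
      show overwrite n (fun i => n + 2 - i) (fun i => x.testBit (n + 2 - i))
        (if decide (p < 2 * x) = true then p - x else x).testBit i = v.testBit (n + 2 - i)
      simp only [decide_eq_true_eq, ← hv]
      by_cases h : 3 ≤ i
      · conv_lhs => rw [show i = n + 2 - (n + 2 - i) by omega]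
        exact overwrite_self (b := fun i => n + 2 - i) hg _ _ (by omega)
      · rw [overwrite_of_ne _ _ (fun j hj => by omega),
          Nat.testBit_lt_two_pow (hxp.trans (hp.trans_le (pow_le_pow_two (by omega)))),
          Nat.testBit_lt_two_pow (hvn.trans_le (pow_le_pow_two (by omega)))]
    · show x.testBit (n + 2 - (n + 2 - i)) = _
      exact congrArg _ (by omega)
  have e₃ : run (X (qubit n .lenT 0)) (c₂.enc n) = c₃.enc n := by
    rw [run_X, toggle_lenT (c := c₂) rfl]
    rfl
  have e₄ : run (sizeXor .work2 (fun i => i + 2) (onEnd n) .lenT .lenR) (c₃.enc n) = c₄.enc n := by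
    have hf : formula (c₃.enc n) (onEnd n) = true := by
      rw [formula_onEnd (c := c₃) (show 0 < 2 ^ (Nat.log 2 n + 2) by positivity)
        (show 0 < 2 ^ (Nat.log 2 n + 3) by positivity)]
      rfl
    rw [run_sizeXor (Or.inr rfl) (fun i hi => by omega) uses_onEnd (by decide) (Or.inl rfl)
      (Or.inr rfl) (by decide) (by decide) (c := c₃) rfl (v := 1) (m := Nat.size v) (fun _ => rfl)
      (fun _ => ⟨hn, by omega, fun i hi h1 h2 => ?_, fun h => ?_⟩), hf]
    · refine enc_ext (fun _ _ => rfl) (fun _ _ => rfl) rfl rfl rfl ?_ rfl rfl rfl rfl rfl rfl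
      show 0 ^^^ (if true = true then Nat.size v else 0) = Nat.size v
      simp
    · show v.testBit (n + 2 - (i + 2)) = false
      exact testBit_of_size_le (by omega)
    · show v.testBit (n + 2 - (n + 1 - Nat.size v + 2)) = true
      have h1 : 2 ^ (Nat.size v - 1) ≤ v := Nat.lt_size.1 (by omega)
      have h2 : v < 2 ^ (Nat.size v - 1) * 2 := by
        rw [← pow_succ, Nat.sub_add_cancel h]
        exact Nat.lt_size_self v
      rw [show n + 2 - (n + 1 - Nat.size v + 2) = Nat.size v - 1 by omega,
        Nat.testBit_eq_decide_div_mod_eq, Nat.div_eq_of_lt_le (k := 1) (by omega) (by omega)]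
      rfl
  rw [e₀, basis_eq]
  refine run_trans (run_trans (run_trans (run_trans e₁ e₂) e₃) e₄) ?_
  rw [run_xorConst]
  refine enc_ext (fun i _ => ?_) (fun i hi => ?_) rfl rfl rfl rfl rfl rfl rfl rfl rfl rfl
  · show xor false (startCell n p i) = if i ≤ 1 then (1 : ℕ).testBit i else
      if i ≤ 1 + 0 then (0 / 2 ^ 0 : ℕ).testBit (1 + 0 - i) else p.testBit (n + 2 - i)
    rw [Bool.false_xor, startCell]
    by_cases h : i ≤ 1
    · rw [if_pos h, if_pos h]
    · rw [if_neg h, if_neg h, if_neg (by omega)]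
  · show v.testBit (n + 2 - i) = (EEAState.start p x).work2Cell n ((i + 0) % (n + 3))
    rw [show (i + 0) % (n + 3) = i from Nat.mod_eq_of_lt hi,
      work2Cell_right rfl (show 0 < 2 ^ i by positivity) (by omega)]
    rfl

/-- The cells of the first work register in the final state, which do not depend on the input. -/
def finalCell (n p i : ℕ) : Bool := if i ≤ n then p.testBit i else (1 : ℕ).testBit (n + 2 - i)

/-- Replaces the final state by one with the result in the second work register. -/
noncomputable def exposeResult (n : ℕ) [NeZero n] (p : ℕ) : Circuit (Qubit n) :=
  xorConst n (finalCell n p) ++ (rotate n).inverse ++ X (qubit n .iter 0) ++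
    negMod n p (fun i => i)

/-- Copies the result into the output register. -/
noncomputable def copyCircuit (n : ℕ) [NeZero n] (p : ℕ) : Circuit (Qubit n) :=
  exposeResult n p ++ (seq n fun i => CX (qubit n .work2 i) (qubit n .output i)) ++
    (exposeResult n p).inverse

theorem run_copyWork2 (c : Conf) :
    run (seq n fun i => CX (qubit n .work2 i) (qubit n .output i)) (c.enc n) =
      { c with out := fun i => xor (c.out i) (c.w2 i) }.enc n := by
  obtain ⟨h1, h2, -⟩ := run_seq_disjoint (k := n)
    (f := fun i => CX (qubit n .work2 i) (qubit n .output i)) (t := qubit n .output)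
    (g := fun i s => s (qubit n .work2 i))
    (fun i _ s => run_CX (qubit_ne_of_reg (by decide) _ _) s)
    (fun i _ j _ s b => toggle_ne (qubit_ne_of_reg (by decide) _ _) b)
    (fun i hi j hj => eq_of_qubit_eq hi hj) (c.enc n)
  refine eq_enc_of_array (R := .output) (c := c) (f := fun i => i) (k := n) (fun i hi => hi)
    (fun R hR => by cases R <;> first | rfl | exact absurd rfl hR) (fun i hi => ?_)
    (fun j hj h => absurd rfl (h j hj)) h2
  rw [h1 i hi, enc_qubit_of_lt (R := .output) c hi,
    enc_qubit_of_lt (R := .work2) c (show i < n + 3 by omega)]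
  rfl

theorem run_copyCircuit {D : IterData} {p x K j : ℕ} (hp : p.Prime) (hpn' : 2 ^ (n - 1) ≤ p)
    (hpn : p < 2 ^ n) (h : D.Valid n p x K) (hv : D.v = 0) (hj : j < 2 ^ (Nat.log 2 n + 3)) :
    run (copyCircuit n p) ((D.search j).basis n 0) =
      (D.search j).basis n ((x : ZMod p)⁻¹).val := by
  have hn : 0 < n := Nat.pos_of_neZero n
  have hut : D.u < p := h.t_eq hv ▸ h.u_lt
  have hinv := inverse_eq hp h hv
  set z := ((x : ZMod p)⁻¹).val with hz
  have hz' : z = if !D.it then p - D.u else D.u := by rw [hinv]; cases D.it <;> rfl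
  -- The contents at the end of `exposeResult`, for a value `y` of the output register.
  set e : ℕ → Conf := fun y => { raw n (D.search j) y with
    w1 := fun _ => false, it := !D.it, w2 := fun i => if i < n then z.testBit i else false } with he
  have key : ∀ y, run (exposeResult n p) ((D.search j).basis n y) = (e y).enc n := by
    intro y
    set c := raw n (D.search j) y with hc
    set c₁ : Conf := { c.rot n with w1 := fun _ => false } with hc₁
    set c₂ : Conf := { c with w1 := fun _ => false } with hc₂
    set c₃ : Conf := { c₂ with it := !D.it } with hc₃
    have e₁ : run (xorConst n (finalCell n p)) ((c.rot n).enc n) = c₁.enc n := by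
      rw [run_xorConst]
      refine enc_ext (fun i _ => ?_) (fun _ _ => rfl) rfl rfl rfl rfl rfl rfl rfl rfl rfl rfl
      show xor ((D.search j).work1Cell n i) (finalCell n p i) = false
      have hst := h.size_t hn hv hpn' hpn
      have : (D.search j).work1Cell n i = finalCell n p i := by
        show (if i ≤ Nat.size D.t then D.t.testBit i else if i ≤ Nat.size D.t + 0 then _
          else D.r.testBit (n + 2 - i)) = finalCell n p i
        rw [hst, h.t_eq hv, h.r_eq_one hv, finalCell]
        by_cases h : i ≤ n
        · rw [if_pos h, if_pos h]
        · rw [if_neg h, if_neg h, if_neg (by omega)]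
      rw [this, Bool.xor_self]
    have e₂ : run (rotate n) (c₂.enc n) = c₁.enc n := by
      rw [run_rotate (c := c₂) hj]
      exact enc_ext (fun _ _ => rfl) (fun _ _ => rfl) rfl rfl rfl rfl rfl rfl rfl rfl rfl rfl
    have e₃ : run (X (qubit n .iter 0)) (c₂.enc n) = c₃.enc n := by
      rw [run_X, toggle_iter]
      exact enc_ext (fun _ _ => rfl) (fun _ _ => rfl) rfl rfl rfl rfl rfl rfl rfl (Bool.xor_true _)
        rfl rfl
    have hw2 : ∀ i < n + 3, c₃.w2 i = D.u.testBit i := fun i hi => by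
      show (D.search j).work2Cell n i = _
      unfold EEAState.work2Cell
      rw [if_pos (show i < n + 3 - (D.search j).lr from by
        show i < n + 3 - Nat.size D.v
        rw [hv, Nat.size_zero]
        omega)]
      rfl
    rw [basis_eq]
    refine run_trans (run_trans (run_trans e₁ (run_inverse_of_run e₂)) e₃) ?_
    rw [run_negMod (A := D.u) (c := c₃) (fun i hi => by omega) (fun i _ j _ h => h) rfl
      (fun _ => rfl) hut.le hpn (fun i hi => hw2 i (by omega))]
    refine enc_ext (fun _ _ => rfl) (fun i hi => ?_) rfl rfl rfl rfl rfl rfl rfl rfl rfl rfl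
    show overwrite n (fun i => i) c₃.w2 (if (!D.it) = true then p - D.u else D.u).testBit i =
      if i < n then z.testBit i else false
    rw [← hz']
    split_ifs with hin
    · exact overwrite_self (b := fun i => i) (fun i _ j _ h => h) _ _ hin
    · rw [overwrite_of_ne _ _ (fun j hj => by omega), hw2 i hi,
        Nat.testBit_lt_two_pow (hut.trans (hpn.trans_le (pow_le_pow_two (by omega))))]
  refine run_trans (run_trans (key 0) (?_ : _ = (e z).enc n)) (run_inverse_of_run (key z))
  rw [run_copyWork2]
  apply enc_congr
  intro R i hi
  cases R <;> first | rfl | skip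
  show xor ((0 : ℕ).testBit i) (if i < n then z.testBit i else false) = z.testBit i
  have hi' : i < n := hi
  simp [hi']

/-! ### Counting Toffoli gates -/

theorem two_pow_log_le : 2 ^ Nat.log 2 n ≤ n := Nat.pow_log_le_self 2 (NeZero.ne n)

/-- A bound for the number of Toffoli gates needed to toggle a wire by the XOR of the terms in
`F`. -/
def flipCost (F : List (Term (Qubit n))) : ℕ :=
  (F.map fun m => 8 * 2 ^ m.1.length + 4 * 2 ^ m.2.length).sum

theorem toffoliCount_cflip (F : List (Term (Qubit n))) (t d e : Qubit n) :
    toffoliCount (cflip F t d e) ≤ flipCost F := by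
  induction F with
  | nil => simp [cflip]
  | cons m F ih =>
    have h := toffoliCount_termFlip m t d e
    simp only [cflip, flipCost, toffoliCount_append, List.map_cons, List.sum_cons] at ih ⊢
    omega

theorem toffoliCount_flip {F : List (Term (Qubit n))} (hF : flipCost F ≤ 150 * n) (x : Qubit n) :
    toffoliCount (flip F x) ≤ 150 * n :=
  (toffoliCount_cflip F x _ _).trans hF

theorem flipCost_onPhase (a b : Bool) : flipCost (onPhase n a b) ≤ 150 * n := by
  have := NeZero.pos n
  simp only [flipCost, onPhase, List.map, List.sum_cons, List.sum_nil, List.length]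
  omega

theorem flipCost_onPhaseSign (a b : Bool) : flipCost (onPhaseSign n a b) ≤ 150 * n := by
  have := NeZero.pos n
  simp only [flipCost, onPhaseSign, List.map, List.sum_cons, List.sum_nil, List.length]
  omega

theorem flipCost_onPhase1 : flipCost (onPhase1 n) ≤ 150 * n := by
  have := NeZero.pos n
  simp only [flipCost, onPhase1, List.map, List.sum_cons, List.sum_nil, List.length]
  omega

theorem flipCost_onPhaseXor : flipCost (onPhaseXor n) ≤ 150 * n := by
  have := NeZero.pos n
  simp only [flipCost, onPhaseXor, List.map, List.sum_cons, List.sum_nil, List.length]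
  omega

theorem flipCost_onSearch : flipCost (onSearch n) ≤ 150 * n := by
  have := NeZero.pos n
  have := two_pow_log_le (n := n)
  simp only [flipCost, onSearch, List.map, List.sum_cons, List.sum_nil, List.length,
      length_zeroLits,
    pow_add]
  omega

theorem flipCost_onDigits : flipCost (onDigits n) ≤ 150 * n := by
  have := NeZero.pos n
  have := two_pow_log_le (n := n)
  simp only [flipCost, onDigits, List.map, List.sum_cons, List.sum_nil, List.length,
      length_zeroLits,
    pow_add]
  omega

theorem flipCost_onEmpty (R : Reg) : flipCost (onEmpty n R) ≤ 150 * n := by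
  have := NeZero.pos n
  have := two_pow_log_le (n := n)
  simp only [flipCost, onEmpty, List.map, List.sum_cons, List.sum_nil, List.length, length_zeroLits,
    pow_add]
  omega

theorem flipCost_onUnshifted : flipCost (onUnshifted n) ≤ 150 * n := by
  have := NeZero.pos n
  have := two_pow_log_le (n := n)
  simp only [flipCost, onUnshifted, List.map, List.sum_cons, List.sum_nil, List.length,
    length_zeroLits, pow_add]
  omega

theorem flipCost_onEnd : flipCost (onEnd n) ≤ 150 * n := by
  have := NeZero.pos n
  have := two_pow_log_le (n := n)
  simp only [flipCost, onEnd, List.map, List.sum_cons, List.sum_nil, length_zeroLits,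
    pow_add]
  omega

theorem log_le_self : Nat.log 2 n ≤ n := Nat.log_le_self 2 n

theorem toffoliCount_incReg {L : List (Qubit n × Bool)} {R : Reg} (hL : L.length ≤ 2)
    (hR : R.width n ≤ Nat.log 2 n + 3) : toffoliCount (incReg L R) ≤ 160 * n := by
  have h := toffoliCount_inc L (qubit n R) (qubit n .work1 1) (qubit n .work1 2) (R.width n)
  have hpos := NeZero.pos n
  have h1 := two_pow_log_le (n := n)
  have h2 := log_le_self (n := n)
  have h3 : 2 ^ R.width n ≤ 2 ^ (Nat.log 2 n + 3) := Nat.pow_le_pow_right (by norm_num) hR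
  have h4 : 2 ^ L.length ≤ 2 ^ 2 := Nat.pow_le_pow_right (by norm_num) hL
  have h5 : 8 * R.width n * 2 ^ L.length ≤ 8 * (Nat.log 2 n + 3) * 2 ^ 2 :=
    Nat.mul_le_mul (by omega) h4
  rw [pow_add] at h3
  rw [incReg]
  omega

theorem toffoliCount_addReg (A R : Reg) (hR : R.width n ≤ Nat.log 2 n + 3) :
    toffoliCount (addReg n A R) ≤ 8 * n := by
  have h := toffoliCount_add (qubit n .ctrl 0) (qubit n A) (qubit n R) (R.width n)
  have hpos := NeZero.pos n
  have h2 := log_le_self (n := n)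
  rw [addReg]
  omega

theorem toffoliCount_rotateOne {F : List (Term (Qubit n))} (hF : flipCost F ≤ 150 * n) :
    toffoliCount (rotateOne F) ≤ 308 * n := by
  have h := toffoliCount_flip hF (qubit n .ctrl 0)
  have h1 := (toffoliCount_cperm (qubit n .ctrl 0) (rotPerm n)).trans card_support_rotPerm
  have hpos := NeZero.pos n
  rw [rotateOne, toffoliCount_append, toffoliCount_append]
  omega

theorem toffoliCount_swapWork {F : List (Term (Qubit n))} (hF : flipCost F ≤ 150 * n) :
    toffoliCount (swapWork F) ≤ 308 * n := by
  have h := toffoliCount_flip hF (qubit n .ctrl 0)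
  have h1 := (toffoliCount_cperm (qubit n .ctrl 0) (swapPerm n)).trans card_support_swapPerm
  have hpos := NeZero.pos n
  rw [swapWork, toffoliCount_append, toffoliCount_append]
  omega

theorem toffoliCount_markReg {F : List (Term (Qubit n))} (hF : flipCost F ≤ 150 * n) (R : Reg) :
    toffoliCount (markReg F R) ≤ 158 * n := by
  have h := (toffoliCount_cflip F (pos n 0) (qubit n .work1 1) (qubit n .work1 2)).trans hF
  have h1 := toffoliCount_dec (qubit n R) (pos n) (n + 1) (Nat.log 2 n + 2)
  have h2 := two_pow_log_le (n := n)
  rw [pow_add] at h1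
  rw [markReg, mark, toffoliCount_append, toffoliCount_append, toffoliCount_inverse]
  omega

theorem toffoliCount_marked {F : List (Term (Qubit n))} (hF : flipCost F ≤ 150 * n)
    (B : Circuit (Qubit n)) (R : Reg) :
    toffoliCount (marked B F R) ≤ 2 * toffoliCount B + 316 * n := by
  have h := toffoliCount_markReg hF R
  simp only [marked, toffoliCount_append]
  omega

theorem toffoliCount_readCell {F : List (Term (Qubit n))} (hF : flipCost F ≤ 150 * n) (R : Reg) :
    toffoliCount (readCell F R) ≤ 320 * n := by
  have hpos := NeZero.pos n
  have h1 : toffoliCount (seq (n + 1) fun j =>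
      CCX (pos n j) (qubit n .work1 (j + 1)) (qubit n .sign 0)) ≤ (n + 1) * 1 :=
    toffoliCount_seq_le fun j _ => toffoliCount_CCX _ _ _
  refine (toffoliCount_marked hF _ R).trans ?_
  omega

theorem toffoliCount_writeCell {F : List (Term (Qubit n))} (hF : flipCost F ≤ 150 * n) (R : Reg) :
    toffoliCount (writeCell F R) ≤ 316 * n := by
  have h1 : toffoliCount (seq (n + 1) fun j =>
      CX (pos n j) (qubit n .work1 (j + 1))) ≤ (n + 1) * 0 :=
    toffoliCount_seq_le fun j _ => (toffoliCount_CX _ _).le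
  refine (toffoliCount_marked hF _ R).trans ?_
  omega

theorem toffoliCount_notReg (R : Reg) : toffoliCount (notReg n R) = 0 := by
  have h : toffoliCount (notReg n R) ≤ (n + 3) * 0 :=
    toffoliCount_seq_le fun j _ => (toffoliCount_X _).le
  omega

theorem toffoliCount_compare {F : List (Term (Qubit n))} (hF : flipCost F ≤ 150 * n) (A B R : Reg)
    (g f : ℕ → ℕ) {k : ℕ} (hk : k ≤ n + 1) : toffoliCount (compare A B g f k F R) ≤ 328 * n := by
  have hpos := NeZero.pos n
  have h := toffoliCount_carryXor (qubit n .sign 0) (qubit n .ctrl 0) (fun i => pos n (f i))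
    (fun i => qubit n A (g i)) (fun i => qubit n B (g i)) k
  have h1 := toffoliCount_marked hF (carryXor (qubit n .sign 0) (qubit n .ctrl 0)
    (fun i => pos n (f i)) (fun i => qubit n A (g i)) (fun i => qubit n B (g i)) k) R
  rw [compare, toffoliCount_append, toffoliCount_append, toffoliCount_notReg]
  omega

theorem toffoliCount_condSub {F : List (Term (Qubit n))} (hF : flipCost F ≤ 150 * n)
    (A B B' R : Reg) (h g a b : ℕ → ℕ) (guard : ℕ) :
    toffoliCount (condSub (regionFlip B' h g guard F R) A B a b (n + 2)) ≤ 944 * n := by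
  have hpos := NeZero.pos n
  have h1 := toffoliCount_add (qubit n .ctrl 0) (fun i => qubit n A (a i))
    (fun i => qubit n B (b i)) (n + 2)
  have h2 := toffoliCount_maskXor (fun j => pos n (h j)) (fun j => qubit n B' (g j)) n
  have h3 := toffoliCount_marked hF (maskXor (fun j => pos n (h j)) (fun j => qubit n B' (g j)) n) R
  have h4 := toffoliCount_flip hF (qubit n B' guard)
  simp only [condSub, addWork, regionFlip, toffoliCount_append, toffoliCount_inverse]
  omega

theorem toffoliCount_sizeXor {F : List (Term (Qubit n))} (hF : flipCost F ≤ 150 * n) (W : Reg)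
    (g : ℕ → ℕ) (R T : Reg) : toffoliCount (sizeXor W g F R T) ≤ 328 * n := by
  have hpos := NeZero.pos n
  have h := toffoliCount_firstOne (pos n) (fun i => qubit n W (g i)) (fun i => n + 1 - i)
    (qubit n T) (Nat.log 2 n + 2) (qubit n .ctrl 0) n
  refine (toffoliCount_marked hF _ R).trans ?_
  omega

theorem toffoliCount_shift (a : Bool) : toffoliCount (shift n a) ≤ 936 * n := by
  have h1 := toffoliCount_incReg (n := n) (L := [lit n .phase1 a, lit n .phase2 false])
    (R := .lenS) le_rfl le_rfl
  have h2 := toffoliCount_incReg (n := n) (L := [lit n .phase1 a, lit n .phase2 true])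
    (R := .lenS) le_rfl le_rfl
  have h3 := toffoliCount_rotateOne (flipCost_onPhase (n := n) a false)
  have h4 := toffoliCount_rotateOne (flipCost_onPhase (n := n) a true)
  simp only [shift, toffoliCount_append, toffoliCount_inverse]
  omega

theorem toffoliCount_aligned (C : Circuit (Qubit n)) :
    toffoliCount (aligned C) ≤ toffoliCount C + 4 * n * Nat.log 2 n + 412 * n := by
  have hpos := NeZero.pos n
  have h1 := toffoliCount_incReg (n := n) (L := []) (R := .lenT) (by simp) (Nat.le_succ _)
  have h2 := toffoliCount_addReg (n := n) .lenQ .lenT (Nat.le_succ _)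
  have h3 := toffoliCount_addReg (n := n) .lenS .lenT (Nat.le_succ _)
  have h4 := toffoliCount_rotate (n := n)
  have h5 := log_le_self (n := n)
  simp only [aligned, toffoliCount_append, toffoliCount_inverse]
  nlinarith

theorem toffoliCount_quotientStage : toffoliCount (quotientStage n) ≤ 2374 * n := by
  have h1 := toffoliCount_compare (flipCost_onSearch (n := n)) .work2 .work1 .lenT
    (fun i => n + 2 - i) (fun i => if i = 0 then 0 else n + 1 - i) le_rfl
  have h2 := toffoliCount_flip (flipCost_onPhase (n := n) false true) (qubit n .sign 0)
  have h3 : toffoliCount (condSubR (onPhaseSign n false true)) ≤ 944 * n :=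
    toffoliCount_condSub (flipCost_onPhaseSign false true) _ _ _ _ _ _ _ _ _
  have h4 := toffoliCount_writeCell (flipCost_onPhaseSign (n := n) false true) .lenT
  have h5 := toffoliCount_readCell (flipCost_onPhaseXor (n := n)) .lenT
  have h6 := toffoliCount_writeCell (flipCost_onPhaseSign (n := n) true false) .lenT
  simp only [quotientStage, toffoliCount_append]
  omega

theorem toffoliCount_productStage : toffoliCount (productStage n) ≤ 2878 * n := by
  have h1 := toffoliCount_incReg (n := n) (L := [lit n .phase1 true, lit n .phase2 false])
    (R := .lenQ) le_rfl (Nat.le_succ _)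
  have h2 := toffoliCount_writeCell (flipCost_onDigits (n := n)) .lenT
  have h3 : toffoliCount (condSubT (onPhaseSign n true false)) ≤ 944 * n :=
    toffoliCount_condSub (flipCost_onPhaseSign true false) _ _ _ _ _ _ _ _ _
  have h4 := toffoliCount_compare (flipCost_onPhase (n := n) true false) .work1 .work2 .lenT
    (fun i => i) (fun i => i) le_rfl
  have h5 := toffoliCount_compare (flipCost_onPhase (n := n) true true) .work1 .work2 .lenR
    (fun i => i) (fun i => n - i) (Nat.le_succ n)
  have h6 := toffoliCount_addReg (n := n) .lenS .lenR (Nat.le_succ _)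
  have h7 := toffoliCount_incReg (n := n) (L := []) (R := .lenR) (by simp) (Nat.le_succ _)
  have h8 := toffoliCount_flip (flipCost_onPhase1 (n := n)) (qubit n .sign 0)
  simp only [productStage, toffoliCount_append, toffoliCount_inverse]
  omega

theorem toffoliCount_phaseStage : toffoliCount (phaseStage n) ≤ 750 * n := by
  have h1 := toffoliCount_flip (flipCost_onEmpty (n := n) .sign) (qubit n .phase2 0)
  have h2 := toffoliCount_flip (flipCost_onEmpty (n := n) .phase1) (qubit n .phase2 0)
  have h3 := toffoliCount_flip (flipCost_onEmpty (n := n) .phase2) (qubit n .sign 0)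
  have h4 := toffoliCount_flip (flipCost_onUnshifted (n := n)) (qubit n .phase1 0)
  have h5 := toffoliCount_flip (flipCost_onUnshifted (n := n)) (qubit n .phase2 0)
  simp only [phaseStage, toffoliCount_append]
  omega

theorem toffoliCount_endStage : toffoliCount (endStage n) ≤ 1770 * n := by
  have h := fun W g R T => toffoliCount_sizeXor (flipCost_onEnd (n := n)) W g R T
  have h1 := h .work1 (fun i => n - i) .lenR .lenT
  have h2 := h .work2 (fun i => n - i) .lenR .lenT
  have h3 := h .work2 (fun i => i + 2) .lenT .lenR
  have h4 := h .work1 (fun i => i + 2) .lenT .lenR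
  have h5 := toffoliCount_swapWork (flipCost_onEnd (n := n))
  have h6 := toffoliCount_flip (flipCost_onEnd (n := n)) (qubit n .iter 0)
  simp only [endStage, toffoliCount_append]
  omega

/-- The leading term of the cost of a step comes from the two rotations in `aligned`. -/
theorem toffoliCount_stepCircuit :
    toffoliCount (stepCircuit n) ≤ 4 * n * Nat.log 2 n + 10216 * n := by
  have h1 := toffoliCount_shift (n := n) false
  have h2 := toffoliCount_incReg (n := n) (L := [lit n .phase1 false, lit n .phase2 true])
    (R := .lenQ) le_rfl (Nat.le_succ _)
  have h3 := toffoliCount_aligned (quotientStage n)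
  have h4 := toffoliCount_quotientStage (n := n)
  have h5 := toffoliCount_productStage (n := n)
  have h6 := toffoliCount_shift (n := n) true
  have h7 := toffoliCount_phaseStage (n := n)
  have h8 := toffoliCount_endStage (n := n)
  simp only [stepCircuit, toffoliCount_append]
  omega

theorem toffoliCount_xorConst (f : ℕ → Bool) : toffoliCount (xorConst n f) = 0 := by
  have h : toffoliCount (xorConst n f) ≤ (n + 3) * 0 :=
    toffoliCount_seq_le fun j _ => by split_ifs <;> simp
  omega

theorem toffoliCount_negMod (p : ℕ) (g : ℕ → ℕ) : toffoliCount (negMod n p g) ≤ 2 * n := by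
  have h : ∀ R f g, toffoliCount (xorIter n R f g) = 0 := fun R f g => by
    have : toffoliCount (xorIter n R f g) ≤ n * 0 :=
      toffoliCount_seq_le fun j _ => by split_ifs <;> simp
    omega
  have h1 := toffoliCount_add (qubit n .ctrl 0) (fun i => qubit n .work1 i)
    (fun i => qubit n .work2 (g i)) n
  simp only [negMod, addWork, toffoliCount_append, h]
  omega

theorem toffoliCount_loadCircuit (p : ℕ) : toffoliCount (loadCircuit n p) ≤ 333 * n := by
  have h1 := toffoliCount_carryXor (qubit n .iter 0) (qubit n .ctrl 0)
    (fun i => qubit n .work1 (if i = n - 1 then n else n + 1))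
    (fun i => qubit n .work2 (n + 2 - i)) (fun i => qubit n .work1 i) n
  have h2 := toffoliCount_negMod (n := n) p (fun i => n + 2 - i)
  have h3 := toffoliCount_sizeXor (flipCost_onEnd (n := n)) .work2 (fun i => i + 2) .lenT .lenR
  simp only [loadCircuit, compareHalf, toffoliCount_append, toffoliCount_xorConst, toffoliCount_X]
  omega

theorem toffoliCount_copyCircuit (p : ℕ) :
    toffoliCount (copyCircuit n p) ≤ 68 * n ^ 2 := by
  have hpos := NeZero.pos n
  have h1 := toffoliCount_negMod (n := n) p (fun i => i)
  have h2 := toffoliCount_rotate (n := n)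
  have h3 : toffoliCount (seq n fun i => CX (qubit n .work2 i) (qubit n .output i)) ≤ n * 0 :=
    toffoliCount_seq_le fun j _ => (toffoliCount_CX _ _).le
  have h4 := log_le_self (n := n)
  have h5 : (Nat.log 2 n + 3) * (2 * (n + 3)) ≤ (4 * n) * (2 * (4 * n)) :=
    Nat.mul_le_mul (by omega) (by omega)
  simp only [copyCircuit, exposeResult, toffoliCount_append, toffoliCount_xorConst, toffoliCount_X,
    toffoliCount_inverse]
  nlinarith

/-! ### The inversion circuit -/

/-- A circuit of `2 * m` Toffoli gates that does nothing. -/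
def idle (n : ℕ) [NeZero n] (m : ℕ) : Circuit (Qubit n) :=
  List.replicate (2 * m) (.toffoli (qubit n .iter 0) (qubit n .sign 0) (qubit n .ctrl 0)
    (qubit_ne_of_reg (by decide) _ _) (qubit_ne_of_reg (by decide) _ _)
    (qubit_ne_of_reg (by decide) _ _))

theorem run_idle (m : ℕ) (s : Qubit n → Bool) : run (idle n m) s = s := by
  induction m generalizing s with
  | zero => rfl
  | succ m ih =>
    rw [idle, Nat.mul_succ, List.replicate_succ, List.replicate_succ]
    exact (congrArg (run (idle n m)) (Gate.apply_apply _ s)).trans (ih s)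

theorem toffoliCount_idle (m : ℕ) : toffoliCount (idle n m) = 2 * m := by
  rw [toffoliCount, idle, List.countP_replicate]
  exact if_pos rfl

/-- The blocks of the inversion circuit: `8 * n` equal steps, and a copy block that is prolonged by
`2 * m` idle Toffoli gates. -/
noncomputable def blocks (n : ℕ) [NeZero n] (p m : ℕ) : InversionBlocks n where
  numSteps := 8 * n
  load := loadCircuit n p
  step _ := stepCircuit n
  copy := copyCircuit n p ++ idle n m

theorem compute_succ (B : InversionBlocks n) (T : ℕ) :
    B.compute (T + 1) = B.compute T ++ B.step T := by
  simp [InversionBlocks.compute, List.range_succ]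

theorem toffoliCount_compute_blocks (p m T : ℕ) : toffoliCount ((blocks n p m).compute T) =
    toffoliCount (loadCircuit n p) + T * toffoliCount (stepCircuit n) := by
  induction T with
  | zero => simp [InversionBlocks.compute, blocks]
  | succ T ih =>
    rw [compute_succ, toffoliCount_append, ih, Nat.succ_mul, add_assoc]
    rfl

theorem exists_toffoliCount_blocks (p : ℕ) :
    ∃ T₀ ≤ 64 * n ^ 2 * Nat.log 2 n + 165000 * n ^ 2,
      ∀ m, toffoliCount (blocks n p m).circuit = T₀ + 2 * m := by
  refine ⟨2 * (toffoliCount (loadCircuit n p) + 8 * n * toffoliCount (stepCircuit n)) +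
    toffoliCount (copyCircuit n p), ?_, fun m => ?_⟩
  · have hpos := NeZero.pos n
    have h1 := toffoliCount_loadCircuit (n := n) p
    have h2 := Nat.mul_le_mul_left (8 * n) (toffoliCount_stepCircuit (n := n))
    have h3 := toffoliCount_copyCircuit (n := n) p
    nlinarith
  · have h := toffoliCount_compute_blocks (n := n) p m (8 * n)
    have hc : toffoliCount (blocks n p m).copy = toffoliCount (copyCircuit n p) + 2 * m := by
      rw [blocks, toffoliCount_append, toffoliCount_idle]
    have hN : (blocks n p m).numSteps = 8 * n := rfl
    rw [InversionBlocks.circuit, toffoliCount_append, toffoliCount_append, toffoliCount_inverse, hN,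
      h, hc]
    ring

/-- The steps are correct for any content `y` of the output register, as is needed when they are
undone after the result has been copied. -/
theorem run_compute_blocks {p x y m T : ℕ} (hp : p.Prime) (hpn' : 2 ^ (n - 1) ≤ p) (hpn : p < 2 ^ n)
    (hx : 0 < x) (hxp : x < p) (hT : T ≤ 8 * n) :
    run ((blocks n p m).compute T) (ioBasis n x y) = (EEAState.after p x T).basis n y := by
  induction T with
  | zero =>
    rw [InversionBlocks.compute, List.range_zero, List.map_nil, List.flatten_nil, List.append_nil]
    exact run_loadCircuit hpn hx hxp
  | succ T ih =>
    rw [compute_succ, run_append, ih (by omega)]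
    exact run_stepCircuit_after hp hpn' hpn hx hxp (by omega)

theorem copy_blocks {p x m : ℕ} (hp : p.Prime) (hpn' : 2 ^ (n - 1) ≤ p) (hpn : p < 2 ^ n)
    (hx : 0 < x) (hxp : x < p) : (EEAState.after p x (8 * n)).r' = 0 ∧
      run (blocks n p m).copy ((EEAState.after p x (8 * n)).basis n 0) =
        (EEAState.after p x (8 * n)).basis n ((x : ZMod p)⁻¹).val := by
  obtain ⟨D, K, j, hD, hv, hj, h⟩ := terminated hp hpn hx hxp
  have hK := hD.K_ge hv hpn'
  have hlog := lt_two_pow_log (n := n)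
  rw [h]
  refine ⟨hv, ?_⟩
  rw [blocks, run_append, run_idle]
  refine run_copyCircuit hp hpn' hpn hD hv ?_
  rw [pow_add] at hlog ⊢
  omega

theorem realizesEEA_blocks {p : ℕ} (m : ℕ) (hp : p.Prime) (hpn' : 2 ^ (n - 1) ≤ p)
    (hpn : p < 2 ^ n) : (blocks n p m).RealizesEEA p := fun _ hx hxp =>
  ⟨fun _ hT => run_compute_blocks hp hpn' hpn hx hxp hT, copy_blocks hp hpn' hpn hx hxp⟩

theorem run_circuit_blocks {p x : ℕ} (m : ℕ) (hp : p.Prime) (hpn' : 2 ^ (n - 1) ≤ p)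
    (hpn : p < 2 ^ n) (hx : 0 < x) (hxp : x < p) :
    run (blocks n p m).circuit (ioBasis n x 0) = ioBasis n x ((x : ZMod p)⁻¹).val := by
  have h := fun y => run_compute_blocks (y := y) (m := m) hp hpn' hpn hx hxp le_rfl
  have hN : (blocks n p m).numSteps = 8 * n := rfl
  rw [InversionBlocks.circuit, run_append, run_append, hN, h 0,
    (copy_blocks hp hpn' hpn hx hxp).2, ← h, run_inverse_run]

end

theorem card_qubit (n : ℕ) : Fintype.card (Qubit n) = 3 * n + 4 * Nat.log 2 n + 20 := by
  have hu : (Finset.univ : Finset Reg) = {.work1, .work2, .output, .lenT, .lenQ, .lenR, .lenS,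
    .phase1, .phase2, .iter, .sign, .ctrl} := rfl
  rw [Fintype.card_sigma]
  simp only [Fintype.card_fin]
  rw [hu]
  simp [Reg.width]
  ring

/-! ### The constant -/

theorem goldenRatio_bounds :
    (1.618 : ℝ) < Real.goldenRatio ∧ Real.goldenRatio < (1.6181 : ℝ) := by
  have h1 : (2.236 : ℝ) < √5 := Real.lt_sqrt_of_sq_lt (by norm_num)
  have h2 : √5 < (2.2362 : ℝ) := (Real.sqrt_lt' (by norm_num)).2 (by norm_num)
  rw [Real.goldenRatio]
  constructor <;> linarith

/-- The bounds come from `2 ^ 84 < φ ^ 121` and `φ ^ 23 < 2 ^ 16`, where powers of `φ` are computed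
with Fibonacci numbers. -/
theorem abs_stepConst : |2 * (80 * stepConst - 13) - 204| < 1 / 2 := by
  obtain ⟨h1, h2⟩ := goldenRatio_bounds
  have hpos := Real.goldenRatio_pos
  have e1 : (84 : ℝ) < 121 * Real.logb 2 Real.goldenRatio := by
    have h : (2 : ℝ) ^ 84 < Real.goldenRatio ^ 121 := by
      rw [← Real.goldenRatio_mul_fib_succ_add_fib]
      norm_num
      linarith
    have := Real.logb_lt_logb one_lt_two (by positivity) h
    rwa [Real.logb_pow, Real.logb_pow, Real.logb_self_eq_one one_lt_two, mul_one] at this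
  have e2 : 23 * Real.logb 2 Real.goldenRatio < (16 : ℝ) := by
    have h : Real.goldenRatio ^ 23 < (2 : ℝ) ^ 16 := by
      rw [← Real.goldenRatio_mul_fib_succ_add_fib]
      norm_num
      linarith
    have := Real.logb_lt_logb one_lt_two (by positivity) h
    rwa [Real.logb_pow, Real.logb_pow, Real.logb_self_eq_one one_lt_two, mul_one] at this
  have hl : 0 < Real.logb 2 Real.goldenRatio := by linarith
  have c1 : stepConst < 461 / 320 := by
    rw [stepConst, div_lt_iff₀ hl]
    linarith
  have c2 : 459 / 320 < stepConst := by
    rw [stepConst, lt_div_iff₀ hl]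
    linarith
  rw [abs_lt]
  constructor <;> linarith

/-- Idle Toffoli gates bring any count of at most `64 * n ^ 2 * log n + O(n ^ 2)` up to the nominal
one, up to a bounded error. -/
theorem exists_count_near {n T₀ : ℕ} (hn : 0 < n)
    (h : T₀ ≤ 64 * n ^ 2 * Nat.log 2 n + 165000 * n ^ 2) :
    ∃ m : ℕ, |((T₀ + 2 * m : ℕ) : ℝ) - 2 * (80 * stepConst - 13) * (n : ℝ) ^ 2 * Real.logb 2 n| ≤
      165000 * (n : ℝ) ^ 2 := by
  set τ : ℝ := 2 * (80 * stepConst - 13) * (n : ℝ) ^ 2 * Real.logb 2 n with hτ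
  have hn1 : (1 : ℝ) ≤ n := by exact_mod_cast hn
  have hn2 : (1 : ℝ) ≤ (n : ℝ) ^ 2 := one_le_pow₀ hn1
  have hc := (abs_lt.1 abs_stepConst).1
  have hlog : (Nat.log 2 n : ℝ) ≤ Real.logb 2 n := by
    have := Real.natLog_le_logb n 2
    exact_mod_cast this
  have hl0 : (0 : ℝ) ≤ (n : ℝ) ^ 2 * Nat.log 2 n := by positivity
  have hT : (T₀ : ℝ) ≤ 64 * ((n : ℝ) ^ 2 * Nat.log 2 n) + 165000 * (n : ℝ) ^ 2 := by
    have : (T₀ : ℝ) ≤ ((64 * n ^ 2 * Nat.log 2 n + 165000 * n ^ 2 : ℕ) : ℝ) := by exact_mod_cast h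
    push_cast at this
    linarith
  have hle : 64 * ((n : ℝ) ^ 2 * Nat.log 2 n) ≤ τ := by
    have h1 : (n : ℝ) ^ 2 * Nat.log 2 n ≤ (n : ℝ) ^ 2 * Real.logb 2 n :=
      mul_le_mul_of_nonneg_left hlog (by positivity)
    have h2 : 64 * ((n : ℝ) ^ 2 * Real.logb 2 n) ≤
        2 * (80 * stepConst - 13) * ((n : ℝ) ^ 2 * Real.logb 2 n) :=
      mul_le_mul_of_nonneg_right (by linarith) (by linarith)
    rw [hτ]
    linarith
  by_cases hcase : τ ≤ T₀
  · refine ⟨0, ?_⟩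
    rw [Nat.mul_zero, Nat.add_zero, abs_le]
    constructor <;> linarith
  · refine ⟨⌊(τ - T₀) / 2⌋₊, ?_⟩
    have h1 := Nat.floor_le (show (0 : ℝ) ≤ (τ - T₀) / 2 by linarith)
    have h2 := Nat.lt_floor_add_one ((τ - T₀) / 2)
    push_cast
    rw [abs_le]
    constructor <;> linarith

end Inversion

theorem mainTheorem1 :
    (∀ n : ℕ, Fintype.card (Qubit n) = 3 * n + 4 * Nat.log 2 n + 20) ∧
    |2 * (80 * stepConst - 13) - 204| < 1 / 2 ∧
    ∃ C : ℝ, ∀ n p : ℕ, p.Prime → 2 ^ (n - 1) ≤ p → p < 2 ^ n →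
      ∃ B : InversionBlocks n,
        B.RealizesEEA p ∧
        (∀ x : ℕ, 0 < x → x < p →
          B.circuit.run (ioBasis n x 0) = ioBasis n x ((x : ZMod p)⁻¹).val) ∧
        |(B.circuit.toffoliCount : ℝ) -
            2 * (80 * stepConst - 13) * (n : ℝ) ^ 2 * Real.logb 2 n| ≤ C * (n : ℝ) ^ 2 := by
  refine ⟨Inversion.card_qubit, Inversion.abs_stepConst, 165000, fun n p hp hpn' hpn => ?_⟩
  have hn : n ≠ 0 := by
    rintro rfl
    have := hp.two_le
    omega
  have : NeZero n := ⟨hn⟩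
  obtain ⟨T₀, hT₀, hcount⟩ := Inversion.exists_toffoliCount_blocks (n := n) p
  obtain ⟨m, hm⟩ := Inversion.exists_count_near (Nat.pos_of_ne_zero hn) hT₀
  refine ⟨Inversion.blocks n p m, Inversion.realizesEEA_blocks m hp hpn' hpn,
    fun x hx hxp => Inversion.run_circuit_blocks m hp hpn' hpn hx hxp, ?_⟩
  rw [hcount]
  exact hm
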